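/- **Setting.** Let $\Sigma$ be a closed (compact, without boundary, non-empty) smooth 3-manifold with a smooth Riemannian metric $\gamma$. $L^2(\mathrm{Sym}^2T^*\Sigma)$ is the space of symmetric 2-tensor fields with $\langle h,k\rangle=\int_\Sigma \gamma^{ik}\gamma^{jl}h_{ij}k_{kl}\,d\mathrm{vol}_\gamma$. Let $K=K_{ijkl}(x,y)$ be a continuous, symmetric, strictly positive-definite kernel, acting by $(Kf)_{ij}(x)=\int K_{ijkl}(x,y)f^{kl}(y)\,d\mathrm{vol}_\gamma(y)$. Let $W_{ij}(\tau,x)$, $\tau\ge0$, be a symmetric tensor-valued Wiener process on a probability space: $W_0=0$; independent, centred Gaussian increments with $\mathbb E[(W_t-W_s)_{ij}(x)(W_t-W_s)_{kl}(y)]=(t-s)K_{ijkl}(x,y)$; paths a.s. continuous in $L^2$. Let $\ell_P>0$, let $\mathcal D$ be any drift functional and let the symmetric-tensor-valued process $g$ solve $$dg_{ij}=\mathcal D_{ij}[g]\,d\tau+\ell_P\,dW_{ij}$$ (tested against continuous symmetric tensor fields, with measurable and locally integrable drift). **Spectral decomposition.** There are $\lambda_n>0$ and a complete orthonormal system of continuous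 eigentensors $e^{(n)}$ of $K$, $n=1,2,\dots$. For every such system: - $K_{ijkl}(x,y)=\sum_n\lambda_n e^{(n)}_{ij}(x)e^{(n)}_{kl}(y)$, uniformly on $\Sigma\times\Sigma$. - $\beta_n=\lambda_n^{-1/2}\langle W,e^{(n)}\rangle$ are independent standard Brownian motions and $W=\sum_n\sqrt{\lambda_n}\,e^{(n)}\beta_n$ (for each $\tau$ in mean square, uniformly on $\Sigma$; and a.s. in $L^2$ for all $\tau$). The product rules $(d\tau)^2=0$, $d\beta_n\,d\tau=0$, $d\beta_m\,d\beta_n=\delta_{mn}d\tau$ hold, as limits in probability of sums of products of increments over partitions whose mesh tends to $0$. - With $g_n=\langle g,e^{(n)}\rangle$ and $\mathcal D_n=\langle\mathcal D,e^{(n)}\rangle$: $dg_n=\mathcal D_n\,d\tau+\ell_P\sqrt{\lambda_n}\,d\beta_n$. - $\langle h,K^{-1}h\rangle=\sum_n\lambda_n^{-1}\langle h,e^{(n)}\rangle^2$ for all $h$ in the range of $K$; for a finite set $S$ of modes, the projection $P_Sh=\sum_{n\in S}\langle h,e^{(n)}\rangle e^{(n)}$ of any $h\in L^2$ is in the range,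 and $\langle P_Sh,K^{-1}P_Sh\rangle=\sum_{n\in S}\lambda_n^{-1}\langle h,e^{(n)}\rangle^2$. **Emergent time.** The quadratic form is regularised by keeping a finite set $S$ of modes. For $0\le a\le b$ let $\int_a^b\langle dg,K^{-1}dg\rangle$ denote the limit in probability of $\sum_k\langle P_S\Delta_kg,K^{-1}P_S\Delta_kg\rangle$ over partitions of $[a,b]$ with mesh tending to $0$, where $\Delta_kg$ are the increments of $g$. It exists and equals $\ell_P^2\,|S|\,(b-a)$. For $S\neq\emptyset$ and $n_{\rm eff}=|S|$ put $$t_{[a,b]}=\frac1{\ell_P^2\,n_{\rm eff}}\int_a^b\langle dg,K^{-1}dg\rangle,\qquad t(\tau)=t_{[0,\tau]}.$$ This is well defined almost surely, and, almost surely: 1. $t(\tau)=\tau$, and $t(a)<t(b)$ for $0\le a<b$. 2. $t_{[a,c]}=t_{[a,b]}+t_{[b,c]}$ for $0\le a\le b\le c$. 3. Coordinate independence: for every diffeomorphism $\varphi:\Sigma'\to\Sigma$, $\varphi^*K$ is a covariance kernel of the same kind on $(\Sigma',\varphi^*\gamma)$, the $\varphi^*e^{(n)}$ are a complete orthonormal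 eigensystem of it with the same $\lambda_n$, and the functional $t$ formed from $\varphi^*\gamma,\varphi^*K,\varphi^*e^{(n)},\varphi^*g$ is that formed from $\gamma,K,e^{(n)},g$. 4. Drift independence: if $g'$ solves the equation with the same $W$ and any other drift $\mathcal D'$, then $g'$ and $g$ have the same functional $t$. 5. Semiclassical limit. Let $L,r>0$, $A,B\ge0$, $\kappa>0$, and suppose that for $0\le\tau\le r$ the history is semiclassical at scale $L$, that is: - $g_\tau$ fluctuates about its mean $h_\tau=\mathbb E[g_\tau]$ with $\mathbb E[q(g_\tau-h_\tau)^2]\le A(\ell_P/L)^2$, for some $q$ with $q\ge\|\cdot\|_{L^2}$. - The $h_\tau$ are Riemannian metrics, the slices of a smooth spacetime with line element $-\alpha^2d\tau^2+h_{ij}(dx^i+\beta^id\tau)(dx^j+\beta^jd\tau)$, $\alpha>0$, whose extrinsic curvature $K^{\rm ext}$ (defined by $\partial_\tau h=-2\alpha K^{\rm ext}+\mathcal L_\beta h$) satisfies $|K^{\rm ext}|_\gamma\ge\kappa$. - The drift is the Einstein flow at the means, $\mathcal D[h_\tau]=-2NK^{\rm ext}+\mathcal L_\beta h_\tau$, with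 smooth lapse $N$, and is twice differentiable there: for each smooth symmetric $\phi$ there are $\psi_\tau\in L^2$, bounded in $\tau$, with $|\langle\mathcal D[h_\tau+f]-\mathcal D[h_\tau],\phi\rangle-\langle f,\psi_\tau\rangle|\le B\,q(f)^2\|\phi\|_{L^1}$ for all $f\in L^2$ with $\mathcal D[h_\tau+f]\in L^1$. Then $|\alpha-N|\le\frac{AB}{2\kappa}\frac{\ell_P^2}{L^2}$ everywhere on $[0,r]\times\Sigma$, so that along observers normal to the slices $dt_{\rm proper}=N\,dt+O(\ell_P^2/L^2)$: for such an observer $x(\cdot)$ and $\tau\le r$, $\bigl|t_{\rm proper}(\tau)-\int_0^\tau N(s,x(s))\,dt(s)\bigr|\le\frac{AB}{2\kappa}\frac{\ell_P^2}{L^2}\,\tau$. In particular, if $N\equiv1$, then $|t_{\rm proper}(\tau)-t(\tau)|\le\frac{AB}{2\kappa}\frac{\ell_P^2}{L^2}\,\tau$. Here $\mathcal D$ may depend explicitly on $\tau$ (through lapse and shift). Statements 1 and 2 hold almost surely for each fixed $\tau,a,b,c$. -/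

import Mathlib

open MeasureTheory ProbabilityTheory Set Filter
open scoped Manifold ContDiff NNReal ENNReal Topology

namespace EmergentTime

noncomputable section

/-- The model space of a three-manifold. -/
abbrev E3 : Type := EuclideanSpace ℝ (Fin 3)

/-- The tangent space of a three-manifold. -/
abbrev Tan {M : Type*} [TopologicalSpace M] [ChartedSpace E3 M] (x : M) : Type :=
  TangentSpace (𝓡 3) x

/-- Sections of `T*Σ ⊗ T*Σ`, without any regularity. -/
abbrev TField (M : Type*) [TopologicalSpace M] [ChartedSpace E3 M] : Type _ :=
  (x : M) → Tan x →L[ℝ] Tan x →L[ℝ] ℝ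

/-- Covariance kernels `K_{ijkl}(x, y)`: the first two slots take vectors at `x`, the last two
slots vectors at `y`. -/
abbrev TKernel (M : Type*) [TopologicalSpace M] [ChartedSpace E3 M] : Type _ :=
  (x y : M) → Tan x → Tan x → (Tan y →L[ℝ] Tan y →L[ℝ] ℝ)

/-- The `i`-th vector of the standard basis of the model space, as a tangent vector at `x`. -/
def bvec {M : Type*} [TopologicalSpace M] [ChartedSpace E3 M] (x : M) (i : Fin 3) : Tan x :=
  (EuclideanSpace.single i (1 : ℝ) : E3)

section Geometry

variable {M : Type*} [TopologicalSpace M] [ChartedSpace E3 M]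

/-- Continuous vector fields. -/
def ContVF [IsManifold (𝓡 3) ∞ M] (X : (x : M) → Tan x) : Prop :=
  Continuous fun x => (⟨x, X x⟩ : TangentBundle (𝓡 3) M)

/-- Symmetric tensor fields. -/
def IsSymm (h : TField M) : Prop := ∀ x (u v : Tan x), h x u v = h x v u

/-- Continuous sections of `T*Σ ⊗ T*Σ`. -/
def ContTF [IsManifold (𝓡 3) ∞ M] (h : TField M) : Prop :=
  ContMDiff (𝓡 3) ((𝓡 3).prod 𝓘(ℝ, E3 →L[ℝ] E3 →L[ℝ] ℝ)) 0
    fun x => Bundle.TotalSpace.mk' (E3 →L[ℝ] E3 →L[ℝ] ℝ)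
      (E := fun x : M => Tan x →L[ℝ] Tan x →L[ℝ] ℝ) x (h x)

/-- Smooth sections of `T*Σ ⊗ T*Σ`. -/
def SmoothTF [IsManifold (𝓡 3) ∞ M] (h : TField M) : Prop :=
  ContMDiff (𝓡 3) ((𝓡 3).prod 𝓘(ℝ, E3 →L[ℝ] E3 →L[ℝ] ℝ)) ∞
    fun x => Bundle.TotalSpace.mk' (E3 →L[ℝ] E3 →L[ℝ] ℝ)
      (E := fun x : M => Tan x →L[ℝ] Tan x →L[ℝ] ℝ) x (h x)

/-- Smooth Riemannian metrics. -/
structure IsRiemannian [IsManifold (𝓡 3) ∞ M] (γ : TField M) : Prop where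
  symm : IsSymm γ
  pos : ∀ x (u : Tan x), u ≠ 0 → 0 < γ x u u
  smooth : SmoothTF γ

/-- The matrix `γ_ij` at `x`. -/
def gram (γ : TField M) (x : M) : Matrix (Fin 3) (Fin 3) ℝ :=
  Matrix.of fun i j => γ x (bvec x i) (bvec x j)

/-- The length of a tangent vector. -/
def vlen (γ : TField M) (x : M) (u : Tan x) : ℝ := Real.sqrt (γ x u u)

/-- The fibre inner product `γ^{ik} γ^{jl} a_ij b_kl` of two bilinear forms on `T_x Σ`. -/
def pair (γ : TField M) (x : M) (a b : Tan x → Tan x → ℝ) : ℝ :=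
  ∑ i, ∑ j, ∑ k, ∑ l, (gram γ x)⁻¹ i k * (gram γ x)⁻¹ j l *
    a (bvec x i) (bvec x j) * b (bvec x k) (bvec x l)

/-- The fibre norm of a bilinear form on `T_x Σ`. -/
def tlen (γ : TField M) (x : M) (a : Tan x →L[ℝ] Tan x →L[ℝ] ℝ) : ℝ :=
  Real.sqrt (pair γ x (fun u v => a u v) (fun u v => a u v))

/-- The coordinate components `γ(∂_i, ∂_j)` in the chart `φ`, at the point of `Σ` with
coordinates `y`. -/
def chartGram (γ : TField M) (φ : OpenPartialHomeomorph M E3) (y : E3) :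
    Matrix (Fin 3) (Fin 3) ℝ :=
  Matrix.of fun i j => γ (φ.symm y)
    (mfderiv 𝓘(ℝ, E3) (𝓡 3) φ.symm y (bvec y i)) (mfderiv 𝓘(ℝ, E3) (𝓡 3) φ.symm y (bvec y j))

/-- The Riemannian volume measure of `γ`: the least measure which dominates
`√(det γ_ij) dy¹dy²dy³` on the domain of every smooth chart. Since these measures agree on overlaps,
it coincides with `√(det γ_ij) dy¹dy²dy³` there. -/
def vol [MeasurableSpace M] (γ : TField M) : Measure M :=
  ⨆ φ ∈ IsManifold.maximalAtlas (𝓡 3) ∞ M, Measure.map φ.symm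
    (((volume : Measure E3).withDensity
      fun y => ENNReal.ofReal (Real.sqrt (chartGram γ φ y).det)).restrict φ.target)

variable [IsManifold (𝓡 3) ∞ M] [MeasurableSpace M]

/-- Symmetric tensor fields that are measurable and of class `L^p`. -/
structure MemField (γ : TField M) (p : ℝ≥0∞) (h : TField M) : Prop where
  symm : IsSymm h
  meas : ∀ X Y : (x : M) → Tan x, ContVF X → ContVF Y → Measurable fun x => h x (X x) (Y x)
  memLp : MemLp (fun x => tlen γ x (h x)) p (vol γ)

/-- The inner product `∫ γ^{ik} γ^{jl} h_ij k_kl dvol` of `L²(Sym² T*Σ)`. -/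
def ip (γ : TField M) (h k : TField M) : ℝ :=
  ∫ x, pair γ x (fun u v => h x u v) (fun u v => k x u v) ∂(vol γ)

/-- The `L²` norm. -/
def norm2 (γ : TField M) (h : TField M) : ℝ := Real.sqrt (ip γ h h)

/-- The `L¹` norm. -/
def norm1 (γ : TField M) (h : TField M) : ℝ := ∫ x, tlen γ x (h x) ∂(vol γ)

/-- The integral operator `(K f)_ij(x) = ∫ K_ijkl(x, y) f^{kl}(y) dvol(y)`. -/
def applyK (γ : TField M) (K : TKernel M) (f : TField M) (x : M) (u v : Tan x) : ℝ :=
  ∫ y, pair γ y (fun w z => K x y u v w z) (fun w z => f y w z) ∂(vol γ)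

/-- Continuous, symmetric, (strictly) positive-definite kernels on `L²(Sym² T*Σ)`. -/
structure IsCovKernel (γ : TField M) (K : TKernel M) : Prop where
  symm_right : ∀ x y (u v : Tan x) (w z : Tan y), K x y u v w z = K x y u v z w
  symm : ∀ x y (u v : Tan x) (w z : Tan y), K x y u v w z = K y x w z u v
  cont : ∀ X Y Z V : (x : M) → Tan x, ContVF X → ContVF Y → ContVF Z → ContVF V →
    Continuous fun p : M × M => K p.1 p.2 (X p.1) (Y p.1) (Z p.2) (V p.2)
  pos : ∀ h, MemField γ 2 h → ¬ (∀ᵐ x ∂(vol γ), h x = 0) →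
    0 < ∫ x, pair γ x (fun u v => h x u v) (fun u v => applyK γ K h x u v) ∂(vol γ)

/-- `f` is a preimage of `h` under the operator `K`. -/
def IsPreimage (γ : TField M) (K : TKernel M) (f h : TField M) : Prop :=
  MemField γ 2 f ∧ ∀ᵐ x ∂(vol γ), ∀ u v : Tan x, applyK γ K f x u v = h x u v

open Classical in
/-- The quadratic form `⟨h, K⁻¹ h⟩`, for `h` in the range of `K`. -/
def invForm (γ : TField M) (K : TKernel M) (h : TField M) : ℝ :=
  if H : ∃ f, IsPreimage γ K f h then ip γ h H.choose else 0

/-- `e` is a complete orthonormal system of (continuous) eigentensors of `K`, with positive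
eigenvalues `lam`. -/
structure IsEigensystem (γ : TField M) (K : TKernel M) (lam : ℕ → ℝ) (e : ℕ → TField M) :
    Prop where
  pos : ∀ n, 0 < lam n
  symm : ∀ n, IsSymm (e n)
  cont : ∀ n, ContTF (e n)
  eigen : ∀ n x (u v : Tan x), applyK γ K (e n) x u v = lam n * e n x u v
  orthonormal : ∀ m n, ip γ (e m) (e n) = if m = n then 1 else 0
  complete : ∀ h, MemField γ 2 h → (∀ n, ip γ h (e n) = 0) → ∀ᵐ x ∂(vol γ), h x = 0

/-- The Mercer expansion `K_ijkl(x, y) = ∑ λ_n e⁽ⁿ⁾_ij(x) e⁽ⁿ⁾_kl(y)`, uniformly on `Σ × Σ`. -/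
def MercerExpansion (γ : TField M) (K : TKernel M) (lam : ℕ → ℝ) (e : ℕ → TField M) : Prop :=
  ∀ ε > (0 : ℝ), ∃ N₀ : ℕ, ∀ N ≥ N₀, ∀ x y (u v : Tan x) (w z : Tan y),
    |K x y u v w z - ∑ n ∈ Finset.range N, lam n * e n x u v * e n y w z| ≤
      ε * vlen γ x u * vlen γ x v * vlen γ y w * vlen γ y z

/-- The part of `h` in the modes of `S`. -/
def proj (γ : TField M) (e : ℕ → TField M) (S : Finset ℕ) (h : TField M) : TField M :=
  ∑ n ∈ S, ip γ h (e n) • e n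

end Geometry

section Pullback

variable {M M' : Type*} [TopologicalSpace M] [ChartedSpace E3 M]
  [TopologicalSpace M'] [ChartedSpace E3 M']

/-- The pullback of a bilinear form along a linear map. -/
def pullForm {V W : Type*} [AddCommGroup V] [Module ℝ V] [TopologicalSpace V]
    [IsTopologicalAddGroup V] [ContinuousSMul ℝ V]
    [AddCommGroup W] [Module ℝ W] [TopologicalSpace W] [IsTopologicalAddGroup W]
    [ContinuousSMul ℝ W] (A : V →L[ℝ] W) (h : W →L[ℝ] W →L[ℝ] ℝ) : V →L[ℝ] V →L[ℝ] ℝ :=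
  (A.precomp ℝ).comp (h.comp A)

/-- The pullback `φ^* h` of a tensor field. -/
def pullT (φ : M' ≃ₘ⟮𝓡 3, 𝓡 3⟯ M) (h : TField M) : TField M' :=
  fun x => pullForm (mfderiv (𝓡 3) (𝓡 3) φ x) (h (φ x))

/-- The pullback `φ^* K` of a kernel. -/
def pullK (φ : M' ≃ₘ⟮𝓡 3, 𝓡 3⟯ M) (K : TKernel M) : TKernel M' :=
  fun x y u v => pullForm (mfderiv (𝓡 3) (𝓡 3) φ y)
    (K (φ x) (φ y) (mfderiv (𝓡 3) (𝓡 3) φ x u) (mfderiv (𝓡 3) (𝓡 3) φ x v))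

end Pullback

section Probability

variable {Ω : Type*} [MeasurableSpace Ω]

/-- The sums `∑ f(t_k, t_{k+1})` over the partitions `a = t_0 ≤ … ≤ t_m = b` converge to `X` in
probability as the mesh tends to zero. -/
def MeshLimit (P : Measure Ω) (f : ℝ → ℝ → Ω → ℝ) (a b : ℝ) (X : Ω → ℝ) : Prop :=
  ∀ ε > (0 : ℝ), ∃ δ > (0 : ℝ), ∀ (m : ℕ) (π : ℕ → ℝ), Monotone π → π 0 = a → π m = b →
    (∀ k < m, π (k + 1) - π k < δ) →
    P {ξ | ε ≤ |(∑ k ∈ Finset.range m, f (π k) (π (k + 1)) ξ) - X ξ|} ≤ ENNReal.ofReal ε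

variable {M : Type*} [TopologicalSpace M] [ChartedSpace E3 M] [IsManifold (𝓡 3) ∞ M]
  [MeasurableSpace M]

/-- Index set of the components `h_ij(x)` of a tensor field: a point and two tangent vectors. -/
abbrev Idx (M : Type*) [TopologicalSpace M] [ChartedSpace E3 M] : Type _ :=
  Σ x : M, Tan x × Tan x

/-- The components of a tensor field. -/
def comp (h : TField M) (i : Idx M) : ℝ := h i.1 i.2.1 i.2.2

/-- `W` is a symmetric tensor-valued Wiener process, with
`E[dW_ij(x) dW_kl(y)] = K_ijkl(x, y) dτ`. Only the values `W τ` with `0 ≤ τ` matter. -/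
structure IsWiener (P : Measure Ω) (γ : TField M) (K : TKernel M) (W : ℝ → Ω → TField M) :
    Prop where
  meas : ∀ τ, 0 ≤ τ → ∀ X Y : (x : M) → Tan x, ContVF X → ContVF Y →
    Measurable fun p : Ω × M => W τ p.1 p.2 (X p.2) (Y p.2)
  mem : ∀ᵐ ξ ∂P, ∀ τ, 0 ≤ τ → MemField γ 2 (W τ ξ)
  zero : ∀ᵐ ξ ∂P, W 0 ξ = 0
  gaussian : ∀ s t, 0 ≤ s → s ≤ t → IsGaussianProcess (fun i ξ => comp (W t ξ - W s ξ) i) P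
  mean : ∀ s t, 0 ≤ s → s ≤ t → ∀ i, ∫ ξ, comp (W t ξ - W s ξ) i ∂P = 0
  cov : ∀ s t, 0 ≤ s → s ≤ t → ∀ i j : Idx M,
    ∫ ξ, comp (W t ξ - W s ξ) i * comp (W t ξ - W s ξ) j ∂P =
      (t - s) * K i.1 j.1 i.2.1 i.2.2 j.2.1 j.2.2
  indep : HasIndepIncrements (fun (t : ℝ≥0) ξ => comp (W t ξ)) P
  cont : ∀ᵐ ξ ∂P, ∀ τ, 0 ≤ τ →
    Tendsto (fun σ => norm2 γ (W σ ξ - W τ ξ)) (𝓝[Ici 0] τ) (𝓝 0)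

/-- The normalised modes `β_n = λ_n^{-1/2} ⟨W, e⁽ⁿ⁾⟩`. -/
def mode (γ : TField M) (lam : ℕ → ℝ) (e : ℕ → TField M) (W : ℝ → Ω → TField M)
    (n : ℕ) (τ : ℝ) (ξ : Ω) : ℝ :=
  ip γ (W τ ξ) (e n) / Real.sqrt (lam n)

/-- The Karhunen–Loève expansion `W = ∑ √λ_n e⁽ⁿ⁾ β_n`: the `β_n` are independent standard
Brownian motions, and the series converges in mean square, uniformly on `Σ`, as well as
almost surely in `L²(Sym² T*Σ)`. -/
structure KarhunenLoeve (P : Measure Ω) (γ : TField M) (lam : ℕ → ℝ) (e : ℕ → TField M)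
    (W : ℝ → Ω → TField M) : Prop where
  brownian : ∀ n, IsBrownianReal (fun (τ : ℝ≥0) ξ => mode γ lam e W n τ ξ) P
  indep : iIndepFun (fun n ξ (τ : ℝ≥0) => mode γ lam e W n τ ξ) P
  meanSquare : ∀ τ, 0 ≤ τ → ∀ ε > (0 : ℝ), ∃ N₀ : ℕ, ∀ N ≥ N₀, ∀ x (u v : Tan x),
    ∫⁻ ξ, ENNReal.ofReal ((W τ ξ x u v - ∑ n ∈ Finset.range N,
      Real.sqrt (lam n) * mode γ lam e W n τ ξ * e n x u v) ^ 2) ∂P ≤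
      ENNReal.ofReal (ε * vlen γ x u ^ 2 * vlen γ x v ^ 2)
  almostSure : ∀ᵐ ξ ∂P, ∀ τ, 0 ≤ τ → Tendsto (fun N : ℕ => norm2 γ (W τ ξ -
      ∑ n ∈ Finset.range N, (Real.sqrt (lam n) * mode γ lam e W n τ ξ) • e n)) atTop (𝓝 0)

/-- The Itô product rules `(dτ)² = 0`, `dβ_n dτ = 0`, `dβ_m dβ_n = δ_mn dτ`. -/
structure ItoRules (P : Measure Ω) (β : ℕ → ℝ → Ω → ℝ) : Prop where
  time_time : ∀ a b, 0 ≤ a → a ≤ b → MeshLimit P (fun s t _ => (t - s) * (t - s)) a b fun _ => 0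
  noise_time : ∀ n a b, 0 ≤ a → a ≤ b →
    MeshLimit P (fun s t ξ => (β n t ξ - β n s ξ) * (t - s)) a b fun _ => 0
  noise_noise : ∀ m n a b, 0 ≤ a → a ≤ b →
    MeshLimit P (fun s t ξ => (β m t ξ - β m s ξ) * (β n t ξ - β n s ξ)) a b
      fun _ => if m = n then b - a else 0

/-- `g` solves `dg_ij = 𝒟_ij[g] dτ + ℓ dW_ij`, as an equation between symmetric tensor fields
tested against continuous symmetric tensor fields. The drift functional `𝒟` may also depend on `τ`
(through a choice of lapse and shift); the initial value may be random. -/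
structure SolvesSDE (P : Measure Ω) (γ : TField M) (l : ℝ) (D : ℝ → TField M → TField M)
    (W g : ℝ → Ω → TField M) : Prop where
  mem : ∀ᵐ ξ ∂P, ∀ τ, 0 ≤ τ → MemField γ 2 (g τ ξ)
  meas : ∀ τ, 0 ≤ τ → ∀ φ, ContTF φ → IsSymm φ → AEMeasurable (fun ξ => ip γ (g τ ξ) φ) P
  drift_mem : ∀ᵐ p ∂((volume.restrict (Ici (0 : ℝ))).prod P), MemField γ 1 (D p.1 (g p.1 p.2))
  drift_meas : ∀ φ, ContTF φ → IsSymm φ →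
    AEMeasurable (fun p : ℝ × Ω => ip γ (D p.1 (g p.1 p.2)) φ)
      ((volume.restrict (Ici (0 : ℝ))).prod P)
  eq : ∀ φ, ContTF φ → IsSymm φ → ∀ᵐ ξ ∂P, ∀ τ, 0 ≤ τ →
    IntervalIntegrable (fun s => ip γ (D s (g s ξ)) φ) volume 0 τ ∧
    ip γ (g τ ξ) φ = ip γ (g 0 ξ) φ + (∫ s in (0 : ℝ)..τ, ip γ (D s (g s ξ)) φ)
      + l * ip γ (W τ ξ) φ

/-- `T a b` is the emergent time elapsed on the piece of path over `[a, b]`, that is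
`(1 / (ℓ² n_eff)) ∫_a^b ⟨dg, K⁻¹ dg⟩`, the integral being the quadratic variation (a limit in
probability over partitions) and the quadratic form being restricted to the finite set `S` of
`n_eff = #S` modes. The time functional is `t(τ) = T 0 τ`. -/
def IsEmergentTime (P : Measure Ω) (γ : TField M) (K : TKernel M) (e : ℕ → TField M)
    (S : Finset ℕ) (l : ℝ) (g : ℝ → Ω → TField M) (T : ℝ → ℝ → Ω → ℝ) : Prop :=
  ∀ a b, 0 ≤ a → a ≤ b →
    MeshLimit P (fun s t ξ => 1 / (l ^ 2 * (S.card : ℝ)) *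
      invForm γ K (proj γ e S (g t ξ - g s ξ))) a b (T a b)

end Probability

section ADM

variable {M : Type*} [TopologicalSpace M] [ChartedSpace E3 M]

/-- The Lie derivative `(L_β h)_ij = β^k ∂_k h_ij + h_kj ∂_i β^k + h_ik ∂_j β^k`
(`= ∇_i β_j + ∇_j β_i` for a metric `h`), computed in the preferred chart at `x`. -/
def lieDer (β : (x : M) → Tan x) (h : TField M) (x : M) (u v : Tan x) : ℝ :=
  let φ := chartAt E3 x
  let H : E3 → E3 → E3 → ℝ := fun y a b => h (φ.symm y)
    (mfderiv 𝓘(ℝ, E3) (𝓡 3) φ.symm y a) (mfderiv 𝓘(ℝ, E3) (𝓡 3) φ.symm y b)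
  let B : E3 → E3 := fun y => mfderiv (𝓡 3) 𝓘(ℝ, E3) φ (φ.symm y) (β (φ.symm y))
  let a : E3 := mfderiv (𝓡 3) 𝓘(ℝ, E3) φ x u
  let b : E3 := mfderiv (𝓡 3) 𝓘(ℝ, E3) φ x v
  fderiv ℝ (fun y => H y a b) (φ x) (B (φ x)) + H (φ x) (fderiv ℝ B (φ x) a) b
    + H (φ x) a (fderiv ℝ B (φ x) b)

/-- The ADM line element `-α² dτ² + h_ij (dx^i + β^i dτ)(dx^j + β^j dτ)` at `(τ, x)`, evaluated
on the vector `c ∂_τ + u`. -/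
def admForm (α : ℝ → M → ℝ) (β : ℝ → (x : M) → Tan x) (h : ℝ → TField M) (τ : ℝ) (x : M)
    (c : ℝ) (u : Tan x) : ℝ :=
  -(α τ x) ^ 2 * c ^ 2 + h τ x (u + c • β τ x) (u + c • β τ x)

/-- The extrinsic curvature `-(1 / 2α) (∂_τ h - L_β h)` of the slices of the ADM spacetime. -/
def extCurv (α : ℝ → M → ℝ) (β : ℝ → (x : M) → Tan x) (h : ℝ → TField M) (τ : ℝ) (x : M)
    (u v : Tan x) : ℝ :=
  -(1 / (2 * α τ x)) * (deriv (fun s => h s x u v) τ - lieDer (β τ) (h τ) x u v)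

/-- The worldline `τ ↦ (τ, x(τ))` of an observer following the foliation (normal to the slices) for
`0 ≤ τ ≤ r`. -/
def IsNormalObserver (β : ℝ → (x : M) → Tan x) (r : ℝ) (x : ℝ → M) : Prop :=
  ∀ s ∈ Icc 0 r, HasMFDerivAt 𝓘(ℝ, ℝ) (𝓡 3) x s
    (ContinuousLinearMap.toSpanSingleton ℝ (-(β s (x s))) : ℝ →L[ℝ] Tan (x s))

/-- The proper time along the worldline `s ↦ (s, x(s))`, `0 ≤ s ≤ r`. -/
def properTime (α : ℝ → M → ℝ) (β : ℝ → (x : M) → Tan x) (h : ℝ → TField M) (x : ℝ → M)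
    (r : ℝ) : ℝ :=
  ∫ s in (0 : ℝ)..r, Real.sqrt (-admForm α β h s (x s) 1 (mfderiv 𝓘(ℝ, ℝ) (𝓡 3) x s (1 : ℝ)))

variable [IsManifold (𝓡 3) ∞ M] [MeasurableSpace M] {Ω : Type*} [MeasurableSpace Ω]

/-- The history `g` of amplitude `l` is semiclassical at the length scale `L` for `0 ≤ τ ≤ r`.
It fluctuates about its mean `h`, in a norm `q` stronger than the `L²` norm, with a mean square of
order `(l / L)²`. The means `h_τ` are the slices of the spacetime with line element
`-α² dτ² + h_ij (dx^i + β^i dτ)(dx^j + β^j dτ)`, with extrinsic curvature nowhere zero.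
At the means the drift functional is the Einstein flow `-2 N K_ext + L_β h` with lapse `N`, and it is
twice differentiable there: its linearisation is bounded when tested against smooth fields, and the
remainder is quadratic. -/
structure IsSemiclassical (P : Measure Ω) (γ : TField M) (l : ℝ) (D : ℝ → TField M → TField M)
    (g : ℝ → Ω → TField M) (L r : ℝ) (h : ℝ → TField M) (α N : ℝ → M → ℝ)
    (β : ℝ → (x : M) → Tan x) (q : TField M → ℝ≥0∞) (A B κ : ℝ) : Prop where
  scale_pos : 0 < L
  duration_pos : 0 < r
  const_nonneg : 0 ≤ A ∧ 0 ≤ B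
  curv_pos : 0 < κ
  norm_le : ∀ f, MemField γ 2 f → ENNReal.ofReal (norm2 γ f) ≤ q f
  metric : ∀ τ ∈ Icc 0 r, IsRiemannian (h τ)
  smooth_h : ContMDiff (𝓘(ℝ, ℝ).prod (𝓡 3)) ((𝓡 3).prod 𝓘(ℝ, E3 →L[ℝ] E3 →L[ℝ] ℝ)) ∞
    fun p : ℝ × M => Bundle.TotalSpace.mk' (E3 →L[ℝ] E3 →L[ℝ] ℝ)
      (E := fun x : M => Tan x →L[ℝ] Tan x →L[ℝ] ℝ) p.2 (h p.1 p.2)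
  smooth_β : ContMDiff (𝓘(ℝ, ℝ).prod (𝓡 3)) (𝓡 3).tangent ∞
    fun p : ℝ × M => (⟨p.2, β p.1 p.2⟩ : TangentBundle (𝓡 3) M)
  smooth_α : ContMDiff (𝓘(ℝ, ℝ).prod (𝓡 3)) 𝓘(ℝ, ℝ) ∞ fun p : ℝ × M => α p.1 p.2
  smooth_N : ContMDiff (𝓘(ℝ, ℝ).prod (𝓡 3)) 𝓘(ℝ, ℝ) ∞ fun p : ℝ × M => N p.1 p.2
  α_pos : ∀ τ x, 0 < α τ x
  mean : ∀ τ ∈ Icc 0 r, ∀ φ, ContTF φ → IsSymm φ →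
    Integrable (fun ξ => ip γ (g τ ξ) φ) P ∧ ∫ ξ, ip γ (g τ ξ) φ ∂P = ip γ (h τ) φ
  fluctuation : ∀ τ ∈ Icc 0 r,
    ∫⁻ ξ, q (g τ ξ - h τ) ^ 2 ∂P ≤ ENNReal.ofReal (A * (l / L) ^ 2)
  einstein : ∀ τ ∈ Icc 0 r, ∀ x (u v : Tan x),
    D τ (h τ) x u v = -2 * N τ x * extCurv α β h τ x u v + lieDer (β τ) (h τ) x u v
  curv : ∀ τ ∈ Icc 0 r, ∀ x, κ ≤ Real.sqrt (pair γ x (extCurv α β h τ x) (extCurv α β h τ x))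
  differentiable : ∀ φ, SmoothTF φ → IsSymm φ → ∃ c : ℝ, ∀ τ ∈ Icc 0 r, ∃ ψ,
    MemField γ 2 ψ ∧ norm2 γ ψ ≤ c ∧
    ∀ f, MemField γ 2 f → MemField γ 1 (D τ (h τ + f)) →
      ENNReal.ofReal |ip γ (D τ (h τ + f)) φ - ip γ (D τ (h τ)) φ - ip γ f ψ| ≤
        ENNReal.ofReal (B * norm1 γ φ) * q f ^ 2

end ADM

end

end EmergentTime

open EmergentTime

/-!
The symmetric tensor fields are reduced to scalar functions by a *tight frame*: finitely many
continuous vector fields `X a` with `∑ a, γ(u, X a) γ(v, X a) = γ(u, v)`, which a partition of unity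
and Gram–Schmidt provide (`exists_tight_frame`). Reading off components in it embeds
`L²(Sym² T*Σ)` isometrically into `L²` of `Σ` times a finite set, and turns the covariance operator
into an integral operator with a continuous kernel. That operator is compact and self-adjoint, and
strictly positive on the symmetric fields, so the spectral theorem gives the eigentensors
(`TightFrame.exists_eigensystem`), and Mercer's theorem for continuous kernels gives the uniform
expansion (`MercerSystem.uniform_expansion`, `TightFrame.mercerExpansion`). Completeness of the
eigentensors yields Parseval's identity and with it the inverse quadratic form, mode by mode
(`TightFrame.hasSum_invForm`).

The modes of the Wiener process are integrals of a Gaussian field, and as such they lie in the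
closed linear span of the values of the field, where everything is jointly Gaussian
(`integral_field_mem`, `isGaussianProcess_of_mem`). Fubini's theorem and the eigenvalue equation
give the covariance `δ_ij min s t` of the normalised modes, so these are independent Brownian
motions, and the variance of the truncated expansion is the remainder of the Mercer series
(`TightFrame.karhunenLoeve`).

A mode of a solution is a multiple of a Brownian motion plus a continuous drift part of bounded
variation. The Brownian part has quadratic variation `b - a`, while products of increments with one
factor of bounded variation sum up to zero in the limit. Division by `lam m` cancels the size of the
noise, so every mode in `S` contributes `l² (b - a)` whatever the drift
(`TightFrame.meshLimit_invForm`). Hence the emergent time functionals are precisely the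
modifications of `b - a` (`TightFrame.isEmergentTime_iff`), from which its values, monotonicity,
additivity and independence of the drift follow. Independence of the coordinates is naturality: the
Riemannian volume, which is computed chart by chart, is transported by diffeomorphisms (`vol_pullT`),
and with it all the inner products and operators involved.

For the semiclassical limit the equation is tested against a smooth field `φ` and averaged. The noise
is centred, and so is the linear term in the Taylor expansion of the drift at the mean, so the
velocity of the means differs from the drift at the means only by the second-order remainder, at
most `A B (l / L)² ‖φ‖₁` (`TightFrame.abs_ip_flowDefect_le`). As `φ` is arbitrary, the bound
localises to a pointwise one (`TightFrame.tlen_le_of_ip_le`). By the definition of the extrinsic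
curvature the defect equals `-2 (α - N) K_ext`, and `|K_ext| ≥ κ`, which gives the bound on
`α - N` (`TightFrame.abs_lapse_sub_le`). Along a normal observer proper time is the integral of `α`.
-/

set_option linter.unusedSectionVars false

namespace EmergentTime

/-! ### Linear algebra in a fibre -/

section Fibre

variable {M : Type*} [TopologicalSpace M] [ChartedSpace E3 M]

/-- The `i`-th coordinate of a tangent vector with respect to `bvec`. -/
noncomputable def vcoord {x : M} (u : Tan x) (i : Fin 3) : ℝ := (show E3 from u) i

lemma sum_vcoord {x : M} (u : Tan x) : ∑ i, vcoord u i • bvec x i = u := by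
  have h : ∀ w : E3, ∑ i, w i • EuclideanSpace.single i (1 : ℝ) = w := by
    intro w
    ext j
    simp [Finset.sum_apply, Pi.single_apply]
  exact h u

lemma clm_eq_sum {x : M} (f : Tan x →L[ℝ] ℝ) (u : Tan x) :
    f u = ∑ i, vcoord u i * f (bvec x i) := by
  conv_lhs => rw [← sum_vcoord u]
  simp [map_sum]

lemma bilin_eq_sum {x : M} (a : Tan x →L[ℝ] Tan x →L[ℝ] ℝ) (u v : Tan x) :
    a u v = ∑ i, ∑ j, vcoord u i * vcoord v j * a (bvec x i) (bvec x j) := by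
  conv_lhs => rw [← sum_vcoord u]
  simp only [map_sum, map_smul, sum_apply,
    smul_apply, smul_eq_mul]
  refine Finset.sum_congr rfl fun i _ => ?_
  rw [clm_eq_sum (a (bvec x i)) v, Finset.mul_sum]
  exact Finset.sum_congr rfl fun j _ => by ring

/-- A family of tangent vectors with `∑ X_a ⊗ X_a = γ⁻¹`. -/
def IsTight {ι : Type*} [Fintype ι] (γ : TField M) (x : M) (X : ι → Tan x) : Prop :=
  ∀ u v : Tan x, ∑ a, γ x u (X a) * γ x v (X a) = γ x u v

/-- The Gram matrix of an inner product is positive definite, hence invertible: the inverse in the fibre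
inner product `pair` is a genuine one. -/
lemma gram_posDef {γ : TField M} {x : M} (hs : ∀ u v : Tan x, γ x u v = γ x v u)
    (hp : ∀ u : Tan x, u ≠ 0 → 0 < γ x u u) : (gram γ x).PosDef := by
  refine Matrix.PosDef.of_dotProduct_mulVec_pos ?_ ?_
  · ext i j
    simp [gram, hs (bvec x j)]
  · intro w hw
    have key : star w ⬝ᵥ (gram γ x).mulVec w
        = γ x (∑ i, w i • bvec x i) (∑ i, w i • bvec x i) := by
      simp only [dotProduct, Matrix.mulVec, gram, map_sum, map_smul,
        sum_apply, smul_apply, smul_eq_mul,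
        Matrix.of_apply, Pi.star_apply, star_trivial, Finset.mul_sum]
      rw [Finset.sum_comm]
      exact Finset.sum_congr rfl fun i _ => Finset.sum_congr rfl fun j _ => by ring
    rw [key]
    apply hp
    intro h0
    apply hw
    have : ∀ j, vcoord (∑ i, w i • bvec x i : Tan x) j = w j := by
      intro j
      have h : ∀ w : Fin 3 → ℝ, (∑ i, w i • (EuclideanSpace.single i (1 : ℝ) : E3)) j = w j := by
        intro w
        simp [Finset.sum_apply, Pi.single_apply]
      exact h w
    funext j
    rw [← this j, h0]
    rfl

/-- For a tight family the inverse Gram matrix is `C Cᵀ`, where `C` is the matrix of coordinates of the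
family: tightness says `G C Cᵀ G = G`. -/
lemma IsTight.gram_inv {ι : Type*} [Fintype ι] {γ : TField M} {x : M} {X : ι → Tan x}
    (hX : IsTight γ x X) (hs : ∀ u v : Tan x, γ x u v = γ x v u)
    (hp : ∀ u : Tan x, u ≠ 0 → 0 < γ x u u) (i k : Fin 3) :
    (gram γ x)⁻¹ i k = ∑ a, vcoord (X a) i * vcoord (X a) k := by
  set G := gram γ x with hG
  let C : Matrix (Fin 3) ι ℝ := Matrix.of fun i a => vcoord (X a) i
  have hunit : IsUnit G.det := (gram_posDef hs hp).det_pos.ne'.isUnit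
  have hGC : ∀ i a, (G * C) i a = γ x (bvec x i) (X a) := by
    intro i a
    rw [Matrix.mul_apply, clm_eq_sum]
    exact Finset.sum_congr rfl fun j _ => by simp [hG, gram, C, mul_comm]
  have h1 : (G * C) * (G * C).transpose = G := by
    ext i j
    rw [Matrix.mul_apply]
    simp only [Matrix.transpose_apply, hGC]
    exact hX _ _
  have hGt : G.transpose = G := by
    ext i j
    simp [hG, gram, hs (bvec x j)]
  have h2 : C * C.transpose = G⁻¹ := by
    rw [Matrix.transpose_mul, hGt] at h1
    have h3 : G * (C * C.transpose * G) = G * 1 := by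
      simpa [Matrix.mul_assoc] using h1
    have h4 : C * C.transpose * G = 1 := by
      have := congrArg (fun A => G⁻¹ * A) h3
      simpa [← Matrix.mul_assoc, Matrix.nonsing_inv_mul G hunit] using this
    exact (Matrix.inv_eq_left_inv h4).symm
  rw [← h2, Matrix.mul_apply]
  rfl

/-- In a tight family the fibre inner product is the Euclidean one of the components. -/
lemma IsTight.pair_eq {ι : Type*} [Fintype ι] {γ : TField M} {x : M} {X : ι → Tan x}
    (hX : IsTight γ x X) (hs : ∀ u v : Tan x, γ x u v = γ x v u)
    (hp : ∀ u : Tan x, u ≠ 0 → 0 < γ x u u) (a b : Tan x →L[ℝ] Tan x →L[ℝ] ℝ) :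
    pair γ x (fun u v => a u v) (fun u v => b u v) =
      ∑ p, ∑ q, a (X p) (X q) * b (X p) (X q) := by
  have expand : ∀ p q, a (X p) (X q) * b (X p) (X q) = ∑ i, ∑ j, ∑ k, ∑ l,
      (vcoord (X p) i * vcoord (X p) k) * (vcoord (X q) j * vcoord (X q) l) *
        a (bvec x i) (bvec x j) * b (bvec x k) (bvec x l) := by
    intro p q
    rw [bilin_eq_sum a (X p), bilin_eq_sum b (X p), Finset.sum_mul]
    refine Finset.sum_congr rfl fun i _ => ?_
    rw [Finset.sum_mul]
    refine Finset.sum_congr rfl fun j _ => ?_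
    rw [Finset.mul_sum]
    refine Finset.sum_congr rfl fun k _ => ?_
    rw [Finset.mul_sum]
    exact Finset.sum_congr rfl fun l _ => by ring
  simp only [expand, pair, hX.gram_inv hs hp, Finset.sum_mul, Finset.mul_sum]
  simp only [← Finset.sum_product', Finset.univ_product_univ]
  exact Finset.sum_bij' (fun t _ => (t.2.2.2.2.2, t.2.2.2.2.1, t.1, t.2.1, t.2.2.1, t.2.2.2.1))
    (fun s _ => (s.2.2.1, s.2.2.2.1, s.2.2.2.2.1, s.2.2.2.2.2, s.2.1, s.1))
    (by simp) (by simp) (by simp) (by simp) (by simp)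

/-- Reconstruction of a vector from its components in a tight family. -/
lemma IsTight.sum_smul {ι : Type*} [Fintype ι] {γ : TField M} {x : M} {X : ι → Tan x}
    (hX : IsTight γ x X) (hs : ∀ u v : Tan x, γ x u v = γ x v u)
    (hp : ∀ u : Tan x, u ≠ 0 → 0 < γ x u u) (u : Tan x) :
    ∑ a, γ x u (X a) • X a = u := by
  by_contra hne
  have h1 : ∀ v, γ x v (∑ a, γ x u (X a) • X a - u) = 0 := by
    intro v
    simp only [map_sub, map_sum, map_smul, smul_eq_mul]
    rw [hX u v, hs u v, sub_self]
  exact (hp _ (sub_ne_zero.2 hne)).ne' (h1 _)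

/-- Reconstruction of a bilinear form from its components in a tight family. -/
lemma IsTight.bilin_eq {ι : Type*} [Fintype ι] {γ : TField M} {x : M} {X : ι → Tan x}
    (hX : IsTight γ x X) (hs : ∀ u v : Tan x, γ x u v = γ x v u)
    (hp : ∀ u : Tan x, u ≠ 0 → 0 < γ x u u) (h : Tan x →L[ℝ] Tan x →L[ℝ] ℝ) (u v : Tan x) :
    h u v = ∑ a, ∑ b, γ x u (X a) * γ x v (X b) * h (X a) (X b) := by
  conv_lhs => rw [← hX.sum_smul hs hp u, ← hX.sum_smul hs hp v]
  simp only [map_sum, map_smul, sum_apply, smul_apply, smul_eq_mul, Finset.mul_sum]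
  rw [Finset.sum_comm]
  exact Finset.sum_congr rfl fun i _ => Finset.sum_congr rfl fun j _ => by ring

lemma pair_smul_left (γ : TField M) (x : M) (c : ℝ) (a b : Tan x → Tan x → ℝ) :
    pair γ x (fun u v => c * a u v) b = c * pair γ x a b := by
  simp only [pair, Finset.mul_sum]
  refine Finset.sum_congr rfl fun i _ => Finset.sum_congr rfl fun j _ =>
    Finset.sum_congr rfl fun k _ => Finset.sum_congr rfl fun l _ => by ring

lemma pair_smul_right (γ : TField M) (x : M) (c : ℝ) (a b : Tan x → Tan x → ℝ) :
    pair γ x a (fun u v => c * b u v) = c * pair γ x a b := by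
  simp only [pair, Finset.mul_sum]
  refine Finset.sum_congr rfl fun i _ => Finset.sum_congr rfl fun j _ =>
    Finset.sum_congr rfl fun k _ => Finset.sum_congr rfl fun l _ => by ring

end Fibre

/-! ### Tensor fields in local frames -/

section LocalFrames

open Bundle

lemma continuousWithinAt_of_trivial {M : Type*} [TopologicalSpace M] {N : Type*}
    [TopologicalSpace N] {b : N → M} {f : N → ℝ} {s : Set N} {m : N}
    (h : ContinuousWithinAt (fun m => TotalSpace.mk' ℝ (E := fun _ : M => ℝ) (b m) (f m)) s m) :
    ContinuousWithinAt f s m :=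
  ((FiberBundle.continuousWithinAt_totalSpace ℝ _).1 h).2

variable {M : Type*} [TopologicalSpace M] [ChartedSpace E3 M]

lemma contMDiffWithinAt_of_trivial {EN HN N : Type*} [NormedAddCommGroup EN] [NormedSpace ℝ EN]
    [TopologicalSpace HN] {J : ModelWithCorners ℝ EN HN} [TopologicalSpace N] [ChartedSpace HN N]
    {n : ℕ∞ω} {b : N → M} {f : N → ℝ} {s : Set N} {m : N}
    (h : ContMDiffWithinAt J ((𝓡 3).prod 𝓘(ℝ, ℝ)) n
      (fun m => TotalSpace.mk' ℝ (E := fun _ : M => ℝ) (b m) (f m)) s m) :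
    ContMDiffWithinAt J 𝓘(ℝ, ℝ) n f s m :=
  (contMDiffWithinAt_totalSpace.1 h).2

variable [IsManifold (𝓡 3) ∞ M]

/-- The frame at `x` induced by the chart centred at `c`. It is meaningful for `x` in the domain of
that chart. -/
noncomputable def frame (c x : M) : E3 →L[ℝ] Tan x :=
  mfderiv 𝓘(ℝ, E3) (𝓡 3) (chartAt E3 c).symm (chartAt E3 c x)

omit [IsManifold (𝓡 3) ∞ M] in
lemma frame_def (c x : M) : frame c x =
    mfderiv 𝓘(ℝ, E3) (𝓡 3) (chartAt E3 c).symm (chartAt E3 c x) := rfl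

lemma frame_eq_symmL {c x : M} (hx : x ∈ (chartAt E3 c).source) :
    frame c x = (trivializationAt E3 (TangentSpace (𝓡 3)) c).symmL ℝ x := by
  rw [TangentBundle.symmL_trivializationAt hx]
  simp [mfderivWithin_univ]
  rfl

/-- The components of a bilinear form in the frame of the chart centred at `c`, in the form in which
Mathlib states smoothness of sections of the bundle of bilinear forms. -/
noncomputable def loc (h : TField M) (c x : M) : E3 →L[ℝ] E3 →L[ℝ] ℝ :=
  ContinuousLinearMap.inCoordinates E3 (fun x : M => Tan x) (E3 →L[ℝ] ℝ)
    (fun x : M => Tan x →L[ℝ] ℝ) c x c x (h x)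

lemma loc_apply (h : TField M) {c x : M} (hx : x ∈ (chartAt E3 c).source) (a b : E3) :
    loc h c x a b = h x (frame c x a) (frame c x b) := by
  have hx' : x ∈ (trivializationAt E3 (TangentSpace (𝓡 3)) c).baseSet := by simpa using hx
  unfold loc
  rw [inCoordinates_apply_eq₂ (F₃ := ℝ) (E₃ := fun _ : M => ℝ) hx' hx' (by simp),
    frame_eq_symmL hx, Trivialization.symmL_apply _ hx', Trivialization.symmL_apply _ hx']
  simp

lemma contMDiff_iff_loc (h : TField M) (n : ℕ∞ω) :
    ContMDiff (𝓡 3) ((𝓡 3).prod 𝓘(ℝ, E3 →L[ℝ] E3 →L[ℝ] ℝ)) n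
      (fun x => Bundle.TotalSpace.mk' (E3 →L[ℝ] E3 →L[ℝ] ℝ)
        (E := fun x : M => Tan x →L[ℝ] Tan x →L[ℝ] ℝ) x (h x)) ↔
    ∀ c, ContMDiffAt (𝓡 3) 𝓘(ℝ, E3 →L[ℝ] E3 →L[ℝ] ℝ) n (loc h c) c := by
  refine forall_congr' fun c => ?_
  rw [contMDiffAt_hom_bundle]
  exact ⟨fun h => h.2, fun h => ⟨contMDiffAt_id, h⟩⟩

lemma bilin_eq_sum_proj (F : E3 →L[ℝ] E3 →L[ℝ] ℝ) :
    F = ∑ i, ∑ j, F (EuclideanSpace.single i 1) (EuclideanSpace.single j 1) •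
      (EuclideanSpace.proj i : E3 →L[ℝ] ℝ).smulRight
        (EuclideanSpace.proj j : E3 →L[ℝ] ℝ) := by
  have hv : ∀ w : E3, w = ∑ i, w i • EuclideanSpace.single i (1 : ℝ) := by
    intro w
    ext j
    simp [Finset.sum_apply, Pi.single_apply]
  refine ContinuousLinearMap.ext fun u => ContinuousLinearMap.ext fun v => ?_
  conv_lhs => rw [hv u, hv v]
  simp only [map_sum, map_smul, sum_apply, smul_apply, smul_eq_mul, Finset.mul_sum,
    ContinuousLinearMap.smulRight_apply, PiLp.proj_apply]
  rw [Finset.sum_comm]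
  exact Finset.sum_congr rfl fun i _ => Finset.sum_congr rfl fun j _ => by ring

lemma contMDiffAt_bilin {EN HN N : Type*} [NormedAddCommGroup EN] [NormedSpace ℝ EN]
    [TopologicalSpace HN] {J : ModelWithCorners ℝ EN HN} [TopologicalSpace N] [ChartedSpace HN N]
    {n : ℕ∞ω} {F : N → E3 →L[ℝ] E3 →L[ℝ] ℝ} {c : N}
    (hF : ∀ a b : E3, ContMDiffAt J 𝓘(ℝ, ℝ) n (fun x => F x a b) c) :
    ContMDiffAt J 𝓘(ℝ, E3 →L[ℝ] E3 →L[ℝ] ℝ) n F c := by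
  have : F = fun x => ∑ i, ∑ j, F x (EuclideanSpace.single i 1) (EuclideanSpace.single j 1) •
      (EuclideanSpace.proj i : E3 →L[ℝ] ℝ).smulRight
        (EuclideanSpace.proj j : E3 →L[ℝ] ℝ) :=
    funext fun x => bilin_eq_sum_proj (F x)
  rw [this]
  exact contMDiffAt_finsetSum fun i _ => contMDiffAt_finsetSum fun j _ =>
    (hF _ _).smul contMDiffAt_const

/-- A tensor field is `C^n` when its components in the coordinate frames are. -/
lemma contMDiff_of_frame {h : TField M} {n : ℕ∞ω}
    (H : ∀ c, ∀ a b : E3,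
      ContMDiffAt (𝓡 3) 𝓘(ℝ, ℝ) n (fun x => h x (frame c x a) (frame c x b)) c) :
    ContMDiff (𝓡 3) ((𝓡 3).prod 𝓘(ℝ, E3 →L[ℝ] E3 →L[ℝ] ℝ)) n
      (fun x => Bundle.TotalSpace.mk' (E3 →L[ℝ] E3 →L[ℝ] ℝ)
        (E := fun x : M => Tan x →L[ℝ] Tan x →L[ℝ] ℝ) x (h x)) := by
  rw [contMDiff_iff_loc]
  refine fun c => contMDiffAt_bilin fun a b => (H c a b).congr_of_eventuallyEq ?_
  filter_upwards [(chartAt E3 c).open_source.mem_nhds (mem_chart_source E3 c)] with x hx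
  exact loc_apply h hx a b

lemma continuousAt_bilin {N : Type*} [TopologicalSpace N] {F : N → E3 →L[ℝ] E3 →L[ℝ] ℝ} {c : N}
    (hF : ∀ a b : E3, ContinuousAt (fun x => F x a b) c) : ContinuousAt F c := by
  have : F = fun x => ∑ i, ∑ j, F x (EuclideanSpace.single i 1) (EuclideanSpace.single j 1) •
      (EuclideanSpace.proj i : E3 →L[ℝ] ℝ).smulRight (EuclideanSpace.proj j : E3 →L[ℝ] ℝ) :=
    funext fun x => bilin_eq_sum_proj (F x)
  rw [this]
  have : ContinuousAdd (E3 →L[ℝ] E3 →L[ℝ] ℝ) :=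
    (inferInstance : IsTopologicalAddGroup (E3 →L[ℝ] E3 →L[ℝ] ℝ)).toContinuousAdd
  exact tendsto_finsetSum _ fun i _ => tendsto_finsetSum _ fun j _ => (hF _ _).smul tendsto_const_nhds

lemma contTF_of_frame {h : TField M} (H : ∀ c, ∀ a b : E3,
      ContinuousAt (fun x => h x (frame c x a) (frame c x b)) c) : ContTF h := by
  refine contMDiff_zero_iff.2 (continuous_iff_continuousAt.2 fun c => ?_)
  rw [continuousAt_hom_bundle]
  refine ⟨continuousAt_id, ?_⟩
  refine continuousAt_bilin fun a b => (H c a b).congr_of_eventuallyEq ?_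
  filter_upwards [(chartAt E3 c).open_source.mem_nhds (mem_chart_source E3 c)] with x hx
  exact loc_apply h hx a b

lemma contMDiffOn_frame (c : M) (a : E3) :
    ContMDiffOn (𝓡 3) (𝓡 3).tangent (∞ : ℕ∞ω)
      (fun x => (⟨x, frame c x a⟩ : TangentBundle (𝓡 3) M)) (chartAt E3 c).source := by
  have h1 := (trivializationAt E3 (TangentSpace (𝓡 3) (M := M)) c).contMDiffOn_symm
    (IB := 𝓡 3) (n := (∞ : ℕ∞ω))
  have h2 : ContMDiff (𝓡 3) ((𝓡 3).prod 𝓘(ℝ, E3)) (∞ : ℕ∞ω) (fun x : M => (x, a)) :=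
    contMDiff_id.prodMk contMDiff_const
  refine (h1.comp h2.contMDiffOn (s := (chartAt E3 c).source) ?_).congr ?_
  · intro x hx
    simpa [Trivialization.target_eq] using hx
  · intro x hx
    have hx' : x ∈ (trivializationAt E3 (TangentSpace (𝓡 3)) c).baseSet := by simpa using hx
    rw [frame_eq_symmL hx, Trivialization.symmL_apply _ hx']
    exact Trivialization.mk_symm _ hx' a

lemma continuousOn_frame (c : M) (a : E3) :
    ContinuousOn (fun x => (⟨x, frame c x a⟩ : TangentBundle (𝓡 3) M)) (chartAt E3 c).source :=
  (contMDiffOn_frame c a).continuousOn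

lemma continuousWithinAt_apply {h : TField M} (hh : ContTF h) {N : Type*} [TopologicalSpace N]
    {b : N → M} {X Y : (m : N) → Tan (b m)} {s : Set N} {m : N}
    (hX : ContinuousWithinAt (fun m => (⟨b m, X m⟩ : TangentBundle (𝓡 3) M)) s m)
    (hY : ContinuousWithinAt (fun m => (⟨b m, Y m⟩ : TangentBundle (𝓡 3) M)) s m) :
    ContinuousWithinAt (fun m => h (b m) (X m) (Y m)) s m := by
  have hb : ContinuousWithinAt b s m := ((FiberBundle.continuousWithinAt_totalSpace E3 _).1 hX).1
  have h1 := (ContMDiff.continuous hh).continuousAt.comp_continuousWithinAt hb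
  exact continuousWithinAt_of_trivial (ContinuousWithinAt.clm_bundle_apply₂ (𝕜 := ℝ)
    (E₃ := fun _ : M => ℝ) (F₃ := ℝ) h1 hX hY)

lemma ContTF.continuous_apply {h : TField M} (hh : ContTF h) {X Y : (x : M) → Tan x}
    (hX : ContVF X) (hY : ContVF Y) : Continuous fun x => h x (X x) (Y x) := by
  rw [← continuousOn_univ]
  exact fun x hx => continuousWithinAt_apply hh (b := id) hX.continuousWithinAt hY.continuousWithinAt

lemma SmoothTF.contTF {h : TField M} (hh : SmoothTF h) : ContTF h :=
  ContMDiff.of_le hh (by simp)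

end LocalFrames

/-! ### Global tight families of continuous vector fields -/

section GramSchmidt

/-- The vector `z`, normalised with respect to the form `G`. -/
noncomputable def nrm (G : E3 →L[ℝ] E3 →L[ℝ] ℝ) (z : E3) : E3 := (Real.sqrt (G z z))⁻¹ • z

/-- The standard basis of the model space. -/
noncomputable abbrev stdE (i : Fin 3) : E3 := EuclideanSpace.single i (1 : ℝ)

/-- The second vector of the Gram–Schmidt process, before normalisation. -/
noncomputable def gsSnd (G : E3 →L[ℝ] E3 →L[ℝ] ℝ) : E3 :=
  stdE 1 - G (stdE 1) (nrm G (stdE 0)) • nrm G (stdE 0)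

/-- The third vector of the Gram–Schmidt process, before normalisation. -/
noncomputable def gsTrd (G : E3 →L[ℝ] E3 →L[ℝ] ℝ) : E3 :=
  stdE 2 - G (stdE 2) (nrm G (stdE 0)) • nrm G (stdE 0) -
    G (stdE 2) (nrm G (gsSnd G)) • nrm G (gsSnd G)

/-- The Gram–Schmidt basis of the form `G`, by explicit formulas, so that it depends continuously
on `G`. -/
noncomputable def gs (G : E3 →L[ℝ] E3 →L[ℝ] ℝ) : Fin 3 → E3 :=
  ![nrm G (stdE 0), nrm G (gsSnd G), nrm G (gsTrd G)]

lemma nrm_self {G : E3 →L[ℝ] E3 →L[ℝ] ℝ} (hp : ∀ u, u ≠ 0 → 0 < G u u) {z : E3} (hz : z ≠ 0) :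
    G (nrm G z) (nrm G z) = 1 := by
  have h := hp z hz
  have h2 : Real.sqrt (G z z) ≠ 0 := (Real.sqrt_pos.2 h).ne'
  have h3 : Real.sqrt (G z z) * Real.sqrt (G z z) = G z z := Real.mul_self_sqrt h.le
  simp only [nrm, map_smul, smul_apply, smul_eq_mul]
  field_simp
  rw [pow_two, h3]

lemma nrm_orth {G : E3 →L[ℝ] E3 →L[ℝ] ℝ} {z w : E3} (h : G z w = 0) : G (nrm G z) w = 0 := by
  simp [nrm, h]

lemma gs_spec {G : E3 →L[ℝ] E3 →L[ℝ] ℝ} (hs : ∀ u v, G u v = G v u)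
    (hp : ∀ u, u ≠ 0 → 0 < G u u) :
    gsSnd G ≠ 0 ∧ gsTrd G ≠ 0 ∧ ∀ i j, G (gs G i) (gs G j) = if i = j then 1 else 0 := by
  set e : Fin 3 → E3 := stdE with he
  set a := nrm G (e 0) with ha
  have hzb : gsSnd G = e 1 - G (e 1) a • a := rfl
  set zb := gsSnd G
  set b := nrm G zb with hb
  have hzc : gsTrd G = e 2 - G (e 2) a • a - G (e 2) b • b := rfl
  set zc := gsTrd G
  set c := nrm G zc with hc
  have h0 : e 0 ≠ 0 := by
    intro h
    have := congrArg (fun w : E3 => w 0) h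
    simp [he] at this
  have ha1 : a 1 = 0 := by simp [ha, nrm, he]
  have ha2 : a 2 = 0 := by simp [ha, nrm, he]
  have hb1 : zb ≠ 0 := by
    intro h
    have := congrArg (fun w : E3 => w 1) h
    simp [hzb, ha1, he] at this
  have hb2 : b 2 = 0 := by simp [hb, nrm, hzb, ha2, he]
  have hc0 : zc ≠ 0 := by
    intro h
    have := congrArg (fun w : E3 => w 2) h
    simp [hzc, ha2, hb2, he] at this
  have haa : G a a = 1 := nrm_self hp h0
  have hbb : G b b = 1 := nrm_self hp hb1
  have hcc : G c c = 1 := nrm_self hp hc0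
  have hba : G b a = 0 := nrm_orth (by simp [hzb, haa])
  have hab : G a b = 0 := by rw [hs, hba]
  have hca : G c a = 0 := nrm_orth (by simp [hzc, haa, hba])
  have hcb : G c b = 0 := nrm_orth (by simp [hzc, hbb, hab])
  have hac : G a c = 0 := by rw [hs, hca]
  have hbc : G b c = 0 := by rw [hs, hcb]
  have hgs : gs G = ![a, b, c] := rfl
  refine ⟨hb1, hc0, ?_⟩
  · intro i j
    rw [hgs]
    fin_cases i <;> fin_cases j <;>
      simp [haa, hbb, hcc, hba, hab, hca, hcb, hac, hbc]

lemma gs_tight {G : E3 →L[ℝ] E3 →L[ℝ] ℝ} (hs : ∀ u v, G u v = G v u)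
    (hp : ∀ u, u ≠ 0 → 0 < G u u) (u v : E3) :
    ∑ j, G u (gs G j) * G v (gs G j) = G u v := by
  obtain ⟨-, -, ho⟩ := gs_spec hs hp
  have hli : LinearIndependent ℝ (gs G) := by
    rw [Fintype.linearIndependent_iff]
    intro g hg i
    have := congrArg (fun w => G w (gs G i)) hg
    simpa [ho, sum_apply] using this
  let B := basisOfLinearIndependentOfCardEqFinrank hli (by simp)
  have hB : ∀ i, B i = gs G i := fun i => by simp [B]
  have hu : ∀ w : E3, ∀ j, G w (gs G j) = B.repr w j := by
    intro w j
    conv_lhs => rw [← B.sum_repr w]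
    simp [hB, ho, sum_apply]
  conv_rhs => rw [← B.sum_repr u]
  simp only [map_sum, map_smul, sum_apply, smul_apply, smul_eq_mul, hB]
  refine Finset.sum_congr rfl fun j _ => ?_
  rw [hu u j, hs v]

lemma continuousAt_nrm {N : Type*} [TopologicalSpace N] {F : N → E3 →L[ℝ] E3 →L[ℝ] ℝ}
    {z : N → E3} {c : N} (hF : ContinuousAt F c) (hz : ContinuousAt z c)
    (h0 : F c (z c) (z c) ≠ 0) (h1 : 0 ≤ F c (z c) (z c)) :
    ContinuousAt (fun x => nrm (F x) (z x)) c := by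
  unfold nrm
  have h2 : ContinuousAt (fun x => F x (z x) (z x)) c := (hF.clm_apply hz).clm_apply hz
  exact (h2.sqrt.inv₀ (Real.sqrt_ne_zero'.2 (lt_of_le_of_ne h1 h0.symm))).smul hz

lemma continuousAt_gs {N : Type*} [TopologicalSpace N] {F : N → E3 →L[ℝ] E3 →L[ℝ] ℝ} {c : N}
    (hF : ContinuousAt F c) (hs : ∀ u v, F c u v = F c v u) (hp : ∀ u, u ≠ 0 → 0 < F c u u)
    (j : Fin 3) : ContinuousAt (fun x => gs (F x) j) c := by
  obtain ⟨hb, hc, -⟩ := gs_spec hs hp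
  have h0 : stdE 0 ≠ 0 := by
    intro h
    have := congrArg (fun w : E3 => w 0) h
    simp at this
  have n0 : ContinuousAt (fun x => nrm (F x) (stdE 0)) c :=
    continuousAt_nrm hF continuousAt_const (hp _ h0).ne' (hp _ h0).le
  have z1 : ContinuousAt (fun x => gsSnd (F x)) c :=
    continuousAt_const.sub (((hF.clm_apply continuousAt_const).clm_apply n0).smul n0)
  have n1 : ContinuousAt (fun x => nrm (F x) (gsSnd (F x))) c :=
    continuousAt_nrm hF z1 (hp _ hb).ne' (hp _ hb).le
  have z2 : ContinuousAt (fun x => gsTrd (F x)) c :=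
    (continuousAt_const.sub (((hF.clm_apply continuousAt_const).clm_apply n0).smul n0)).sub
      (((hF.clm_apply continuousAt_const).clm_apply n1).smul n1)
  have n2 : ContinuousAt (fun x => nrm (F x) (gsTrd (F x))) c :=
    continuousAt_nrm hF z2 (hp _ hc).ne' (hp _ hc).le
  fin_cases j
  exacts [n0, n1, n2]

end GramSchmidt

section TightFrame

open Bundle

variable {M : Type*} [TopologicalSpace M] [ChartedSpace E3 M] [IsManifold (𝓡 3) ∞ M]

lemma continuousOn_frame_apply (c : M) {v : M → E3}
    (hv : ContinuousOn v (chartAt E3 c).source) :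
    ContinuousOn (fun x => (⟨x, frame c x (v x)⟩ : TangentBundle (𝓡 3) M))
      (chartAt E3 c).source := by
  have h1 := (trivializationAt E3 (TangentSpace (𝓡 3) (M := M)) c).continuousOn_symm
  have h2 : ContinuousOn (fun x : M => (x, v x)) (chartAt E3 c).source := continuousOn_id.prodMk hv
  refine (h1.comp h2 ?_).congr ?_
  · intro x hx
    simpa using hx
  · intro x hx
    have hx' : x ∈ (trivializationAt E3 (TangentSpace (𝓡 3)) c).baseSet := by simpa using hx
    simp [frame_eq_symmL hx, Trivialization.symmL_apply _ hx']

lemma frame_bijective {c x : M} (hx : x ∈ (chartAt E3 c).source) :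
    Function.Bijective (frame c x) := by
  have hx' : x ∈ (trivializationAt E3 (TangentSpace (𝓡 3)) c).baseSet := by simpa using hx
  have := ((trivializationAt E3 (TangentSpace (𝓡 3)) c).continuousLinearEquivAt ℝ x hx').symm.bijective
  rw [frame_eq_symmL hx]
  convert this using 1
  ext a
  simp [Trivialization.symmL_apply _ hx']

variable {γ : TField M}

lemma loc_symm (hs : IsSymm γ) {c x : M} (hx : x ∈ (chartAt E3 c).source) (u v : E3) :
    loc γ c x u v = loc γ c x v u := by
  rw [loc_apply γ hx, loc_apply γ hx, hs]

lemma loc_pos (hp : ∀ x (u : Tan x), u ≠ 0 → 0 < γ x u u) {c x : M}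
    (hx : x ∈ (chartAt E3 c).source) {u : E3} (hu : u ≠ 0) : 0 < loc γ c x u u := by
  rw [loc_apply γ hx]
  apply hp
  intro h
  exact hu ((frame_bijective hx).1 (by simpa using h))

lemma ContTF.continuousOn_loc (hγ : ContTF γ) (c : M) :
    ContinuousOn (loc γ c) (chartAt E3 c).source := by
  intro x hx
  refine ContinuousAt.continuousWithinAt (continuousAt_bilin fun a b => ?_)
  have h := continuousWithinAt_apply hγ (b := fun x => x) (continuousOn_frame c a x hx)
    (continuousOn_frame c b x hx)
  refine (h.continuousAt ((chartAt E3 c).open_source.mem_nhds hx)).congr ?_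
  filter_upwards [(chartAt E3 c).open_source.mem_nhds hx] with y hy
  exact (loc_apply γ hy a b).symm

/-- A compact Riemannian manifold carries finitely many continuous vector fields which form a tight
family in every tangent space: local orthonormal frames, weighted by the square roots of a
partition of unity. -/
theorem exists_tight_frame [T2Space M] [CompactSpace M] (hγ : IsRiemannian γ) :
    ∃ n, ∃ X : Fin n → (x : M) → Tan x, (∀ a, ContVF (X a)) ∧
      ∀ x, IsTight γ x (fun a => X a x) := by
  classical
  obtain ⟨t, ht⟩ := CompactSpace.elim_nhds_subcover (fun c : M => (chartAt E3 c).source)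
    fun c => (chartAt E3 c).open_source.mem_nhds (mem_chart_source E3 c)
  obtain ⟨ρ, hρ⟩ := PartitionOfUnity.exists_isSubordinate (s := (univ : Set M)) isClosed_univ
    (fun c : t => (chartAt E3 (c : M)).source) (fun c => (chartAt E3 (c : M)).open_source) (by
      intro x _
      have : x ∈ ⋃ c ∈ t, (chartAt E3 c).source := by rw [ht]; trivial
      simpa using this)
  have hρ1 : ∀ x, ∑ c : t, ρ c x = 1 := by
    intro x
    rw [← finsum_eq_sum_of_fintype]
    exact ρ.sum_eq_one (mem_univ x)
  -- The partition of unity enters by its square roots, as tightness is quadratic in the fields.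
  let Y : t × Fin 3 → (x : M) → Tan x := fun p x =>
    frame (p.1 : M) x (Real.sqrt (ρ p.1 x) • gs (loc γ p.1 x) p.2)
  have hzero : ∀ (p : t × Fin 3) x, x ∉ tsupport (ρ p.1) → Y p x = 0 := by
    intro p x hx
    have : ρ p.1 x = 0 := image_eq_zero_of_notMem_tsupport hx
    simp [Y, this]
  have hYc : ∀ p, ContVF (Y p) := by
    intro p
    refine continuous_iff_continuousAt.2 fun x => ?_
    by_cases hx : x ∈ tsupport (ρ p.1)
    · have hx' := hρ p.1 hx
      refine ContinuousOn.continuousAt (s := (chartAt E3 (p.1 : M)).source) ?_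
        ((chartAt E3 (p.1 : M)).open_source.mem_nhds hx')
      refine continuousOn_frame_apply _ fun y hy => ?_
      refine ContinuousWithinAt.smul (f := fun y => Real.sqrt (ρ p.1 y))
        (g := fun y => gs (loc γ p.1 y) p.2) ?_ ?_
      · exact (Real.continuous_sqrt.comp (ρ p.1).continuous).continuousWithinAt
      · have hl := (hγ.smooth.contTF.continuousOn_loc (p.1 : M)).continuousAt
          ((chartAt E3 (p.1 : M)).open_source.mem_nhds hy)
        exact (continuousAt_gs hl (loc_symm hγ.symm hy)
          (fun u hu => loc_pos hγ.pos hy hu) p.2).continuousWithinAt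
    · have hz : Continuous (fun y : M => (⟨y, 0⟩ : TangentBundle (𝓡 3) M)) :=
        (contMDiff_zeroSection (IB := 𝓡 3) (n := 0) ℝ (TangentSpace (𝓡 3) (M := M))
          (F := E3)).continuous
      refine hz.continuousAt.congr ?_
      filter_upwards [(isClosed_tsupport (ρ p.1)).isOpen_compl.mem_nhds hx] with y hy
      rw [hzero p y hy]
  have hYt : ∀ x, IsTight γ x (fun p => Y p x) := by
    intro x u v
    rw [Fintype.sum_prod_type]
    have key : ∀ c : t, ∑ j, γ x u (Y (c, j) x) * γ x v (Y (c, j) x) = ρ c x * γ x u v := by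
      intro c
      by_cases hx : x ∈ tsupport (ρ c)
      · have hx' := hρ c hx
        obtain ⟨a, rfl⟩ := (frame_bijective hx').2 u
        obtain ⟨b, rfl⟩ := (frame_bijective hx').2 v
        have hsq : Real.sqrt (ρ c x) * Real.sqrt (ρ c x) = ρ c x :=
          Real.mul_self_sqrt (ρ.nonneg c x)
        rw [← loc_apply γ hx', ← gs_tight (loc_symm hγ.symm hx')
          (fun u hu => loc_pos hγ.pos hx' hu), Finset.mul_sum]
        refine Finset.sum_congr rfl fun j _ => ?_
        simp only [Y, map_smul, smul_eq_mul, ← loc_apply γ hx']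
        rw [← hsq]
        simp only [Real.sqrt_mul_self (Real.sqrt_nonneg _)]
        ring
      · have h0 : ρ c x = 0 := image_eq_zero_of_notMem_tsupport hx
        simp [hzero (c, _) x hx, h0]
    simp only [key, ← Finset.sum_mul, hρ1, one_mul]
  let σ := Fintype.equivFin (t × Fin 3)
  refine ⟨_, fun a => Y (σ.symm a), fun a => hYc _, fun x u v => ?_⟩
  rw [← hYt x u v]
  exact Equiv.sum_comp σ.symm (fun p => γ x u (Y p x) * γ x v (Y p x))

end TightFrame

/-! ### The Riemannian volume measure -/

section Charts

lemma sum_stdE (w : E3) : ∑ i, w i • stdE i = w := by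
  ext j
  simp [Finset.sum_apply, Pi.single_apply]

lemma posDef_of_bilin {G : E3 →L[ℝ] E3 →L[ℝ] ℝ} (hs : ∀ u v, G u v = G v u)
    (hp : ∀ u, u ≠ 0 → 0 < G u u) : (Matrix.of fun i j => G (stdE i) (stdE j)).PosDef := by
  refine Matrix.PosDef.of_dotProduct_mulVec_pos ?_ ?_
  · ext i j
    simp [hs (stdE j)]
  · intro w hw
    have key : star w ⬝ᵥ (Matrix.of fun i j => G (stdE i) (stdE j)).mulVec w
        = G (∑ i, w i • stdE i) (∑ i, w i • stdE i) := by
      simp only [dotProduct, Matrix.mulVec, map_sum, map_smul, sum_apply, smul_apply, smul_eq_mul,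
        Matrix.of_apply, Pi.star_apply, star_trivial, Finset.mul_sum]
      rw [Finset.sum_comm]
      exact Finset.sum_congr rfl fun i _ => Finset.sum_congr rfl fun j _ => by ring
    rw [key]
    apply hp
    intro h0
    apply hw
    funext j
    have h1 : (∑ i, w i • stdE i : E3) j = w j := by
      simp [Finset.sum_apply, Pi.single_apply]
    rw [← h1, h0]
    rfl

lemma det_bilin_comp (G : E3 →L[ℝ] E3 →L[ℝ] ℝ) (A : E3 →L[ℝ] E3) :
    (Matrix.of fun i j => G (A (stdE i)) (A (stdE j))).det =
      A.det ^ 2 * (Matrix.of fun i j => G (stdE i) (stdE j)).det := by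
  let J := LinearMap.toMatrix (EuclideanSpace.basisFun (Fin 3) ℝ).toBasis
    (EuclideanSpace.basisFun (Fin 3) ℝ).toBasis (A : E3 →ₗ[ℝ] E3)
  have hJ : J.det = A.det := by
    rw [LinearMap.det_toMatrix]
  have hJa : ∀ i j, J i j = A (stdE j) i := by
    intro i j
    simp [J, LinearMap.toMatrix_apply]
  have hM : (Matrix.of fun i j => G (A (stdE i)) (A (stdE j))) =
      J.transpose * (Matrix.of fun i j => G (stdE i) (stdE j)) * J := by
    ext i j
    simp only [Matrix.mul_apply, Matrix.of_apply, Matrix.transpose_apply, hJa]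
    conv_lhs => rw [← sum_stdE (A (stdE i)), ← sum_stdE (A (stdE j))]
    simp only [map_sum, map_smul, sum_apply, smul_apply, smul_eq_mul, Finset.mul_sum,
      Finset.sum_mul]
    exact Finset.sum_congr rfl fun k _ => Finset.sum_congr rfl fun l _ => by ring
  rw [hM, Matrix.det_mul, Matrix.det_mul, Matrix.det_transpose, hJ]
  ring

variable {M : Type*} [TopologicalSpace M] [ChartedSpace E3 M]

lemma tfield_congr (h : TField M) {x x' : M} (hx : x = x') (a b : E3) :
    (h x : E3 →L[ℝ] E3 →L[ℝ] ℝ) a b = (h x' : E3 →L[ℝ] E3 →L[ℝ] ℝ) a b := by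
  subst hx; rfl

variable [IsManifold (𝓡 3) ∞ M]

lemma mdiffAt_chart {φ : OpenPartialHomeomorph M E3} (hφ : φ ∈ IsManifold.maximalAtlas (𝓡 3) ∞ M)
    {x : M} (hx : x ∈ φ.source) : MDifferentiableAt (𝓡 3) 𝓘(ℝ, E3) φ x :=
  (contMDiffAt_of_mem_maximalAtlas hφ hx).mdifferentiableAt (by simp)

lemma mdiffAt_chart_symm {φ : OpenPartialHomeomorph M E3}
    (hφ : φ ∈ IsManifold.maximalAtlas (𝓡 3) ∞ M) {y : E3} (hy : y ∈ φ.target) :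
    MDifferentiableAt 𝓘(ℝ, E3) (𝓡 3) φ.symm y :=
  (contMDiffAt_symm_of_mem_maximalAtlas hφ hy).mdifferentiableAt (by simp)

variable {φ ψ : OpenPartialHomeomorph M E3}

/-- Transition maps between charts are smooth. -/
lemma contDiffAt_transition (hφ : φ ∈ IsManifold.maximalAtlas (𝓡 3) ∞ M)
    (hψ : ψ ∈ IsManifold.maximalAtlas (𝓡 3) ∞ M) {y : E3} (hy : y ∈ φ.target)
    (hy' : φ.symm y ∈ ψ.source) : ContDiffAt ℝ (∞ : ℕ∞ω) (fun z => ψ (φ.symm z)) y := by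
  rw [← contMDiffAt_iff_contDiffAt]
  exact (contMDiffAt_of_mem_maximalAtlas hψ hy').comp y (contMDiffAt_symm_of_mem_maximalAtlas hφ hy)

/-- The coordinate frames of two charts are related by the Jacobian of the transition map. -/
lemma mfderiv_symm_transition (hφ : φ ∈ IsManifold.maximalAtlas (𝓡 3) ∞ M)
    (hψ : ψ ∈ IsManifold.maximalAtlas (𝓡 3) ∞ M) {y : E3} (hy : y ∈ φ.target)
    (hy' : φ.symm y ∈ ψ.source) (a : E3) :
    (mfderiv 𝓘(ℝ, E3) (𝓡 3) ψ.symm (ψ (φ.symm y)) (fderiv ℝ (fun z => ψ (φ.symm z)) y a) : E3) =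
      (mfderiv 𝓘(ℝ, E3) (𝓡 3) φ.symm y a : E3) := by
  have h1 : HasMFDerivAt 𝓘(ℝ, E3) 𝓘(ℝ, E3) (fun z => ψ (φ.symm z)) y
      (fderiv ℝ (fun z => ψ (φ.symm z)) y) :=
    (((contDiffAt_transition hφ hψ hy hy').differentiableAt (by simp)).hasFDerivAt).hasMFDerivAt
  have h2 := (mdiffAt_chart_symm hψ (ψ.map_source hy')).hasMFDerivAt
  have h3 := HasMFDerivAt.comp (I' := 𝓘(ℝ, E3)) y h2 h1
  have h4 : φ.symm =ᶠ[𝓝 y] ψ.symm ∘ (fun z => ψ (φ.symm z)) := by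
    have : φ.symm ⁻¹' ψ.source ∈ 𝓝 y :=
      (φ.continuousAt_symm hy).preimage_mem_nhds (ψ.open_source.mem_nhds hy')
    filter_upwards [this] with z hz
    exact (ψ.left_inv hz).symm
  have h5 := h3.congr_of_eventuallyEq h4
  have := h5.mfderiv
  rw [this]
  rfl

variable (γ : TField M)

/-- The components of a tensor field in an arbitrary chart. -/
noncomputable def chartForm (h : TField M) (φ : OpenPartialHomeomorph M E3) (y : E3) :
    E3 →L[ℝ] E3 →L[ℝ] ℝ :=
  pullForm (V := E3) (mfderiv 𝓘(ℝ, E3) (𝓡 3) φ.symm y) (h (φ.symm y))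

lemma chartForm_apply (h : TField M) (φ : OpenPartialHomeomorph M E3) (y a b : E3) :
    chartForm h φ y a b = h (φ.symm y) (mfderiv 𝓘(ℝ, E3) (𝓡 3) φ.symm y a)
      (mfderiv 𝓘(ℝ, E3) (𝓡 3) φ.symm y b) := rfl

lemma chartForm_transition (h : TField M) (hφ : φ ∈ IsManifold.maximalAtlas (𝓡 3) ∞ M)
    (hψ : ψ ∈ IsManifold.maximalAtlas (𝓡 3) ∞ M) {y : E3} (hy : y ∈ φ.target)
    (hy' : φ.symm y ∈ ψ.source) (a b : E3) :
    chartForm h φ y a b = chartForm h ψ (ψ (φ.symm y)) (fderiv ℝ (fun z => ψ (φ.symm z)) y a)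
      (fderiv ℝ (fun z => ψ (φ.symm z)) y b) := by
  have ha := mfderiv_symm_transition hφ hψ hy hy' a
  have hb := mfderiv_symm_transition hφ hψ hy hy' b
  have := tfield_congr h (ψ.left_inv hy') (mfderiv 𝓘(ℝ, E3) (𝓡 3) φ.symm y a)
    (mfderiv 𝓘(ℝ, E3) (𝓡 3) φ.symm y b)
  refine Eq.trans this.symm ?_
  rw [← ha, ← hb]
  rfl

lemma chartGram_apply (φ : OpenPartialHomeomorph M E3) (y : E3) (i j : Fin 3) :
    chartGram γ φ y i j = chartForm γ φ y (stdE i) (stdE j) := rfl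

lemma mfderiv_symm_injective (hφ : φ ∈ IsManifold.maximalAtlas (𝓡 3) ∞ M) {y : E3}
    (hy : y ∈ φ.target) : Function.Injective (mfderiv 𝓘(ℝ, E3) (𝓡 3) φ.symm y) := by
  have h2 := (mdiffAt_chart hφ (φ.map_target hy)).hasMFDerivAt
  have h1 := (mdiffAt_chart_symm hφ hy).hasMFDerivAt
  have h3 := h2.comp y h1
  have h4 : (id : E3 → E3) =ᶠ[𝓝 y] φ ∘ φ.symm := by
    filter_upwards [φ.open_target.mem_nhds hy] with z hz
    exact (φ.right_inv hz).symm
  have h5 := (h3.congr_of_eventuallyEq h4).mfderiv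
  rw [mfderiv_id] at h5
  intro a b hab
  have ha := DFunLike.congr_fun h5 a
  have hb := DFunLike.congr_fun h5 b
  have : (a : E3) = b := by
    refine Eq.trans ha (Eq.trans ?_ hb.symm)
    exact congrArg (mfderiv (𝓡 3) 𝓘(ℝ, E3) φ (φ.symm y)) hab
  exact this

variable {γ}

lemma chartForm_pos (hp : ∀ x (u : Tan x), u ≠ 0 → 0 < γ x u u)
    (hφ : φ ∈ IsManifold.maximalAtlas (𝓡 3) ∞ M) {y : E3} (hy : y ∈ φ.target) (u : E3)
    (hu : u ≠ 0) : 0 < chartForm γ φ y u u := by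
  rw [chartForm_apply]
  apply hp
  intro h
  exact hu (mfderiv_symm_injective hφ hy (h.trans (map_zero _).symm))

lemma chartGram_posDef (hs : IsSymm γ) (hp : ∀ x (u : Tan x), u ≠ 0 → 0 < γ x u u)
    (hφ : φ ∈ IsManifold.maximalAtlas (𝓡 3) ∞ M) {y : E3} (hy : y ∈ φ.target) :
    (chartGram γ φ y).PosDef :=
  posDef_of_bilin (G := chartForm γ φ y) (fun _ _ => hs _ _ _) (chartForm_pos hp hφ hy)

lemma chartGram_transition (hφ : φ ∈ IsManifold.maximalAtlas (𝓡 3) ∞ M)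
    (hψ : ψ ∈ IsManifold.maximalAtlas (𝓡 3) ∞ M) {y : E3} (hy : y ∈ φ.target)
    (hy' : φ.symm y ∈ ψ.source) :
    (chartGram γ φ y).det =
      (fderiv ℝ (fun z => ψ (φ.symm z)) y).det ^ 2 * (chartGram γ ψ (ψ (φ.symm y))).det := by
  have h1 : chartGram γ φ y = Matrix.of fun i j => chartForm γ ψ (ψ (φ.symm y))
      (fderiv ℝ (fun z => ψ (φ.symm z)) y (stdE i))
      (fderiv ℝ (fun z => ψ (φ.symm z)) y (stdE j)) := by
    ext i j
    rw [chartGram_apply, chartForm_transition γ hφ hψ hy hy']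
    rfl
  rw [h1, det_bilin_comp]
  rfl

end Charts

section Volume

variable {M : Type*} [TopologicalSpace M] [ChartedSpace E3 M] [IsManifold (𝓡 3) ∞ M]
  [MeasurableSpace M] [BorelSpace M]
variable {φ ψ : OpenPartialHomeomorph M E3} {γ : TField M}

/-- The measure `√(det γ_ij) dy¹dy²dy³` on the domain of a chart. -/
noncomputable def chartVol (γ : TField M) (φ : OpenPartialHomeomorph M E3) : Measure M :=
  Measure.map φ.symm (((volume : Measure E3).withDensity
    fun y => ENNReal.ofReal (Real.sqrt (chartGram γ φ y).det)).restrict φ.target)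

lemma measurableSet_target_inter (φ : OpenPartialHomeomorph M E3) {A : Set M}
    (hA : MeasurableSet A) : MeasurableSet (φ.target ∩ φ.symm ⁻¹' A) := by
  have h : Measurable (fun y : φ.target => φ.symm y) :=
    (continuousOn_iff_continuous_domRestrict.1 φ.continuousOn_symm).measurable
  have := (MeasurableEmbedding.subtype_coe φ.open_target.measurableSet).measurableSet_image.2 (h hA)
  convert this using 1
  ext y
  constructor
  · rintro ⟨h1, h2⟩
    exact ⟨⟨y, h1⟩, h2, rfl⟩
  · rintro ⟨z, h1, rfl⟩
    exact ⟨z.2, h1⟩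

lemma chartVol_apply (γ : TField M) (φ : OpenPartialHomeomorph M E3) {A : Set M}
    (hA : MeasurableSet A) : chartVol γ φ A =
      ∫⁻ y in φ.target ∩ φ.symm ⁻¹' A, ENNReal.ofReal (Real.sqrt (chartGram γ φ y).det) := by
  have hm : MeasurableSet (φ.target ∩ φ.symm ⁻¹' A) :=
    measurableSet_target_inter φ hA
  have hae : AEMeasurable φ.symm (((volume : Measure E3).withDensity
    fun y => ENNReal.ofReal (Real.sqrt (chartGram γ φ y).det)).restrict φ.target) :=
    φ.continuousOn_symm.aemeasurable φ.open_target.measurableSet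
  rw [chartVol, Measure.map_apply_of_aemeasurable hae hA, Measure.restrict_apply₀', inter_comm,
    withDensity_apply _ hm]
  exact φ.open_target.measurableSet.nullMeasurableSet

/-- On the overlap of two charts their volume measures agree. -/
lemma chartVol_eq (hφ : φ ∈ IsManifold.maximalAtlas (𝓡 3) ∞ M)
    (hψ : ψ ∈ IsManifold.maximalAtlas (𝓡 3) ∞ M) {A : Set M} (hA : MeasurableSet A)
    (hA1 : A ⊆ φ.source) (hA2 : A ⊆ ψ.source) : chartVol γ φ A = chartVol γ ψ A := by
  rw [chartVol_apply γ φ hA, chartVol_apply γ ψ hA]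
  set f := fun z => ψ (φ.symm z) with hf
  have himg : ψ.target ∩ ψ.symm ⁻¹' A = f '' (φ.target ∩ φ.symm ⁻¹' A) := by
    ext z
    constructor
    · rintro ⟨hz, hzA⟩
      refine ⟨φ (ψ.symm z), ⟨φ.map_source (hA1 hzA), ?_⟩, ?_⟩
      · show φ.symm (φ (ψ.symm z)) ∈ A
        rw [φ.left_inv (hA1 hzA)]; exact hzA
      · simp only [hf]
        rw [φ.left_inv (hA1 hzA), ψ.right_inv hz]
    · rintro ⟨y, ⟨hy, hyA⟩, rfl⟩
      refine ⟨ψ.map_source (hA2 hyA), ?_⟩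
      show ψ.symm (ψ (φ.symm y)) ∈ A
      rw [ψ.left_inv (hA2 hyA)]; exact hyA
  have hinj : InjOn f (φ.target ∩ φ.symm ⁻¹' A) := by
    intro y hy z hz hyz
    have h1 := ψ.injOn (hA2 hy.2) (hA2 hz.2) hyz
    exact φ.symm.injOn hy.1 hz.1 h1
  rw [himg, lintegral_image_eq_lintegral_abs_det_fderiv_mul volume
    (measurableSet_target_inter φ hA) (f' := fderiv ℝ f) ?_ hinj]
  · refine setLIntegral_congr_fun (measurableSet_target_inter φ hA) fun y hy => ?_
    show _ = ENNReal.ofReal _ * ENNReal.ofReal _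
    rw [chartGram_transition hφ hψ hy.1 (hA2 hy.2), Real.sqrt_mul (sq_nonneg _), Real.sqrt_sq_eq_abs,
      ENNReal.ofReal_mul (abs_nonneg _)]
  · intro y hy
    exact ((contDiffAt_transition hφ hψ hy.1 (hA2 hy.2)).differentiableAt
      (by simp)).hasFDerivAt.hasFDerivWithinAt

lemma vol_eq_iSup (γ : TField M) :
    vol γ = ⨆ φ ∈ IsManifold.maximalAtlas (𝓡 3) ∞ M, chartVol γ φ := rfl

lemma chartVol_le (hφ : φ ∈ IsManifold.maximalAtlas (𝓡 3) ∞ M) : chartVol γ φ ≤ vol γ := by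
  rw [vol_eq_iSup]
  exact le_iSup₂ (f := fun φ (_ : φ ∈ IsManifold.maximalAtlas (𝓡 3) ∞ M) => chartVol γ φ) φ hφ

/-- In a chart the volume measure is `√(det γ_ij) dy¹dy²dy³`. -/
lemma vol_apply (hφ : φ ∈ IsManifold.maximalAtlas (𝓡 3) ∞ M) {A : Set M} (hA : MeasurableSet A)
    (hA1 : A ⊆ φ.source) : vol γ A = chartVol γ φ A := by
  refine le_antisymm ?_ (chartVol_le hφ A)
  -- The supremum defining the volume is below the right-hand side, which is infinite on the sets
  -- that meet the complement of the chart and therefore imposes nothing there.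
  have h1 : vol γ ≤ chartVol γ φ + (⊤ : Measure M).restrict φ.sourceᶜ := by
    rw [vol_eq_iSup]
    refine iSup₂_le fun ψ hψ => Measure.le_iff.2 fun B hB => ?_
    rw [Measure.add_apply, Measure.restrict_apply hB]
    rcases (B ∩ φ.sourceᶜ).eq_empty_or_nonempty with he | ⟨x, hx⟩
    · have hsub : B ⊆ φ.source := fun y hy => by
        by_contra hy'
        exact (he ▸ ⟨hy, hy'⟩ : y ∈ (∅ : Set M))
      have hm := hB.inter ψ.open_source.measurableSet
      have h3 : chartVol γ ψ B = chartVol γ ψ (B ∩ ψ.source) := by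
        rw [chartVol_apply γ ψ hB, chartVol_apply γ ψ hm]
        congr 2
        ext y
        exact ⟨fun h => ⟨h.1, h.2, ψ.map_target h.1⟩, fun h => ⟨h.1, h.2.1⟩⟩
      rw [h3, ← chartVol_eq hφ hψ hm (fun x hx => hsub hx.1) (fun x hx => hx.2)]
      exact (measure_mono inter_subset_left).trans le_self_add
    · have h4 : (⊤ : ℝ≥0∞) ≤ (⊤ : Measure M) (B ∩ φ.sourceᶜ) := by
        have h5 : (⊤ : ℝ≥0∞) • Measure.dirac x ≤ (⊤ : Measure M) := le_top
        have h6 := h5 (B ∩ φ.sourceᶜ)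
        rwa [Measure.smul_apply, Measure.dirac_apply' _
          (hB.inter φ.open_source.measurableSet.compl), indicator_of_mem hx, Pi.one_apply,
          smul_eq_mul, mul_one] at h6
      rw [top_le_iff.1 h4]
      simp
  have h2 := h1 A
  have h7 : A ∩ φ.sourceᶜ = ∅ := by
    ext x
    simp only [mem_inter_iff, mem_compl_iff, mem_empty_iff_false, iff_false, not_and, not_not]
    exact fun hx => hA1 hx
  rwa [Measure.add_apply, Measure.restrict_apply hA, h7, measure_empty, add_zero] at h2

lemma continuousOn_chartGram_det (hγ : ContTF γ) (c : M) :
    ContinuousOn (fun y => (chartGram γ (chartAt E3 c) y).det) (chartAt E3 c).target := by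
  have h1 : ContinuousOn (fun y => (Matrix.of fun i j =>
      loc γ c ((chartAt E3 c).symm y) (stdE i) (stdE j)).det) (chartAt E3 c).target := by
    have h2 : ContinuousOn (fun y => loc γ c ((chartAt E3 c).symm y)) (chartAt E3 c).target :=
      (hγ.continuousOn_loc c).comp (chartAt E3 c).continuousOn_symm fun y hy =>
        (chartAt E3 c).map_target hy
    simp only [Matrix.det_fin_three, Matrix.of_apply]
    fun_prop
  refine h1.congr fun y hy => ?_
  congr 1
  ext i j
  rw [chartGram_apply, Matrix.of_apply, loc_apply γ ((chartAt E3 c).map_target hy), frame_def,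
    (chartAt E3 c).right_inv hy]
  rfl

instance isOpenPosMeasure_vol [hγ : Fact (IsRiemannian γ)] : (vol γ).IsOpenPosMeasure where
  open_pos U hU hne := by
    obtain ⟨x, hx⟩ := hne
    set φ := chartAt E3 x with hφd
    have hφ : φ ∈ IsManifold.maximalAtlas (𝓡 3) ∞ M := IsManifold.chart_mem_maximalAtlas x
    have hO : IsOpen (φ.target ∩ φ.symm ⁻¹' U) := φ.isOpen_inter_preimage_symm hU
    intro h0
    have h1 : chartVol γ φ U = 0 := le_antisymm ((chartVol_le hφ U).trans h0.le) bot_le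
    rw [chartVol_apply γ φ hU.measurableSet, lintegral_eq_zero_iff'] at h1
    · have h2 : (volume.restrict (φ.target ∩ φ.symm ⁻¹' U)) univ = 0 := by
        rw [Filter.EventuallyEq, ae_restrict_iff' hO.measurableSet] at h1
        rw [Measure.restrict_apply_univ]
        refine measure_mono_null ?_ h1
        intro y hy h
        have h3 := h hy
        simp only [Pi.zero_apply, ENNReal.ofReal_eq_zero] at h3
        exact absurd h3 (not_le.2 (Real.sqrt_pos.2
          (chartGram_posDef hγ.out.symm hγ.out.pos hφ hy.1).det_pos))
      rw [Measure.restrict_apply_univ] at h2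
      exact (hO.measure_pos volume ⟨φ x, mem_chart_target E3 x, by
        show φ.symm (φ x) ∈ U
        rw [φ.left_inv (mem_chart_source E3 x)]; exact hx⟩).ne' h2
    · refine ContinuousOn.aemeasurable ?_ hO.measurableSet
      exact ENNReal.continuous_ofReal.comp_continuousOn (Real.continuous_sqrt.comp_continuousOn
        ((continuousOn_chartGram_det hγ.out.smooth.contTF x).mono inter_subset_left))

instance isFiniteMeasure_vol [T2Space M] [CompactSpace M] [hγ : Fact (IsRiemannian γ)] :
    IsFiniteMeasure (vol γ) := by
  have hlf : IsLocallyFiniteMeasure (vol γ) := by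
    refine ⟨fun x => ?_⟩
    set φ := chartAt E3 x with hφd
    have hφ : φ ∈ IsManifold.maximalAtlas (𝓡 3) ∞ M := IsManifold.chart_mem_maximalAtlas x
    obtain ⟨k, hk, hkc, hkt⟩ := exists_mem_nhds_isCompact_mapsTo (f := id) continuous_id
      (φ.open_target.mem_nhds (mem_chart_target E3 x))
    refine ⟨φ.source ∩ φ ⁻¹' interior k, ?_, ?_⟩
    · exact (φ.isOpen_inter_preimage isOpen_interior).mem_nhds
        ⟨mem_chart_source E3 x, mem_interior_iff_mem_nhds.2 hk⟩
    · have hm : MeasurableSet (φ.source ∩ φ ⁻¹' interior k) :=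
        (φ.isOpen_inter_preimage isOpen_interior).measurableSet
      rw [vol_apply hφ hm inter_subset_left, chartVol_apply γ φ hm]
      have hsub : φ.target ∩ φ.symm ⁻¹' (φ.source ∩ φ ⁻¹' interior k) ⊆ k := by
        rintro y ⟨hy, -, hy2⟩
        have : φ (φ.symm y) ∈ interior k := hy2
        rw [φ.right_inv hy] at this
        exact interior_subset this
      refine (lintegral_mono_set hsub).trans_lt ?_
      have hc : ContinuousOn (fun y => Real.sqrt (chartGram γ φ y).det) k :=
        Real.continuous_sqrt.comp_continuousOn
          ((continuousOn_chartGram_det hγ.out.smooth.contTF x).mono hkt)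
      exact (hc.integrableOn_compact hkc).lintegral_lt_top
  exact CompactSpace.isFiniteMeasure

end Volume

section Diffeo

variable {M : Type*} [TopologicalSpace M] [ChartedSpace E3 M] [IsManifold (𝓡 3) ∞ M]
  [MeasurableSpace M] [BorelSpace M] {M' : Type*} [TopologicalSpace M'] [ChartedSpace E3 M']
  [IsManifold (𝓡 3) ∞ M'] [MeasurableSpace M'] [BorelSpace M']
  (Φ : M' ≃ₘ⟮𝓡 3, 𝓡 3⟯ M) (γ : TField M)

/-- The chart of `M'` induced by a chart of `M` and a diffeomorphism. -/
noncomputable def pullChart (φ : OpenPartialHomeomorph M E3) : OpenPartialHomeomorph M' E3 :=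
  Φ.toHomeomorph.toOpenPartialHomeomorph.trans φ

lemma pullChart_mem {φ : OpenPartialHomeomorph M E3}
    (hφ : φ ∈ IsManifold.maximalAtlas (𝓡 3) ∞ M) :
    pullChart Φ φ ∈ IsManifold.maximalAtlas (𝓡 3) ∞ M' := by
  refine OpenPartialHomeomorph.mem_maximalAtlas_of_contMDiffOn _ ?_ ?_
  · refine (contMDiffOn_of_mem_maximalAtlas hφ).comp Φ.contMDiff.contMDiffOn ?_
    intro x hx
    simpa [pullChart] using hx
  · refine Φ.symm.contMDiff.comp_contMDiffOn
      ((contMDiffOn_symm_of_mem_maximalAtlas hφ).mono ?_)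
    intro x hx
    simpa [pullChart] using hx

lemma chartGram_pullT {φ : OpenPartialHomeomorph M E3}
    (hφ : φ ∈ IsManifold.maximalAtlas (𝓡 3) ∞ M) {y : E3} (hy : y ∈ φ.target) :
    chartGram (pullT Φ γ) (pullChart Φ φ) y = chartGram γ φ y := by
  have hy' : y ∈ (pullChart Φ φ).target := by simpa [pullChart] using hy
  have h1 := (mdiffAt_chart_symm (pullChart_mem Φ hφ) hy').hasMFDerivAt
  have h2 := (Φ.contMDiff.mdifferentiable (by simp) ((pullChart Φ φ).symm y)).hasMFDerivAt
  have hcomp : Φ ∘ (pullChart Φ φ).symm = φ.symm := by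
    funext z
    exact Φ.apply_symm_apply _
  have h3 := h2.comp y h1
  rw [hcomp] at h3
  have h4 := h3.mfderiv
  ext i j
  rw [chartGram_apply, chartGram_apply, chartForm_apply, chartForm_apply, h4]
  exact tfield_congr γ (congrFun hcomp y) _ _

lemma chartVol_pullT {φ : OpenPartialHomeomorph M E3}
    (hφ : φ ∈ IsManifold.maximalAtlas (𝓡 3) ∞ M) :
    chartVol (pullT Φ γ) (pullChart Φ φ) = Measure.map Φ.symm (chartVol γ φ) := by
  have hmeas : Measurable Φ.symm := Φ.symm.continuous.measurable
  ext A hA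
  rw [Measure.map_apply hmeas hA, chartVol_apply _ _ hA, chartVol_apply _ _ (hmeas hA)]
  have hset : (pullChart Φ φ).target ∩ (pullChart Φ φ).symm ⁻¹' A =
      φ.target ∩ φ.symm ⁻¹' (Φ.symm ⁻¹' A) := by
    ext y
    simp [pullChart]
  rw [hset]
  refine setLIntegral_congr_fun (measurableSet_target_inter φ (hmeas hA)) fun y hy => ?_
  show ENNReal.ofReal _ = ENNReal.ofReal _
  rw [chartGram_pullT Φ γ hφ hy.1]

/-- The volume measure is natural with respect to diffeomorphisms. -/
theorem vol_pullT : vol (pullT Φ γ) = Measure.map Φ.symm (vol γ) := by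
  have hmeas : Measurable Φ.symm := Φ.symm.continuous.measurable
  have hmeas' : Measurable Φ := Φ.continuous.measurable
  refine le_antisymm ?_ ?_
  · rw [vol_eq_iSup]
    refine iSup₂_le fun χ hχ => ?_
    have h1 : pullChart Φ (pullChart Φ.symm χ) = χ := by
      refine OpenPartialHomeomorph.ext _ _ ?_ ?_ ?_
      · intro x
        exact congrArg χ (Φ.symm_apply_apply x)
      · intro x
        exact Φ.symm_apply_apply (χ.symm x)
      · ext x
        have : Φ.symm (Φ x) = x := Φ.symm_apply_apply x
        simp [pullChart, this]
    have h2 : pullChart Φ.symm χ ∈ IsManifold.maximalAtlas (𝓡 3) ∞ M := pullChart_mem Φ.symm hχ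
    rw [← h1, chartVol_pullT Φ γ h2]
    exact Measure.map_mono (chartVol_le h2) hmeas
  · have h3 : vol γ ≤ Measure.map Φ (vol (pullT Φ γ)) := by
      rw [vol_eq_iSup γ]
      refine iSup₂_le fun φ hφ => ?_
      have h4 := Measure.map_mono (chartVol_le (γ := pullT Φ γ) (pullChart_mem Φ hφ)) hmeas'
      rw [chartVol_pullT Φ γ hφ, Measure.map_map hmeas' hmeas] at h4
      have h5 : (Φ ∘ Φ.symm : M → M) = id := funext fun x => Φ.apply_symm_apply x
      rwa [h5, Measure.map_id] at h4
    have h6 := Measure.map_mono h3 hmeas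
    rw [Measure.map_map hmeas hmeas'] at h6
    have h7 : (Φ.symm ∘ Φ : M' → M') = id := funext fun x => Φ.symm_apply_apply x
    rwa [h7, Measure.map_id] at h6

end Diffeo

/-! ### Tensor fields as functions: components in a tight family -/

section ProdCount

variable {α ι : Type*} [MeasurableSpace α] [Fintype ι] [MeasurableSpace ι]
  [MeasurableSingletonClass ι] {μ : Measure α} [SFinite μ]

lemma integrable_prod_count {f : α × ι → ℝ} (hf : AEStronglyMeasurable f (μ.prod Measure.count)) :
    Integrable f (μ.prod Measure.count) ↔ ∀ p, Integrable (fun x => f (x, p)) μ := by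
  rw [integrable_prod_iff' hf]
  have : (∀ᵐ y ∂(Measure.count : Measure ι), Integrable (fun x => f (x, y)) μ) ↔
      ∀ p, Integrable (fun x => f (x, p)) μ := by
    rw [Measure.ae_count_iff]
  rw [this]
  exact and_iff_left Integrable.of_finite

lemma integral_prod_count {f : α × ι → ℝ} (hf : Integrable f (μ.prod Measure.count)) :
    ∫ z, f z ∂(μ.prod Measure.count) = ∑ p, ∫ x, f (x, p) ∂μ := by
  rw [integral_prod_symm _ hf, integral_count]

end ProdCount

section Hat

variable {M : Type*} [TopologicalSpace M] [ChartedSpace E3 M] [IsManifold (𝓡 3) ∞ M]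

/-- A finite family of continuous vector fields which is tight in every tangent space. -/
structure TightFrame (γ : TField M) {n : ℕ} (X : Fin n → (x : M) → Tan x) : Prop where
  metric : IsRiemannian γ
  cont : ∀ a, ContVF (X a)
  tight : ∀ x, IsTight γ x (fun a => X a x)

variable {γ : TField M} {n : ℕ} {X : Fin n → (x : M) → Tan x}

/-- The components `h(X_a, X_b)` of a tensor field, as a function of the point and of the pair of
indices. -/
noncomputable def hat (X : Fin n → (x : M) → Tan x) (h : TField M) (z : M × (Fin n × Fin n)) : ℝ :=
  h z.1 (X z.2.1 z.1) (X z.2.2 z.1)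

namespace TightFrame

variable (F : TightFrame γ X)

include F in
lemma pair_eq (h k : TField M) (x : M) :
    pair γ x (fun u v => h x u v) (fun u v => k x u v) = ∑ p, hat X h (x, p) * hat X k (x, p) := by
  rw [(F.tight x).pair_eq (F.metric.symm x) (F.metric.pos x), Fintype.sum_prod_type]
  rfl

include F in
lemma tlen_sq (h : TField M) (x : M) : tlen γ x (h x) ^ 2 = ∑ p, hat X h (x, p) ^ 2 := by
  rw [tlen, Real.sq_sqrt, F.pair_eq]
  · simp only [pow_two]
  · rw [F.pair_eq]
    exact Finset.sum_nonneg fun p _ => mul_self_nonneg _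

include F in
lemma abs_hat_le (h : TField M) (x : M) (p : Fin n × Fin n) :
    |hat X h (x, p)| ≤ tlen γ x (h x) := by
  refine abs_le_of_sq_le_sq' ?_ (Real.sqrt_nonneg _) |> abs_le.2
  rw [F.tlen_sq]
  exact Finset.single_le_sum (f := fun p => hat X h (x, p) ^ 2) (fun q _ => sq_nonneg _)
    (Finset.mem_univ p)

include F in
lemma tlen_le (h : TField M) (x : M) : tlen γ x (h x) ≤ ∑ p, |hat X h (x, p)| := by
  refine le_of_sq_le_sq ?_ (Finset.sum_nonneg fun p _ => abs_nonneg _)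
  rw [F.tlen_sq]
  have := Finset.sum_sq_le_sq_sum_of_nonneg (s := Finset.univ) (f := fun p => |hat X h (x, p)|)
    (fun p _ => abs_nonneg _)
  simpa using this

include F in
lemma bilin_eq (h : TField M) (x : M) (u v : Tan x) :
    h x u v = ∑ a, ∑ b, γ x u (X a x) * γ x v (X b x) * hat X h (x, (a, b)) :=
  (F.tight x).bilin_eq (F.metric.symm x) (F.metric.pos x) (h x) u v

include F in
lemma eq_zero_iff (h : TField M) (x : M) : h x = 0 ↔ ∀ p, hat X h (x, p) = 0 := by
  constructor
  · intro h0 p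
    simp [hat, h0]
  · intro h0
    refine ContinuousLinearMap.ext fun u => ContinuousLinearMap.ext fun v => ?_
    rw [F.bilin_eq h x u v]
    simp [h0]

/-- The tensor field with components `f_ab` in the tight family (symmetrised). -/
noncomputable def unhat (γ : TField M) (X : Fin n → (x : M) → Tan x) (f : M × (Fin n × Fin n) → ℝ) :
    TField M := fun x =>
  ∑ a, ∑ b, ((f (x, (a, b)) + f (x, (b, a))) / 2) • (γ x (X a x)).smulRight (γ x (X b x))

omit [IsManifold (𝓡 3) ∞ M] in
lemma unhat_apply (f : M × (Fin n × Fin n) → ℝ) (x : M) (u v : Tan x) :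
    unhat γ X f x u v = ∑ a, ∑ b, ((f (x, (a, b)) + f (x, (b, a))) / 2) *
      (γ x (X a x) u * γ x (X b x) v) := by
  simp [unhat, sum_apply, smul_apply, ContinuousLinearMap.smulRight_apply]

lemma unhat_symm (f : M × (Fin n × Fin n) → ℝ) : IsSymm (unhat γ X f) := by
  intro x u v
  rw [unhat_apply, unhat_apply, Finset.sum_comm]
  exact Finset.sum_congr rfl fun a _ => Finset.sum_congr rfl fun b _ => by ring

include F in
/-- `unhat` is adjoint to `hat`. -/
lemma pair_unhat {k : TField M} (hk : IsSymm k) (f : M × (Fin n × Fin n) → ℝ) (x : M) :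
    pair γ x (fun u v => k x u v) (fun u v => unhat γ X f x u v) =
      ∑ p, hat X k (x, p) * f (x, p) := by
  rw [F.pair_eq, Fintype.sum_prod_type, Fintype.sum_prod_type]
  have key : ∀ a b, hat X k (x, (a, b)) =
      ∑ c, ∑ d, γ x (X a x) (X c x) * γ x (X b x) (X d x) * hat X k (x, (c, d)) :=
    fun a b => F.bilin_eq k x (X a x) (X b x)
  have hks : ∀ a b, hat X k (x, (a, b)) = hat X k (x, (b, a)) := fun a b => hk x _ _
  calc _ = ∑ c, ∑ d, (∑ a, ∑ b, γ x (X c x) (X a x) * γ x (X d x) (X b x) * hat X k (x, (a, b)))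
        * ((f (x, (c, d)) + f (x, (d, c))) / 2) := by
        simp only [hat, unhat_apply, Finset.mul_sum, Finset.sum_mul]
        simp only [← Finset.sum_product', Finset.univ_product_univ]
        exact Finset.sum_bij' (fun t _ => (t.2.2.1, t.2.2.2, t.1, t.2.1))
          (fun t _ => (t.2.2.1, t.2.2.2, t.1, t.2.1)) (by simp) (by simp) (by simp) (by simp)
          (fun t _ => by ring)
    _ = ∑ c, ∑ d, hat X k (x, (c, d)) * ((f (x, (c, d)) + f (x, (d, c))) / 2) := by
        simp only [← key]
    _ = (∑ c, ∑ d, hat X k (x, (c, d)) * f (x, (c, d)) / 2) +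
        ∑ c, ∑ d, hat X k (x, (c, d)) * f (x, (d, c)) / 2 := by
        simp only [← Finset.sum_add_distrib]
        exact Finset.sum_congr rfl fun a _ => Finset.sum_congr rfl fun b _ => by ring
    _ = _ := by
        rw [Finset.sum_comm (f := fun c d => hat X k (x, (c, d)) * f (x, (d, c)) / 2),
          ← Finset.sum_add_distrib]
        refine Finset.sum_congr rfl fun a _ => ?_
        rw [← Finset.sum_add_distrib]
        refine Finset.sum_congr rfl fun b _ => ?_
        rw [hks b a]
        ring

include F in
lemma contTF_unhat {f : M × (Fin n × Fin n) → ℝ} (hf : ∀ p, Continuous fun x => f (x, p)) :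
    ContTF (unhat γ X f) := by
  refine contTF_of_frame fun c a b => ?_
  simp only [unhat_apply]
  have hc := mem_chart_source E3 c
  have hγ := F.metric.smooth.contTF
  have h1 : ∀ i (a : E3), ContinuousAt (fun x => γ x (X i x) (frame c x a)) c := by
    intro i a
    refine ContinuousWithinAt.continuousAt (continuousWithinAt_apply hγ (b := fun x => x)
      (F.cont i).continuousWithinAt (continuousOn_frame c a c hc))
        ((chartAt E3 c).open_source.mem_nhds hc)
  refine tendsto_finsetSum _ fun i _ => tendsto_finsetSum _ fun j _ => ?_
  exact ContinuousAt.mul ((((hf (i, j)).continuousAt).add (hf (j, i)).continuousAt).div_const 2)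
    ((h1 i a).mul (h1 j b))

end TightFrame

end Hat

/-! ### Square integrable tensor fields -/

section L2

variable {M : Type*} [TopologicalSpace M] [ChartedSpace E3 M] [IsManifold (𝓡 3) ∞ M]
  [MeasurableSpace M] [BorelSpace M]
variable {γ : TField M} {n : ℕ} {X : Fin n → (x : M) → Tan x}

lemma sub_neg_one_smul (h k : TField M) : h - (-1 : ℝ) • k = h + k := by
  funext x
  refine ContinuousLinearMap.ext fun u => ContinuousLinearMap.ext fun v => ?_
  change h x u v - (-1) * k x u v = h x u v + k x u v
  ring

lemma tlen_nonneg (h : TField M) (x : M) : 0 ≤ tlen γ x (h x) := Real.sqrt_nonneg _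

/-- The measure on the space of points with a pair of indices. -/
noncomputable abbrev volZ (γ : TField M) (n : ℕ) : Measure (M × (Fin n × Fin n)) :=
  (vol γ).prod Measure.count

namespace TightFrame

variable (F : TightFrame γ X)

include F in
lemma continuous_frame_pair {Y : (x : M) → Tan x} (hY : ContVF Y) (a : Fin n) :
    Continuous fun x => γ x (Y x) (X a x) :=
  F.metric.smooth.contTF.continuous_apply hY (F.cont a)

include F in
/-- Membership in `L^p(Sym² T*Σ)` in terms of components. -/
lemma memField_iff {p : ℝ≥0∞} {h : TField M} : MemField γ p h ↔ IsSymm h ∧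
    ∀ q, Measurable (fun x => hat X h (x, q)) ∧ MemLp (fun x => hat X h (x, q)) p (vol γ) := by
  constructor
  · intro H
    have hm : ∀ q, Measurable (fun x => hat X h (x, q)) := fun q =>
      H.meas _ _ (F.cont q.1) (F.cont q.2)
    exact ⟨H.symm, fun q => ⟨hm q, H.memLp.mono (hm q).aestronglyMeasurable
      (ae_of_all _ fun x => by
        rw [Real.norm_eq_abs, Real.norm_eq_abs]
        exact (F.abs_hat_le h x q).trans (le_abs_self _))⟩⟩
  · rintro ⟨hs, H⟩
    refine ⟨hs, fun Y Y' hY hY' => ?_, ?_⟩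
    · have : (fun x => h x (Y x) (Y' x)) = fun x => ∑ a, ∑ b,
          γ x (Y x) (X a x) * γ x (Y' x) (X b x) * hat X h (x, (a, b)) :=
        funext fun x => F.bilin_eq h x (Y x) (Y' x)
      rw [this]
      exact Finset.measurable_fun_sum _ fun a _ => Finset.measurable_fun_sum _ fun b _ =>
        ((F.continuous_frame_pair hY a).measurable.mul
          (F.continuous_frame_pair hY' b).measurable).mul (H (a, b)).1
    · have h1 : MemLp (fun x => ∑ q, |hat X h (x, q)|) p (vol γ) :=
        memLp_finsetSum _ fun q _ => (H q).2.abs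
      refine h1.mono ?_ (ae_of_all _ fun x => ?_)
      · have : (fun x => tlen γ x (h x)) = fun x => Real.sqrt (∑ q, hat X h (x, q) ^ 2) := by
          funext x
          rw [← F.tlen_sq, Real.sqrt_sq (tlen_nonneg h x)]
        rw [this]
        exact (Finset.measurable_fun_sum _ fun q _ => (H q).1.pow_const 2).sqrt.aestronglyMeasurable
      · rw [Real.norm_eq_abs, Real.norm_eq_abs, abs_of_nonneg (tlen_nonneg h x),
          abs_of_nonneg (Finset.sum_nonneg fun q _ => abs_nonneg _)]
        exact F.tlen_le h x

include F in
lemma memField_sub {p : ℝ≥0∞} {h k : TField M} (hh : MemField γ p h) (hk : MemField γ p k) :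
    MemField γ p (h - k) := by
  rw [F.memField_iff] at hh hk ⊢
  exact ⟨fun x u v => congrArg₂ (· - ·) (hh.1 x u v) (hk.1 x u v),
    fun q => ⟨(hh.2 q).1.sub (hk.2 q).1, (hh.2 q).2.sub (hk.2 q).2⟩⟩

include F in
lemma memField_smul {p : ℝ≥0∞} {h : TField M} (c : ℝ) (hh : MemField γ p h) :
    MemField γ p (c • h) := by
  rw [F.memField_iff] at hh ⊢
  exact ⟨fun x u v => congrArg (c * ·) (hh.1 x u v),
    fun q => ⟨(hh.2 q).1.const_mul c, (hh.2 q).2.const_mul c⟩⟩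

include F in
lemma memField_zero {p : ℝ≥0∞} : MemField γ p (0 : TField M) := by
  rw [F.memField_iff]
  exact ⟨fun x u v => rfl, fun q => ⟨measurable_const, MemLp.zero⟩⟩

include F in
lemma memField_sum {ι : Type*} {p : ℝ≥0∞} {h : ι → TField M} (s : Finset ι)
    (hh : ∀ i ∈ s, MemField γ p (h i)) : MemField γ p (∑ i ∈ s, h i) := by
  classical
  induction s using Finset.induction_on with
  | empty => simpa using F.memField_zero
  | insert i s hi ih =>
    rw [Finset.sum_insert hi]
    have h1 := F.memField_sub (hh i (by simp)) (F.memField_smul (-1 : ℝ)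
      (ih fun j hj => hh j (by simp [hj])))
    rwa [sub_neg_one_smul] at h1

include F in
lemma continuous_hat {h : TField M} (hh : ContTF h) (q : Fin n × Fin n) :
    Continuous fun x => hat X h (x, q) :=
  hh.continuous_apply (F.cont q.1) (F.cont q.2)

variable [T2Space M] [CompactSpace M]

include F in
lemma isFinite_vol : IsFiniteMeasure (vol γ) :=
  haveI : Fact (IsRiemannian γ) := ⟨F.metric⟩
  inferInstance

include F in
lemma memField_cont {h : TField M} (hh : ContTF h) (hs : IsSymm h) (p : ℝ≥0∞) :
    MemField γ p h := by
  have := F.isFinite_vol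
  rw [F.memField_iff]
  refine ⟨hs, fun q => ⟨(F.continuous_hat hh q).measurable, ?_⟩⟩
  have hc := F.continuous_hat hh q
  obtain ⟨C, hC⟩ := (isCompact_range hc).isBounded.exists_norm_le
  exact MemLp.of_bound hc.measurable.aestronglyMeasurable C
    (ae_of_all _ fun x => hC _ (mem_range_self x))

lemma measurable_of_slices {f : M × (Fin n × Fin n) → ℝ} (hf : ∀ q, Measurable fun x => f (x, q)) :
    Measurable f := measurable_from_prod_countable_left hf

include F in
lemma memLp_hat {h : TField M} (hh : MemField γ 2 h) : MemLp (hat X h) 2 (volZ γ n) := by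
  have := F.isFinite_vol
  have hm := F.memField_iff.1 hh
  have hmeas : Measurable (hat X h) := measurable_of_slices fun q => (hm.2 q).1
  rw [memLp_two_iff_integrable_sq hmeas.aestronglyMeasurable,
    integrable_prod_count (hmeas.pow_const 2).aestronglyMeasurable]
  exact fun q => (hm.2 q).2.integrable_sq

include F in
lemma ip_eq_integral {h k : TField M} (hh : MemField γ 2 h) (hk : MemField γ 2 k) :
    ip γ h k = ∫ z, hat X h z * hat X k z ∂(volZ γ n) := by
  have := F.isFinite_vol
  have hi : Integrable (fun z => hat X h z * hat X k z) (volZ γ n) :=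
    (F.memLp_hat hh).integrable_mul (F.memLp_hat hk)
  rw [integral_prod_count hi, ip, ← integral_finsetSum]
  · simp only [F.pair_eq]
  · exact fun q _ => (integrable_prod_count hi.aestronglyMeasurable).1 hi q

open Classical in
/-- The element of `L²` of components determined by a square-integrable tensor field. -/
noncomputable def toL2 (γ : TField M) (X : Fin n → (x : M) → Tan x) (h : TField M) :
    Lp ℝ 2 (volZ γ n) :=
  if H : MemLp (hat X h) 2 (volZ γ n) then H.toLp (hat X h) else 0

include F in
lemma toL2_eq {h : TField M} (hh : MemField γ 2 h) : toL2 γ X h = (F.memLp_hat hh).toLp (hat X h) :=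
  dif_pos _

include F in
lemma coeFn_toL2 {h : TField M} (hh : MemField γ 2 h) : toL2 γ X h =ᵐ[volZ γ n] hat X h := by
  rw [F.toL2_eq hh]
  exact MemLp.coeFn_toLp _

include F in
lemma ip_eq_inner {h k : TField M} (hh : MemField γ 2 h) (hk : MemField γ 2 k) :
    ip γ h k = inner ℝ (toL2 γ X h) (toL2 γ X k) := by
  rw [F.ip_eq_integral hh hk, L2.inner_def]
  refine integral_congr_ae ?_
  filter_upwards [F.coeFn_toL2 hh, F.coeFn_toL2 hk] with z h1 h2
  rw [h1, h2]
  simp [mul_comm]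

include F in
lemma norm2_eq_norm {h : TField M} (hh : MemField γ 2 h) : norm2 γ h = ‖toL2 γ X h‖ := by
  rw [norm2, F.ip_eq_inner hh hh, real_inner_self_eq_norm_sq, Real.sqrt_sq (norm_nonneg _)]

include F in
lemma toL2_sub {h k : TField M} (hh : MemField γ 2 h) (hk : MemField γ 2 k) :
    toL2 γ X (h - k) = toL2 γ X h - toL2 γ X k := by
  rw [F.toL2_eq hh, F.toL2_eq hk, F.toL2_eq (F.memField_sub hh hk), ← MemLp.toLp_sub]
  rfl

include F in
lemma toL2_smul {h : TField M} (c : ℝ) (hh : MemField γ 2 h) :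
    toL2 γ X (c • h) = c • toL2 γ X h := by
  rw [F.toL2_eq hh, F.toL2_eq (F.memField_smul c hh), ← MemLp.toLp_const_smul]
  rfl

include F in
lemma toL2_sum {ι : Type*} {h : ι → TField M} (s : Finset ι)
    (hh : ∀ i ∈ s, MemField γ 2 (h i)) : toL2 γ X (∑ i ∈ s, h i) = ∑ i ∈ s, toL2 γ X (h i) := by
  classical
  induction s using Finset.induction_on with
  | empty =>
    rw [Finset.sum_empty, Finset.sum_empty, F.toL2_eq F.memField_zero]
    exact MemLp.toLp_zero _
  | insert i s hi ih =>
    have h2 := F.memField_sum s fun j hj => hh j (by simp [hj])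
    have h1 := F.toL2_sub (hh i (by simp)) (F.memField_smul (-1 : ℝ) h2)
    rw [Finset.sum_insert hi, Finset.sum_insert hi, ← ih fun j hj => hh j (by simp [hj])]
    rwa [F.toL2_smul _ h2, sub_neg_one_smul, neg_smul, one_smul, sub_neg_eq_add] at h1

include F in
lemma toL2_eq_zero_iff {h : TField M} (hh : MemField γ 2 h) :
    toL2 γ X h = 0 ↔ ∀ᵐ x ∂(vol γ), h x = 0 := by
  have := F.isFinite_vol
  rw [F.toL2_eq hh, ← MemLp.toLp_zero (MemLp.zero (p := 2) (μ := volZ γ n) (ε := ℝ)), MemLp.toLp_eq_toLp_iff]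
  have h1 : (hat X h =ᵐ[volZ γ n] 0) ↔ ∀ᵐ x ∂(vol γ), ∀ q, hat X h (x, q) = 0 := by
    have hmeas : Measurable (hat X h) := measurable_of_slices fun q => ((F.memField_iff.1 hh).2 q).1
    have hms : MeasurableSet {z | hat X h z = 0} := hmeas (measurableSet_singleton 0)
    change (∀ᵐ z ∂((vol γ).prod Measure.count), hat X h z = 0) ↔ _
    rw [Measure.ae_prod_iff_ae_ae hms]
    refine eventually_congr (ae_of_all _ fun x => ?_)
    rw [Measure.ae_count_iff]
  rw [h1]
  exact eventually_congr (ae_of_all _ fun x => (F.eq_zero_iff h x).symm)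

end TightFrame

end L2

/-! ### Integral operators with continuous kernels, and Mercer's theorem -/

section Mercer

variable {Z : Type*} [TopologicalSpace Z] [CompactSpace Z] [MeasurableSpace Z] [BorelSpace Z]
  [SecondCountableTopology Z] (μ : Measure Z) [IsFiniteMeasure μ]

lemma inner_toLp_right (f : Lp ℝ 2 μ) (φ : C(Z, ℝ)) :
    inner ℝ f (ContinuousMap.toLp 2 μ ℝ φ) = ∫ w, f w * φ w ∂μ := by
  rw [L2.inner_def]
  refine integral_congr_ae ?_
  filter_upwards [ContinuousMap.coeFn_toLp (p := 2) (𝕜 := ℝ) μ φ] with w hw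
  rw [hw]
  simp [mul_comm]

/-- The integral operator with a continuous kernel, as a map from `L²` to continuous functions. -/
noncomputable def intOpC (k : C(Z × Z, ℝ)) : Lp ℝ 2 μ →L[ℝ] C(Z, ℝ) :=
  LinearMap.mkContinuous
    { toFun := fun f => ⟨fun z => inner ℝ (ContinuousMap.toLp 2 μ ℝ (k.curry z)) f,
        ((ContinuousMap.toLp 2 μ ℝ).continuous.comp k.curry.continuous).inner continuous_const⟩
      map_add' := fun f g => by ext z; exact inner_add_right (𝕜 := ℝ) (E := Lp ℝ 2 μ) _ _ _
      map_smul' := fun c f => by ext z; exact real_inner_smul_right (F := Lp ℝ 2 μ) _ _ _ }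
    (‖(ContinuousMap.toLp 2 μ ℝ : C(Z, ℝ) →L[ℝ] Lp ℝ 2 μ)‖ * ‖k.curry‖) (fun f => by
      refine (ContinuousMap.norm_le _ (by positivity)).2 fun z => ?_
      refine (norm_inner_le_norm (𝕜 := ℝ) (E := Lp ℝ 2 μ) _ _).trans ?_
      gcongr
      refine (ContinuousLinearMap.le_opNorm _ _).trans ?_
      gcongr
      exact k.curry.norm_coe_le_norm z)

lemma intOpC_apply (k : C(Z × Z, ℝ)) (f : Lp ℝ 2 μ) (z : Z) :
    intOpC μ k f z = ∫ w, k (z, w) * f w ∂μ := by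
  change inner ℝ (ContinuousMap.toLp 2 μ ℝ (k.curry z)) f = _
  rw [real_inner_comm, inner_toLp_right]
  exact integral_congr_ae (.of_forall fun w => mul_comm _ _)

/-- The integral operator with a continuous kernel on `L²`. -/
noncomputable def intOp (k : C(Z × Z, ℝ)) : Lp ℝ 2 μ →L[ℝ] Lp ℝ 2 μ :=
  (ContinuousMap.toLp 2 μ ℝ).comp (intOpC μ k)

lemma intOp_apply (k : C(Z × Z, ℝ)) (f : Lp ℝ 2 μ) :
    intOp μ k f = ContinuousMap.toLp 2 μ ℝ (intOpC μ k f) := rfl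

/-- By the Arzelà–Ascoli theorem: the image of the unit ball is equicontinuous because the slices of
the kernel depend continuously on the point in `L²`. -/
lemma isCompactOperator_intOp (k : C(Z × Z, ℝ)) : IsCompactOperator (intOp μ k) := by
  refine IsCompactOperator.clm_comp (R₂ := ℝ) (f := intOpC μ k) ?_ (ContinuousMap.toLp 2 μ ℝ)
  refine (isCompactOperator_iff_image_closedBall_subset_compact
    (f := (intOpC μ k).toLinearMap) one_pos).2 ?_
  set A := (intOpC μ k) '' Metric.closedBall 0 1
  have hbd : ∀ f ∈ A, ‖f‖ ≤ ‖intOpC μ k‖ := by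
    rintro _ ⟨f, hf, rfl⟩
    refine ((intOpC μ k).le_opNorm f).trans ?_
    have : ‖f‖ ≤ 1 := by simpa using hf
    nlinarith [norm_nonneg (intOpC μ k)]
  let E := ContinuousMap.isometryEquivBoundedOfCompact Z ℝ
  have hcpt : IsCompact (closure (E '' A)) := by
    refine BoundedContinuousFunction.arzela_ascoli (Metric.closedBall 0 ‖intOpC μ k‖)
      (isCompact_closedBall _ _) _ ?_ ?_
    · rintro _ z ⟨f, hf, rfl⟩
      rw [mem_closedBall_zero_iff]
      exact (f.norm_coe_le_norm z).trans (hbd f hf)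
    · intro z
      rw [Metric.equicontinuousAt_iff_right]
      intro ε hε
      have hc : Continuous fun z => (ContinuousMap.toLp 2 μ ℝ (k.curry z) : Lp ℝ 2 μ) :=
        (ContinuousMap.toLp 2 μ ℝ).continuous.comp k.curry.continuous
      filter_upwards [Metric.continuousAt_iff'.1 hc.continuousAt ε hε] with w hw
      rintro ⟨_, _, ⟨f, hf, rfl⟩, rfl⟩
      change dist (inner ℝ (ContinuousMap.toLp 2 μ ℝ (k.curry z)) f)
        (inner ℝ (ContinuousMap.toLp 2 μ ℝ (k.curry w)) f) < ε
      rw [dist_comm, Real.dist_eq, ← inner_sub_left]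
      refine (abs_real_inner_le_norm _ _).trans_lt ?_
      rw [← dist_eq_norm]
      have : ‖f‖ ≤ 1 := by simpa using hf
      nlinarith [dist_nonneg (x := (ContinuousMap.toLp 2 μ ℝ (k.curry w) : Lp ℝ 2 μ))
        (y := ContinuousMap.toLp 2 μ ℝ (k.curry z))]
  refine ⟨E.symm '' closure (E '' A), hcpt.image E.symm.continuous, ?_⟩
  intro f hf
  exact ⟨E f, subset_closure ⟨f, hf, rfl⟩, E.symm_apply_apply f⟩

lemma isSymmetric_intOp {k : C(Z × Z, ℝ)} (hk : ∀ z w, k (z, w) = k (w, z)) :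
    (intOp μ k).toLinearMap.IsSymmetric := by
  intro f g
  change inner ℝ (intOp μ k f) g = inner ℝ f (intOp μ k g)
  rw [real_inner_comm, intOp_apply, intOp_apply, inner_toLp_right, inner_toLp_right]
  simp only [intOpC_apply, ← integral_const_mul]
  have hi : Integrable (fun p : Z × Z => g p.1 * (k (p.1, p.2) * f p.2)) (μ.prod μ) := by
    have h1 : Integrable (fun p : Z × Z => g p.1 * f p.2) (μ.prod μ) :=
      ((Lp.memLp g).integrable one_le_two).mul_prod ((Lp.memLp f).integrable one_le_two)
    refine (h1.bdd_mul (c := ‖k‖) k.continuous.aestronglyMeasurable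
      (.of_forall fun p => k.norm_coe_le_norm p)).congr (.of_forall fun p => ?_)
    simp only [Prod.mk.eta]; ring
  rw [integral_integral_swap hi]
  refine integral_congr_ae (.of_forall fun w => integral_congr_ae (.of_forall fun z => ?_))
  simp only [hk z w]
  ring

/-- An orthonormal family of eigenvectors with non-zero eigenvalues whose orthogonal complement is
annihilated by the operator. -/
lemma exists_orthonormal_eigenvectors {E : Type*} [NormedAddCommGroup E] [InnerProductSpace ℝ E]
    [CompleteSpace E] {T : E →L[ℝ] E} (hc : IsCompactOperator T)
    (hs : T.toLinearMap.IsSymmetric) :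
    ∃ (I : Type) (lam : I → ℝ) (v : I → E), Orthonormal ℝ v ∧ (∀ i, lam i ≠ 0) ∧
      (∀ i, T (v i) = lam i • v i) ∧ ∀ x, (∀ i, inner ℝ (v i) x = 0) → T x = 0 := by
  -- Orthonormal bases of the eigenspaces, which are finite-dimensional, put together.
  let V : {m : ℝ // m ≠ 0} → Submodule ℝ E := fun m => Module.End.eigenspace T.toLinearMap m
  have hfin : ∀ m, FiniteDimensional ℝ (V m) := fun m =>
    ContinuousLinearMap.finite_dimensional_eigenspace hc m.1 m.2
  have hV : OrthogonalFamily ℝ (fun m => V m) fun m => (V m).subtypeₗᵢ :=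
    hs.orthogonalFamily_eigenspaces.comp Subtype.val_injective
  refine ⟨Σ m, Fin (Module.finrank ℝ (V m)), fun i => i.1.1,
    fun i => (stdOrthonormalBasis ℝ (V i.1) i.2 : E),
    hV.orthonormal_sigma_orthonormal (v_family := fun m => stdOrthonormalBasis ℝ (V m))
      fun m => (stdOrthonormalBasis ℝ (V m)).orthonormal, fun i => i.1.2,
    fun i => Module.End.mem_eigenspace_iff.1 (stdOrthonormalBasis ℝ (V i.1) i.2).2, ?_⟩
  intro x hx
  have hort : ∀ (m : ℝ), m ≠ 0 → ∀ y ∈ Module.End.eigenspace T.toLinearMap m,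
      inner ℝ y x = 0 := by
    intro m hm y hy
    let b := stdOrthonormalBasis ℝ (V ⟨m, hm⟩)
    have h1 : y = ∑ i, inner ℝ (b i) ⟨y, hy⟩ • (b i : E) := by
      have := congrArg Subtype.val (b.sum_repr' ⟨y, hy⟩)
      simpa using this.symm
    rw [h1, sum_inner]
    refine Finset.sum_eq_zero fun i _ => ?_
    rw [real_inner_smul_left, hx ⟨⟨m, hm⟩, i⟩, mul_zero]
  have hmem : T x ∈ (⨆ m, Module.End.eigenspace T.toLinearMap m)ᗮ := by
    rw [← Submodule.iInf_orthogonal, Submodule.mem_iInf]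
    intro m y hy
    have h1 : inner ℝ y (T x) = inner ℝ (T y) x := (hs y x).symm
    have h2 : T y = m • y := Module.End.mem_eigenspace_iff.1 hy
    rw [h1, h2, real_inner_smul_left]
    rcases eq_or_ne m 0 with rfl | hm
    · rw [zero_mul]
    · rw [hort m hm y hy, mul_zero]
  rwa [ContinuousLinearMap.orthogonalComplement_iSup_eigenspaces_eq_bot hc hs,
    Submodule.mem_bot] at hmem

end Mercer

section Mercer

variable {Z : Type*} [TopologicalSpace Z] [CompactSpace Z] [T2Space Z] [MeasurableSpace Z]
  [BorelSpace Z] [SecondCountableTopology Z] {μ : Measure Z} [IsFiniteMeasure μ]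

/-- A continuous kernel which is positive semidefinite on indicator functions of open sets is
nonnegative on the diagonal. -/
lemma nonneg_diagonal [μ.IsOpenPosMeasure] {R : Z × Z → ℝ} (hR : Continuous R)
    (hpos : ∀ U : Set Z, IsOpen U → 0 ≤ ∫ z in U, ∫ w in U, R (z, w) ∂μ ∂μ) (z : Z) :
    0 ≤ R (z, z) := by
  by_contra! hz
  obtain ⟨c, hc1, hc2⟩ := exists_between hz
  have hn : {p | R p < c} ∈ 𝓝 (z, z) := hR.continuousAt.eventually_lt continuousAt_const hc1
  obtain ⟨U, V, hU, hzU, hV, hzV, hUV⟩ := mem_nhds_prod_iff'.1 hn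
  -- On a small square around a negative diagonal value the double integral would be negative.
  set O := U ∩ V with hO
  have hOo : IsOpen O := hU.inter hV
  have hm : 0 < μ.real O :=
    ENNReal.toReal_pos (hOo.measure_pos μ ⟨z, hzU, hzV⟩).ne' (measure_ne_top _ _)
  have hRlt : ∀ x ∈ O, ∀ y ∈ O, R (x, y) ≤ c := fun x hx y hy => (hUV ⟨hx.1, hy.2⟩).le
  have hint : ∀ (x : Z), IntegrableOn (fun w => R (x, w)) O μ := fun x =>
    (Continuous.integrable_of_hasCompactSupport (by fun_prop)
      (HasCompactSupport.of_compactSpace _)).integrableOn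
  have hle : ∀ x ∈ O, ∫ w in O, R (x, w) ∂μ ≤ c * μ.real O := by
    intro x hx
    have := setIntegral_mono_on (hint x) (integrableOn_const (C := c) (measure_ne_top μ O))
      hOo.measurableSet (hRlt x hx)
    simpa [mul_comm] using this
  have hcont : Continuous fun x => ∫ w in O, R (x, w) ∂μ := by
    have := continuous_parametric_integral_of_continuous (μ := μ.restrict O)
      (f := fun x w => R (x, w)) hR isCompact_univ
    simpa only [Measure.restrict_univ] using this
  have h2 := setIntegral_mono_on (s := O) (μ := μ)
    (Continuous.integrable_of_hasCompactSupport hcont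
      (HasCompactSupport.of_compactSpace _)).integrableOn
    (integrableOn_const (C := c * μ.real O) (measure_ne_top μ O)) hOo.measurableSet hle
  have h3 := hpos O hOo
  rw [setIntegral_const, smul_eq_mul] at h2
  nlinarith [mul_pos hm hm]

/-- A continuous positive semidefinite kernel with an orthonormal system of continuous
eigenfunctions whose orthogonal complement is annihilated by the integral operator. -/
structure MercerSystem (μ : Measure Z) [IsFiniteMeasure μ] (k : C(Z × Z, ℝ)) (lam : ℕ → ℝ)
    (e : ℕ → C(Z, ℝ)) : Prop where
  symm : ∀ z w, k (z, w) = k (w, z)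
  psd : ∀ f : Lp ℝ 2 μ, 0 ≤ inner ℝ (intOp μ k f) f
  pos : ∀ n, 0 < lam n
  orthonormal : Orthonormal ℝ fun n => ContinuousMap.toLp 2 μ ℝ (e n)
  eigen : ∀ n z, ∫ w, k (z, w) * e n w ∂μ = lam n * e n z
  complete : ∀ f : Lp ℝ 2 μ, (∀ n, inner ℝ (ContinuousMap.toLp 2 μ ℝ (e n)) f = 0) →
    intOpC μ k f = 0

namespace MercerSystem

variable {k : C(Z × Z, ℝ)} {lam : ℕ → ℝ} {e : ℕ → C(Z, ℝ)} (H : MercerSystem μ k lam e)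

include H in
lemma intOp_eigen (n : ℕ) : intOp μ k (ContinuousMap.toLp 2 μ ℝ (e n)) =
    lam n • ContinuousMap.toLp 2 μ ℝ (e n) := by
  rw [intOp_apply, ← map_smul]
  congr 1
  ext z
  rw [intOpC_apply, ContinuousMap.smul_apply, smul_eq_mul, ← H.eigen]
  refine integral_congr_ae ?_
  filter_upwards [ContinuousMap.coeFn_toLp (p := 2) (𝕜 := ℝ) μ (e n)] with w hw
  rw [hw]

include H in
/-- Bessel's inequality for the form `⟨T f, f⟩`: subtracting from `f` its first `N` modes leaves a
nonnegative value of the form. -/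
lemma sum_sq_le_inner (f : Lp ℝ 2 μ) (N : ℕ) :
    ∑ n ∈ Finset.range N, lam n * inner ℝ (ContinuousMap.toLp 2 μ ℝ (e n)) f ^ 2 ≤
      inner ℝ (intOp μ k f) f := by
  set E : ℕ → Lp ℝ 2 μ := fun n => ContinuousMap.toLp 2 μ ℝ (e n) with hE
  set c : ℕ → ℝ := fun n => inner ℝ (E n) f with hc
  set f' := f - ∑ n ∈ Finset.range N, c n • E n with hf'
  have h1 : ∀ n ∈ Finset.range N, inner ℝ (E n) f' = 0 := by
    intro n hn
    rw [hf', inner_sub_right, H.orthonormal.inner_right_sum _ hn, sub_self]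
  have h2 : intOp μ k f' = intOp μ k f - ∑ n ∈ Finset.range N, (c n * lam n) • E n := by
    rw [hf', map_sub, map_sum]
    congr 1
    refine Finset.sum_congr rfl fun n _ => ?_
    rw [map_smul, H.intOp_eigen, smul_smul]
  have h3 : inner ℝ (intOp μ k f') f' = inner ℝ (intOp μ k f) f' := by
    rw [h2, inner_sub_left, sum_inner, Finset.sum_eq_zero, sub_zero]
    intro n hn
    rw [real_inner_smul_left, h1 n hn, mul_zero]
  have h4 : inner ℝ (intOp μ k f) f' =
      inner ℝ (intOp μ k f) f - ∑ n ∈ Finset.range N, lam n * c n ^ 2 := by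
    rw [hf', inner_sub_right, inner_sum]
    congr 1
    refine Finset.sum_congr rfl fun n _ => ?_
    have : inner ℝ (intOp μ k f) (E n) = lam n * c n := by
      have := isSymmetric_intOp (μ := μ) H.symm f (E n)
      change inner ℝ (intOp μ k f) (E n) = inner ℝ f (intOp μ k (E n)) at this
      rw [this, H.intOp_eigen, real_inner_smul_right, real_inner_comm]
    rw [real_inner_smul_right, this]; ring
  have := H.psd f'
  rw [h3, h4] at this
  linarith

include H in
/-- The truncated kernels leave positive semidefinite remainders, so that their diagonals increase to
at most the diagonal of the kernel. -/
lemma sum_sq_le [μ.IsOpenPosMeasure] (N : ℕ) (z : Z) :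
    ∑ n ∈ Finset.range N, lam n * e n z ^ 2 ≤ k (z, z) := by
  have key := nonneg_diagonal (μ := μ)
    (R := fun p => k p - ∑ n ∈ Finset.range N, lam n * (e n p.1 * e n p.2)) (by fun_prop) ?_ z
  · simp only [pow_two]; linarith
  intro U hU
  have hUf : μ U ≠ ⊤ := measure_ne_top _ _
  have hi : ∀ f : C(Z, ℝ), IntegrableOn f U μ := fun f =>
    (f.continuous.integrable_of_hasCompactSupport (HasCompactSupport.of_compactSpace _)).integrableOn
  set f : Lp ℝ 2 μ := indicatorConstLp 2 hU.measurableSet hUf (1 : ℝ) with hf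
  have h1 := H.sum_sq_le_inner f N
  have hc : ∀ φ : C(Z, ℝ), inner ℝ f (ContinuousMap.toLp 2 μ ℝ φ) = ∫ z in U, φ z ∂μ := by
    intro φ
    rw [hf, L2.inner_indicatorConstLp_one]
    refine integral_congr_ae (ae_restrict_of_ae ?_)
    exact ContinuousMap.coeFn_toLp (p := 2) (𝕜 := ℝ) μ φ
  have hT : ∀ z, intOpC μ k f z = ∫ w in U, k (z, w) ∂μ := by
    intro z
    exact (real_inner_comm _ _).trans (hc (k.curry z))
  have h2 : inner ℝ (intOp μ k f) f = ∫ z in U, ∫ w in U, k (z, w) ∂μ ∂μ := by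
    rw [real_inner_comm, intOp_apply, hc]
    simp only [hT]
  have h3 : ∀ z, ∫ w in U, (k (z, w) - ∑ n ∈ Finset.range N, lam n * (e n z * e n w)) ∂μ =
      intOpC μ k f z - ∑ n ∈ Finset.range N, lam n * (e n z * ∫ w in U, e n w ∂μ) := by
    intro z
    have hk : IntegrableOn (fun w => k (z, w)) U μ := hi (k.curry z)
    rw [integral_sub hk (integrable_finsetSum _ fun n _ =>
      ((hi (e n)).const_mul (e n z)).const_mul (lam n)), integral_finsetSum _ fun n _ =>
      ((hi (e n)).const_mul (e n z)).const_mul (lam n), hT]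
    simp only [integral_const_mul]
  simp only [h3]
  have hi2 : ∀ n, Integrable (fun z => lam n * (e n z * ∫ w in U, e n w ∂μ)) (μ.restrict U) :=
    fun n => ((hi (e n)).mul_const _).const_mul _
  rw [integral_sub (hi (intOpC μ k f)) (integrable_finsetSum _ fun n _ => hi2 n),
    integral_finsetSum _ fun n _ => hi2 n]
  simp only [integral_const_mul, integral_mul_const, hT]
  rw [h2] at h1
  have h4 : ∀ n, inner ℝ (ContinuousMap.toLp 2 μ ℝ (e n)) f = ∫ w in U, e n w ∂μ := fun n =>
    (real_inner_comm _ _).trans (hc (e n))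
  simp only [h4, pow_two] at h1
  linarith

include H in
lemma summable_sq [μ.IsOpenPosMeasure] (z : Z) : Summable fun n => lam n * e n z ^ 2 :=
  summable_of_sum_range_le (fun n => mul_nonneg (H.pos n).le (sq_nonneg _)) fun N =>
    H.sum_sq_le N z

include H in
lemma finset_sum_sq_le (s : Finset ℕ) (z w : Z) :
    (∑ n ∈ s, lam n * (e n z * e n w)) ^ 2 ≤
      (∑ n ∈ s, lam n * e n z ^ 2) * ∑ n ∈ s, lam n * e n w ^ 2 := by
  have := Finset.sum_mul_sq_le_sq_mul_sq s (fun n => √(lam n) * e n z) (fun n => √(lam n) * e n w)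
  refine le_of_eq_of_le ?_ (this.trans_eq ?_)
  · congr 1
    refine Finset.sum_congr rfl fun n _ => ?_
    nth_rewrite 1 [← Real.mul_self_sqrt (H.pos n).le]; ring
  · simp only [mul_pow, Real.sq_sqrt (H.pos _).le]

include H in
/-- The expansion of the kernel, pointwise in the first variable and uniformly in the second. -/
lemma hasSum_curry [μ.IsOpenPosMeasure] (z : Z) :
    HasSum (fun n => (lam n * e n z) • e n) (k.curry z) := by
  have hs : Summable fun n => (lam n * e n z) • e n := by
    rw [summable_iff_vanishing_norm]
    intro ε hε
    have hC : 0 < ‖k‖ + 1 := by positivity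
    obtain ⟨s, hs⟩ := summable_iff_vanishing_norm.1 (H.summable_sq z) (ε ^ 2 / (‖k‖ + 1) / 4)
      (by positivity)
    refine ⟨s, fun t ht => ?_⟩
    refine ((ContinuousMap.norm_le _ (half_pos hε).le).2 fun w => ?_).trans_lt (half_lt_self hε)
    have h1 := H.finset_sum_sq_le t z w
    have h2 := (le_abs_self _).trans_lt (hs t ht)
    have h3 : ∑ n ∈ t, lam n * e n w ^ 2 ≤ ‖k‖ + 1 := by
      refine ((H.summable_sq w).sum_le_tsum t
        (fun n _ => mul_nonneg (H.pos n).le (sq_nonneg _))).trans ?_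
      refine (Real.tsum_le_of_sum_range_le (fun n => mul_nonneg (H.pos n).le (sq_nonneg _))
        fun N => H.sum_sq_le N w).trans ?_
      exact ((le_abs_self _).trans (k.norm_coe_le_norm _)).trans (by linarith)
    have h0 : 0 ≤ ∑ n ∈ t, lam n * e n z ^ 2 :=
      Finset.sum_nonneg fun n _ => mul_nonneg (H.pos n).le (sq_nonneg _)
    have h4 : (∑ n ∈ t, lam n * (e n z * e n w)) ^ 2 ≤ (ε / 2) ^ 2 := by
      refine h1.trans ((mul_le_mul_of_nonneg_left h3 h0).trans ?_)
      refine (mul_le_mul_of_nonneg_right h2.le hC.le).trans_eq ?_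
      field_simp; ring
    have h5 : (∑ n ∈ t, (lam n * e n z) • e n) w = ∑ n ∈ t, lam n * (e n z * e n w) := by
      simp [ContinuousMap.coe_sum, Finset.sum_apply, mul_assoc]
    rw [h5, Real.norm_eq_abs]
    exact abs_le_of_sq_le_sq h4 (half_pos hε).le
  obtain ⟨φ, hφ⟩ := hs
  set E : ℕ → Lp ℝ 2 μ := fun n => ContinuousMap.toLp 2 μ ℝ (e n) with hE
  have hφ2 : HasSum (fun n => (lam n * e n z) • E n) (ContinuousMap.toLp 2 μ ℝ φ) := by
    have := hφ.mapL (ContinuousMap.toLp 2 μ ℝ : C(Z, ℝ) →L[ℝ] Lp ℝ 2 μ)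
    simpa only [map_smul] using this
  set V : Lp ℝ 2 μ := ContinuousMap.toLp 2 μ ℝ (k.curry z) - ContinuousMap.toLp 2 μ ℝ φ with hV
  -- The slice and the sum of its expansion have the same modes.
  have h1 : ∀ m, inner ℝ (E m) V = 0 := by
    intro m
    have ha : inner ℝ (E m) (ContinuousMap.toLp 2 μ ℝ φ) = lam m * e m z := by
      have h := hφ2.mapL (innerSL ℝ (E m))
      have hfun : (fun n => innerSL ℝ (E m) ((lam n * e n z) • E n)) =
          fun n => if n = m then lam m * e m z else 0 := funext fun n => ?_
      · rw [hfun] at h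
        exact h.unique (hasSum_ite_eq m _)
      rw [innerSL_apply_apply, real_inner_smul_right, orthonormal_iff_ite.1 H.orthonormal m n]
      by_cases hmn : n = m
      · subst hmn; simp
      · simp [hmn, Ne.symm hmn]
    have hb : inner ℝ (E m) (ContinuousMap.toLp 2 μ ℝ (k.curry z)) = lam m * e m z := by
      rw [← H.eigen, inner_toLp_right]
      refine integral_congr_ae ?_
      filter_upwards [ContinuousMap.coeFn_toLp (p := 2) (𝕜 := ℝ) μ (e m)] with w hw
      rw [hE, hw]
      exact mul_comm _ _
    rw [hV, inner_sub_right, ha, hb, sub_self]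
  have h2 : inner ℝ (ContinuousMap.toLp 2 μ ℝ (k.curry z)) V = 0 :=
    congrArg (fun ψ : C(Z, ℝ) => ψ z) (H.complete V h1)
  have h3 : inner ℝ (ContinuousMap.toLp 2 μ ℝ φ) V = 0 := by
    rw [real_inner_comm]
    have h := hφ2.mapL (innerSL ℝ V)
    have hfun : (fun n => innerSL ℝ V ((lam n * e n z) • E n)) = fun _ => 0 := funext fun n => ?_
    · rw [hfun] at h
      exact h.unique hasSum_zero
    rw [innerSL_apply_apply, real_inner_smul_right, real_inner_comm, h1, mul_zero]
  -- The difference of the slice and of its expansion is orthogonal to every mode, so the operator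
  -- annihilates it, which means that it is orthogonal to the slices as well.
  have h4 : V = 0 := by
    rw [← inner_self_eq_zero (𝕜 := ℝ)]
    nth_rewrite 1 [hV]
    rw [inner_sub_left, h2, h3, sub_zero]
  have h5 : k.curry z = φ := ContinuousMap.toLp_injective μ (sub_eq_zero.1 h4)
  rwa [h5]

include H in
lemma hasSum_apply [μ.IsOpenPosMeasure] (z w : Z) :
    HasSum (fun n => lam n * (e n z * e n w)) (k (z, w)) := by
  have := (H.hasSum_curry z).mapL (ContinuousMap.evalCLM ℝ w)
  simpa [mul_assoc] using this

include H in
/-- **Mercer's theorem**: the kernel is the uniform sum of its eigenfunction expansion. -/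
theorem uniform_expansion [μ.IsOpenPosMeasure] {ε : ℝ} (hε : 0 < ε) :
    ∃ N₀ : ℕ, ∀ N ≥ N₀, ∀ z w,
      |k (z, w) - ∑ n ∈ Finset.range N, lam n * (e n z * e n w)| ≤ ε := by
  -- Dini's theorem on the diagonal; the tail off the diagonal follows by Cauchy–Schwarz.
  have hd : TendstoUniformly (fun N z => ∑ n ∈ Finset.range N, lam n * (e n z * e n z))
      (fun z => k (z, z)) atTop := by
    refine Monotone.tendstoUniformly_of_forall_tendsto (fun N => by fun_prop) ?_ (by fun_prop)
      fun z => (H.hasSum_apply z z).tendsto_sum_nat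
    intro N N' h z
    exact Finset.sum_le_sum_of_subset_of_nonneg (Finset.range_mono h) fun n _ _ =>
      mul_nonneg (H.pos n).le (mul_self_nonneg _)
  obtain ⟨N₀, hN₀⟩ := eventually_atTop.1 (Metric.tendstoUniformly_iff.1 hd ε hε)
  refine ⟨N₀, fun N hN z w => ?_⟩
  have hlim := (((H.hasSum_apply z w).tendsto_sum_nat.sub_const
    (∑ n ∈ Finset.range N, lam n * (e n z * e n w)))).abs
  refine le_of_tendsto hlim (eventually_atTop.2 ⟨N, fun M hM => ?_⟩)
  have htail : ∀ y, ∑ n ∈ Finset.Ico N M, lam n * e n y ^ 2 ≤ ε := by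
    intro y
    have h1 := hN₀ N hN y
    rw [Real.dist_eq] at h1
    have h2 := H.sum_sq_le M y
    rw [← Finset.sum_range_add_sum_Ico _ hM] at h2
    simp only [pow_two] at h2 ⊢
    linarith [le_abs_self (k (y, y) - ∑ n ∈ Finset.range N, lam n * (e n y * e n y))]
  rw [← Finset.sum_range_add_sum_Ico _ hM, add_sub_cancel_left]
  refine abs_le_of_sq_le_sq ((H.finset_sum_sq_le _ z w).trans ?_) hε.le
  rw [pow_two]
  exact mul_le_mul (htail z) (htail w)
    (Finset.sum_nonneg fun n _ => mul_nonneg (H.pos n).le (sq_nonneg _)) hε.le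

end MercerSystem

/-- Orthonormal vectors are at mutual distance `√2`. -/
lemma _root_.Orthonormal.countable {E I : Type*} [NormedAddCommGroup E] [InnerProductSpace ℝ E]
    [TopologicalSpace.SeparableSpace E] {v : I → E} (hv : Orthonormal ℝ v) : Countable I := by
  refine Pairwise.countable_of_isOpen_disjoint (s := fun i => Metric.ball (v i) (1 / 2)) ?_
    (fun i => Metric.isOpen_ball) (fun i => ⟨v i, Metric.mem_ball_self (by norm_num)⟩)
  intro i j hij
  refine Metric.ball_disjoint_ball ?_
  rw [dist_eq_norm]
  have : ‖v i - v j‖ ^ 2 = 2 := by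
    rw [norm_sub_sq_real, hv.1 i, hv.1 j, hv.2 hij]; norm_num
  nlinarith [norm_nonneg (v i - v j)]

end Mercer

/-! ### The covariance operator in a tight frame -/

instance isOpenPosMeasure_count {ι : Type*} [TopologicalSpace ι] [MeasurableSpace ι]
    [MeasurableSingletonClass ι] : (Measure.count : Measure ι).IsOpenPosMeasure :=
  ⟨fun _ _ hU h0 => hU.ne_empty (Measure.count_eq_zero_iff.1 h0)⟩

section Operator

variable {M : Type*} [TopologicalSpace M] [T2Space M] [CompactSpace M] [SecondCountableTopology M]
  [ChartedSpace E3 M] [IsManifold (𝓡 3) ∞ M] [MeasurableSpace M] [BorelSpace M]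
variable {γ : TField M} {n : ℕ} {X : Fin n → (x : M) → Tan x}

lemma continuous_of_slices {α : Type*} [TopologicalSpace α] {f : M × (Fin n × Fin n) → α}
    (hf : ∀ q, Continuous fun x => f (x, q)) : Continuous f :=
  continuous_prod_of_discrete_right.2 hf

namespace TightFrame

variable (F : TightFrame γ X)

include F in
lemma isOpenPos_vol : (vol γ).IsOpenPosMeasure :=
  haveI : Fact (IsRiemannian γ) := ⟨F.metric⟩
  inferInstance

include F in
/-- Elements of `L²` on the space of points with pairs of indices define square-integrable tensor
fields. -/
lemma memField_unhat (f : Lp ℝ 2 (volZ γ n)) : MemField γ 2 (unhat γ X f) := by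
  have := F.isFinite_vol
  have hfm : Measurable f := (Lp.stronglyMeasurable f).measurable
  have hfq : ∀ q, Measurable fun x => f (x, q) := fun q => hfm.comp (measurable_id.prodMk measurable_const)
  have hf2 : ∀ q, MemLp (fun x => f (x, q)) 2 (vol γ) := by
    intro q
    rw [memLp_two_iff_integrable_sq (hfq q).aestronglyMeasurable]
    exact (integrable_prod_count (hfm.pow_const 2).aestronglyMeasurable).1
      (Lp.memLp f).integrable_sq q
  rw [F.memField_iff]
  refine ⟨unhat_symm _, fun q => ?_⟩
  have heq : (fun x => hat X (unhat γ X f) (x, q)) = fun x => ∑ a, ∑ b,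
      ((γ x (X a x) (X q.1 x) * γ x (X b x) (X q.2 x)) *
        ((f (x, (a, b)) + f (x, (b, a))) / 2)) := by
    funext x
    simp only [hat, unhat_apply]
    exact Finset.sum_congr rfl fun a _ => Finset.sum_congr rfl fun b _ => mul_comm _ _
  have hc : ∀ a b, Continuous fun x => γ x (X a x) (X q.1 x) * γ x (X b x) (X q.2 x) :=
    fun a b => (F.continuous_frame_pair (F.cont a) q.1).mul (F.continuous_frame_pair (F.cont b) q.2)
  have hs : ∀ a b, Measurable fun x => (f (x, (a, b)) + f (x, (b, a))) / 2 :=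
    fun a b => ((hfq _).add (hfq _)).div_const 2
  rw [heq]
  constructor
  · exact Finset.measurable_fun_sum _ fun a _ => Finset.measurable_fun_sum _ fun b _ =>
      (hc a b).measurable.mul (hs a b)
  · refine memLp_finsetSum _ fun a _ => memLp_finsetSum _ fun b _ => ?_
    obtain ⟨C, hC⟩ := isCompact_univ.exists_bound_of_continuousOn (hc a b).continuousOn
    refine MemLp.of_le_mul (c := C) (g := fun x => (f (x, (a, b)) + f (x, (b, a))) / 2) ?_
      ((hc a b).measurable.mul (hs a b)).aestronglyMeasurable (.of_forall fun x => ?_)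
    · have := ((hf2 (a, b)).add (hf2 (b, a))).const_mul (1 / 2)
      refine this.ae_eq (.of_forall fun x => ?_)
      simp only [Pi.add_apply]; ring
    · rw [norm_mul]
      exact mul_le_mul_of_nonneg_right (hC x (mem_univ x)) (norm_nonneg _)

include F in
lemma inner_toL2_unhat {k : TField M} (hk : MemField γ 2 k) (f : Lp ℝ 2 (volZ γ n)) :
    ip γ k (unhat γ X f) = inner ℝ (toL2 γ X k) f := by
  have := F.isFinite_vol
  have hi : Integrable (fun z => hat X k z * f z) (volZ γ n) :=
    (F.memLp_hat hk).integrable_mul (Lp.memLp f)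
  have h1 : inner ℝ (toL2 γ X k) f = ∫ z, hat X k z * f z ∂(volZ γ n) := by
    rw [L2.inner_def]
    refine integral_congr_ae ?_
    filter_upwards [F.coeFn_toL2 hk] with z hz
    rw [hz]
    exact mul_comm _ _
  rw [h1, integral_prod_count hi, ip]
  simp only [F.pair_unhat hk.symm]
  exact integral_finsetSum _ fun q _ => (integrable_prod_count hi.1).1 hi q

variable {K : TKernel M} (hK : IsCovKernel γ K)

include F hK in
/-- The kernel is bilinear in its first pair of arguments. -/
lemma kernel_expand (x y : M) (u v : Tan x) : K x y u v =
    ∑ a, ∑ b, (γ x u (X a x) * γ x v (X b x)) • K x y (X a x) (X b x) := by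
  refine ContinuousLinearMap.ext fun w => ContinuousLinearMap.ext fun z => ?_
  rw [hK.symm, (F.tight x).bilin_eq (F.metric.symm x) (F.metric.pos x) (K y x w z) u v]
  simp only [sum_apply, smul_apply, smul_eq_mul]
  exact Finset.sum_congr rfl fun a _ => Finset.sum_congr rfl fun b _ => by rw [hK.symm]

include F hK in
/-- The field `K(x, ·)(u, v)`. -/
lemma memField_kernel (x : M) (u v : Tan x) : MemField γ 2 (fun y => K x y u v) := by
  have := F.isFinite_vol
  rw [F.memField_iff]
  refine ⟨fun y w z => hK.symm_right x y u v w z, fun q => ?_⟩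
  have hc : Continuous fun y => hat X (fun y => K x y u v) (y, q) := by
    have : (fun y => hat X (fun y => K x y u v) (y, q)) = fun y => ∑ a, ∑ b,
        (γ x u (X a x) * γ x v (X b x)) * K x y (X a x) (X b x) (X q.1 y) (X q.2 y) := by
      funext y
      simp only [hat, F.kernel_expand hK x y u v, sum_apply, smul_apply, smul_eq_mul]
    rw [this]
    refine continuous_finsetSum _ fun a _ => continuous_finsetSum _ fun b _ => ?_
    refine continuous_const.mul ?_
    exact (hK.cont _ _ _ _ (F.cont a) (F.cont b) (F.cont q.1) (F.cont q.2)).comp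
      (Continuous.prodMk_right x)
  refine ⟨hc.measurable, ?_⟩
  exact MemLp.of_bound (C := ‖(⟨_, hc⟩ : C(M, ℝ))‖) hc.aestronglyMeasurable
    (.of_forall fun y => ContinuousMap.norm_coe_le_norm (⟨_, hc⟩ : C(M, ℝ)) y)

/-- The components of a covariance kernel in a frame. -/
noncomputable def kerZ (hK : IsCovKernel γ K) :
    C((M × (Fin n × Fin n)) × (M × (Fin n × Fin n)), ℝ) where
  toFun p := K p.1.1 p.2.1 (X p.1.2.1 p.1.1) (X p.1.2.2 p.1.1) (X p.2.2.1 p.2.1) (X p.2.2.2 p.2.1)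
  continuous_toFun := by
    let e := Homeomorph.prodProdProdComm M (Fin n × Fin n) M (Fin n × Fin n)
    rw [← e.symm.comp_continuous_iff']
    refine continuous_prod_of_discrete_right.2 fun q => ?_
    exact hK.cont _ _ _ _ (F.cont q.1.1) (F.cont q.1.2) (F.cont q.2.1) (F.cont q.2.2)

lemma kerZ_apply (p) : F.kerZ hK p = K p.1.1 p.2.1 (X p.1.2.1 p.1.1) (X p.1.2.2 p.1.1)
    (X p.2.2.1 p.2.1) (X p.2.2.2 p.2.1) := rfl

/-- The integral operator of a covariance kernel, acting on components. -/
noncomputable def opZ [IsFiniteMeasure (vol γ)] :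
    Lp ℝ 2 (volZ γ n) →L[ℝ] C(M × (Fin n × Fin n), ℝ) :=
  intOpC (volZ γ n) (F.kerZ hK)

lemma opZ_apply [IsFiniteMeasure (vol γ)] (f : Lp ℝ 2 (volZ γ n)) (x : M) (q : Fin n × Fin n) :
    F.opZ hK f (x, q) = inner ℝ (toL2 γ X (fun y => K x y (X q.1 x) (X q.2 x))) f := by
  change inner ℝ (ContinuousMap.toLp 2 _ ℝ ((F.kerZ hK).curry (x, q))) f = _
  congr 1
  rw [F.toL2_eq (F.memField_kernel hK x _ _)]
  rfl

include F hK in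
lemma applyK_eq_inner [IsFiniteMeasure (vol γ)] {h : TField M} (hh : MemField γ 2 h) (x : M)
    (u v : Tan x) :
    applyK γ K h x u v = inner ℝ (toL2 γ X (fun y => K x y u v)) (toL2 γ X h) :=
  F.ip_eq_inner (F.memField_kernel hK x u v) hh

/-- The image of (the symmetric part of) `f` under the covariance operator, as a tensor field. -/
noncomputable def opT [IsFiniteMeasure (vol γ)] (f : Lp ℝ 2 (volZ γ n)) : TField M :=
  unhat γ X (F.opZ hK f)

lemma symm_opT [IsFiniteMeasure (vol γ)] (f : Lp ℝ 2 (volZ γ n)) : IsSymm (F.opT hK f) :=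
  unhat_symm _

lemma contTF_opT [IsFiniteMeasure (vol γ)] (f : Lp ℝ 2 (volZ γ n)) : ContTF (F.opT hK f) :=
  F.contTF_unhat fun _ => (F.opZ hK f).continuous.comp (Continuous.prodMk_left _)

lemma memField_opT [IsFiniteMeasure (vol γ)] (f : Lp ℝ 2 (volZ γ n)) {p : ℝ≥0∞} :
    MemField γ p (F.opT hK f) :=
  F.memField_cont (F.contTF_opT hK f) (F.symm_opT hK f) p

include F hK in
lemma toL2_kernel_symm [IsFiniteMeasure (vol γ)] (x : M) (u v : Tan x) (f : Lp ℝ 2 (volZ γ n)) :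
    inner ℝ (toL2 γ X (fun y => K x y u v)) f = inner ℝ (toL2 γ X (fun y => K x y v u)) f := by
  congr 3
  funext y
  refine ContinuousLinearMap.ext fun w => ContinuousLinearMap.ext fun z => ?_
  rw [hK.symm, hK.symm_right, ← hK.symm]

lemma opT_apply [IsFiniteMeasure (vol γ)] (f : Lp ℝ 2 (volZ γ n)) (x : M) (u v : Tan x) :
    F.opT hK f x u v = inner ℝ (toL2 γ X (fun y => K x y u v)) f := by
  have h1 : (fun y => K x y u v) = ∑ a, ∑ b, (γ x u (X a x) * γ x v (X b x)) •
      (fun y => K x y (X a x) (X b x) : TField M) := by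
    funext y
    rw [F.kernel_expand hK]
    simp only [Finset.sum_apply, Pi.smul_apply]
  have hm : ∀ a b, MemField γ 2 ((γ x u (X a x) * γ x v (X b x)) •
      (fun y => K x y (X a x) (X b x) : TField M)) := fun a b =>
    F.memField_smul _ (F.memField_kernel hK _ _ _)
  rw [h1, F.toL2_sum _ fun a _ => F.memField_sum _ fun b _ => hm a b, sum_inner, opT, unhat_apply]
  refine Finset.sum_congr rfl fun a _ => ?_
  rw [F.toL2_sum _ fun b _ => hm a b, sum_inner]
  refine Finset.sum_congr rfl fun b _ => ?_
  rw [F.toL2_smul _ (F.memField_kernel hK _ _ _), real_inner_smul_left, opZ_apply, opZ_apply]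
  simp only
  rw [F.toL2_kernel_symm hK x (X b x) (X a x), F.metric.symm x u, F.metric.symm x v]
  ring

lemma applyK_eq_opT [IsFiniteMeasure (vol γ)] {h : TField M} (hh : MemField γ 2 h) (x : M)
    (u v : Tan x) : applyK γ K h x u v = F.opT hK (toL2 γ X h) x u v := by
  rw [F.opT_apply, F.applyK_eq_inner hK hh]

lemma hat_opT [IsFiniteMeasure (vol γ)] (f : Lp ℝ 2 (volZ γ n)) :
    hat X (F.opT hK f) = F.opZ hK f := by
  funext ⟨x, q⟩
  rw [opZ_apply, hat, opT_apply]

include F in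
lemma toL2_cont [IsFiniteMeasure (vol γ)] {h : TField M} (hh : MemField γ 2 h)
    (φ : C(M × (Fin n × Fin n), ℝ)) (hφ : hat X h = φ) :
    toL2 γ X h = ContinuousMap.toLp 2 (volZ γ n) ℝ φ := by
  rw [F.toL2_eq hh]
  simp only [hφ]
  rfl

lemma toL2_opT [IsFiniteMeasure (vol γ)] (f : Lp ℝ 2 (volZ γ n)) :
    toL2 γ X (F.opT hK f) = intOp (volZ γ n) (F.kerZ hK) f :=
  F.toL2_cont (F.memField_opT hK f) (F.opZ hK f) (F.hat_opT hK f)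

/-- The covariance operator only sees the symmetric tensor field underlying an element of `L²`. -/
lemma opT_toL2_unhat [IsFiniteMeasure (vol γ)] (f : Lp ℝ 2 (volZ γ n)) :
    F.opT hK (toL2 γ X (unhat γ X f)) = F.opT hK f := by
  funext x
  refine ContinuousLinearMap.ext fun u => ContinuousLinearMap.ext fun v => ?_
  rw [opT_apply, opT_apply, ← F.inner_toL2_unhat (F.memField_kernel hK x u v) f,
    F.ip_eq_inner (F.memField_kernel hK x u v) (F.memField_unhat f)]

lemma opZ_toL2_unhat [IsFiniteMeasure (vol γ)] (f : Lp ℝ 2 (volZ γ n)) :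
    F.opZ hK (toL2 γ X (unhat γ X f)) = F.opZ hK f := by
  refine DFunLike.coe_injective ?_
  rw [← hat_opT, ← hat_opT, opT_toL2_unhat]

lemma kernel_pos [IsFiniteMeasure (vol γ)] {h : TField M} (hh : MemField γ 2 h)
    (h0 : ¬ ∀ᵐ x ∂(vol γ), h x = 0) : 0 < ip γ h (F.opT hK (toL2 γ X h)) := by
  refine (hK.pos h hh h0).trans_eq ?_
  have : ∀ x, applyK γ K h x = fun u v => F.opT hK (toL2 γ X h) x u v := fun x => by
    funext u v
    exact F.applyK_eq_opT hK hh x u v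
  simp only [this]
  rfl

lemma intOp_nonneg [IsFiniteMeasure (vol γ)] (f : Lp ℝ 2 (volZ γ n)) :
    0 ≤ inner ℝ (intOp (volZ γ n) (F.kerZ hK) f) f := by
  have hm := F.memField_unhat f
  rw [← F.toL2_opT hK, ← F.inner_toL2_unhat (F.memField_opT hK f),
    F.ip_eq_inner (F.memField_opT hK f) hm, real_inner_comm,
    ← F.ip_eq_inner hm (F.memField_opT hK f), ← F.opT_toL2_unhat hK]
  by_cases h0 : ∀ᵐ x ∂(vol γ), unhat γ X f x = 0
  · rw [F.ip_eq_inner hm (F.memField_opT hK _), (F.toL2_eq_zero_iff hm).2 h0, inner_zero_left]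
  · exact (F.kernel_pos hK hm h0).le

/-- The components of the eigentensors form a Mercer system. -/
lemma mercerSystem [IsFiniteMeasure (vol γ)] {lam : ℕ → ℝ} {e : ℕ → TField M}
    (he : IsEigensystem γ K lam e) : MercerSystem (volZ γ n) (F.kerZ hK) lam
      (fun m => ⟨hat X (e m), continuous_of_slices (F.continuous_hat (he.cont m))⟩) := by
  have hm : ∀ m, MemField γ 2 (e m) := fun m => F.memField_cont (he.cont m) (he.symm m) 2
  have hL : ∀ m, ContinuousMap.toLp 2 (volZ γ n) ℝ
      ⟨hat X (e m), continuous_of_slices (F.continuous_hat (he.cont m))⟩ = toL2 γ X (e m) :=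
    fun m => (F.toL2_cont (hm m) _ rfl).symm
  refine ⟨fun z w => hK.symm _ _ _ _ _ _, F.intOp_nonneg hK, he.pos, ?_, ?_, ?_⟩
  · rw [orthonormal_iff_ite]
    intro i j
    rw [hL, hL, ← F.ip_eq_inner (hm i) (hm j), he.orthonormal]
  · rintro m ⟨x, q⟩
    have h1 := he.eigen m x (X q.1 x) (X q.2 x)
    rw [F.applyK_eq_opT hK (hm m)] at h1
    refine Eq.trans ?_ h1
    have h2 : F.opT hK (toL2 γ X (e m)) x (X q.1 x) (X q.2 x) =
      F.opZ hK (toL2 γ X (e m)) (x, q) := congrFun (F.hat_opT hK (toL2 γ X (e m))) (x, q)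
    rw [h2, opZ, intOpC_apply]
    refine integral_congr_ae ?_
    filter_upwards [F.coeFn_toL2 (hm m)] with w hw
    rw [hw]
    rfl
  · intro f hf
    have h0 : ∀ m, ip γ (unhat γ X f) (e m) = 0 := by
      intro m
      rw [F.ip_eq_inner (F.memField_unhat f) (hm m), real_inner_comm,
        ← F.ip_eq_inner (hm m) (F.memField_unhat f), F.inner_toL2_unhat (hm m), ← hL, hf]
    change F.opZ hK f = 0
    rw [← F.opZ_toL2_unhat, (F.toL2_eq_zero_iff (F.memField_unhat f)).2
      (he.complete _ (F.memField_unhat f) h0), map_zero]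

end TightFrame

end Operator

/-! ### Spectral decomposition of the covariance operator -/

section Spectral

variable {M : Type*} [TopologicalSpace M] [T2Space M] [CompactSpace M] [SecondCountableTopology M]
  [ChartedSpace E3 M] [IsManifold (𝓡 3) ∞ M] [MeasurableSpace M] [BorelSpace M]
variable {γ : TField M} {n : ℕ} {X : Fin n → (x : M) → Tan x}

lemma infinite_of_nonempty [Nonempty M] : Infinite M := by
  obtain ⟨x⟩ := ‹Nonempty M›
  have h1 : (chartAt E3 x).target.Infinite := infinite_of_mem_nhds (chartAt E3 x x)
    ((chartAt E3 x).open_target.mem_nhds (mem_chart_target E3 x))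
  have h2 : ((chartAt E3 x).symm '' (chartAt E3 x).target).Infinite :=
    h1.image (chartAt E3 x).symm.injOn
  exact Set.infinite_univ_iff.1 (h2.mono (subset_univ _))

namespace TightFrame

variable (F : TightFrame γ X)

include F in
/-- The restriction of the metric to an open set, as a tensor field of class `L²`. -/
lemma memField_indicator {U : Set M} (hU : IsOpen U) :
    MemField γ 2 (fun x => U.indicator (fun _ => (1 : ℝ)) x • γ x) := by
  have := F.isFinite_vol
  have hm := F.memField_cont F.metric.smooth.contTF F.metric.symm 2
  rw [F.memField_iff] at hm ⊢
  have heq : ∀ q, (fun x => hat X (fun x => U.indicator (fun _ => (1 : ℝ)) x • γ x) (x, q)) =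
      U.indicator (fun x => hat X γ (x, q)) := by
    intro q
    funext x
    by_cases hx : x ∈ U <;> simp [hat, hx, smul_apply]
  refine ⟨fun x u v => ?_, fun q => ?_⟩
  · change _ * γ x u v = _ * γ x v u
    rw [F.metric.symm]
  · rw [heq]
    exact ⟨(hm.2 q).1.indicator hU.measurableSet, (hm.2 q).2.indicator hU.measurableSet⟩

include F in
/-- A complete system of `L²(Sym² T*Σ)` is infinite: the restrictions of the metric to infinitely
many disjoint open sets span an infinite-dimensional space, on which the map to the inner products
with the members of the system is injective. -/
lemma infinite_of_complete [Nonempty M] {I : Type*} (v : I → Lp ℝ 2 (volZ γ n))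
    (hv : ∀ h, MemField γ 2 h → (∀ i, inner ℝ (v i) (toL2 γ X h) = 0) → toL2 γ X h = 0) :
    Infinite I := by
  by_contra hI
  rw [not_infinite_iff_finite] at hI
  have := F.isFinite_vol
  have hop := F.isOpenPos_vol
  have := infinite_of_nonempty (M := M)
  obtain ⟨U, hUi, hUo, hd⟩ := exists_seq_infinite_isOpen_pairwise_disjoint M
  set f : ℕ → TField M := fun j x => (U j).indicator (fun _ => (1 : ℝ)) x • γ x with hf
  have hm : ∀ j, MemField γ 2 (f j) := fun j => F.memField_indicator (hUo j)
  have hne : ∀ j, toL2 γ X (f j) ≠ 0 := by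
    intro j h0
    rw [F.toL2_eq_zero_iff (hm j)] at h0
    have : vol γ (U j) = 0 := by
      refine measure_mono_null (fun x hx => ?_) (ae_iff.1 h0)
      intro (h : f j x = 0)
      have h1 : γ x (bvec x 0) (bvec x 0) = 0 := by
        have := congrArg (fun b : Tan x →L[ℝ] Tan x →L[ℝ] ℝ => b (bvec x 0) (bvec x 0)) h
        simpa [hf, hx] using this
      refine (F.metric.pos x (bvec x 0) ?_).ne' h1
      intro h2
      have h3 : (EuclideanSpace.single 0 1 : E3) = 0 := h2
      have := congrArg (fun u : E3 => u 0) h3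
      simp at this
    exact (hUo j).measure_ne_zero _ (hUi j).nonempty this
  have hort : Pairwise fun i j => inner ℝ (toL2 γ X (f i)) (toL2 γ X (f j)) = 0 := by
    intro i j hij
    rw [← F.ip_eq_inner (hm i) (hm j), ip]
    refine integral_eq_zero_of_ae (.of_forall fun x => ?_)
    refine (F.pair_eq (f i) (f j) x).trans (Finset.sum_eq_zero fun q _ => ?_)
    by_cases hx : x ∈ U i
    · have hx' : x ∉ U j := fun h => (Set.disjoint_left.1 (hd hij)) hx h
      simp [hat, hf, hx']
    · simp [hat, hf, hx]
  have hli := linearIndependent_of_ne_zero_of_inner_eq_zero (𝕜 := ℝ) hne hort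
  let L : Lp ℝ 2 (volZ γ n) →ₗ[ℝ] (I → ℝ) :=
    LinearMap.pi fun i => (innerSL ℝ (v i) : Lp ℝ 2 (volZ γ n) →ₗ[ℝ] ℝ)
  have hspan : ∀ x ∈ Submodule.span ℝ (range fun j => toL2 γ X (f j)),
      ∃ h, MemField γ 2 h ∧ toL2 γ X h = x := by
    intro x hx
    induction hx using Submodule.span_induction with
    | mem x hx => obtain ⟨j, rfl⟩ := hx; exact ⟨f j, hm j, rfl⟩
    | zero =>
      exact ⟨0, F.memField_zero, (F.toL2_eq_zero_iff F.memField_zero).2 (.of_forall fun x => rfl)⟩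
    | add x y _ _ hx hy =>
      obtain ⟨h, hh, rfl⟩ := hx
      obtain ⟨k, hk, rfl⟩ := hy
      refine ⟨h - (-1 : ℝ) • k, F.memField_sub hh (F.memField_smul _ hk), ?_⟩
      rw [F.toL2_sub hh (F.memField_smul _ hk), F.toL2_smul _ hk, neg_smul, one_smul, sub_neg_eq_add]
    | smul c x _ hx =>
      obtain ⟨h, hh, rfl⟩ := hx
      exact ⟨c • h, F.memField_smul _ hh, F.toL2_smul _ hh⟩
  have hdis : Disjoint (Submodule.span ℝ (range fun j => toL2 γ X (f j))) (LinearMap.ker L) := by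
    rw [Submodule.disjoint_def]
    intro x hx hx0
    obtain ⟨h, hh, rfl⟩ := hspan x hx
    exact hv h hh fun i => congrFun (LinearMap.mem_ker.1 hx0) i
  have := Fintype.ofFinite I
  have hfin := (hli.map hdis).finite
  exact not_finite ℕ

variable {K : TKernel M} (hK : IsCovKernel γ K)

include F hK in
/-- The spectral theorem for the covariance operator. An eigenvector `v` in `L²` with eigenvalue
`lam` has the continuous representative `lam⁻¹ • K v`, and strict positivity of the kernel makes the
eigenvectors complete among the symmetric tensor fields. -/
theorem exists_eigensystem [Nonempty M] : ∃ lam e, IsEigensystem γ K lam e := by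
  have := F.isFinite_vol
  have : Fact ((2 : ℝ≥0∞) ≠ ⊤) := ⟨by norm_num⟩
  classical
  obtain ⟨I, lam, v, hv, hlam, heig, hcompl⟩ := exists_orthonormal_eigenvectors
    (isCompactOperator_intOp (volZ γ n) (F.kerZ hK))
    (isSymmetric_intOp (μ := volZ γ n) (k := F.kerZ hK) fun z w => hK.symm _ _ _ _ _ _)
  set e : I → TField M := fun i => (lam i)⁻¹ • F.opT hK (v i) with he
  have hm : ∀ i, MemField γ 2 (e i) := fun i => F.memField_smul _ (F.memField_opT hK _)
  have hL : ∀ i, toL2 γ X (e i) = v i := by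
    intro i
    rw [he, F.toL2_smul _ (F.memField_opT hK _), F.toL2_opT, heig, smul_smul,
      inv_mul_cancel₀ (hlam i), one_smul]
  have hop : ∀ i, F.opT hK (toL2 γ X (e i)) = lam i • e i := by
    intro i
    funext x
    refine ContinuousLinearMap.ext fun u => ContinuousLinearMap.ext fun w => ?_
    change _ = lam i * ((lam i)⁻¹ * F.opT hK (v i) x u w)
    rw [hL, mul_inv_cancel_left₀ (hlam i)]
  have hon : ∀ i j, ip γ (e i) (e j) = if i = j then 1 else 0 := by
    intro i j
    rw [F.ip_eq_inner (hm i) (hm j), hL, hL]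
    exact orthonormal_iff_ite.1 hv i j
  have hcomp : ∀ h, MemField γ 2 h → (∀ i, inner ℝ (v i) (toL2 γ X h) = 0) → toL2 γ X h = 0 := by
    intro h hh h0
    rw [F.toL2_eq_zero_iff hh]
    by_contra hne
    refine (F.kernel_pos hK hh hne).ne' ?_
    rw [F.ip_eq_inner hh (F.memField_opT hK _), F.toL2_opT, hcompl _ h0, inner_zero_right]
  have hcount : Countable I := hv.countable
  have hinf : Infinite I := F.infinite_of_complete v hcomp
  -- A countable infinite orthonormal system can be numbered by `ℕ`.
  obtain ⟨hden⟩ := nonempty_denumerable_iff.2 ⟨hcount, hinf⟩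
  let E : I ≃ ℕ := Denumerable.eqv I
  refine ⟨fun m => lam (E.symm m), fun m => e (E.symm m), fun m => ?_, fun m => ?_, fun m => ?_,
    fun m x u w => ?_, fun i j => ?_, fun h hh h0 => ?_⟩
  · set i := E.symm m
    have h1 := F.kernel_pos hK (hm i) (fun h0 => by
      rw [← F.toL2_eq_zero_iff (hm i), hL] at h0
      have := hv.1 i
      rw [h0, norm_zero] at this
      exact zero_ne_one this)
    rw [hop, F.ip_eq_inner (hm i) (F.memField_smul _ (hm i)), F.toL2_smul _ (hm i),
      real_inner_smul_right, ← F.ip_eq_inner (hm i) (hm i), hon, if_pos rfl, mul_one] at h1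
    exact h1
  · exact (hm _).symm
  · set i := E.symm m
    have : e i = F.opT hK ((lam i)⁻¹ • v i) := by
      funext x
      refine ContinuousLinearMap.ext fun u => ContinuousLinearMap.ext fun w => ?_
      change (lam i)⁻¹ * F.opT hK (v i) x u w = _
      rw [F.opT_apply, F.opT_apply, real_inner_smul_right]
    rw [this]
    exact F.contTF_opT hK _
  · rw [F.applyK_eq_opT hK (hm _), hop]
    rfl
  · rw [hon]
    simp only [E.symm.injective.eq_iff]
  · rw [← F.toL2_eq_zero_iff hh]
    refine hcomp h hh fun i => ?_
    have := h0 (E i)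
    rwa [E.symm_apply_apply, F.ip_eq_inner hh (hm i), hL, real_inner_comm] at this

include F in
lemma abs_metric_le (x : M) (u : Tan x) (a : Fin n) : |γ x u (X a x)| ≤ vlen γ x u := by
  refine Real.abs_le_sqrt ?_
  rw [← F.tight x u u]
  simp only [← pow_two]
  exact Finset.single_le_sum (f := fun a => γ x u (X a x) ^ 2) (fun b _ => sq_nonneg _)
    (Finset.mem_univ a)

include F hK in
/-- **Mercer's theorem** for tensor-valued kernels, from the scalar one for the components in the
tight frame. -/
theorem mercerExpansion {lam : ℕ → ℝ} {e : ℕ → TField M} (he : IsEigensystem γ K lam e) :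
    MercerExpansion γ K lam e := by
  have := F.isFinite_vol
  have := F.isOpenPos_vol
  intro ε hε
  set m : ℝ := ((Fintype.card (Fin n × Fin n) : ℕ) : ℝ) with hm
  -- The error is a sum over `m * m` pairs of components, hence the scalar tolerance
  -- `ε / (m * m + 1)`.
  obtain ⟨N₀, hN₀⟩ := (F.mercerSystem hK he).uniform_expansion
    (ε := ε / (m * m + 1)) (by positivity)
  refine ⟨N₀, fun N hN x y u v w z => ?_⟩
  set c : Fin n × Fin n → ℝ := fun p => γ x u (X p.1 x) * γ x v (X p.2 x) with hc
  set d : Fin n × Fin n → ℝ := fun p => γ y w (X p.1 y) * γ y z (X p.2 y) with hd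
  have hcb : ∀ p, |c p| ≤ vlen γ x u * vlen γ x v := fun p => by
    rw [hc, abs_mul]
    exact mul_le_mul (F.abs_metric_le x u _) (F.abs_metric_le x v _) (abs_nonneg _)
      (Real.sqrt_nonneg _)
  have hdb : ∀ p, |d p| ≤ vlen γ y w * vlen γ y z := fun p => by
    rw [hd, abs_mul]
    exact mul_le_mul (F.abs_metric_le y w _) (F.abs_metric_le y z _) (abs_nonneg _)
      (Real.sqrt_nonneg _)
  have h1 : K x y u v w z = ∑ p, ∑ q, c p * d q * F.kerZ hK ((x, p), (y, q)) := by
    rw [F.kernel_expand hK x y u v, Fintype.sum_prod_type]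
    simp only [sum_apply, smul_apply, smul_eq_mul]
    refine Finset.sum_congr rfl fun a _ => Finset.sum_congr rfl fun b _ => ?_
    rw [(F.tight y).bilin_eq (F.metric.symm y) (F.metric.pos y), Fintype.sum_prod_type,
      Finset.mul_sum]
    refine Finset.sum_congr rfl fun a' _ => ?_
    rw [Finset.mul_sum]
    refine Finset.sum_congr rfl fun b' _ => ?_
    simp only [hc, hd, kerZ_apply]
    ring
  have h2 : ∀ i, e i x u v = ∑ p, c p * hat X (e i) (x, p) := fun i => by
    rw [F.bilin_eq, Fintype.sum_prod_type]
  have h3 : ∀ i, e i y w z = ∑ p, d p * hat X (e i) (y, p) := fun i => by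
    rw [F.bilin_eq, Fintype.sum_prod_type]
  have h4 : K x y u v w z - ∑ i ∈ Finset.range N, lam i * e i x u v * e i y w z =
      ∑ p, ∑ q, c p * d q * (F.kerZ hK ((x, p), (y, q)) - ∑ i ∈ Finset.range N,
        lam i * (hat X (e i) (x, p) * hat X (e i) (y, q))) := by
    have h5 : ∑ i ∈ Finset.range N, lam i * e i x u v * e i y w z = ∑ p, ∑ q, c p * d q *
        ∑ i ∈ Finset.range N, lam i * (hat X (e i) (x, p) * hat X (e i) (y, q)) := by
      simp only [Finset.mul_sum]
      rw [Finset.sum_congr rfl fun p _ => Finset.sum_comm, Finset.sum_comm]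
      refine Finset.sum_congr rfl fun i _ => ?_
      rw [h2, h3, mul_assoc, Finset.sum_mul_sum, Finset.mul_sum]
      refine Finset.sum_congr rfl fun p _ => ?_
      rw [Finset.mul_sum]
      exact Finset.sum_congr rfl fun q _ => by ring
    rw [h1, h5, ← Finset.sum_sub_distrib]
    refine Finset.sum_congr rfl fun p _ => ?_
    rw [← Finset.sum_sub_distrib]
    exact Finset.sum_congr rfl fun q _ => by ring
  set V := vlen γ x u * vlen γ x v * (vlen γ y w * vlen γ y z) with hV
  have hV0 : 0 ≤ V := by
    have : ∀ (x : M) (u : Tan x), 0 ≤ vlen γ x u := fun x u => Real.sqrt_nonneg _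
    exact mul_nonneg (mul_nonneg (this _ _) (this _ _)) (mul_nonneg (this _ _) (this _ _))
  rw [h4]
  calc _ ≤ ∑ p : Fin n × Fin n, ∑ q : Fin n × Fin n, V * (ε / (m * m + 1)) := by
        refine (Finset.abs_sum_le_sum_abs _ _).trans (Finset.sum_le_sum fun p _ => ?_)
        refine (Finset.abs_sum_le_sum_abs _ _).trans (Finset.sum_le_sum fun q _ => ?_)
        rw [abs_mul, abs_mul]
        exact mul_le_mul (mul_le_mul (hcb p) (hdb q) (abs_nonneg _)
          ((abs_nonneg _).trans (hcb p))) (hN₀ N hN (x, p) (y, q)) (abs_nonneg _) hV0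
    _ = (m * m) * (V * (ε / (m * m + 1))) := by
        simp only [Finset.sum_const, Finset.card_univ, nsmul_eq_mul, ← hm]; ring
    _ ≤ ε * V := by
        have : m * m / (m * m + 1) ≤ 1 := (div_le_one (by positivity)).2 (by linarith)
        calc _ = (m * m / (m * m + 1)) * (ε * V) := by ring
          _ ≤ 1 * (ε * V) := mul_le_mul_of_nonneg_right this (by positivity)
          _ = ε * V := one_mul _
    _ = _ := by rw [hV]; ring

end TightFrame
end Spectral

/-! ### Expansions in eigentensors and the inverse quadratic form -/

section Expansion

variable {M : Type*} [TopologicalSpace M] [T2Space M] [CompactSpace M] [SecondCountableTopology M]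
  [ChartedSpace E3 M] [IsManifold (𝓡 3) ∞ M] [MeasurableSpace M] [BorelSpace M]
variable {γ : TField M} {n : ℕ} {X : Fin n → (x : M) → Tan x}

lemma _root_.Orthonormal.summable_inner_smul {E ι : Type*} [NormedAddCommGroup E]
    [InnerProductSpace ℝ E] [CompleteSpace E] {v : ι → E} (hv : Orthonormal ℝ v) (x : E) :
    Summable fun i => inner ℝ (v i) x • v i := by
  have h := (hv.orthogonalFamily.summable_iff_norm_sq_summable
    fun i => (inner ℝ (v i) x : ℝ)).2 (hv.inner_products_summable x)
  simpa using h

namespace TightFrame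

variable (F : TightFrame γ X) {K : TKernel M} {lam : ℕ → ℝ} {e : ℕ → TField M}
  (he : IsEigensystem γ K lam e)

include F he

lemma memField_eigen (m : ℕ) (p : ℝ≥0∞) : MemField γ p (e m) :=
  F.memField_cont (he.cont m) (he.symm m) p

lemma orthonormal_toL2 : Orthonormal ℝ fun m => toL2 γ X (e m) := by
  rw [orthonormal_iff_ite]
  intro i j
  rw [← F.ip_eq_inner (F.memField_eigen he i 2) (F.memField_eigen he j 2), he.orthonormal]

/-- Completeness of the eigentensors: every field of class `L²` is the sum of its modes. -/
lemma hasSum_toL2 {h : TField M} (hh : MemField γ 2 h) :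
    HasSum (fun m => ip γ h (e m) • toL2 γ X (e m)) (toL2 γ X h) := by
  have hon := F.orthonormal_toL2 he
  obtain ⟨y, hy⟩ := hon.summable_inner_smul (toL2 γ X h)
  have hc : ∀ m, ip γ h (e m) = inner ℝ (toL2 γ X (e m)) (toL2 γ X h) := fun m => by
    rw [F.ip_eq_inner hh (F.memField_eigen he m 2), real_inner_comm]
  simp only [hc]
  -- The remainder `f` is orthogonal to all modes, so by completeness the symmetric tensor field
  -- representing it vanishes; hence `f` is orthogonal to `toL2 γ X h` and to `y`.
  set f := toL2 γ X h - y with hf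
  have h1 : ∀ m, inner ℝ (toL2 γ X (e m)) f = 0 := by
    intro m
    have h2 := hy.mapL (innerSL ℝ (toL2 γ X (e m)))
    have hfun : (fun i => innerSL ℝ (toL2 γ X (e m))
        (inner ℝ (toL2 γ X (e i)) (toL2 γ X h) • toL2 γ X (e i))) =
        fun i => if i = m then inner ℝ (toL2 γ X (e m)) (toL2 γ X h) else 0 := funext fun i => by
      rw [innerSL_apply_apply, real_inner_smul_right, orthonormal_iff_ite.1 hon m i]
      by_cases him : i = m
      · subst him; simp
      · simp [him, Ne.symm him]
    rw [hfun] at h2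
    rw [hf, inner_sub_right, ← innerSL_apply_apply ℝ (toL2 γ X (e m)) y,
      h2.unique (hasSum_ite_eq m _), sub_self]
  have h0 : toL2 γ X (unhat γ X f) = 0 := by
    rw [F.toL2_eq_zero_iff (F.memField_unhat f)]
    refine he.complete _ (F.memField_unhat f) fun m => ?_
    have hm := F.memField_eigen he m 2
    rw [F.ip_eq_inner (F.memField_unhat f) hm, real_inner_comm,
      ← F.ip_eq_inner hm (F.memField_unhat f), F.inner_toL2_unhat hm, h1]
  have h3 : inner ℝ (toL2 γ X h) f = 0 := by
    rw [← F.inner_toL2_unhat hh, F.ip_eq_inner hh (F.memField_unhat f), h0, inner_zero_right]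
  have h4 : inner ℝ y f = 0 := by
    rw [real_inner_comm]
    have h2 := hy.mapL (innerSL ℝ f)
    have hfun : (fun i => innerSL ℝ f
        (inner ℝ (toL2 γ X (e i)) (toL2 γ X h) • toL2 γ X (e i))) = fun _ => 0 := funext fun i => by
      rw [innerSL_apply_apply, real_inner_smul_right, real_inner_comm (toL2 γ X (e i)) f, h1, mul_zero]
    rw [hfun] at h2
    exact h2.unique hasSum_zero
  have h5 : f = 0 := by
    rw [← inner_self_eq_zero (𝕜 := ℝ)]
    nth_rewrite 1 [hf]
    rw [inner_sub_left, h3, h4, sub_zero]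
  rwa [← sub_eq_zero.1 h5] at hy

/-- **Parseval's identity**. -/
lemma hasSum_ip {h k : TField M} (hh : MemField γ 2 h) (hk : MemField γ 2 k) :
    HasSum (fun m => ip γ h (e m) * ip γ k (e m)) (ip γ h k) := by
  have h1 := (F.hasSum_toL2 he hh).mapL (innerSL ℝ (toL2 γ X k))
  have hfun : (fun m => innerSL ℝ (toL2 γ X k) (ip γ h (e m) • toL2 γ X (e m))) =
      fun m => ip γ h (e m) * ip γ k (e m) := funext fun m => by
    rw [innerSL_apply_apply, real_inner_smul_right, F.ip_eq_inner hk (F.memField_eigen he m 2)]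
  rw [hfun, innerSL_apply_apply, real_inner_comm, ← F.ip_eq_inner hh hk] at h1
  exact h1

lemma tendsto_norm2_sub_sum {h : TField M} (hh : MemField γ 2 h) :
    Tendsto (fun N : ℕ => norm2 γ (h - ∑ m ∈ Finset.range N, ip γ h (e m) • e m)) atTop (𝓝 0) := by
  have hm : ∀ m, MemField γ 2 (ip γ h (e m) • e m) := fun m =>
    F.memField_smul _ (F.memField_eigen he m 2)
  have h1 : ∀ N, norm2 γ (h - ∑ m ∈ Finset.range N, ip γ h (e m) • e m) =
      ‖toL2 γ X h - ∑ m ∈ Finset.range N, ip γ h (e m) • toL2 γ X (e m)‖ := by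
    intro N
    have h2 := F.memField_sum (Finset.range N) fun m _ => hm m
    rw [F.norm2_eq_norm (F.memField_sub hh h2), F.toL2_sub hh h2, F.toL2_sum _ fun m _ => hm m]
    simp only [F.toL2_smul _ (F.memField_eigen he _ 2)]
  simp only [h1]
  have := ((F.hasSum_toL2 he hh).tendsto_sum_nat.const_sub (toL2 γ X h)).norm
  simpa using this

lemma ip_sum_eigen (S : Finset ℕ) (c : ℕ → ℝ) (m : ℕ) :
    ip γ (∑ i ∈ S, c i • e i) (e m) = if m ∈ S then c m else 0 := by
  have hm := fun i => F.memField_eigen he i 2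
  have hcm : ∀ i, MemField γ 2 (c i • e i) := fun i => F.memField_smul _ (hm i)
  rw [F.ip_eq_inner (F.memField_sum _ fun i _ => hcm i) (hm m), F.toL2_sum _ fun i _ => hcm i,
    sum_inner]
  simp only [F.toL2_smul _ (hm _), real_inner_smul_left]
  simp only [orthonormal_iff_ite.1 (F.orthonormal_toL2 he), mul_ite, mul_one, mul_zero,
    Finset.sum_ite_eq']

variable (hK : IsCovKernel γ K)

include hK

/-- Since `K` is self-adjoint, it multiplies the modes by the eigenvalues. -/
lemma ip_preimage {f h : TField M} (hh : MemField γ 2 h) (hf : IsPreimage γ K f h) (m : ℕ) :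
    ip γ h (e m) = lam m * ip γ f (e m) := by
  have := F.isFinite_vol
  have hm := F.memField_eigen he m 2
  have h1 : toL2 γ X h = intOp (volZ γ n) (F.kerZ hK) (toL2 γ X f) := by
    rw [← F.toL2_opT hK, ← sub_eq_zero, ← F.toL2_sub hh (F.memField_opT hK _),
      F.toL2_eq_zero_iff (F.memField_sub hh (F.memField_opT hK _))]
    filter_upwards [hf.2] with x hx
    refine ContinuousLinearMap.ext fun u => ContinuousLinearMap.ext fun v => ?_
    change h x u v - F.opT hK (toL2 γ X f) x u v = 0
    rw [← F.applyK_eq_opT hK hf.1, hx, sub_self]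
  have h2 := isSymmetric_intOp (μ := volZ γ n) (k := F.kerZ hK)
    (fun z w => hK.symm _ _ _ _ _ _) (toL2 γ X f) (toL2 γ X (e m))
  change inner ℝ (intOp (volZ γ n) (F.kerZ hK) (toL2 γ X f)) (toL2 γ X (e m)) =
    inner ℝ (toL2 γ X f) (intOp (volZ γ n) (F.kerZ hK) (toL2 γ X (e m))) at h2
  have h3 : intOp (volZ γ n) (F.kerZ hK) (toL2 γ X (e m)) = lam m • toL2 γ X (e m) := by
    rw [F.toL2_cont hm ⟨hat X (e m), continuous_of_slices (F.continuous_hat (he.cont m))⟩ rfl]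
    exact (F.mercerSystem hK he).intOp_eigen m
  rw [F.ip_eq_inner hh hm, h1, h2, h3, real_inner_smul_right, ← F.ip_eq_inner hf.1 hm]

/-- The inverse quadratic form, mode by mode. -/
theorem hasSum_invForm {f h : TField M} (hh : MemField γ 2 h) (hf : IsPreimage γ K f h) :
    HasSum (fun m => ip γ h (e m) ^ 2 / lam m) (invForm γ K h) := by
  have H : ∃ f, IsPreimage γ K f h := ⟨f, hf⟩
  rw [invForm, dif_pos H]
  have h1 := F.hasSum_ip he hh H.choose_spec.1
  convert h1 using 2 with m
  rw [pow_two, mul_div_assoc]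
  nth_rewrite 2 [F.ip_preimage he hK hh H.choose_spec m]
  rw [mul_div_cancel_left₀ _ (he.pos m).ne']

lemma isPreimage_sum (S : Finset ℕ) (c : ℕ → ℝ) :
    IsPreimage γ K (∑ m ∈ S, (c m / lam m) • e m) (∑ m ∈ S, c m • e m) := by
  have := F.isFinite_vol
  have hm := fun i => F.memField_eigen he i 2
  have hcm : ∀ i, MemField γ 2 ((c i / lam i) • e i) := fun i => F.memField_smul _ (hm i)
  refine ⟨F.memField_sum _ fun m _ => hcm m, .of_forall fun x u v => ?_⟩
  rw [F.applyK_eq_inner hK (F.memField_sum _ fun m _ => hcm m), F.toL2_sum _ fun m _ => hcm m,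
    inner_sum]
  have hs : (∑ m ∈ S, c m • e m) x u v = ∑ m ∈ S, c m * e m x u v := by
    simp only [Finset.sum_apply, Pi.smul_apply, sum_apply, smul_apply, smul_eq_mul]
  rw [hs]
  refine Finset.sum_congr rfl fun m _ => ?_
  rw [F.toL2_smul _ (hm m), real_inner_smul_right, ← F.applyK_eq_inner hK (hm m), he.eigen,
    div_mul_eq_mul_div, mul_left_comm, mul_div_cancel_left₀ _ (he.pos m).ne']

lemma exists_isPreimage_proj (S : Finset ℕ) (h : TField M) :
    ∃ f, IsPreimage γ K f (proj γ e S h) :=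
  ⟨_, F.isPreimage_sum he hK S fun m => ip γ h (e m)⟩

theorem invForm_proj (S : Finset ℕ) (h : TField M) :
    invForm γ K (proj γ e S h) = ∑ m ∈ S, ip γ h (e m) ^ 2 / lam m := by
  have hp : MemField γ 2 (proj γ e S h) :=
    F.memField_sum _ fun i _ => F.memField_smul _ (F.memField_eigen he i 2)
  obtain ⟨f, hf⟩ := F.exists_isPreimage_proj he hK S h
  have h1 := F.hasSum_invForm he hK hp hf
  have h2 : ∀ m, ip γ (proj γ e S h) (e m) = if m ∈ S then ip γ h (e m) else 0 :=
    F.ip_sum_eigen he S fun m => ip γ h (e m)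
  have h3 := hasSum_sum_of_ne_finset_zero (L := .unconditional ℕ) (f := fun m => ip γ (proj γ e S h) (e m) ^ 2 / lam m)
    (s := S) fun m hm => by simp [h2, hm]
  rw [h1.unique h3]
  exact Finset.sum_congr rfl fun m hm => by rw [h2, if_pos hm]

end TightFrame
end Expansion

/-! ### Gaussian subspaces of `L²` -/

section Gaussian

variable {Ω : Type*} [MeasurableSpace Ω] {P : Measure Ω} [IsProbabilityMeasure P]

/-- A limit in `L²` of Gaussian random variables is Gaussian: the characteristic functions converge
along a subsequence, and the mean and the variance are continuous in `L²`. -/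
lemma isClosed_setOf_hasGaussianLaw :
    IsClosed {f : Lp ℝ 2 P | HasGaussianLaw (f : Ω → ℝ) P} := by
  refine isClosed_of_closure_subset fun f hf => ?_
  obtain ⟨F, hF, hlim⟩ := mem_closure_iff_seq_limit.1 hf
  have hm : ∀ f : Lp ℝ 2 P, AEMeasurable f P := fun f => (Lp.aestronglyMeasurable f).aemeasurable
  obtain ⟨ns, hns, hae⟩ := (tendstoInMeasure_of_tendsto_Lp hlim).exists_seq_tendsto_ae
  have hlim' : Tendsto (fun i => F (ns i)) atTop (𝓝 f) := hlim.comp hns.tendsto_atTop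
  have hchar : ∀ (f : Lp ℝ 2 P) (t : ℝ), charFun (P.map f) t =
      ∫ ξ, Complex.exp (t * f ξ * Complex.I) ∂P := by
    intro f t
    rw [charFun_apply_real, integral_map (hm f) (by fun_prop)]
  have hmean : ∀ (f : Lp ℝ 2 P) (t : ℝ), P[fun ξ => inner ℝ t (f ξ)] =
      t * inner ℝ (indicatorConstLp 2 MeasurableSet.univ (measure_ne_top P univ) (1 : ℝ)) f := by
    intro f t
    rw [L2.inner_indicatorConstLp_one, Measure.restrict_univ, ← integral_const_mul t (f : Ω → ℝ)]
    exact integral_congr_ae (.of_forall fun ξ => mul_comm _ _)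
  have hvar : ∀ (f : Lp ℝ 2 P) (t : ℝ), Var[fun ξ => inner ℝ t (f ξ); P] =
      t ^ 2 * inner ℝ f f - (t * inner ℝ (indicatorConstLp 2 MeasurableSet.univ
        (measure_ne_top P univ) (1 : ℝ)) f) ^ 2 := by
    intro f t
    have h1 : MemLp (fun ξ => inner ℝ t (f ξ)) 2 P :=
      ((Lp.memLp f).const_mul t).ae_eq (.of_forall fun ξ => mul_comm _ _)
    rw [variance_eq_sub h1, hmean, L2.inner_def (𝕜 := ℝ) f f,
      ← integral_const_mul (t ^ 2) (fun ξ => inner ℝ (f ξ) (f ξ))]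
    congr 1
    refine integral_congr_ae (.of_forall fun ξ => ?_)
    change (f ξ * t) ^ 2 = t ^ 2 * (f ξ * f ξ)
    ring
  rw [mem_ofPred_eq, hasGaussianLaw_iff_charFun_map_eq (hm f)]
  intro t
  have hl : Tendsto (fun i => charFun (P.map (F (ns i))) t) atTop (𝓝 (charFun (P.map f) t)) := by
    simp only [hchar]
    refine tendsto_integral_of_dominated_convergence (fun _ => 1) (fun i => ?_)
      (integrable_const _) (fun i => .of_forall fun ξ => ?_) ?_
    · have := (hm (F (ns i))).aestronglyMeasurable
      exact (Complex.continuous_exp.comp_aestronglyMeasurable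
        ((Complex.continuous_ofReal.comp_aestronglyMeasurable this).const_mul (t : ℂ)
          |>.mul_const Complex.I))
    · rw [← Complex.ofReal_mul, Complex.norm_exp_ofReal_mul_I]
    · filter_upwards [hae] with ξ hξ
      have : Continuous fun x : ℝ => Complex.exp (t * x * Complex.I) := by fun_prop
      exact (this.tendsto _).comp hξ
  refine tendsto_nhds_unique hl ?_
  have hg : ∀ i, charFun (P.map (F (ns i))) t = _ := fun i => (hF (ns i)).charFun_map_eq t
  simp only [hg]
  simp only [hmean, hvar]
  have hc : Continuous fun f : Lp ℝ 2 P => Complex.exp (((t * inner ℝ (indicatorConstLp 2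
      MeasurableSet.univ (measure_ne_top P univ) (1 : ℝ)) f : ℝ) : ℂ) * Complex.I -
      ((t ^ 2 * inner ℝ f f - (t * inner ℝ (indicatorConstLp 2 MeasurableSet.univ
        (measure_ne_top P univ) (1 : ℝ)) f) ^ 2 : ℝ) : ℂ) / 2) := by fun_prop
  exact (hc.tendsto f).comp hlim'

variable {ι κ : Type*} {Y : ι → Ω → ℝ}

lemma _root_.ProbabilityTheory.IsGaussianProcess.memLp_two (hY : IsGaussianProcess Y P) (i : ι) :
    MemLp (Y i) 2 P :=
  (hY.hasGaussianLaw_eval i).memLp_two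

/-- The Gaussian Hilbert space generated by a Gaussian process: the closed linear span of its values
in `L²`. -/
noncomputable def gaussianSpace (hY : IsGaussianProcess Y P) : Submodule ℝ (Lp ℝ 2 P) :=
  (Submodule.span ℝ (range fun i => (hY.memLp_two i).toLp (Y i))).topologicalClosure

lemma hasGaussianLaw_of_mem (hY : IsGaussianProcess Y P) {f : Lp ℝ 2 P}
    (hf : f ∈ gaussianSpace hY) : HasGaussianLaw (f : Ω → ℝ) P := by
  refine closure_minimal ?_ isClosed_setOf_hasGaussianLaw hf
  intro f hf
  obtain ⟨c, rfl⟩ := Finsupp.mem_span_range_iff_exists_finsupp.1 hf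
  let L : (c.support → ℝ) →L[ℝ] ℝ := ∑ i : c.support, c i • ContinuousLinearMap.proj i
  refine ((hY.hasGaussianLaw c.support).map L).congr ?_
  have h1 : ∀ i ∈ c.support, ((c i • (hY.memLp_two i).toLp (Y i) : Lp ℝ 2 P) : Ω → ℝ) =ᵐ[P]
      fun ξ => c i * Y i ξ := by
    intro i _
    filter_upwards [Lp.coeFn_smul (c i) ((hY.memLp_two i).toLp (Y i)),
      (hY.memLp_two i).coeFn_toLp] with ξ h1 h2
    rw [h1, Pi.smul_apply, h2, smul_eq_mul]
  have h2 := (ae_ball_iff c.support.countable_toSet).2 h1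
  rw [Finsupp.sum]
  filter_upwards [h2, Lp.coeFn_finsetSum c.support
    (fun i => (c i • (hY.memLp_two i).toLp (Y i) : Lp ℝ 2 P))] with ξ h3 h4
  rw [h4, Finset.sum_apply]
  simp only [L, Function.comp_apply, sum_apply, smul_apply, ContinuousLinearMap.proj_apply,
    smul_eq_mul]
  rw [Finset.univ_eq_attach]
  refine (Finset.sum_attach c.support (fun i => c i * Y i ξ)).trans ?_
  exact (Finset.sum_congr rfl fun i hi => h3 i hi).symm

/-- Random variables in the Gaussian Hilbert space of a Gaussian process form a Gaussian process,
because their linear combinations stay in that space. -/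
lemma isGaussianProcess_of_mem (hY : IsGaussianProcess Y P) {X : κ → Ω → ℝ}
    (hX : ∀ j, MemLp (X j) 2 P) (hm : ∀ j, (hX j).toLp (X j) ∈ gaussianSpace hY) :
    IsGaussianProcess X P := by
  refine ⟨fun I => ⟨⟨fun L => ?_⟩⟩⟩
  have hXm : AEMeasurable (fun ξ => I.restrict (X · ξ)) P :=
    aemeasurable_pi_lambda _ fun j => (hX j).aestronglyMeasurable.aemeasurable
  have hg : HasGaussianLaw (fun ξ => L (I.restrict (X · ξ))) P := by
    classical
    have h1 : ∀ ξ, L (I.restrict (X · ξ)) = ∑ j : I, L (Pi.single j 1) * X j ξ := by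
      intro ξ
      have : I.restrict (X · ξ) = ∑ j : I, X j ξ • Pi.single j (1 : ℝ) := by
        ext k
        simp [Finset.sum_apply, Pi.single_apply]
      conv_lhs => rw [this]
      rw [map_sum]
      exact Finset.sum_congr rfl fun j _ => by rw [map_smul, smul_eq_mul, mul_comm]
    have h2 : (∑ j : I, L (Pi.single j 1) • (hX j).toLp (X j)) ∈ gaussianSpace hY :=
      Submodule.sum_mem _ fun j _ => Submodule.smul_mem _ _ (hm j)
    refine (hasGaussianLaw_of_mem hY h2).congr ?_
    have h3 : ∀ᵐ ξ ∂P, ∀ j : I, ((L (Pi.single j 1) • (hX j).toLp (X j) : Lp ℝ 2 P) : Ω → ℝ) ξ =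
        L (Pi.single j 1) * X j ξ := by
      refine ae_all_iff.2 fun j => ?_
      filter_upwards [Lp.coeFn_smul (L (Pi.single j 1)) ((hX j).toLp (X j)),
        (hX j).coeFn_toLp] with ξ h1 h2
      rw [h1, Pi.smul_apply, h2, smul_eq_mul]
    filter_upwards [h3, Lp.coeFn_finsetSum Finset.univ
      (fun j : I => (L (Pi.single j 1) • (hX j).toLp (X j) : Lp ℝ 2 P))] with ξ h4 h5
    rw [h1, h5, Finset.sum_apply]
    exact Finset.sum_congr rfl fun j _ => h4 j
  have := hg.map_eq_gaussianReal
  rw [AEMeasurable.map_map_of_aemeasurable (by fun_prop) hXm, integral_map hXm (by fun_prop),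
    variance_map (by fun_prop) hXm]
  exact this

end Gaussian

/-! ### Integrals of random fields -/

section RandomField

variable {Ω Z : Type*} [MeasurableSpace Ω] {P : Measure Ω} [IsProbabilityMeasure P]
  [MeasurableSpace Z] {μ : Measure Z} [IsFiniteMeasure μ]
  {Φ : Ω × Z → ℝ} {φ : Z → ℝ} {C : ℝ}

/-- Integrating a square integrable random field against a bounded function gives a square
integrable random variable. -/
lemma memLp_integral_field (hΦ : MemLp Φ 2 (P.prod μ)) (hφ : Measurable φ) (hC : ∀ z, |φ z| ≤ C) :
    MemLp (fun ξ => ∫ z, Φ (ξ, z) * φ z ∂μ) 2 P := by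
  have hφ2 : MemLp φ 2 μ := MemLp.of_bound hφ.aestronglyMeasurable C (.of_forall hC)
  have hm : AEStronglyMeasurable (fun p : Ω × Z => Φ p * φ p.2) (P.prod μ) :=
    hΦ.aestronglyMeasurable.mul (hφ.comp measurable_snd).aestronglyMeasurable
  have hb : AEStronglyMeasurable (fun ξ => ∫ z, Φ (ξ, z) * φ z ∂μ) P := hm.integral_prod_right'
  rw [memLp_two_iff_integrable_sq hb]
  have hsq := hΦ.integrable_sq
  have hi : Integrable (fun ξ => (∫ z, Φ (ξ, z) ^ 2 ∂μ) * ∫ z, φ z ^ 2 ∂μ) P :=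
    hsq.integral_prod_left.mul_const _
  refine hi.mono' (hb.pow 2) ?_
  filter_upwards [hsq.prod_right_ae, hΦ.aestronglyMeasurable.prodMk_left] with ξ h1 h2
  have h3 : MemLp (fun z => Φ (ξ, z)) 2 μ := (memLp_two_iff_integrable_sq h2).2 h1
  have h4 : ∫ z, Φ (ξ, z) * φ z ∂μ = inner ℝ (h3.toLp _) (hφ2.toLp _) := by
    rw [L2.inner_def]
    refine integral_congr_ae ?_
    filter_upwards [h3.coeFn_toLp, hφ2.coeFn_toLp] with z h5 h6
    rw [h5, h6]
    exact mul_comm _ _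
  have h5 : ∀ {f : Z → ℝ} (hf : MemLp f 2 μ), ‖hf.toLp f‖ ^ 2 = ∫ z, f z ^ 2 ∂μ := by
    intro f hf
    rw [← real_inner_self_eq_norm_sq, L2.inner_def]
    refine integral_congr_ae ?_
    filter_upwards [hf.coeFn_toLp] with z h6
    rw [h6]
    exact (pow_two _).symm
  rw [← h5 h3, ← h5 hφ2, h4, Real.norm_eq_abs, abs_of_nonneg (sq_nonneg _), ← mul_pow]
  exact sq_le_sq' (by linarith [neg_le_of_abs_le (abs_real_inner_le_norm (h3.toLp _) (hφ2.toLp _))])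
    (real_inner_le_norm _ _)

/-- Fubini's theorem for a random field tested against a function and a random variable. -/
lemma integral_mul_integral_field (hΦ : MemLp Φ 2 (P.prod μ)) (hφ : Measurable φ)
    (hC : ∀ z, |φ z| ≤ C) {ρ : Ω → ℝ} (hρ : MemLp ρ 2 P) :
    ∫ ξ, ρ ξ * ∫ z, Φ (ξ, z) * φ z ∂μ ∂P = ∫ z, φ z * ∫ ξ, ρ ξ * Φ (ξ, z) ∂P ∂μ := by
  have h1 : Integrable (fun p : Ω × Z => ρ p.1 * Φ p) (P.prod μ) :=
    (hρ.comp_fst μ).integrable_mul hΦ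
  have h2 : Integrable (fun p : Ω × Z => ρ p.1 * (Φ p * φ p.2)) (P.prod μ) := by
    refine (h1.bdd_mul (hφ.comp measurable_snd).aestronglyMeasurable
      (.of_forall fun p : Ω × Z => hC p.2)).congr (.of_forall fun p => ?_)
    simp only [Function.comp_apply]; ring
  simp only [← integral_const_mul]
  rw [integral_integral_swap h2]
  refine integral_congr_ae (.of_forall fun z => integral_congr_ae (.of_forall fun ξ => ?_))
  simp only; ring

/-- The integral of a field is in the closed linear span of the values of the field: by Fubini,
whatever is orthogonal to the values is orthogonal to the integral. This is how a pointwise Gaussian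
law passes to the modes. -/
lemma integral_field_mem {ι : Type*} {Y : ι → Ω → ℝ} (hY : IsGaussianProcess Y P) (i : Z → ι)
    (hi : ∀ z ξ, Y (i z) ξ = Φ (ξ, z)) (hΦ : MemLp Φ 2 (P.prod μ)) (hφ : Measurable φ)
    (hC : ∀ z, |φ z| ≤ C) :
    (memLp_integral_field hΦ hφ hC).toLp _ ∈ gaussianSpace hY := by
  set V := gaussianSpace hY with hV
  have : CompleteSpace V := (Submodule.isClosed_topologicalClosure _).completeSpace_coe
  rw [← Submodule.orthogonal_orthogonal V, Submodule.mem_orthogonal]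
  intro r hr
  have h0 : ∀ z, ∫ ξ, r ξ * Φ (ξ, z) ∂P = 0 := by
    intro z
    have h1 : (hY.memLp_two (i z)).toLp (Y (i z)) ∈ V :=
      Submodule.le_topologicalClosure _ (Submodule.subset_span ⟨i z, rfl⟩)
    have h2 := Submodule.inner_left_of_mem_orthogonal h1 hr
    rw [L2.inner_def] at h2
    rw [← h2]
    refine integral_congr_ae ?_
    filter_upwards [(hY.memLp_two (i z)).coeFn_toLp] with ξ h3
    rw [h3, hi]
    exact mul_comm _ _
  have h1 := integral_mul_integral_field hΦ hφ hC (Lp.memLp r)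
  simp only [h0, mul_zero, integral_zero] at h1
  rw [← h1, L2.inner_def]
  refine integral_congr_ae ?_
  filter_upwards [(memLp_integral_field hΦ hφ hC).coeFn_toLp] with ξ h3
  rw [h3]
  exact mul_comm _ _

end RandomField

/-! ### The Wiener process -/

section Wiener

variable {M : Type*} [TopologicalSpace M] [T2Space M] [CompactSpace M] [SecondCountableTopology M]
  [ChartedSpace E3 M] [IsManifold (𝓡 3) ∞ M] [MeasurableSpace M] [BorelSpace M]
variable {γ : TField M} {n : ℕ} {X : Fin n → (x : M) → Tan x}
variable {Ω : Type*} [MeasurableSpace Ω] {P : Measure Ω} [IsProbabilityMeasure P]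
  {K : TKernel M} {W : ℝ → Ω → TField M}

omit [T2Space M] [CompactSpace M] [SecondCountableTopology M] [IsManifold (𝓡 3) ∞ M]
  [MeasurableSpace M] [BorelSpace M] in
lemma tfield_sub_zero (h : TField M) : h - 0 = h := by
  funext x
  refine ContinuousLinearMap.ext fun u => ContinuousLinearMap.ext fun v => ?_
  exact sub_zero (h x u v)

/-- The components of the Wiener process in a frame. -/
noncomputable def wienerZ (X : Fin n → (x : M) → Tan x) (W : ℝ → Ω → TField M)
    (p : ℝ≥0 × (M × (Fin n × Fin n))) (ξ : Ω) : ℝ :=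
  hat X (W p.1 ξ) p.2

namespace TightFrame

variable (F : TightFrame γ X) (hK : IsCovKernel γ K) (hW : IsWiener P γ K W)

include hW

/-- The components are jointly Gaussian in time, point and frame indices: for finitely many of
them, the vector-valued process has independent Gaussian increments. -/
lemma isGaussianProcess_wienerZ : IsGaussianProcess (wienerZ X W) P := by
  classical
  refine ⟨fun I => ?_⟩
  let J := I.image Prod.snd
  let T := I.image Prod.fst
  let idx : M × (Fin n × Fin n) → Idx M := fun z => ⟨z.1, X z.2.1 z.1, X z.2.2 z.1⟩
  let f : (Idx M → ℝ) →+ (J → ℝ) :=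
    { toFun := fun a j => a (idx j.1)
      map_zero' := rfl
      map_add' := fun a b => rfl }
  have hf : Measurable f := measurable_pi_lambda _ fun j => measurable_pi_apply _
  have h0 : ∀ᵐ ξ ∂P, f (comp (W (⊥ : ℝ≥0) ξ)) = 0 := by
    filter_upwards [hW.zero] with ξ hξ
    funext j
    change W (((0 : ℝ≥0) : ℝ)) ξ _ _ _ = 0
    rw [NNReal.coe_zero, hξ]
    rfl
  have hG : IsGaussianProcess (fun (t : ℝ≥0) ξ => f (comp (W t ξ))) P := by
    refine HasIndepIncrements.isGaussianProcess (fun t => ?_) h0 (hW.indep.map' hf)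
    have h1 := ((hW.gaussian 0 t le_rfl t.2).comp_right idx).hasGaussianLaw J
    refine h1.congr ?_
    filter_upwards [hW.zero] with ξ hξ
    funext j
    change (W t ξ - W 0 ξ) _ _ _ = W t ξ _ _ _
    rw [hξ, tfield_sub_zero]
  let L : (T → (J → ℝ)) →L[ℝ] (I → ℝ) := ContinuousLinearMap.pi fun p : I =>
    (ContinuousLinearMap.proj (R := ℝ) (φ := fun _ : J => ℝ)
      ⟨p.1.2, Finset.mem_image_of_mem _ p.2⟩).comp
      (ContinuousLinearMap.proj (R := ℝ) (φ := fun _ : T => (J → ℝ))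
        ⟨p.1.1, Finset.mem_image_of_mem _ p.2⟩)
  exact (hG.hasGaussianLaw T).map L

lemma integral_wienerZ (p : ℝ≥0 × (M × (Fin n × Fin n))) : ∫ ξ, wienerZ X W p ξ ∂P = 0 := by
  rw [← hW.mean 0 p.1 le_rfl p.1.2 ⟨p.2.1, X p.2.2.1 p.2.1, X p.2.2.2 p.2.1⟩]
  refine integral_congr_ae ?_
  filter_upwards [hW.zero] with ξ hξ
  rw [hξ, tfield_sub_zero]
  rfl

include F hK in
/-- The covariance of the components is `min s t` times the kernel. -/
lemma integral_wienerZ_mul (s t : ℝ≥0) (z w : M × (Fin n × Fin n)) :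
    ∫ ξ, wienerZ X W (s, z) ξ * wienerZ X W (t, w) ξ ∂P = (min s t : ℝ≥0) * F.kerZ hK (z, w) := by
  wlog hst : s ≤ t generalizing s t z w
  · have := this t s w z (le_of_not_ge hst)
    rw [min_comm, show F.kerZ hK (z, w) = F.kerZ hK (w, z) from hK.symm _ _ _ _ _ _, ← this]
    exact integral_congr_ae (.of_forall fun ξ => mul_comm _ _)
  have hG : IsGaussianProcess (wienerZ X W) P := isGaussianProcess_wienerZ hW
  let iz : Idx M := ⟨z.1, X z.2.1 z.1, X z.2.2 z.1⟩
  let iw : Idx M := ⟨w.1, X w.2.1 w.1, X w.2.2 w.1⟩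
  have h0 : ∀ᵐ ξ ∂P, comp (W ((0 : ℝ≥0) : ℝ) ξ) = 0 := by
    filter_upwards [hW.zero] with ξ hξ
    rw [NNReal.coe_zero, hξ]
    rfl
  have hind := hW.indep.indepFun_eval_sub zero_le hst h0
  have hind2 : IndepFun (wienerZ X W (s, z)) (wienerZ X W (t, w) - wienerZ X W (s, w)) P :=
    hind.comp (φ := fun a : Idx M → ℝ => a iz) (ψ := fun a : Idx M → ℝ => a iw)
      (measurable_pi_apply _) (measurable_pi_apply _)
  have hm := fun p => hG.memLp_two p
  have h1 : ∫ ξ, wienerZ X W (s, z) ξ * (wienerZ X W (t, w) - wienerZ X W (s, w)) ξ ∂P = 0 := by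
    rw [hind2.integral_fun_mul_eq_mul_integral (hm _).aestronglyMeasurable
      ((hm _).sub (hm _)).aestronglyMeasurable, integral_wienerZ hW, zero_mul]
  have h2 : ∫ ξ, wienerZ X W (s, z) ξ * wienerZ X W (s, w) ξ ∂P = s * F.kerZ hK (z, w) := by
    have := hW.cov 0 s le_rfl s.2 iz iw
    rw [sub_zero] at this
    refine Eq.trans (integral_congr_ae ?_) this
    filter_upwards [hW.zero] with ξ hξ
    rw [hξ, tfield_sub_zero]
    rfl
  have h3 := integral_sub ((hm (s, z)).integrable_mul (hm (t, w)))
    ((hm (s, z)).integrable_mul (hm (s, w)))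
  simp only [Pi.mul_apply] at h3
  rw [min_eq_left hst, ← h2, ← sub_eq_zero, ← h3, ← h1]
  exact integral_congr_ae (.of_forall fun ξ => by simp only [Pi.sub_apply]; ring)

include F in
lemma measurable_wienerZ (t : ℝ≥0) :
    Measurable fun p : Ω × (M × (Fin n × Fin n)) => wienerZ X W (t, p.2) p.1 := by
  have h1 : Measurable fun p : (Ω × M) × (Fin n × Fin n) => wienerZ X W (t, (p.1.2, p.2)) p.1.1 :=
    measurable_from_prod_countable_left fun q => hW.meas t t.2 _ _ (F.cont q.1) (F.cont q.2)
  exact h1.comp (MeasurableEquiv.prodAssoc.symm.measurable)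

include F hK in
/-- The Wiener process is square integrable over the product of the probability space and the
manifold, as the diagonal of the kernel is bounded. -/
lemma memLp_wienerZ [IsFiniteMeasure (vol γ)] (t : ℝ≥0) :
    MemLp (fun p : Ω × (M × (Fin n × Fin n)) => wienerZ X W (t, p.2) p.1) 2
      (P.prod (volZ γ n)) := by
  have hm := F.measurable_wienerZ hW t
  have hG : IsGaussianProcess (wienerZ X W) P := isGaussianProcess_wienerZ hW
  rw [memLp_two_iff_integrable_sq hm.aestronglyMeasurable,
    integrable_prod_iff' (hm.pow_const 2).aestronglyMeasurable]
  refine ⟨.of_forall fun z => (hG.memLp_two (t, z)).integrable_sq, ?_⟩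
  have h1 : ∀ z, ∫ ξ, ‖wienerZ X W (t, z) ξ ^ 2‖ ∂P = t * F.kerZ hK (z, z) := by
    intro z
    have := F.integral_wienerZ_mul hK hW t t z z
    rw [min_self] at this
    rw [← this]
    refine integral_congr_ae (.of_forall fun ξ => ?_)
    simp only [Real.norm_eq_abs, pow_two, abs_mul_self]
  simp only [h1]
  exact Continuous.integrable_of_hasCompactSupport (by fun_prop)
    (HasCompactSupport.of_compactSpace _)

variable {lam : ℕ → ℝ} {e : ℕ → TField M} (he : IsEigensystem γ K lam e)

include F he

omit hW [IsProbabilityMeasure P] [SecondCountableTopology M] in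
lemma exists_bound_hat (m : ℕ) : ∃ C, ∀ z, |hat X (e m) z| ≤ C := by
  have h : ∃ C, ∀ z ∈ (univ : Set (M × (Fin n × Fin n))), ‖hat X (e m) z‖ ≤ C :=
    isCompact_univ.exists_bound_of_continuousOn
      (continuous_prod_of_discrete_right.2 (F.continuous_hat (he.cont m))).continuousOn
  obtain ⟨C, hC⟩ := h
  exact ⟨C, fun z => hC z (mem_univ z)⟩

omit hW [IsProbabilityMeasure P] in
lemma measurable_hat_eigen (m : ℕ) : Measurable (hat X (e m)) :=
  measurable_of_slices fun q => (F.continuous_hat (he.cont m) q).measurable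

lemma ip_wiener_ae [IsFiniteMeasure (vol γ)] (m : ℕ) (t : ℝ≥0) :
    (fun ξ => ∫ z, wienerZ X W (t, z) ξ * hat X (e m) z ∂(volZ γ n)) =ᵐ[P]
      fun ξ => ip γ (W t ξ) (e m) := by
  filter_upwards [hW.mem] with ξ hξ
  exact (F.ip_eq_integral (hξ t t.2) (F.memField_eigen he m 2)).symm

include hK

lemma memLp_ip_wiener [IsFiniteMeasure (vol γ)] (m : ℕ) (t : ℝ≥0) :
    MemLp (fun ξ => ip γ (W t ξ) (e m)) 2 P := by
  obtain ⟨C, hC⟩ := F.exists_bound_hat he m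
  exact (memLp_integral_field (F.memLp_wienerZ hK hW t) (F.measurable_hat_eigen he m) hC).ae_eq
    (F.ip_wiener_ae hW he m t)

/-- The modes of the Wiener process lie in its Gaussian Hilbert space. -/
lemma ip_wiener_mem [IsFiniteMeasure (vol γ)] (m : ℕ) (t : ℝ≥0) :
    (F.memLp_ip_wiener hK hW he m t).toLp _ ∈
      gaussianSpace (isGaussianProcess_wienerZ (X := X) hW) := by
  obtain ⟨C, hC⟩ := F.exists_bound_hat he m
  have h := integral_field_mem (isGaussianProcess_wienerZ (X := X) hW) (fun z => (t, z))
    (fun z ξ => rfl) (F.memLp_wienerZ hK hW t) (F.measurable_hat_eigen he m) hC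
  convert h using 1
  exact MemLp.toLp_congr _ _ (F.ip_wiener_ae hW he m t).symm

lemma integral_mul_ip_wiener [IsFiniteMeasure (vol γ)] (m : ℕ) (t : ℝ≥0) {ρ : Ω → ℝ}
    (hρ : MemLp ρ 2 P) : ∫ ξ, ρ ξ * ip γ (W t ξ) (e m) ∂P =
      ∫ z, hat X (e m) z * ∫ ξ, ρ ξ * wienerZ X W (t, z) ξ ∂P ∂(volZ γ n) := by
  obtain ⟨C, hC⟩ := F.exists_bound_hat he m
  rw [← integral_mul_integral_field (F.memLp_wienerZ hK hW t) (F.measurable_hat_eigen he m) hC hρ]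
  refine integral_congr_ae ?_
  filter_upwards [F.ip_wiener_ae hW he m t] with ξ hξ
  rw [← hξ]

lemma integral_ip_wiener [IsFiniteMeasure (vol γ)] (m : ℕ) (t : ℝ≥0) :
    ∫ ξ, ip γ (W t ξ) (e m) ∂P = 0 := by
  have h := F.integral_mul_ip_wiener hK hW he m t (memLp_const (1 : ℝ))
  simpa only [one_mul, integral_wienerZ hW, mul_zero, integral_zero] using h

/-- The covariance of the Wiener process with its modes. -/
lemma integral_wienerZ_mul_ip [IsFiniteMeasure (vol γ)] (m : ℕ) (s t : ℝ≥0)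
    (z : M × (Fin n × Fin n)) : ∫ ξ, wienerZ X W (s, z) ξ * ip γ (W t ξ) (e m) ∂P =
      (min s t : ℝ≥0) * (lam m * hat X (e m) z) := by
  rw [F.integral_mul_ip_wiener hK hW he m t ((isGaussianProcess_wienerZ hW).memLp_two _)]
  simp only [F.integral_wienerZ_mul hK hW]
  have := (F.mercerSystem hK he).eigen m z
  simp only [ContinuousMap.coe_mk] at this
  rw [← this, ← integral_const_mul]
  exact integral_congr_ae (.of_forall fun w => by simp only; ring)

/-- The modes of the Wiener process are uncorrelated, with variances `lam i` per unit time. -/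
lemma integral_ip_mul_ip [IsFiniteMeasure (vol γ)] (i j : ℕ) (s t : ℝ≥0) :
    ∫ ξ, ip γ (W s ξ) (e i) * ip γ (W t ξ) (e j) ∂P =
      if i = j then (min s t : ℝ≥0) * lam i else 0 := by
  rw [F.integral_mul_ip_wiener hK hW he j t (F.memLp_ip_wiener hK hW he i s)]
  have h1 : ∀ z, ∫ ξ, ip γ (W s ξ) (e i) * wienerZ X W (t, z) ξ ∂P =
      (min s t : ℝ≥0) * (lam i * hat X (e i) z) := by
    intro z
    rw [min_comm, ← F.integral_wienerZ_mul_ip hK hW he i t s z]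
    exact integral_congr_ae (.of_forall fun w => mul_comm _ _)
  simp only [h1]
  have h2 := F.ip_eq_integral (F.memField_eigen he i 2) (F.memField_eigen he j 2)
  rw [he.orthonormal] at h2
  have h3 : ∫ z, hat X (e j) z * ((min s t : ℝ≥0) * (lam i * hat X (e i) z)) ∂(volZ γ n) =
      ((min s t : ℝ≥0) * lam i) * ∫ z, hat X (e i) z * hat X (e j) z ∂(volZ γ n) := by
    rw [← integral_const_mul]
    exact integral_congr_ae (.of_forall fun w => by simp only; ring)
  rw [h3, ← h2]
  split_ifs <;> simp

end TightFrame
end Wiener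

/-! ### The Karhunen–Loève expansion -/

section KarhunenLoeve

variable {M : Type*} [TopologicalSpace M] [T2Space M] [CompactSpace M] [SecondCountableTopology M]
  [ChartedSpace E3 M] [IsManifold (𝓡 3) ∞ M] [MeasurableSpace M] [BorelSpace M]
variable {γ : TField M} {n : ℕ} {X : Fin n → (x : M) → Tan x}
variable {Ω : Type*} [MeasurableSpace Ω] {P : Measure Ω} [IsProbabilityMeasure P]
  {K : TKernel M} {W : ℝ → Ω → TField M} {lam : ℕ → ℝ} {e : ℕ → TField M}

namespace TightFrame

variable (F : TightFrame γ X) (hK : IsCovKernel γ K) (hW : IsWiener P γ K W)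
  (he : IsEigensystem γ K lam e)

include F in
lemma abs_ip_le {h k : TField M} (hh : MemField γ 2 h) (hk : MemField γ 2 k) :
    |ip γ h k| ≤ norm2 γ h * norm2 γ k := by
  rw [F.ip_eq_inner hh hk, F.norm2_eq_norm hh, F.norm2_eq_norm hk]
  exact abs_real_inner_le_norm _ _

include F in
lemma ip_sub_left {h h' k : TField M} (hh : MemField γ 2 h) (hh' : MemField γ 2 h')
    (hk : MemField γ 2 k) : ip γ (h - h') k = ip γ h k - ip γ h' k := by
  rw [F.ip_eq_inner (F.memField_sub hh hh') hk, F.ip_eq_inner hh hk, F.ip_eq_inner hh' hk,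
    F.toL2_sub hh hh', inner_sub_left]

include F he in
lemma norm2_eigen (m : ℕ) : norm2 γ (e m) = 1 := by
  rw [norm2, he.orthonormal, if_pos rfl, Real.sqrt_one]

include F he in
omit [SecondCountableTopology M] in
lemma sqrt_lam_mul_mode (m : ℕ) (τ : ℝ) (ξ : Ω) :
    √(lam m) * mode γ lam e W m τ ξ = ip γ (W τ ξ) (e m) := by
  rw [mode, mul_div_cancel₀]
  exact (Real.sqrt_pos.2 (he.pos m)).ne'

include F hW he in
lemma continuous_ip_wiener (m : ℕ) :
    ∀ᵐ ξ ∂P, ContinuousOn (fun τ => ip γ (W τ ξ) (e m)) (Ici 0) := by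
  filter_upwards [hW.mem, hW.cont] with ξ h1 h2 τ hτ
  have hm := F.memField_eigen he m 2
  rw [ContinuousWithinAt, tendsto_iff_dist_tendsto_zero]
  refine squeeze_zero' (.of_forall fun _ => dist_nonneg) ?_ (h2 τ hτ)
  filter_upwards [self_mem_nhdsWithin] with σ hσ
  rw [Real.dist_eq, ← F.ip_sub_left (h1 σ hσ) (h1 τ hτ) hm]
  refine (F.abs_ip_le (F.memField_sub (h1 σ hσ) (h1 τ hτ)) hm).trans ?_
  rw [F.norm2_eigen he, mul_one]

variable [IsFiniteMeasure (vol γ)]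

include F hK hW he

lemma memLp_mode (m : ℕ) (t : ℝ≥0) : MemLp (mode γ lam e W m t) 2 P := by
  have h := (F.memLp_ip_wiener hK hW he m t).const_mul ((√(lam m))⁻¹)
  refine h.ae_eq (.of_forall fun ξ => ?_)
  simp only [mode, div_eq_inv_mul]

/-- The normalised modes of the Wiener process are jointly Gaussian. -/
lemma isGaussianProcess_mode :
    IsGaussianProcess (fun (p : (_ : ℕ) × ℝ≥0) ξ => mode γ lam e W p.1 p.2 ξ) P := by
  refine isGaussianProcess_of_mem (isGaussianProcess_wienerZ (X := X) hW)
    (fun p => F.memLp_mode hK hW he p.1 p.2) fun p => ?_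
  have h := Submodule.smul_mem _ ((√(lam p.1))⁻¹) (F.ip_wiener_mem hK hW he p.1 p.2)
  rw [← MemLp.toLp_const_smul] at h
  convert h using 1
  refine MemLp.toLp_congr _ _ (.of_forall fun ξ => ?_)
  simp only [mode, div_eq_inv_mul, Pi.smul_apply, smul_eq_mul]

lemma integral_mode (m : ℕ) (t : ℝ≥0) : ∫ ξ, mode γ lam e W m t ξ ∂P = 0 := by
  simp only [mode]
  rw [integral_div, F.integral_ip_wiener hK hW he, zero_div]

lemma covariance_mode (i j : ℕ) (s t : ℝ≥0) :
    cov[mode γ lam e W i s, mode γ lam e W j t; P] = if i = j then ((min s t : ℝ≥0) : ℝ) else 0 := by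
  rw [covariance_eq_sub (F.memLp_mode hK hW he i s) (F.memLp_mode hK hW he j t),
    F.integral_mode hK hW he, zero_mul, sub_zero]
  have h1 : ∀ ξ, (mode γ lam e W i s * mode γ lam e W j t) ξ =
      ip γ (W s ξ) (e i) * ip γ (W t ξ) (e j) / (√(lam i) * √(lam j)) := fun ξ => by
    simp only [Pi.mul_apply, mode]
    rw [div_mul_div_comm]
  simp only [h1]
  rw [integral_div, F.integral_ip_mul_ip hK hW he]
  split_ifs with hij
  · subst hij
    rw [Real.mul_self_sqrt (he.pos i).le, mul_div_cancel_right₀ _ (he.pos i).ne']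
  · exact zero_div _

lemma isBrownianReal_mode (m : ℕ) :
    IsBrownianReal (fun (τ : ℝ≥0) ξ => mode γ lam e W m τ ξ) P where
  toIsPreBrownianReal := by
    refine IsGaussianProcess.isPreBrownianReal_of_covariance
      ((F.isGaussianProcess_mode hK hW he).comp_right fun t : ℝ≥0 => ⟨m, t⟩)
      (fun t => F.integral_mode hK hW he m t) fun s t hst => ?_
    have := F.covariance_mode hK hW he m m s t
    rw [if_pos rfl, min_eq_left hst] at this
    exact this
  cont := by
    filter_upwards [F.continuous_ip_wiener hW he m] with ξ h
    have h1 : Continuous fun τ : ℝ≥0 => ip γ (W τ ξ) (e m) :=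
      h.comp_continuous NNReal.continuous_coe fun τ => τ.2
    exact h1.div_const _

/-- The mean square error of the truncated expansion: the error is orthogonal to the modes that have
been subtracted, so its variance is the remainder of the Mercer series on the diagonal. -/
lemma integral_sq_sub_sum (t : ℝ≥0) (z : M × (Fin n × Fin n)) (N : ℕ) :
    Integrable (fun ξ => (wienerZ X W (t, z) ξ -
      ∑ m ∈ Finset.range N, ip γ (W t ξ) (e m) * hat X (e m) z) ^ 2) P ∧
    ∫ ξ, (wienerZ X W (t, z) ξ -
      ∑ m ∈ Finset.range N, ip γ (W t ξ) (e m) * hat X (e m) z) ^ 2 ∂P =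
      t * (F.kerZ hK (z, z) -
        ∑ m ∈ Finset.range N, lam m * (hat X (e m) z * hat X (e m) z)) := by
  set w := wienerZ X W (t, z) with hw
  set a : ℕ → Ω → ℝ := fun m ξ => ip γ (W t ξ) (e m) with ha
  have hwL : MemLp w 2 P := (isGaussianProcess_wienerZ hW).memLp_two _
  have haL : ∀ m, MemLp (a m) 2 P := fun m => F.memLp_ip_wiener hK hW he m t
  set ρ : Ω → ℝ := fun ξ => w ξ - ∑ m ∈ Finset.range N, a m ξ * hat X (e m) z with hρ
  have hsL : MemLp (fun ξ => ∑ m ∈ Finset.range N, a m ξ * hat X (e m) z) 2 P :=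
    memLp_finsetSum _ fun m _ => (haL m).mul_const _
  have hρL : MemLp ρ 2 P := hwL.sub hsL
  have hexp : ∀ f : Ω → ℝ, MemLp f 2 P → ∫ ξ, f ξ * ρ ξ ∂P =
      ∫ ξ, f ξ * w ξ ∂P - ∑ m ∈ Finset.range N, (∫ ξ, f ξ * a m ξ ∂P) * hat X (e m) z := by
    intro f hf
    simp only [hρ, mul_sub, Finset.mul_sum, ← mul_assoc]
    have hi : ∀ m, Integrable (fun ξ => f ξ * a m ξ * hat X (e m) z) P := fun m =>
      (hf.integrable_mul (haL m)).mul_const _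
    have hiw : Integrable (fun ξ => f ξ * w ξ) P := hf.integrable_mul hwL
    rw [integral_sub hiw (integrable_finsetSum _ fun m _ => hi m),
      integral_finsetSum _ fun m _ => hi m]
    simp only [integral_mul_const]
  have h0 : ∀ m, m ∈ Finset.range N → ∫ ξ, a m ξ * ρ ξ ∂P = 0 := by
    intro m hm
    rw [hexp _ (haL m)]
    have h1 : ∫ ξ, a m ξ * w ξ ∂P = t * (lam m * hat X (e m) z) := by
      have := F.integral_wienerZ_mul_ip hK hW he m t t z
      rw [min_self] at this
      rw [← this]
      exact integral_congr_ae (.of_forall fun ξ => mul_comm _ _)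
    rw [h1]
    simp only [ha, F.integral_ip_mul_ip hK hW he, min_self, ite_mul, zero_mul]
    rw [Finset.sum_ite_eq, if_pos hm]
    ring
  refine ⟨hρL.integrable_sq, ?_⟩
  have h1 : ∫ ξ, ρ ξ ^ 2 ∂P = ∫ ξ, ρ ξ * ρ ξ ∂P := by simp only [pow_two]
  have h2 : ∀ m ∈ Finset.range N, (∫ ξ, ρ ξ * a m ξ ∂P) * hat X (e m) z = 0 := by
    intro m hm
    rw [integral_congr_ae (.of_forall fun ξ => mul_comm (ρ ξ) (a m ξ)), h0 m hm, zero_mul]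
  change ∫ ξ, ρ ξ ^ 2 ∂P = _
  rw [h1, hexp _ hρL, Finset.sum_eq_zero h2, sub_zero,
    integral_congr_ae (.of_forall fun ξ => mul_comm (ρ ξ) (w ξ)), hexp _ hwL]
  have h3 := F.integral_wienerZ_mul hK hW t t z z
  have h4 := fun m => F.integral_wienerZ_mul_ip hK hW he m t t z
  simp only [min_self] at h3 h4
  simp only [ha, hw, h3, h4, mul_sub, Finset.mul_sum]
  congr 1
  exact Finset.sum_congr rfl fun m _ => by ring

/-- The expansion converges in mean square, uniformly on the manifold. The tolerance
`ε / (k * t + 1)` in Mercer's theorem accounts for the `k` components in the frame and for the factor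
`t` in the variance. -/
lemma meanSquare_expansion (t : ℝ≥0) {ε : ℝ} (hε : 0 < ε) : ∃ N₀ : ℕ, ∀ N ≥ N₀, ∀ x (u v : Tan x),
    ∫⁻ ξ, ENNReal.ofReal ((W t ξ x u v - ∑ m ∈ Finset.range N,
      ip γ (W t ξ) (e m) * e m x u v) ^ 2) ∂P ≤
      ENNReal.ofReal (ε * vlen γ x u ^ 2 * vlen γ x v ^ 2) := by
  have := F.isOpenPos_vol
  set k : ℝ := ((Fintype.card (Fin n × Fin n) : ℕ) : ℝ) with hk
  have ht : (0 : ℝ) ≤ t := t.2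
  obtain ⟨N₀, hN₀⟩ := (F.mercerSystem hK he).uniform_expansion
    (ε := ε / (k * t + 1)) (by positivity)
  refine ⟨N₀, fun N hN x u v => ?_⟩
  set c : Fin n × Fin n → ℝ := fun p => γ x u (X p.1 x) * γ x v (X p.2 x) with hc
  set ρ : Fin n × Fin n → Ω → ℝ := fun p ξ => wienerZ X W (t, (x, p)) ξ -
      ∑ m ∈ Finset.range N, ip γ (W t ξ) (e m) * hat X (e m) (x, p) with hρ
  have hρi := fun p => (F.integral_sq_sub_sum hK hW he t (x, p) N).1
  have hρe := fun p => (F.integral_sq_sub_sum hK hW he t (x, p) N).2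
  have hsq : ∀ w : Tan x, vlen γ x w ^ 2 = ∑ a, γ x w (X a x) ^ 2 := by
    intro w
    rw [vlen, Real.sq_sqrt, ← F.tight x w w]
    · simp only [pow_two]
    · rw [← F.tight x w w]
      exact Finset.sum_nonneg fun a _ => mul_self_nonneg _
  have hc2 : ∑ p, c p ^ 2 = vlen γ x u ^ 2 * vlen γ x v ^ 2 := by
    rw [hsq, hsq, Finset.sum_mul_sum, Fintype.sum_prod_type]
    simp only [hc, mul_pow]
  have hR : ∀ ξ, W t ξ x u v - ∑ m ∈ Finset.range N, ip γ (W t ξ) (e m) * e m x u v =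
      ∑ p, c p * ρ p ξ := by
    intro ξ
    simp only [hρ, mul_sub, Finset.sum_sub_distrib, Finset.mul_sum]
    congr 1
    · rw [F.bilin_eq (W t ξ) x u v, Fintype.sum_prod_type]
      rfl
    · rw [Finset.sum_comm]
      refine Finset.sum_congr rfl fun m _ => ?_
      rw [F.bilin_eq (e m) x u v, Fintype.sum_prod_type, Finset.mul_sum]
      refine Finset.sum_congr rfl fun a _ => ?_
      rw [Finset.mul_sum]
      exact Finset.sum_congr rfl fun b _ => by ring
  have hint : Integrable (fun ξ => (∑ p, c p ^ 2) * ∑ p, ρ p ξ ^ 2) P :=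
    (integrable_finsetSum _ fun p _ => hρi p).const_mul _
  calc _ ≤ ∫⁻ ξ, ENNReal.ofReal ((∑ p, c p ^ 2) * ∑ p, ρ p ξ ^ 2) ∂P := by
        refine lintegral_mono fun ξ => ENNReal.ofReal_le_ofReal ?_
        rw [hR]
        exact Finset.sum_mul_sq_le_sq_mul_sq _ _ _
    _ = ENNReal.ofReal ((∑ p, c p ^ 2) * ∑ p, ∫ ξ, ρ p ξ ^ 2 ∂P) := by
        rw [← ofReal_integral_eq_lintegral_ofReal hint (.of_forall fun ξ => mul_nonneg
          (Finset.sum_nonneg fun p _ => sq_nonneg _) (Finset.sum_nonneg fun p _ => sq_nonneg _)),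
          integral_const_mul, integral_finsetSum _ fun p _ => hρi p]
    _ ≤ _ := by
        refine ENNReal.ofReal_le_ofReal ?_
        have h1 : ∑ p, ∫ ξ, ρ p ξ ^ 2 ∂P ≤ ε := by
          calc _ ≤ ∑ _p : Fin n × Fin n, t * (ε / (k * t + 1)) := by
                refine Finset.sum_le_sum fun p _ => ?_
                rw [hρe]
                exact mul_le_mul_of_nonneg_left ((le_abs_self _).trans (hN₀ N hN (x, p) (x, p))) ht
            _ = ε * ((k * t) / (k * t + 1)) := by
                rw [Finset.sum_const, Finset.card_univ, nsmul_eq_mul, ← hk]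
                ring
            _ ≤ ε * 1 := by
                refine mul_le_mul_of_nonneg_left ?_ hε.le
                rw [div_le_one (by positivity)]
                linarith
            _ = ε := mul_one ε
        rw [hc2, mul_assoc ε, mul_comm ε]
        exact mul_le_mul_of_nonneg_left h1 (by positivity)

/-- **Karhunen–Loève expansion** of the Wiener process. Its modes are jointly Gaussian and
uncorrelated, hence independent. -/
theorem karhunenLoeve : KarhunenLoeve P γ lam e W where
  brownian m := F.isBrownianReal_mode hK hW he m
  indep := by
    refine IsGaussianProcess.iIndepFun_of_covariance_eq_zero (T := ℕ) (S := fun _ => ℝ≥0)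
      (X := fun m (t : ℝ≥0) => mode γ lam e W m t) (F.isGaussianProcess_mode hK hW he)
      (fun m t => (F.memLp_mode hK hW he m t).aestronglyMeasurable.aemeasurable) ?_
    intro i j hij s t
    rw [F.covariance_mode hK hW he, if_neg hij]
  meanSquare τ hτ ε hε := by
    obtain ⟨N₀, hN₀⟩ := F.meanSquare_expansion hK hW he ⟨τ, hτ⟩ hε
    refine ⟨N₀, fun N hN x u v => ?_⟩
    simp only [F.sqrt_lam_mul_mode he]
    exact hN₀ N hN x u v
  almostSure := by
    filter_upwards [hW.mem] with ξ h τ hτ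
    simp only [F.sqrt_lam_mul_mode he]
    exact F.tendsto_norm2_sub_sum he (h τ hτ)

end TightFrame
end KarhunenLoeve

/-! ### Limits in probability over partitions -/

section MeshLimit

variable {Ω : Type*} [MeasurableSpace Ω] {P : Measure Ω} {f f' : ℝ → ℝ → Ω → ℝ} {a b : ℝ}
  {X X' : Ω → ℝ}

lemma partition_mem {m : ℕ} {π : ℕ → ℝ} (hm : Monotone π) (h0 : π 0 = a) (h1 : π m = b) {k : ℕ}
    (hk : k ≤ m) : π k ∈ Icc a b :=
  ⟨h0 ▸ hm (Nat.zero_le k), h1 ▸ hm hk⟩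

lemma exists_partition (hab : a ≤ b) {δ : ℝ} (hδ : 0 < δ) : ∃ (m : ℕ) (π : ℕ → ℝ), Monotone π ∧
    π 0 = a ∧ π m = b ∧ ∀ k < m, π (k + 1) - π k < δ := by
  obtain ⟨m, hm⟩ := exists_nat_ge ((b - a) / (δ / 2))
  refine ⟨m, fun k => min (a + k * (δ / 2)) b, ?_, ?_, ?_, fun k _ => ?_⟩
  · intro i j hij
    have : (i : ℝ) ≤ j := by exact_mod_cast hij
    exact min_le_min_right _ (by nlinarith)
  · simp [hab]
  · rw [div_le_iff₀ (by positivity)] at hm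
    exact min_eq_right (by linarith)
  · have h1 : min (a + ((k + 1 : ℕ) : ℝ) * (δ / 2)) b ≤ min (a + k * (δ / 2)) b + δ / 2 := by
      rw [← min_add_add_right]
      refine min_le_min ?_ (by linarith)
      push_cast
      linarith
    linarith

namespace MeshLimit

lemma congr (h : MeshLimit P f a b X) (hf : ∀ s t, a ≤ s → s ≤ t → t ≤ b → f s t =ᵐ[P] f' s t)
    (hX : X =ᵐ[P] X') : MeshLimit P f' a b X' := by
  intro ε hε
  obtain ⟨δ, hδ, H⟩ := h ε hε
  refine ⟨δ, hδ, fun m π hm h0 h1 hk => (measure_mono_ae ?_).trans (H m π hm h0 h1 hk)⟩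
  have h2 : ∀ᵐ ξ ∂P, ∀ k ∈ Finset.range m, f (π k) (π (k + 1)) ξ = f' (π k) (π (k + 1)) ξ := by
    refine (ae_ball_iff (Finset.range m).countable_toSet).2 fun k hk => ?_
    have hk' := Finset.mem_range.1 hk
    exact hf _ _ (partition_mem hm h0 h1 hk'.le).1 (hm k.le_succ) (partition_mem hm h0 h1 hk').2
  filter_upwards [h2, hX] with ξ h3 h4 h5
  change ε ≤ _
  rw [Finset.sum_congr rfl h3, h4]
  exact h5

lemma add (h : MeshLimit P f a b X) (h' : MeshLimit P f' a b X') :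
    MeshLimit P (fun s t ξ => f s t ξ + f' s t ξ) a b fun ξ => X ξ + X' ξ := by
  intro ε hε
  obtain ⟨δ, hδ, H⟩ := h (ε / 2) (by positivity)
  obtain ⟨δ', hδ', H'⟩ := h' (ε / 2) (by positivity)
  refine ⟨min δ δ', lt_min hδ hδ', fun m π hm h0 h1 hk => ?_⟩
  have h2 := H m π hm h0 h1 fun k hkm => (hk k hkm).trans_le (min_le_left _ _)
  have h3 := H' m π hm h0 h1 fun k hkm => (hk k hkm).trans_le (min_le_right _ _)
  calc _ ≤ P ({ξ | ε / 2 ≤ |(∑ k ∈ Finset.range m, f (π k) (π (k + 1)) ξ) - X ξ|} ∪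
        {ξ | ε / 2 ≤ |(∑ k ∈ Finset.range m, f' (π k) (π (k + 1)) ξ) - X' ξ|}) := by
        refine measure_mono fun ξ hξ => ?_
        by_contra hn
        simp only [mem_union, mem_ofPred_eq, not_or, not_le] at hn
        have h4 : ε ≤ |(∑ k ∈ Finset.range m, (f (π k) (π (k + 1)) ξ + f' (π k) (π (k + 1)) ξ)) -
          (X ξ + X' ξ)| := hξ
        rw [Finset.sum_add_distrib, add_sub_add_comm] at h4
        linarith [abs_add_le ((∑ k ∈ Finset.range m, f (π k) (π (k + 1)) ξ) - X ξ)
          ((∑ k ∈ Finset.range m, f' (π k) (π (k + 1)) ξ) - X' ξ), hn.1, hn.2]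
    _ ≤ ENNReal.ofReal (ε / 2) + ENNReal.ofReal (ε / 2) :=
        (measure_union_le _ _).trans (add_le_add h2 h3)
    _ = _ := by rw [← ENNReal.ofReal_add (by positivity) (by positivity), add_halves]

lemma const_mul (h : MeshLimit P f a b X) (c : ℝ) :
    MeshLimit P (fun s t ξ => c * f s t ξ) a b fun ξ => c * X ξ := by
  intro ε hε
  have hc : 0 < |c| + 1 := by positivity
  obtain ⟨δ, hδ, H⟩ := h (ε / (|c| + 1)) (by positivity)
  refine ⟨δ, hδ, fun m π hm h0 h1 hk => ?_⟩
  have hle : ε / (|c| + 1) ≤ ε := div_le_self hε.le (by linarith [abs_nonneg c])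
  refine (measure_mono fun ξ hξ => ?_).trans
    ((H m π hm h0 h1 hk).trans (ENNReal.ofReal_le_ofReal hle))
  have h2 : ε ≤ |(∑ k ∈ Finset.range m, c * f (π k) (π (k + 1)) ξ) - c * X ξ| := hξ
  rw [← Finset.mul_sum, ← mul_sub, abs_mul] at h2
  change ε / (|c| + 1) ≤ _
  rw [div_le_iff₀ hc]
  nlinarith [abs_nonneg ((∑ k ∈ Finset.range m, f (π k) (π (k + 1)) ξ) - X ξ)]

lemma zero : MeshLimit P (fun _ _ _ => 0) a b fun _ => 0 := by
  intro ε hε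
  refine ⟨1, one_pos, fun m π _ _ _ _ => ?_⟩
  simp [hε.not_ge]

lemma finset_sum {ι : Type*} (S : Finset ι) {f : ι → ℝ → ℝ → Ω → ℝ} {X : ι → Ω → ℝ}
    (h : ∀ i ∈ S, MeshLimit P (f i) a b (X i)) :
    MeshLimit P (fun s t ξ => ∑ i ∈ S, f i s t ξ) a b fun ξ => ∑ i ∈ S, X i ξ := by
  classical
  induction S using Finset.induction_on with
  | empty => simpa using MeshLimit.zero
  | insert i S hi ih =>
    simp only [Finset.sum_insert hi]
    exact (h i (by simp)).add (ih fun j hj => h j (by simp [hj]))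

/-- Limits in probability are almost surely unique. -/
lemma unique (hab : a ≤ b) (h : MeshLimit P f a b X) (h' : MeshLimit P f a b X') : X =ᵐ[P] X' := by
  have key : ∀ ε > 0, ∀ c > 0, ε ≤ c → P {ξ | c + c ≤ |X ξ - X' ξ|} ≤ ENNReal.ofReal (ε + ε) := by
    intro ε hε c hc hεc
    obtain ⟨δ, hδ, H⟩ := h ε hε
    obtain ⟨δ', hδ', H'⟩ := h' ε hε
    obtain ⟨m, π, hm, h0, h1, hk⟩ := exists_partition hab (lt_min hδ hδ')
    have h2 := H m π hm h0 h1 fun k hkm => (hk k hkm).trans_le (min_le_left _ _)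
    have h3 := H' m π hm h0 h1 fun k hkm => (hk k hkm).trans_le (min_le_right _ _)
    rw [ENNReal.ofReal_add hε.le hε.le]
    refine (measure_mono fun ξ hξ => ?_).trans ((measure_union_le _ _).trans (add_le_add h2 h3))
    by_contra hn
    simp only [mem_union, mem_ofPred_eq, not_or, not_le] at hn
    have h4 : c + c ≤ |X ξ - X' ξ| := hξ
    have h5 := abs_sub_le (X ξ) (∑ k ∈ Finset.range m, f (π k) (π (k + 1)) ξ) (X' ξ)
    rw [abs_sub_comm (X ξ) (∑ k ∈ Finset.range m, f (π k) (π (k + 1)) ξ)] at h5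
    linarith [hn.1, hn.2]
  have hz : ∀ c > 0, P {ξ | c + c ≤ |X ξ - X' ξ|} = 0 := by
    intro c hc
    refine le_antisymm (ge_of_tendsto (x := 𝓝[>] (0 : ℝ))
      (f := fun ε : ℝ => ENNReal.ofReal (ε + ε)) ?_ ?_) zero_le
    · have : Continuous fun ε : ℝ => ENNReal.ofReal (ε + ε) :=
        ENNReal.continuous_ofReal.comp (by fun_prop)
      simpa using (this.tendsto 0).mono_left nhdsWithin_le_nhds
    · filter_upwards [Ioc_mem_nhdsGT hc] with ε hε using key ε hε.1 c hc hε.2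
  have hn : ∀ᵐ ξ ∂P, ∀ j : ℕ, ¬ (1 / ((j : ℝ) + 1) + 1 / ((j : ℝ) + 1) ≤ |X ξ - X' ξ|) := by
    refine ae_all_iff.2 fun j => ?_
    rw [ae_iff]
    simpa using hz (1 / ((j : ℝ) + 1)) (by positivity)
  filter_upwards [hn] with ξ hξ
  by_contra hne
  have hpos : 0 < |X ξ - X' ξ| / 2 := by
    have := abs_pos.2 (sub_ne_zero.2 hne)
    positivity
  obtain ⟨j, hj⟩ := exists_nat_one_div_lt hpos
  exact hξ j (by linarith)

/-- If the sums over every sequence of partitions with mesh tending to zero converge almost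
surely, then they converge in probability. -/
lemma of_seq [IsFiniteMeasure P]
    (hf : ∀ s t, a ≤ s → s ≤ t → t ≤ b → AEStronglyMeasurable (f s t) P)
    (H : ∀ (m : ℕ → ℕ) (π : ℕ → ℕ → ℝ), (∀ j, Monotone (π j)) → (∀ j, π j 0 = a) →
      (∀ j, π j (m j) = b) → (∀ j, ∀ k < m j, π j (k + 1) - π j k < 1 / ((j : ℝ) + 1)) →
      ∀ᵐ ξ ∂P, Tendsto (fun j => ∑ k ∈ Finset.range (m j), f (π j k) (π j (k + 1)) ξ) atTop
        (𝓝 (X ξ))) : MeshLimit P f a b X := by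
  by_contra hn
  rw [MeshLimit] at hn
  push Not at hn
  obtain ⟨ε, hε, hn⟩ := hn
  -- A sequence of partitions on which convergence in probability fails would contradict almost
  -- sure convergence along it.
  choose m π h1 h2 h3 h4 h5 using fun j : ℕ => hn (1 / ((j : ℝ) + 1)) (by positivity)
  have hm : ∀ j, AEStronglyMeasurable
      (fun ξ => ∑ k ∈ Finset.range (m j), f (π j k) (π j (k + 1)) ξ) P := by
    intro j
    refine Finset.aestronglyMeasurable_fun_sum _ fun k hk => ?_
    have hk' := Finset.mem_range.1 hk
    exact hf _ _ (partition_mem (h1 j) (h2 j) (h3 j) hk'.le).1 (h1 j k.le_succ)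
      (partition_mem (h1 j) (h2 j) (h3 j) hk').2
  have h6 := tendstoInMeasure_of_tendsto_ae hm (H m π h1 h2 h3 h4) (ENNReal.ofReal ε)
    (ENNReal.ofReal_pos.2 hε)
  obtain ⟨j, hj⟩ := (h6.eventually (gt_mem_nhds (ENNReal.ofReal_pos.2 hε))).exists
  refine (h5 j).not_ge (le_trans (measure_mono fun ξ hξ => ?_) hj.le)
  change ENNReal.ofReal ε ≤ edist _ _
  rw [edist_dist, Real.dist_eq]
  exact ENNReal.ofReal_le_ofReal hξ

end MeshLimit

/-- The sum is at most the oscillation of `u` on the mesh scale, which tends to zero by uniform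
continuity, times the total increase of `V`, which dominates the variation of `v`. -/
lemma tendsto_sum_mul_zero {u v V : ℝ → ℝ} (hu : ContinuousOn u (Icc a b))
    (hv : ∀ s t, a ≤ s → s ≤ t → t ≤ b → |v t - v s| ≤ V t - V s)
    {m : ℕ → ℕ} {π : ℕ → ℕ → ℝ} (h1 : ∀ j, Monotone (π j)) (h2 : ∀ j, π j 0 = a)
    (h3 : ∀ j, π j (m j) = b) (h4 : ∀ j, ∀ k < m j, π j (k + 1) - π j k < 1 / ((j : ℝ) + 1)) :
    Tendsto (fun j => ∑ k ∈ Finset.range (m j),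
      (u (π j (k + 1)) - u (π j k)) * (v (π j (k + 1)) - v (π j k))) atTop (𝓝 0) := by
  rw [Metric.tendsto_atTop]
  intro ε hε
  have huc := isCompact_Icc.uniformContinuousOn_of_continuous hu
  rw [Metric.uniformContinuousOn_iff] at huc
  have hden : 0 < |V b - V a| + 1 := by positivity
  obtain ⟨δ, hδ, huc⟩ := huc (ε / (|V b - V a| + 1)) (by positivity)
  obtain ⟨J, hJ⟩ := exists_nat_one_div_lt hδ
  refine ⟨J, fun j hj => ?_⟩
  rw [Real.dist_eq, sub_zero]
  have hjJ : 1 / ((j : ℝ) + 1) < δ := by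
    refine lt_of_le_of_lt ?_ hJ
    exact one_div_le_one_div_of_le (by positivity) (by exact_mod_cast Nat.succ_le_succ hj)
  calc _ ≤ ∑ k ∈ Finset.range (m j),
        ε / (|V b - V a| + 1) * (V (π j (k + 1)) - V (π j k)) := by
        refine (Finset.abs_sum_le_sum_abs _ _).trans (Finset.sum_le_sum fun k hk => ?_)
        have hk' := Finset.mem_range.1 hk
        have p1 := partition_mem (h1 j) (h2 j) (h3 j) hk'.le
        have p2 := partition_mem (h1 j) (h2 j) (h3 j) hk'
        have hle := h1 j k.le_succ
        rw [abs_mul]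
        refine mul_le_mul ?_ (hv _ _ p1.1 hle p2.2) (abs_nonneg _) (by positivity)
        rw [← Real.dist_eq]
        refine (huc _ p2 _ p1 ?_).le
        rw [Real.dist_eq, abs_of_nonneg (sub_nonneg.2 hle)]
        exact (h4 j k hk').trans hjJ
    _ = ε / (|V b - V a| + 1) * (V b - V a) := by
        rw [← Finset.mul_sum, Finset.sum_range_sub (fun k => V (π j k)), h2, h3]
    _ < ε := by
        rw [div_mul_eq_mul_div, div_lt_iff₀ hden]
        nlinarith [le_abs_self (V b - V a)]

/-- Products of increments of a continuous process and of a process of bounded variation sum up to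
zero. -/
lemma meshLimit_mul_of_boundedVariation [IsFiniteMeasure P] {u v V : ℝ → Ω → ℝ}
    (hum : ∀ t ∈ Icc a b, AEMeasurable (u t) P) (hvm : ∀ t ∈ Icc a b, AEMeasurable (v t) P)
    (hu : ∀ᵐ ξ ∂P, ContinuousOn (fun t => u t ξ) (Icc a b))
    (hv : ∀ᵐ ξ ∂P, ∀ s t, a ≤ s → s ≤ t → t ≤ b → |v t ξ - v s ξ| ≤ V t ξ - V s ξ) :
    MeshLimit P (fun s t ξ => (u t ξ - u s ξ) * (v t ξ - v s ξ)) a b fun _ => 0 := by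
  refine MeshLimit.of_seq (fun s t hs hst ht => ?_) fun m π h1 h2 h3 h4 => ?_
  · have hs' : s ∈ Icc a b := ⟨hs, hst.trans ht⟩
    have ht' : t ∈ Icc a b := ⟨hs.trans hst, ht⟩
    exact (((hum t ht').sub (hum s hs')).mul ((hvm t ht').sub (hvm s hs'))).aestronglyMeasurable
  · filter_upwards [hu, hv] with ξ h5 h6
    exact tendsto_sum_mul_zero h5 h6 h1 h2 h3 h4

/-- Riemann sums of a continuous function converge to its integral. -/
lemma meshLimit_riemann [IsFiniteMeasure P] {u : ℝ → ℝ} (hu : ContinuousOn u (Icc a b))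
    (hab : a ≤ b) :
    MeshLimit P (fun s t _ => u s * (t - s)) a b fun _ => ∫ s in a..b, u s := by
  have hint : ∀ s t, a ≤ s → s ≤ t → t ≤ b → IntervalIntegrable u volume s t :=
    fun s t hs hst ht => (hu.mono (by
      rw [uIcc_of_le hst]; exact Icc_subset_Icc hs ht)).intervalIntegrable
  intro ε hε
  have huc := isCompact_Icc.uniformContinuousOn_of_continuous hu
  rw [Metric.uniformContinuousOn_iff] at huc
  have hden : 0 < b - a + 1 := by linarith
  obtain ⟨δ, hδ, huc⟩ := huc (ε / (b - a + 1)) (by positivity)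
  refine ⟨δ, hδ, fun m π hm h0 h1 hk => ?_⟩
  have hlt : |(∑ k ∈ Finset.range m, u (π k) * (π (k + 1) - π k)) - ∫ s in a..b, u s| < ε := by
    have hsum : ∫ s in a..b, u s = ∑ k ∈ Finset.range m, ∫ s in π k..π (k + 1), u s := by
      rw [intervalIntegral.sum_integral_adjacent_intervals, h0, h1]
      intro k hkm
      exact hint _ _ (partition_mem hm h0 h1 hkm.le).1 (hm k.le_succ) (partition_mem hm h0 h1 hkm).2
    rw [hsum, ← Finset.sum_sub_distrib]
    calc _ ≤ ∑ k ∈ Finset.range m, ε / (b - a + 1) * (π (k + 1) - π k) := by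
          refine (Finset.abs_sum_le_sum_abs _ _).trans (Finset.sum_le_sum fun k hkm => ?_)
          have hkm' := Finset.mem_range.1 hkm
          have p1 := partition_mem hm h0 h1 hkm'.le
          have p2 := partition_mem hm h0 h1 hkm'
          have hle := hm k.le_succ
          have h2 : u (π k) * (π (k + 1) - π k) - ∫ s in π k..π (k + 1), u s =
              ∫ s in π k..π (k + 1), (u (π k) - u s) := by
            rw [intervalIntegral.integral_sub intervalIntegrable_const (hint _ _ p1.1 hle p2.2),
              intervalIntegral.integral_const, smul_eq_mul, mul_comm]
          rw [h2]
          have h3 := intervalIntegral.norm_integral_le_of_norm_le_const (a := π k) (b := π (k + 1))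
            (f := fun s => u (π k) - u s) (C := ε / (b - a + 1)) fun s hs => ?_
          · rwa [Real.norm_eq_abs, abs_of_nonneg (sub_nonneg.2 hle)] at h3
          · rw [uIoc_of_le hle] at hs
            rw [← dist_eq_norm]
            refine (huc _ p1 _ ⟨p1.1.trans hs.1.le, hs.2.trans p2.2⟩ ?_).le
            rw [Real.dist_eq, abs_sub_comm, abs_of_nonneg (by linarith [hs.1])]
            exact lt_of_le_of_lt (by linarith [hs.2]) (hk k hkm')
      _ = ε / (b - a + 1) * (b - a) := by
          rw [← Finset.mul_sum, Finset.sum_range_sub, h0, h1]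
      _ < ε := by
          rw [div_mul_eq_mul_div, div_lt_iff₀ hden]
          nlinarith
  simp [hlt.not_ge]

/-- The quadratic variation of Brownian motion. The squared increments over a partition are
independent with means summing to `b - a`, and their variances sum to at most the mesh times
`(b - a) * c`, where `c` is the fourth moment of the standard normal law. -/
lemma meshLimit_sq_of_isPreBrownianReal [IsProbabilityMeasure P] {β : ℝ → Ω → ℝ}
    (hB : IsPreBrownianReal (fun t : ℝ≥0 => β t) P) (ha : 0 ≤ a) (hab : a ≤ b) :
    MeshLimit P (fun s t ξ => (β t ξ - β s ξ) ^ 2) a b fun _ => b - a := by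
  set c : ℝ := ∫ x, x ^ 4 ∂(gaussianReal 0 1) with hc
  have hc0 : 0 ≤ c := integral_nonneg fun x => by positivity
  have hlaw : ∀ s t, 0 ≤ s → s ≤ t →
      HasLaw (fun ξ => β t ξ - β s ξ) (gaussianReal 0 ((t - s).toNNReal)) P := by
    intro s t hs hst
    have h := hB.hasLaw_sub ⟨t, hs.trans hst⟩ ⟨s, hs⟩
    have hv : (t - s).toNNReal = nndist (⟨t, hs.trans hst⟩ : ℝ≥0).1 (⟨s, hs⟩ : ℝ≥0).1 := ?_
    · rw [hv]
      exact h
    refine NNReal.eq ?_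
    rw [Real.coe_toNNReal _ (sub_nonneg.2 hst)]
    change t - s = |t - s|
    rw [abs_of_nonneg (sub_nonneg.2 hst)]
  have hL4 : ∀ s t, 0 ≤ s → s ≤ t → MemLp (fun ξ => (β t ξ - β s ξ) ^ 2) 2 P := by
    intro s t hs hst
    have h := hlaw s t hs hst
    have h1 : MemLp (fun x : ℝ => x ^ 2) 2 (gaussianReal 0 ((t - s).toNNReal)) := by
      have h2 := memLp_id_gaussianReal (μ := 0) (v := (t - s).toNNReal) 4
      rw [memLp_two_iff_integrable_sq (by fun_prop)]
      have h3 := h2.integrable_norm_pow (by norm_num)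
      refine h3.congr (.of_forall fun x => ?_)
      simp only [id, Real.norm_eq_abs, ← pow_mul]
      norm_num
      exact (show Even 4 by decide).pow_abs x
    rw [← h.map_eq] at h1
    exact h1.comp_of_map h.aemeasurable
  have hE2 : ∀ s t, 0 ≤ s → s ≤ t → ∫ ξ, (β t ξ - β s ξ) ^ 2 ∂P = t - s := by
    intro s t hs hst
    have h := hlaw s t hs hst
    have h1 := variance_of_integral_eq_zero (X := id) (μ := gaussianReal 0 ((t - s).toNNReal))
      aemeasurable_id integral_id_gaussianReal
    rw [variance_id_gaussianReal, Real.coe_toNNReal _ (sub_nonneg.2 hst)] at h1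
    rw [h1, ← h.map_eq, integral_map h.aemeasurable (by fun_prop)]
    rfl
  have hE4 : ∀ s t, 0 ≤ s → s ≤ t → ∫ ξ, (β t ξ - β s ξ) ^ 4 ∂P = (t - s) ^ 2 * c := by
    intro s t hs hst
    have h := hlaw s t hs hst
    have h0 := sub_nonneg.2 hst
    have h2 : gaussianReal 0 ((t - s).toNNReal) = (gaussianReal 0 1).map (√(t - s) * ·) := by
      rw [gaussianReal_map_const_mul, mul_zero, mul_one]
      congr 1
      ext
      rw [Real.coe_toNNReal _ h0]
      exact (Real.sq_sqrt h0).symm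
    have h3 := integral_map h.aemeasurable (f := fun x : ℝ => x ^ 4) (by fun_prop)
    rw [h.map_eq, h2, integral_map (by fun_prop) (by fun_prop)] at h3
    rw [← h3, hc, ← integral_const_mul]
    refine integral_congr_ae (.of_forall fun x => ?_)
    simp only [mul_pow]
    rw [show √(t - s) ^ 4 = (√(t - s) ^ 2) ^ 2 by ring, Real.sq_sqrt h0]
  intro ε hε
  have hden : 0 < (b - a) * c + 1 := by nlinarith
  -- This mesh makes the variance at most `ε ^ 3`, and then Chebyshev's inequality bounds the
  -- probability of an error `ε` by `ε ^ 3 / ε ^ 2 = ε`.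
  refine ⟨ε ^ 3 / ((b - a) * c + 1), by positivity, fun m π hm h0 h1 hk => ?_⟩
  have hpos : ∀ k, 0 ≤ π k := fun k => ha.trans (h0 ▸ hm (Nat.zero_le k))
  have hind : iIndepFun (fun k ξ => β (π (k + 1)) ξ - β (π k) ξ) P :=
    hB.hasIndepIncrements.nat (t := fun k => (⟨π k, hpos k⟩ : ℝ≥0)) fun i j hij => hm hij
  set Y : ℕ → Ω → ℝ := fun k ξ => (β (π (k + 1)) ξ - β (π k) ξ) ^ 2 with hY
  have hYL : ∀ k, MemLp (Y k) 2 P := fun k => hL4 _ _ (hpos k) (hm k.le_succ)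
  have hind2 : iIndepFun Y P := hind.comp (fun _ x => x ^ 2) fun _ => by fun_prop
  have hE : ∫ ξ, (∑ k ∈ Finset.range m, Y k) ξ ∂P = b - a := by
    simp only [Finset.sum_apply]
    rw [integral_finsetSum _ fun k _ => (hYL k).integrable one_le_two]
    simp only [hY, hE2 _ _ (hpos _) (hm (Nat.le_succ _))]
    rw [Finset.sum_range_sub, h0, h1]
  have hV : variance (∑ k ∈ Finset.range m, Y k) P ≤ ε ^ 3 := by
    rw [IndepFun.variance_sum (fun k _ => hYL k) fun i _ j _ hij => hind2.indepFun hij]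
    calc _ ≤ ∑ k ∈ Finset.range m, ε ^ 3 / ((b - a) * c + 1) * (π (k + 1) - π k) * c := by
          refine Finset.sum_le_sum fun k hkm => ?_
          refine (variance_le_expectation_sq (hYL k).aestronglyMeasurable).trans ?_
          have h2 : ∫ ξ, (Y k ^ 2) ξ ∂P = (π (k + 1) - π k) ^ 2 * c := by
            rw [← hE4 _ _ (hpos k) (hm k.le_succ)]
            refine integral_congr_ae (.of_forall fun ξ => ?_)
            simp only [hY, Pi.pow_apply]
            ring
          rw [h2]
          refine mul_le_mul_of_nonneg_right ?_ hc0
          rw [pow_two]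
          exact mul_le_mul_of_nonneg_right (hk k (Finset.mem_range.1 hkm)).le
            (sub_nonneg.2 (hm k.le_succ))
      _ = ε ^ 3 / ((b - a) * c + 1) * (b - a) * c := by
          rw [← Finset.sum_mul, ← Finset.mul_sum, Finset.sum_range_sub, h0, h1]
      _ ≤ ε ^ 3 := by
          rw [mul_assoc, div_mul_eq_mul_div, div_le_iff₀ hden]
          nlinarith [pow_pos hε 3]
  have hsL : MemLp (∑ k ∈ Finset.range m, Y k) 2 P := memLp_finsetSum' _ fun k _ => hYL k
  have hch := meas_ge_le_variance_div_sq hsL hε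
  rw [hE] at hch
  simp only [Finset.sum_apply] at hch
  refine hch.trans (ENNReal.ofReal_le_ofReal ?_)
  rw [div_le_iff₀ (by positivity)]
  calc _ ≤ ε ^ 3 := hV
    _ = ε * ε ^ 2 := by ring

end MeshLimit

/-! ### Product rules and the emergent time -/

section Emergent

variable {M : Type*} [TopologicalSpace M] [T2Space M] [CompactSpace M] [SecondCountableTopology M]
  [ChartedSpace E3 M] [IsManifold (𝓡 3) ∞ M] [MeasurableSpace M] [BorelSpace M]
variable {γ : TField M} {n : ℕ} {X : Fin n → (x : M) → Tan x}
variable {Ω : Type*} [MeasurableSpace Ω] {P : Measure Ω} [IsProbabilityMeasure P]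
  {K : TKernel M} {W g g' : ℝ → Ω → TField M} {lam : ℕ → ℝ} {e : ℕ → TField M}
  {l : ℝ} {D D' : ℝ → TField M → TField M}

namespace TightFrame

variable (F : TightFrame γ X) (hK : IsCovKernel γ K) (hW : IsWiener P γ K W)
  (he : IsEigensystem γ K lam e)

include F in
/-- The normalised sum of two different modes is again a Brownian motion. Its quadratic variation
gives the mixed one by polarisation. -/
lemma isPreBrownianReal_mode_add [IsFiniteMeasure (vol γ)] (hK : IsCovKernel γ K)
    (hW : IsWiener P γ K W) (he : IsEigensystem γ K lam e) {i j : ℕ} (hij : i ≠ j) :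
    IsPreBrownianReal (fun (t : ℝ≥0) ξ =>
      (√2)⁻¹ * (mode γ lam e W i t ξ + mode γ lam e W j t ξ)) P := by
  have hL := F.memLp_mode hK hW he
  have hGP := F.isGaussianProcess_mode hK hW he
  have hmem : ∀ m (t : ℝ≥0), (hL m t).toLp _ ∈ gaussianSpace hGP := fun m t =>
    Submodule.le_topologicalClosure _ (Submodule.subset_span ⟨⟨m, t⟩, rfl⟩)
  refine IsGaussianProcess.isPreBrownianReal_of_covariance ?_ (fun t => ?_) fun s t hst => ?_
  · refine isGaussianProcess_of_mem hGP (fun t => ((hL i t).add (hL j t)).const_mul _) fun t => ?_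
    exact Submodule.smul_mem _ (√2)⁻¹ (Submodule.add_mem _ (hmem i t) (hmem j t))
  · rw [integral_const_mul, integral_add ((hL i t).integrable one_le_two)
      ((hL j t).integrable one_le_two), F.integral_mode hK hW he, F.integral_mode hK hW he]
    simp
  · rw [covariance_const_mul_left, covariance_const_mul_right]
    have h1 := covariance_add_left (hL i s) (hL j s) ((hL i t).add (hL j t))
    rw [covariance_add_right (hL i s) (hL i t) (hL j t),
      covariance_add_right (hL j s) (hL i t) (hL j t)] at h1
    simp only [F.covariance_mode hK hW he, if_neg hij, if_neg hij.symm, if_true,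
      min_eq_left hst] at h1
    have h2 : cov[fun ξ => mode γ lam e W i s ξ + mode γ lam e W j s ξ,
      fun ξ => mode γ lam e W i t ξ + mode γ lam e W j t ξ; P] = s + 0 + (0 + s) := h1
    rw [h2]
    have h3 : (√2)⁻¹ * (√2)⁻¹ = (2 : ℝ)⁻¹ := by
      rw [← mul_inv, Real.mul_self_sqrt (by norm_num)]
    linear_combination (2 * (s : ℝ)) * h3

include F hW he in
lemma continuousOn_mode (m : ℕ) {a b : ℝ} (ha : 0 ≤ a) :
    ∀ᵐ ξ ∂P, ContinuousOn (fun t => mode γ lam e W m t ξ) (Icc a b) := by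
  filter_upwards [F.continuous_ip_wiener hW he m] with ξ h
  exact (h.mono (Icc_subset_Ici_self.trans (Ici_subset_Ici.2 ha))).div_const _

include F hK hW he in
lemma aemeasurable_mode [IsFiniteMeasure (vol γ)] (m : ℕ) {t : ℝ} (ht : 0 ≤ t) :
    AEMeasurable (mode γ lam e W m t) P :=
  (F.memLp_mode hK hW he m ⟨t, ht⟩).aestronglyMeasurable.aemeasurable

include F hK hW he in
/-- The Itô product rules of the modes. -/
theorem itoRules [IsFiniteMeasure (vol γ)] : ItoRules P (mode γ lam e W) where
  time_time a b ha hab := by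
    refine meshLimit_mul_of_boundedVariation (u := fun t _ => t) (v := fun t _ => t)
      (V := fun t _ => t) (fun t _ => aemeasurable_const) (fun t _ => aemeasurable_const)
      (.of_forall fun _ => continuousOn_id) (.of_forall fun ξ s t _ hst _ => ?_)
    exact (abs_of_nonneg (sub_nonneg.2 hst)).le
  noise_time m a b ha hab := by
    refine meshLimit_mul_of_boundedVariation (u := mode γ lam e W m) (v := fun t _ => t)
      (V := fun t _ => t) (fun t ht => F.aemeasurable_mode hK hW he m (ha.trans ht.1))
      (fun t _ => aemeasurable_const) (F.continuousOn_mode hW he m ha)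
      (.of_forall fun ξ s t _ hst _ => ?_)
    exact (abs_of_nonneg (sub_nonneg.2 hst)).le
  noise_noise i j a b ha hab := by
    have hq := fun m => meshLimit_sq_of_isPreBrownianReal (β := mode γ lam e W m)
      (F.isBrownianReal_mode hK hW he m).toIsPreBrownianReal ha hab
    by_cases hij : i = j
    · subst hij
      simp only [if_true, ← pow_two]
      exact hq i
    · simp only [if_neg hij]
      have hs := meshLimit_sq_of_isPreBrownianReal
        (β := fun t ξ => (√2)⁻¹ * (mode γ lam e W i t ξ + mode γ lam e W j t ξ))
        (F.isPreBrownianReal_mode_add hK hW he hij) ha hab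
      -- Polarisation: `xy = ((x + y) / √2) ² - (x² + y²) / 2`.
      refine (hs.add (((hq i).add (hq j)).const_mul (-(1 / 2)))).congr
        (fun s t _ _ _ => .of_forall fun ξ => ?_) (.of_forall fun ξ => ?_)
      · have h3 : ((√2)⁻¹) ^ 2 = (2 : ℝ)⁻¹ := by
          rw [inv_pow, Real.sq_sqrt (by norm_num)]
        simp only
        linear_combination (mode γ lam e W i t ξ + mode γ lam e W j t ξ -
          (mode γ lam e W i s ξ + mode γ lam e W j s ξ)) ^ 2 * h3
      · simp only
        ring

include F he in
omit [SecondCountableTopology M] in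
/-- The equation for the modes of a solution. -/
theorem mode_equation (hg : SolvesSDE P γ l D W g) (m : ℕ) : ∀ᵐ ξ ∂P, ∀ τ, 0 ≤ τ →
    IntervalIntegrable (fun s => ip γ (D s (g s ξ)) (e m)) volume 0 τ ∧
    ip γ (g τ ξ) (e m) = ip γ (g 0 ξ) (e m) + (∫ s in (0 : ℝ)..τ, ip γ (D s (g s ξ)) (e m))
      + l * √(lam m) * mode γ lam e W m τ ξ := by
  filter_upwards [hg.eq (e m) (he.cont m) (he.symm m)] with ξ h τ hτ
  refine ⟨(h τ hτ).1, ?_⟩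
  rw [mul_assoc, F.sqrt_lam_mul_mode he]
  exact (h τ hτ).2

include F hK hW he in
/-- The quadratic variation of the modes of a solution. The mode is `A + l √lam β`, where the drift
part `A` is continuous of bounded variation, so that only the Brownian part contributes. -/
lemma meshLimit_mode_sq [IsFiniteMeasure (vol γ)] (hg : SolvesSDE P γ l D W g) (m : ℕ) {a b : ℝ}
    (ha : 0 ≤ a) (hab : a ≤ b) :
    MeshLimit P (fun s t ξ => (ip γ (g t ξ) (e m) - ip γ (g s ξ) (e m)) ^ 2 / lam m) a b
      fun _ => l ^ 2 * (b - a) := by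
  set β := mode γ lam e W m with hβ
  -- The part of bounded variation, and its variation on `[0, t]`.
  set A : ℝ → Ω → ℝ := fun t ξ => ip γ (g t ξ) (e m) - l * √(lam m) * β t ξ with hA
  set V : ℝ → Ω → ℝ := fun t ξ => ∫ s in (0 : ℝ)..t, |ip γ (D s (g s ξ)) (e m)| with hV
  have heq := F.mode_equation he hg m
  have hAm : ∀ t ∈ Icc a b, AEMeasurable (A t) P := fun t ht =>
    (hg.meas t (ha.trans ht.1) _ (he.cont m) (he.symm m)).sub
      ((F.aemeasurable_mode hK hW he m (ha.trans ht.1)).const_mul _)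
  have hAV : ∀ᵐ ξ ∂P, ∀ s t, a ≤ s → s ≤ t → t ≤ b → |A t ξ - A s ξ| ≤ V t ξ - V s ξ := by
    filter_upwards [heq] with ξ h s t hs hst ht
    have hs0 := ha.trans hs
    have ht0 := hs0.trans hst
    have h1 : ∀ τ, 0 ≤ τ → A τ ξ =
        ip γ (g 0 ξ) (e m) + ∫ s in (0 : ℝ)..τ, ip γ (D s (g s ξ)) (e m) := fun τ hτ => by
      simp only [hA]
      rw [(h τ hτ).2]
      ring
    rw [h1 s hs0, h1 t ht0, add_sub_add_left_eq_sub]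
    simp only [hV]
    rw [intervalIntegral.integral_interval_sub_left (h t ht0).1 (h s hs0).1,
      intervalIntegral.integral_interval_sub_left (h t ht0).1.abs (h s hs0).1.abs]
    exact intervalIntegral.abs_integral_le_integral_abs hst
  have hAc : ∀ᵐ ξ ∂P, ContinuousOn (fun t => A t ξ) (Icc a b) := by
    filter_upwards [heq] with ξ h
    have hb := ha.trans hab
    have h1 : ContinuousOn (fun τ => ip γ (g 0 ξ) (e m) +
        ∫ s in (0 : ℝ)..τ, ip γ (D s (g s ξ)) (e m)) (Icc a b) := by
      refine continuousOn_const.add ?_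
      refine (intervalIntegral.continuousOn_primitive_interval' (h b hb).1 left_mem_uIcc).mono ?_
      rw [uIcc_of_le hb]
      exact Icc_subset_Icc_left ha
    refine h1.congr fun τ hτ => ?_
    simp only [hA]
    rw [(h τ (ha.trans hτ.1)).2]
    ring
  have hβm : ∀ t ∈ Icc a b, AEMeasurable (β t) P := fun t ht =>
    F.aemeasurable_mode hK hW he m (ha.trans ht.1)
  have h1 := meshLimit_mul_of_boundedVariation hAm hAm hAc hAV
  have h2 := meshLimit_mul_of_boundedVariation hβm hAm (F.continuousOn_mode hW he m ha) hAV
  have h3 := (F.itoRules hK hW he).noise_noise m m a b ha hab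
  simp only [if_true] at h3
  have hl := (he.pos m).ne'
  refine (((h1.const_mul (1 / lam m)).add (h2.const_mul (2 * l * √(lam m) / lam m))).add
    (h3.const_mul (l ^ 2))).congr (fun s t _ _ _ => .of_forall fun ξ => ?_) (.of_forall fun ξ => ?_)
  · simp only [hA]
    field_simp
    have := Real.sq_sqrt (he.pos m).le
    linear_combination (-(l ^ 2 * (β t ξ - β s ξ) ^ 2)) * this
  · simp only
    ring

include F hK hW he in
/-- The quadratic form of the increments of a solution sums up to a multiple of the elapsed
parameter time. -/
theorem meshLimit_invForm [IsFiniteMeasure (vol γ)] (hg : SolvesSDE P γ l D W g) (S : Finset ℕ)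
    {a b : ℝ} (ha : 0 ≤ a) (hab : a ≤ b) :
    MeshLimit P (fun s t ξ => invForm γ K (proj γ e S (g t ξ - g s ξ))) a b
      fun _ => l ^ 2 * (S.card : ℝ) * (b - a) := by
  refine (MeshLimit.finset_sum S fun m _ => F.meshLimit_mode_sq hK hW he hg m ha hab).congr
    (fun s t hs hst ht => ?_) (.of_forall fun ξ => ?_)
  · filter_upwards [hg.mem] with ξ h
    have hs0 := ha.trans hs
    rw [F.invForm_proj he hK]
    refine Finset.sum_congr rfl fun m _ => ?_
    rw [F.ip_sub_left (h t (hs0.trans hst)) (h s hs0) (F.memField_eigen he m 2)]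
  · simp only [Finset.sum_const, nsmul_eq_mul]
    ring

include F hK hW he in
lemma isEmergentTime_sub [IsFiniteMeasure (vol γ)] (hl : 0 < l) (hg : SolvesSDE P γ l D W g)
    {S : Finset ℕ} (hS : S.Nonempty) : IsEmergentTime P γ K e S l g fun a b _ => b - a := by
  intro a b ha hab
  refine ((F.meshLimit_invForm hK hW he hg S ha hab).const_mul (1 / (l ^ 2 * (S.card : ℝ)))).congr
    (fun s t _ _ _ => .of_forall fun ξ => rfl) (.of_forall fun ξ => ?_)
  have : (S.card : ℝ) ≠ 0 := by exact_mod_cast hS.card_pos.ne'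
  simp only
  field_simp

include F hK hW he in
/-- The emergent time functionals are the modifications of the ordering parameter. -/
lemma isEmergentTime_iff [IsFiniteMeasure (vol γ)] (hl : 0 < l) (hg : SolvesSDE P γ l D W g)
    {S : Finset ℕ} (hS : S.Nonempty) (T : ℝ → ℝ → Ω → ℝ) : IsEmergentTime P γ K e S l g T ↔
      ∀ a b, 0 ≤ a → a ≤ b → ∀ᵐ ξ ∂P, T a b ξ = b - a := by
  have h0 := F.isEmergentTime_sub hK hW he hl hg hS
  refine ⟨fun h a b ha hab => (h a b ha hab).unique hab (h0 a b ha hab), fun h a b ha hab => ?_⟩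
  exact (h0 a b ha hab).congr (fun s t _ _ _ => .rfl) ((h a b ha hab).mono fun ξ hξ => hξ.symm)

end TightFrame
end Emergent

/-! ### Naturality under diffeomorphisms -/

section Naturality

variable {M : Type*} [TopologicalSpace M] [ChartedSpace E3 M] [IsManifold (𝓡 3) ∞ M]
  {M' : Type*} [TopologicalSpace M'] [ChartedSpace E3 M'] [IsManifold (𝓡 3) ∞ M']
  (φ : M' ≃ₘ⟮𝓡 3, 𝓡 3⟯ M)

lemma pullT_apply (h : TField M) (x : M') (u v : Tan x) : pullT φ h x u v =
    h (φ x) (mfderiv (𝓡 3) (𝓡 3) φ x u) (mfderiv (𝓡 3) (𝓡 3) φ x v) := rfl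

lemma bijective_mfderiv (x : M') : Function.Bijective (mfderiv (𝓡 3) (𝓡 3) φ x) := by
  rw [← φ.mfderivToContinuousLinearEquiv_coe (by simp)]
  exact (φ.mfderivToContinuousLinearEquiv (by simp) x).bijective

/-- The pushforward of a vector field. -/
noncomputable def pushVF (Y : (x : M') → Tan x) (y : M) : Tan y :=
  (show E3 from mfderiv (𝓡 3) (𝓡 3) φ (φ.symm y) (Y (φ.symm y)))

lemma pushVF_apply (Y : (x : M') → Tan x) (x : M') :
    pushVF φ Y (φ x) = mfderiv (𝓡 3) (𝓡 3) φ x (Y x) :=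
  congrArg (fun z => (show E3 from mfderiv (𝓡 3) (𝓡 3) φ z (Y z))) (φ.symm_apply_apply x)

lemma contVF_pushVF {Y : (x : M') → Tan x} (hY : ContVF Y) : ContVF (pushVF φ Y) := by
  have h1 : Continuous (tangentMap (𝓡 3) (𝓡 3) φ) := φ.contMDiff.continuous_tangentMap (by simp)
  have h2 := (h1.comp hY).comp φ.symm.continuous
  refine h2.congr fun y => ?_
  obtain ⟨x, rfl⟩ := φ.surjective y
  change _ = (⟨φ x, pushVF φ Y (φ x)⟩ : TangentBundle (𝓡 3) M)
  rw [pushVF_apply]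
  exact congrArg (fun z => tangentMap (𝓡 3) (𝓡 3) φ ⟨z, Y z⟩) (φ.symm_apply_apply x)

lemma pullT_symm_pullT (h : TField M) : pullT φ.symm (pullT φ h) = h := by
  funext y
  refine ContinuousLinearMap.ext fun u => ContinuousLinearMap.ext fun v => ?_
  rw [pullT_apply, pullT_apply]
  have h1 := (φ.symm.contMDiff.mdifferentiable (by simp) y).hasMFDerivAt
  have h2 := (φ.contMDiff.mdifferentiable (by simp) (φ.symm y)).hasMFDerivAt
  have hid : (φ ∘ φ.symm : M → M) = id := funext fun z => φ.apply_symm_apply z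
  have h3 := h2.comp y h1
  rw [hid] at h3
  have h4 := hasMFDerivAt_unique h3 (hasMFDerivAt_id y)
  have h5 : ∀ w : Tan y, (show E3 from mfderiv (𝓡 3) (𝓡 3) φ (φ.symm y)
      (mfderiv (𝓡 3) (𝓡 3) φ.symm y w)) = (show E3 from w) := fun w => congrArg (fun L => L w) h4
  refine (tfield_congr h (φ.apply_symm_apply y) _ _).trans ?_
  exact congrArg₂ (fun a b : E3 => h y a b) (h5 u) (h5 v)

lemma pullT_pullT_symm (h : TField M') : pullT φ (pullT φ.symm h) = h :=
  pullT_symm_pullT φ.symm h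

lemma contMDiff_pullT {h : TField M} {n : ℕ∞ω} (hn : n ≤ (∞ : ℕ∞ω))
    (hh : ContMDiff (𝓡 3) ((𝓡 3).prod 𝓘(ℝ, E3 →L[ℝ] E3 →L[ℝ] ℝ)) n
      fun x => Bundle.TotalSpace.mk' (E3 →L[ℝ] E3 →L[ℝ] ℝ)
        (E := fun x : M => Tan x →L[ℝ] Tan x →L[ℝ] ℝ) x (h x)) :
    ContMDiff (𝓡 3) ((𝓡 3).prod 𝓘(ℝ, E3 →L[ℝ] E3 →L[ℝ] ℝ)) n
      fun x => Bundle.TotalSpace.mk' (E3 →L[ℝ] E3 →L[ℝ] ℝ)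
        (E := fun x : M' => Tan x →L[ℝ] Tan x →L[ℝ] ℝ) x (pullT φ h x) := by
  refine contMDiff_of_frame fun c a b => ?_
  have hc := (chartAt E3 c).open_source.mem_nhds (mem_chart_source E3 c)
  have hT : ContMDiff (𝓡 3).tangent (𝓡 3).tangent (∞ : ℕ∞ω) (tangentMap (𝓡 3) (𝓡 3) φ) :=
    φ.contMDiff.contMDiff_tangentMap (by simp)
  have hX : ∀ a : E3, ContMDiffAt (𝓡 3) (𝓡 3).tangent n (fun x =>
      (⟨φ x, mfderiv (𝓡 3) (𝓡 3) φ x (frame c x a)⟩ : TangentBundle (𝓡 3) M)) c := fun a =>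
    (hT.contMDiffAt.comp c ((contMDiffOn_frame c a).contMDiffAt hc)).of_le hn
  have hh' := (hh.contMDiffAt (x := φ c)).comp c (φ.contMDiff.of_le hn c)
  rw [← contMDiffWithinAt_univ]
  exact contMDiffWithinAt_of_trivial (ContMDiffWithinAt.clm_bundle_apply₂
    (E₃ := fun _ : M => ℝ) (F₃ := ℝ) hh'.contMDiffWithinAt (hX a).contMDiffWithinAt
    (hX b).contMDiffWithinAt)

lemma ContTF.pullT {h : TField M} (hh : ContTF h) : ContTF (pullT φ h) :=
  contMDiff_pullT φ (by simp) hh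

lemma IsRiemannian.pullT {γ : TField M} (hγ : IsRiemannian γ) : IsRiemannian (pullT φ γ) where
  symm _ _ _ := hγ.symm _ _ _
  pos x _ hu := hγ.pos _ _ fun h => hu ((bijective_mfderiv φ x).1 (h.trans (map_zero _).symm))
  smooth := contMDiff_pullT φ le_rfl hγ.smooth

variable {γ : TField M} {n : ℕ} {X : Fin n → (x : M) → Tan x}

namespace TightFrame

variable (F : TightFrame γ X)

include F in
lemma pair_pullT (x : M') (a b : Tan (φ x) →L[ℝ] Tan (φ x) →L[ℝ] ℝ) :
    pair (pullT φ γ) x (fun u v => pullForm (mfderiv (𝓡 3) (𝓡 3) φ x) a u v)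
      (fun u v => pullForm (mfderiv (𝓡 3) (𝓡 3) φ x) b u v) =
    pair γ (φ x) (fun u v => a u v) (fun u v => b u v) := by
  choose u hu using fun i => (bijective_mfderiv φ x).2 (X i (φ x))
  have ht : IsTight (pullT φ γ) x u := by
    intro v w
    simp only [pullT_apply, hu]
    exact F.tight (φ x) _ _
  have hR := F.metric.pullT φ
  rw [ht.pair_eq (hR.symm x) (hR.pos x), (F.tight (φ x)).pair_eq (F.metric.symm _) (F.metric.pos _)]
  refine Finset.sum_congr rfl fun i _ => Finset.sum_congr rfl fun j _ => ?_
  rw [← hu i, ← hu j]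
  rfl

include F in
lemma tlen_pullT (h : TField M) (x : M') :
    tlen (pullT φ γ) x (pullT φ h x) = tlen γ (φ x) (h (φ x)) :=
  congrArg Real.sqrt (F.pair_pullT φ x _ _)

variable [MeasurableSpace M] [BorelSpace M] [MeasurableSpace M'] [BorelSpace M']

omit [IsManifold (𝓡 3) ∞ M] [IsManifold (𝓡 3) ∞ M'] in
lemma measurableEmbedding_diffeo : MeasurableEmbedding φ :=
  φ.toHomeomorph.measurableEmbedding

lemma measurePreserving_diffeo : MeasurePreserving φ (vol (pullT φ γ)) (vol γ) := by
  refine ⟨φ.continuous.measurable, ?_⟩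
  rw [vol_pullT, Measure.map_map φ.continuous.measurable φ.symm.continuous.measurable]
  have : (φ ∘ φ.symm : M → M) = id := funext fun z => φ.apply_symm_apply z
  rw [this, Measure.map_id]

lemma integral_pullT (f : M → ℝ) : ∫ x, f (φ x) ∂(vol (pullT φ γ)) = ∫ y, f y ∂(vol γ) :=
  (measurePreserving_diffeo φ).integral_comp (measurableEmbedding_diffeo φ) f

include F in
lemma ip_pullT (h k : TField M) : ip (pullT φ γ) (pullT φ h) (pullT φ k) = ip γ h k := by
  rw [ip, ip, ← integral_pullT φ]
  exact integral_congr_ae (.of_forall fun x => F.pair_pullT φ x _ _)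

include F in
lemma applyK_pullT (K : TKernel M) (f : TField M) (x : M') (u v : Tan x) :
    applyK (pullT φ γ) (pullK φ K) (pullT φ f) x u v =
      applyK γ K f (φ x) (mfderiv (𝓡 3) (𝓡 3) φ x u) (mfderiv (𝓡 3) (𝓡 3) φ x v) := by
  rw [applyK, applyK, ← integral_pullT φ]
  exact integral_congr_ae (.of_forall fun y => F.pair_pullT φ y _ _)

include F in
lemma memField_pullT {p : ℝ≥0∞} {h : TField M} (hh : MemField γ p h) :
    MemField (pullT φ γ) p (pullT φ h) where
  symm _ _ _ := hh.symm _ _ _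
  meas Y Y' hY hY' := by
    have h1 := (hh.meas _ _ (contVF_pushVF φ hY) (contVF_pushVF φ hY')).comp φ.continuous.measurable
    have h2 : (fun x => pullT φ h x (Y x) (Y' x)) =
        (fun y => h y (pushVF φ Y y) (pushVF φ Y' y)) ∘ φ := funext fun x => by
      simp only [Function.comp, pullT_apply, pushVF_apply]
    rw [h2]
    exact h1
  memLp := by
    have h1 := hh.memLp.comp_measurePreserving (measurePreserving_diffeo (γ := γ) φ)
    refine h1.ae_eq (.of_forall fun x => ?_)
    exact (F.tlen_pullT φ h x).symm

include F in
lemma memField_of_pullT {p : ℝ≥0∞} {h : TField M'} (hh : MemField (pullT φ γ) p h) [T2Space M]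
    [CompactSpace M] [T2Space M'] [CompactSpace M'] : MemField γ p (pullT φ.symm h) := by
  obtain ⟨n', X', hX', ht'⟩ := exists_tight_frame (F.metric.pullT φ)
  have h1 := (⟨F.metric.pullT φ, hX', ht'⟩ : TightFrame (pullT φ γ) X').memField_pullT φ.symm hh
  rwa [pullT_symm_pullT] at h1

end TightFrame

end Naturality

section PullKernel

variable {M : Type*} [TopologicalSpace M] [T2Space M] [CompactSpace M] [SecondCountableTopology M]
  [ChartedSpace E3 M] [IsManifold (𝓡 3) ∞ M] [MeasurableSpace M] [BorelSpace M]
  {M' : Type*} [TopologicalSpace M'] [T2Space M'] [CompactSpace M'] [SecondCountableTopology M']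
  [ChartedSpace E3 M'] [IsManifold (𝓡 3) ∞ M'] [MeasurableSpace M'] [BorelSpace M']
  (φ : M' ≃ₘ⟮𝓡 3, 𝓡 3⟯ M)
  {γ : TField M} {n : ℕ} {X : Fin n → (x : M) → Tan x} {K : TKernel M}
  {lam : ℕ → ℝ} {e : ℕ → TField M}

namespace TightFrame

variable (F : TightFrame γ X) (hK : IsCovKernel γ K) (he : IsEigensystem γ K lam e)

include F

lemma ae_zero_of_pullT {h : TField M} (h0 : ∀ᵐ y ∂(vol γ), h y = 0) :
    ∀ᵐ x ∂(vol (pullT φ γ)), pullT φ h x = 0 := by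
  filter_upwards [(measurePreserving_diffeo (γ := γ) φ).quasiMeasurePreserving.ae h0] with x hx
  refine ContinuousLinearMap.ext fun u => ContinuousLinearMap.ext fun v => ?_
  rw [pullT_apply, hx]
  rfl

include hK

/-- The pullback of a covariance kernel. -/
theorem isCovKernel_pullT : IsCovKernel (pullT φ γ) (pullK φ K) where
  symm_right x y u v w z := hK.symm_right _ _ _ _ _ _
  symm x y u v w z := hK.symm _ _ _ _ _ _
  cont Y₁ Y₂ Y₃ Y₄ h₁ h₂ h₃ h₄ := by
    have h := (hK.cont _ _ _ _ (contVF_pushVF φ h₁) (contVF_pushVF φ h₂) (contVF_pushVF φ h₃)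
      (contVF_pushVF φ h₄)).comp (φ.continuous.prodMap φ.continuous)
    refine h.congr fun p => ?_
    simp only [Function.comp, Prod.map, pushVF_apply]
    rfl
  pos h' hh' hne := by
    have := F.isFinite_vol
    obtain ⟨h, hh, rfl⟩ : ∃ h, MemField γ 2 h ∧ pullT φ h = h' :=
      ⟨_, F.memField_of_pullT φ hh', pullT_pullT_symm φ h'⟩
    have h1 := hK.pos h hh fun h0 => hne (F.ae_zero_of_pullT φ h0)
    rw [← integral_pullT φ] at h1
    refine h1.trans_eq (integral_congr_ae (.of_forall fun x => ?_))
    simp only [F.applyK_pullT φ, F.applyK_eq_opT hK hh]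
    exact (F.pair_pullT φ x (h (φ x)) (F.opT hK (toL2 γ X h) (φ x))).symm

omit hK
include he

/-- The pullback of an eigensystem. -/
theorem isEigensystem_pullT :
    IsEigensystem (pullT φ γ) (pullK φ K) lam (fun m => pullT φ (e m)) where
  pos := he.pos
  symm m x u v := he.symm m _ _ _
  cont m := (he.cont m).pullT φ
  eigen m x u v := by
    rw [F.applyK_pullT φ, he.eigen]
    rfl
  orthonormal i j := by rw [F.ip_pullT φ, he.orthonormal]
  complete h' hh' h0 := by
    obtain ⟨h, hh, rfl⟩ : ∃ h, MemField γ 2 h ∧ pullT φ h = h' :=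
      ⟨_, F.memField_of_pullT φ hh', pullT_pullT_symm φ h'⟩
    refine F.ae_zero_of_pullT φ (he.complete h hh fun m => ?_)
    rw [← F.ip_pullT φ, h0]

include hK

lemma invForm_proj_pullT (S : Finset ℕ) (h : TField M) :
    invForm (pullT φ γ) (pullK φ K) (proj (pullT φ γ) (fun m => pullT φ (e m)) S (pullT φ h)) =
      invForm γ K (proj γ e S h) := by
  obtain ⟨n', X', hX', ht'⟩ := exists_tight_frame (F.metric.pullT φ)
  have F' : TightFrame (pullT φ γ) X' := ⟨F.metric.pullT φ, hX', ht'⟩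
  rw [F'.invForm_proj (F.isEigensystem_pullT φ he) (F.isCovKernel_pullT φ hK),
    F.invForm_proj he hK]
  simp only [F.ip_pullT φ]

lemma isEmergentTime_pullT {Ω : Type*} [MeasurableSpace Ω] {P : Measure Ω} (S : Finset ℕ) (l : ℝ)
    (g : ℝ → Ω → TField M) (T : ℝ → ℝ → Ω → ℝ) :
    IsEmergentTime P (pullT φ γ) (pullK φ K) (fun m => pullT φ (e m)) S l
      (fun τ ξ => pullT φ (g τ ξ)) T ↔ IsEmergentTime P γ K e S l g T := by
  have h : ∀ s t ξ, invForm (pullT φ γ) (pullK φ K) (proj (pullT φ γ) (fun m => pullT φ (e m)) S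
      (pullT φ (g t ξ) - pullT φ (g s ξ))) = invForm γ K (proj γ e S (g t ξ - g s ξ)) :=
    fun s t ξ => F.invForm_proj_pullT φ hK he S (g t ξ - g s ξ)
  simp only [IsEmergentTime, h]

end TightFrame

end PullKernel

/-! ### The Lie derivative in arbitrary charts -/

section LieForm

variable {E : Type*} [NormedAddCommGroup E] [NormedSpace ℝ E]

/-- The coordinate expression of the Lie derivative of a bilinear form. -/
noncomputable def lieForm (H : E → E →L[ℝ] E →L[ℝ] ℝ) (B : E → E) (y a b : E) : ℝ :=
  fderiv ℝ (fun z => H z a b) y (B y) + H y (fderiv ℝ B y a) b + H y a (fderiv ℝ B y b)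

/-- The coordinate expression of the Lie derivative is covariant under changes of coordinates, by
the symmetry of second derivatives. -/
lemma lieForm_transition {H H' : E → E →L[ℝ] E →L[ℝ] ℝ} {θ : E → E} {B B' : E → E} {y : E}
    (hθ : ContDiffAt ℝ 2 θ y) (hH' : DifferentiableAt ℝ H' (θ y)) (hB : DifferentiableAt ℝ B y)
    (hB' : DifferentiableAt ℝ B' (θ y))
    (eqB : (fun z => B' (θ z)) =ᶠ[𝓝 y] fun z => fderiv ℝ θ z (B z))
    (eqH : ∀ a b, (fun z => H z a b) =ᶠ[𝓝 y]
      fun z => H' (θ z) (fderiv ℝ θ z a) (fderiv ℝ θ z b)) (a b : E) :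
    lieForm H B y a b = lieForm H' B' (θ y) (fderiv ℝ θ y a) (fderiv ℝ θ y b) := by
  have hθ1 : HasFDerivAt θ (fderiv ℝ θ y) y := (hθ.differentiableAt (by simp)).hasFDerivAt
  have hθ2 : HasFDerivAt (fderiv ℝ θ) (fderiv ℝ (fderiv ℝ θ) y) y :=
    ((hθ.fderiv_right (m := 1) (by norm_num)).differentiableAt (by simp)).hasFDerivAt
  have hsymm : ∀ v w, fderiv ℝ (fderiv ℝ θ) y v w = fderiv ℝ (fderiv ℝ θ) y w v :=
    hθ.isSymmSndFDerivAt (by simp)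
  -- the derivative of the vector field
  have hvec : ∀ c, fderiv ℝ B' (θ y) (fderiv ℝ θ y c) =
      fderiv ℝ (fderiv ℝ θ) y c (B y) + fderiv ℝ θ y (fderiv ℝ B y c) := by
    intro c
    have h1 : HasFDerivAt (fun z => B' (θ z)) _ y := hB'.hasFDerivAt.comp y hθ1
    have h2 := (hθ2.clm_apply hB.hasFDerivAt).congr_of_eventuallyEq eqB
    have h3 := DFunLike.congr_fun (h1.unique h2) c
    simpa [add_comm] using h3
  -- the derivative of the bilinear form
  have hform : fderiv ℝ (fun z => H z a b) y (B y) =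
      fderiv ℝ (fun z => H' z (fderiv ℝ θ y a) (fderiv ℝ θ y b)) (θ y) (fderiv ℝ θ y (B y)) +
      H' (θ y) (fderiv ℝ (fderiv ℝ θ) y (B y) a) (fderiv ℝ θ y b) +
      H' (θ y) (fderiv ℝ θ y a) (fderiv ℝ (fderiv ℝ θ) y (B y) b) := by
    have hc : HasFDerivAt (fun z => H' (θ z)) ((fderiv ℝ H' (θ y)).comp (fderiv ℝ θ y)) y :=
      HasFDerivAt.comp (g := H') (g' := fderiv ℝ H' (θ y)) y hH'.hasFDerivAt hθ1
    have ha := hθ2.clm_apply (hasFDerivAt_const a y)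
    have hb := hθ2.clm_apply (hasFDerivAt_const b y)
    have h1 := ((hc.clm_apply ha).clm_apply hb).congr_of_eventuallyEq (eqH a b)
    have h2 := (hH'.hasFDerivAt.clm_apply (hasFDerivAt_const (fderiv ℝ θ y a) (θ y))).clm_apply
      (hasFDerivAt_const (fderiv ℝ θ y b) (θ y))
    rw [h1.fderiv, h2.fderiv]
    simp
    ring
  have hH0 : ∀ a b, H y a b = H' (θ y) (fderiv ℝ θ y a) (fderiv ℝ θ y b) :=
    fun a b => (eqH a b).self_of_nhds
  have hB0 : B' (θ y) = fderiv ℝ θ y (B y) := eqB.self_of_nhds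
  simp only [lieForm, hform, hH0, hB0, hvec, map_add, add_apply, hsymm (B y)]
  ring

lemma lieForm_symm {H : E → E →L[ℝ] E →L[ℝ] ℝ} (hH : ∀ y a b, H y a b = H y b a) (B : E → E)
    (y a b : E) : lieForm H B y a b = lieForm H B y b a := by
  simp only [lieForm]
  rw [funext fun z => hH z a b, hH y a, hH y _ b]
  ring

end LieForm

section LieDer

variable {M : Type*} [TopologicalSpace M] [ChartedSpace E3 M]

/-- The components of a vector field in a chart. Off the target of the chart the value is junk. -/
noncomputable def chartVec (β : (x : M) → Tan x) (φ : OpenPartialHomeomorph M E3) (y : E3) : E3 :=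
  mfderiv (𝓡 3) 𝓘(ℝ, E3) φ (φ.symm y) (β (φ.symm y))

lemma lieDer_eq (β : (x : M) → Tan x) (h : TField M) (x : M) (u v : Tan x) :
    lieDer β h x u v = lieForm (chartForm h (chartAt E3 x)) (chartVec β (chartAt E3 x))
      (chartAt E3 x x) (mfderiv (𝓡 3) 𝓘(ℝ, E3) (chartAt E3 x) x u)
      (mfderiv (𝓡 3) 𝓘(ℝ, E3) (chartAt E3 x) x v) := rfl

lemma lieDer_symm {h : TField M} (hs : IsSymm h) (β : (x : M) → Tan x) (x : M) (u v : Tan x) :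
    lieDer β h x u v = lieDer β h x v u := by
  have hs' : ∀ y a b, chartForm h (chartAt E3 x) y a b = chartForm h (chartAt E3 x) y b a :=
    fun y a b => hs _ _ _
  exact lieForm_symm hs' (chartVec β (chartAt E3 x)) (chartAt E3 x x)
    (mfderiv (𝓡 3) 𝓘(ℝ, E3) (chartAt E3 x) x u) (mfderiv (𝓡 3) 𝓘(ℝ, E3) (chartAt E3 x) x v)

variable [IsManifold (𝓡 3) ∞ M] {φ ψ : OpenPartialHomeomorph M E3}

lemma mfderiv_symm_mfderiv (hφ : φ ∈ IsManifold.maximalAtlas (𝓡 3) ∞ M) {x : M}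
    (hx : x ∈ φ.source) (u : Tan x) :
    (mfderiv 𝓘(ℝ, E3) (𝓡 3) φ.symm (φ x) (mfderiv (𝓡 3) 𝓘(ℝ, E3) φ x u) : E3) = (u : E3) := by
  have h1 := (mdiffAt_chart hφ hx).hasMFDerivAt
  have h2 := (mdiffAt_chart_symm hφ (φ.map_source hx)).hasMFDerivAt
  have h3 := h2.comp x h1
  have h4 : (id : M → M) =ᶠ[𝓝 x] φ.symm ∘ φ := by
    filter_upwards [φ.open_source.mem_nhds hx] with z hz
    exact (φ.left_inv hz).symm
  have h5 := (h3.congr_of_eventuallyEq h4).mfderiv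
  rw [mfderiv_id] at h5
  exact (DFunLike.congr_fun h5 u).symm

lemma mfderiv_symm_chartVec (β : (x : M) → Tan x) (hφ : φ ∈ IsManifold.maximalAtlas (𝓡 3) ∞ M)
    {y : E3} (hy : y ∈ φ.target) :
    (mfderiv 𝓘(ℝ, E3) (𝓡 3) φ.symm y (chartVec β φ y) : E3) = (β (φ.symm y) : E3) := by
  have h := mfderiv_symm_mfderiv hφ (φ.map_target hy) (β (φ.symm y))
  rw [φ.right_inv hy] at h
  exact h

lemma chartVec_transition (β : (x : M) → Tan x) (hφ : φ ∈ IsManifold.maximalAtlas (𝓡 3) ∞ M)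
    (hψ : ψ ∈ IsManifold.maximalAtlas (𝓡 3) ∞ M) {y : E3} (hy : y ∈ φ.target)
    (hy' : φ.symm y ∈ ψ.source) : chartVec β ψ (ψ (φ.symm y)) =
      fderiv ℝ (fun z => ψ (φ.symm z)) y (chartVec β φ y) := by
  have hz := ψ.map_source hy'
  apply mfderiv_symm_injective hψ hz
  have h1 := mfderiv_symm_transition hφ hψ hy hy' (chartVec β φ y)
  have h2 := mfderiv_symm_chartVec β hφ hy
  have h3 := mfderiv_symm_chartVec β hψ hz
  have h4 : (β (ψ.symm (ψ (φ.symm y))) : E3) = (β (φ.symm y) : E3) :=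
    congrArg (fun x => (β x : E3)) (ψ.left_inv hy')
  exact h3.trans (h4.trans (h2.symm.trans h1.symm))

/-- The Lie derivative at `x`, which is defined through the preferred chart at `x`, computed in the
chart centred at another point. A fixed chart is needed to see that it depends continuously on
`x`. -/
lemma lieDer_frame {β : (x : M) → Tan x} {h : TField M} {c x : M}
    (hx : x ∈ (chartAt E3 c).source)
    (hh : ∀ c, ∀ y ∈ (chartAt E3 c).target, DifferentiableAt ℝ (chartForm h (chartAt E3 c)) y)
    (hβ : ∀ c, ∀ y ∈ (chartAt E3 c).target, DifferentiableAt ℝ (chartVec β (chartAt E3 c)) y)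
    (a b : E3) :
    lieDer β h x (frame c x a) (frame c x b) =
      lieForm (chartForm h (chartAt E3 c)) (chartVec β (chartAt E3 c)) (chartAt E3 c x) a b := by
  set φ := chartAt E3 c with hφd
  set ψ := chartAt E3 x with hψd
  have hφ : φ ∈ IsManifold.maximalAtlas (𝓡 3) ∞ M := IsManifold.chart_mem_maximalAtlas c
  have hψ : ψ ∈ IsManifold.maximalAtlas (𝓡 3) ∞ M := IsManifold.chart_mem_maximalAtlas x
  have hxψ : x ∈ ψ.source := mem_chart_source E3 x
  have hy : φ x ∈ φ.target := φ.map_source hx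
  have hy' : φ.symm (φ x) ∈ ψ.source := by rwa [φ.left_inv hx]
  have hU : ∀ᶠ z in 𝓝 (φ x), z ∈ φ.target ∧ φ.symm z ∈ ψ.source :=
    Filter.Eventually.and (φ.open_target.mem_nhds hy)
      ((φ.continuousAt_symm hy).preimage_mem_nhds (ψ.open_source.mem_nhds hy'))
  have hθ := contDiffAt_transition hφ hψ hy hy'
  have hθx : ψ (φ.symm (φ x)) = ψ x := by rw [φ.left_inv hx]
  have key := lieForm_transition (H := chartForm h φ) (H' := chartForm h ψ)
    (θ := fun z => ψ (φ.symm z)) (B := chartVec β φ) (B' := chartVec β ψ) (y := φ x)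
    (hθ.of_le (by norm_cast)) (hh x _ (ψ.map_source hy')) (hβ c _ hy)
    (hβ x _ (ψ.map_source hy'))
    (by filter_upwards [hU] with z hz using chartVec_transition β hφ hψ hz.1 hz.2)
    (fun a b => by
      filter_upwards [hU] with z hz using chartForm_transition h hφ hψ hz.1 hz.2 a b) a b
  rw [key, lieDer_eq]
  have hv : ∀ a : E3, (mfderiv (𝓡 3) 𝓘(ℝ, E3) ψ x (frame c x a) : E3) =
      fderiv ℝ (fun z => ψ (φ.symm z)) (φ x) a := by
    intro a
    apply mfderiv_symm_injective hψ (ψ.map_source hxψ)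
    have h1 := mfderiv_symm_transition hφ hψ hy hy' a
    rw [hθx] at h1
    exact (mfderiv_symm_mfderiv hψ hxψ _).trans h1.symm
  simp only [hθx]
  exact congrArg₂ (lieForm (chartForm h ψ) (chartVec β ψ) (ψ x)) (hv a) (hv b)

end LieDer

/-! ### Families of tensor fields depending on a parameter -/

section LieFamily

variable {E : Type*} [NormedAddCommGroup E] [NormedSpace ℝ E]

/-- The spatial derivative of a function of time and space, from the total derivative. -/
lemma eventually_fderiv_prodMk {F : Type*} [NormedAddCommGroup F] [NormedSpace ℝ F]
    {f : ℝ × E → F} {p₀ : ℝ × E} (hf : ContDiffAt ℝ (∞ : ℕ∞ω) f p₀) : ∀ᶠ p in 𝓝 p₀, ∀ w,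
      fderiv ℝ (fun z => f (p.1, z)) p.2 w = fderiv ℝ f p (0, w) := by
  filter_upwards [(hf.of_le (m := 1) (by norm_cast)).eventually (by simp)] with p hp w
  have h1 : HasFDerivAt f (fderiv ℝ f p) (p.1, p.2) := (hp.differentiableAt (by simp)).hasFDerivAt
  have h2 : HasFDerivAt (fun z => f (p.1, z)) _ p.2 :=
    h1.comp p.2 (hasFDerivAt_prodMk_right p.1 p.2)
  rw [h2.fderiv]
  simp

lemma continuousAt_fderiv_of_contDiffAt {F : Type*} [NormedAddCommGroup F] [NormedSpace ℝ F]
    {f : ℝ × E → F} {p₀ : ℝ × E} (hf : ContDiffAt ℝ (∞ : ℕ∞ω) f p₀) :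
    ContinuousAt (fderiv ℝ f) p₀ :=
  (hf.fderiv_right (m := 0) (by simp)).continuousAt

lemma continuousAt_lieForm {H : ℝ × E → E →L[ℝ] E →L[ℝ] ℝ} {B : ℝ × E → E} {p₀ : ℝ × E}
    (hH : ∀ a b, ContDiffAt ℝ (∞ : ℕ∞ω) (fun p => H p a b) p₀) (hHc : ContinuousAt H p₀)
    (hB : ContDiffAt ℝ (∞ : ℕ∞ω) B p₀) (a b : E) :
    ContinuousAt (fun p : ℝ × E => lieForm (fun z => H (p.1, z)) (fun z => B (p.1, z)) p.2 a b)
      p₀ := by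
  have hB' := continuousAt_fderiv_of_contDiffAt hB
  have hBc := hB.continuousAt
  have h1 : ContinuousAt (fun p => fderiv ℝ (fun q => H q a b) p (0, B p) +
      H p (fderiv ℝ B p (0, a)) b + H p a (fderiv ℝ B p (0, b))) p₀ :=
    ((((continuousAt_fderiv_of_contDiffAt (hH a b)).clm_apply
      (continuousAt_const.prodMk hBc)).add ((hHc.clm_apply
        (hB'.clm_apply continuousAt_const)).clm_apply continuousAt_const)).add
      ((hHc.clm_apply continuousAt_const).clm_apply (hB'.clm_apply continuousAt_const)))
  refine h1.congr_of_eventuallyEq ?_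
  filter_upwards [eventually_fderiv_prodMk (hH a b), eventually_fderiv_prodMk hB] with p h2 h3
  simp only [lieForm, h2, h3]

end LieFamily

section Family

variable {M : Type*} [TopologicalSpace M] [ChartedSpace E3 M] [IsManifold (𝓡 3) ∞ M]

/-- Jointly continuous families of tensor fields. -/
def ContFam (k : ℝ → TField M) : Prop :=
  Continuous fun p : ℝ × M => Bundle.TotalSpace.mk' (E3 →L[ℝ] E3 →L[ℝ] ℝ)
    (E := fun x : M => Tan x →L[ℝ] Tan x →L[ℝ] ℝ) p.2 (k p.1 p.2)

/-- Jointly smooth families of tensor fields. -/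
def SmoothFam (k : ℝ → TField M) : Prop :=
  ContMDiff (𝓘(ℝ, ℝ).prod (𝓡 3)) ((𝓡 3).prod 𝓘(ℝ, E3 →L[ℝ] E3 →L[ℝ] ℝ)) ∞
    fun p : ℝ × M => Bundle.TotalSpace.mk' (E3 →L[ℝ] E3 →L[ℝ] ℝ)
      (E := fun x : M => Tan x →L[ℝ] Tan x →L[ℝ] ℝ) p.2 (k p.1 p.2)

/-- Jointly smooth families of vector fields. -/
def SmoothVFam (β : ℝ → (x : M) → Tan x) : Prop :=
  ContMDiff (𝓘(ℝ, ℝ).prod (𝓡 3)) (𝓡 3).tangent ∞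
    fun p : ℝ × M => (⟨p.2, β p.1 p.2⟩ : TangentBundle (𝓡 3) M)

lemma contFam_of_frame {k : ℝ → TField M} (H : ∀ s c, ∀ a b : E3, ContinuousAt
      (fun p : ℝ × M => k p.1 p.2 (frame c p.2 a) (frame c p.2 b)) (s, c)) : ContFam k := by
  refine continuous_iff_continuousAt.2 fun ⟨s, c⟩ => ?_
  rw [continuousAt_hom_bundle]
  refine ⟨continuousAt_snd, ?_⟩
  refine continuousAt_bilin fun a b => (H s c a b).congr_of_eventuallyEq ?_
  filter_upwards [continuousAt_snd.preimage_mem_nhds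
    ((chartAt E3 c).open_source.mem_nhds (mem_chart_source E3 c))] with p hp
  exact loc_apply (k p.1) hp a b

lemma ContFam.continuous_apply {k : ℝ → TField M} (hk : ContFam k) {X Y : (x : M) → Tan x}
    (hX : ContVF X) (hY : ContVF Y) :
    Continuous fun p : ℝ × M => k p.1 p.2 (X p.2) (Y p.2) := by
  rw [← continuousOn_univ]
  intro p _
  have h1 := hX.comp (continuous_snd (X := ℝ) (Y := M))
  have h2 := hY.comp (continuous_snd (X := ℝ) (Y := M))
  exact continuousWithinAt_of_trivial (ContinuousWithinAt.clm_bundle_apply₂ (𝕜 := ℝ)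
    (E₃ := fun _ : M => ℝ) (F₃ := ℝ) (Continuous.continuousWithinAt hk) h1.continuousWithinAt
      h2.continuousWithinAt)

lemma ContFam.contTF {k : ℝ → TField M} (hk : ContFam k) (s : ℝ) : ContTF (k s) :=
  contMDiff_zero_iff.2 (Continuous.comp hk (Continuous.prodMk_right s))

lemma contMDiffAt_symm_section {c : M} {y : E3} (hy : y ∈ (chartAt E3 c).target) (s : ℝ) (a : E3) :
    ContMDiffAt 𝓘(ℝ, ℝ × E3) (𝓡 3).tangent (∞ : ℕ∞ω) (fun p : ℝ × E3 =>
      (⟨(chartAt E3 c).symm p.2, mfderiv 𝓘(ℝ, E3) (𝓡 3) (chartAt E3 c).symm p.2 a⟩ :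
        TangentBundle (𝓡 3) M)) (s, y) := by
  set φ := chartAt E3 c
  have h0 : ContMDiffAt 𝓘(ℝ, ℝ × E3) (𝓡 3) (∞ : ℕ∞ω) (fun p : ℝ × E3 => φ.symm p.2) (s, y) :=
    ContMDiffAt.comp (g := φ.symm) (f := Prod.snd) (s, y)
      (contMDiffAt_symm_of_mem_maximalAtlas (IsManifold.chart_mem_maximalAtlas c) hy)
      contDiff_snd.contMDiff.contMDiffAt
  have h1 := ((contMDiffOn_frame c a).contMDiffAt
    (φ.open_source.mem_nhds (φ.map_target hy)))
  have h2 := ContMDiffAt.comp (f := fun p : ℝ × E3 => φ.symm p.2) (s, y) h1 h0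
  refine h2.congr_of_eventuallyEq ?_
  filter_upwards [continuousAt_snd.preimage_mem_nhds (φ.open_target.mem_nhds hy)] with p hp
  simp only [Function.comp]
  rw [frame_def, φ.right_inv hp]
  rfl

/-- The components of a smooth family in a chart are smooth. -/
lemma SmoothFam.contDiffAt_chartForm {k : ℝ → TField M} (hk : SmoothFam k) {c : M} {y : E3}
    (hy : y ∈ (chartAt E3 c).target) (s : ℝ) : ContDiffAt ℝ (∞ : ℕ∞ω)
      (fun p : ℝ × E3 => chartForm (k p.1) (chartAt E3 c) p.2) (s, y) := by
  rw [← contMDiffAt_iff_contDiffAt]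
  refine contMDiffAt_bilin fun a b => ?_
  set φ := chartAt E3 c
  have h0 : ContMDiffAt 𝓘(ℝ, ℝ × E3) (𝓡 3) (∞ : ℕ∞ω) (fun p : ℝ × E3 => φ.symm p.2) (s, y) :=
    ContMDiffAt.comp (g := φ.symm) (f := Prod.snd) (s, y)
      (contMDiffAt_symm_of_mem_maximalAtlas (IsManifold.chart_mem_maximalAtlas c) hy)
      contDiff_snd.contMDiff.contMDiffAt
  have h1 : ContMDiffAt 𝓘(ℝ, ℝ × E3) (𝓘(ℝ, ℝ).prod (𝓡 3)) (∞ : ℕ∞ω)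
      (fun p : ℝ × E3 => (p.1, φ.symm p.2)) (s, y) :=
    contDiff_fst.contMDiff.contMDiffAt.prodMk h0
  have h2 := ContMDiffAt.comp (f := fun p : ℝ × E3 => (p.1, φ.symm p.2)) (s, y)
    (ContMDiff.contMDiffAt hk) h1
  rw [← contMDiffWithinAt_univ]
  exact contMDiffWithinAt_of_trivial (ContMDiffWithinAt.clm_bundle_apply₂
    (E₃ := fun _ : M => ℝ) (F₃ := ℝ) h2.contMDiffWithinAt
    (contMDiffAt_symm_section hy s a).contMDiffWithinAt
    (contMDiffAt_symm_section hy s b).contMDiffWithinAt)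

lemma SmoothVFam.contDiffAt_chartVec {β : ℝ → (x : M) → Tan x} (hβ : SmoothVFam β) {c : M} {y : E3}
    (hy : y ∈ (chartAt E3 c).target) (s : ℝ) : ContDiffAt ℝ (∞ : ℕ∞ω)
      (fun p : ℝ × E3 => chartVec (β p.1) (chartAt E3 c) p.2) (s, y) := by
  rw [← contMDiffAt_iff_contDiffAt]
  set φ := chartAt E3 c with hφ
  have h0 : ContMDiffAt 𝓘(ℝ, ℝ × E3) (𝓡 3) (∞ : ℕ∞ω) (fun p : ℝ × E3 => φ.symm p.2) (s, y) :=
    ContMDiffAt.comp (g := φ.symm) (f := Prod.snd) (s, y)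
      (contMDiffAt_symm_of_mem_maximalAtlas (IsManifold.chart_mem_maximalAtlas c) hy)
      contDiff_snd.contMDiff.contMDiffAt
  have h1 : ContMDiffAt 𝓘(ℝ, ℝ × E3) (𝓘(ℝ, ℝ).prod (𝓡 3)) (∞ : ℕ∞ω)
      (fun p : ℝ × E3 => (p.1, φ.symm p.2)) (s, y) :=
    contDiff_fst.contMDiff.contMDiffAt.prodMk h0
  have h2 := ContMDiffAt.comp (f := fun p : ℝ × E3 => (p.1, φ.symm p.2)) (s, y)
    (ContMDiff.contMDiffAt hβ) h1
  have hb : φ.symm y ∈ (trivializationAt E3 (TangentSpace (𝓡 3) (M := M)) c).baseSet := by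
    simpa using φ.map_target hy
  have h3 := ((trivializationAt E3 (TangentSpace (𝓡 3) (M := M)) c).contMDiffAt_iff
    (IM := 𝓘(ℝ, ℝ × E3)) (n := (∞ : ℕ∞ω))
    (f := fun p : ℝ × E3 => (⟨φ.symm p.2, β p.1 (φ.symm p.2)⟩ : TangentBundle (𝓡 3) M)) (x₀ := (s, y))
    hb).1 h2
  refine h3.2.congr_of_eventuallyEq ?_
  filter_upwards [continuousAt_snd.preimage_mem_nhds (φ.open_target.mem_nhds hy)] with p hp
  have hs := φ.map_target hp
  have hb' : φ.symm p.2 ∈ (trivializationAt E3 (TangentSpace (𝓡 3) (M := M)) c).baseSet := by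
    simpa using hs
  have h4 := TangentBundle.continuousLinearMapAt_trivializationAt (I := 𝓡 3) hs
  have h5 := DFunLike.congr_fun h4 (β p.1 (φ.symm p.2))
  rw [Bundle.Trivialization.continuousLinearMapAt_apply,
    Bundle.Trivialization.coe_linearMapAt_of_mem _ hb'] at h5
  exact h5.symm

lemma SmoothFam.contTF {k : ℝ → TField M} (hk : SmoothFam k) (s : ℝ) : SmoothTF (k s) :=
  ContMDiff.comp (f := fun x : M => (s, x)) hk (contMDiff_const.prodMk contMDiff_id)

lemma chartForm_eq_frame (h : TField M) {c x : M} (hx : x ∈ (chartAt E3 c).source) (a b : E3) :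
    chartForm h (chartAt E3 c) (chartAt E3 c x) a b = h x (frame c x a) (frame c x b) :=
  tfield_congr h ((chartAt E3 c).left_inv hx) _ _

/-- The time derivative of a family of tensor fields, formed from the derivatives of its components
`k_s(∂_i, ∂_j)`. It is junk for families that are not differentiable in time. -/
noncomputable def hdot (k : ℝ → TField M) (s : ℝ) : TField M := fun x =>
  (∑ i, ∑ j, deriv (fun s => k s x (bvec x i) (bvec x j)) s •
    (EuclideanSpace.proj i : E3 →L[ℝ] ℝ).smulRight (EuclideanSpace.proj j : E3 →L[ℝ] ℝ) :
    E3 →L[ℝ] E3 →L[ℝ] ℝ)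

lemma hdot_apply (k : ℝ → TField M) (s : ℝ) (x : M) (u v : Tan x) :
    hdot k s x u v = ∑ i, ∑ j, deriv (fun s => k s x (bvec x i) (bvec x j)) s *
      (vcoord u i * vcoord v j) := by
  change (∑ i, ∑ j, deriv (fun s => k s x (bvec x i) (bvec x j)) s •
    (EuclideanSpace.proj i : E3 →L[ℝ] ℝ).smulRight (EuclideanSpace.proj j : E3 →L[ℝ] ℝ) :
    E3 →L[ℝ] E3 →L[ℝ] ℝ) u v = _
  simp only
  rfl

lemma frame_self_mfderiv (x : M) (u : Tan x) :
    (frame x x (mfderiv (𝓡 3) 𝓘(ℝ, E3) (chartAt E3 x) x u) : E3) = (u : E3) :=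
  mfderiv_symm_mfderiv (IsManifold.chart_mem_maximalAtlas x) (mem_chart_source E3 x) u

lemma SmoothFam.hasDerivAt_frame {k : ℝ → TField M} (hk : SmoothFam k) {c x : M}
    (hx : x ∈ (chartAt E3 c).source) (a b : E3) (s : ℝ) :
    HasDerivAt (fun s => k s x (frame c x a) (frame c x b))
      (fderiv ℝ (fun p : ℝ × E3 => chartForm (k p.1) (chartAt E3 c) p.2 a b)
        (s, chartAt E3 c x) (1, 0)) s := by
  set φ := chartAt E3 c
  have h1 : ContDiffAt ℝ (∞ : ℕ∞ω) (fun p : ℝ × E3 => chartForm (k p.1) φ p.2 a b) (s, φ x) :=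
    ((hk.contDiffAt_chartForm (φ.map_source hx) s).clm_apply contDiffAt_const).clm_apply
      contDiffAt_const
  have h2 := (h1.differentiableAt (by simp)).hasFDerivAt
  have h3 : HasDerivAt (fun s : ℝ => (s, φ x)) ((1 : ℝ), (0 : E3)) s :=
    (hasDerivAt_id s).prodMk (hasDerivAt_const s _)
  have h4 := h2.comp_hasDerivAt s h3
  refine h4.congr_of_eventuallyEq (.of_forall fun s => ?_)
  exact (chartForm_eq_frame (k s) hx a b).symm

lemma SmoothFam.hasDerivAt_apply {k : ℝ → TField M} (hk : SmoothFam k) (x : M) (u v : Tan x)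
    (s : ℝ) : HasDerivAt (fun s => k s x u v) (hdot k s x u v) s := by
  have h1 : ∀ a b : Tan x, DifferentiableAt ℝ (fun s => k s x a b) s := by
    intro a b
    have h2 := hk.hasDerivAt_frame (mem_chart_source E3 x)
      (mfderiv (𝓡 3) 𝓘(ℝ, E3) (chartAt E3 x) x a) (mfderiv (𝓡 3) 𝓘(ℝ, E3) (chartAt E3 x) x b) s
    refine h2.differentiableAt.congr_of_eventuallyEq (.of_forall fun s => ?_)
    exact (congrArg₂ (fun a b : E3 => k s x a b) (frame_self_mfderiv x a)
      (frame_self_mfderiv x b)).symm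
  rw [hdot_apply]
  have h3 : HasDerivAt (fun s => ∑ i, ∑ j, k s x (bvec x i) (bvec x j) *
      (vcoord u i * vcoord v j)) (∑ i, ∑ j, deriv (fun s => k s x (bvec x i) (bvec x j)) s *
      (vcoord u i * vcoord v j)) s :=
    HasDerivAt.fun_sum fun i _ => HasDerivAt.fun_sum fun j _ =>
      (h1 (bvec x i) (bvec x j)).hasDerivAt.mul_const _
  refine h3.congr_of_eventuallyEq (.of_forall fun s => ?_)
  simp only [bilin_eq_sum (k s x) u v]
  exact Finset.sum_congr rfl fun i _ => Finset.sum_congr rfl fun j _ => mul_comm _ _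

lemma SmoothFam.continuousAt_hdot_frame {k : ℝ → TField M} (hk : SmoothFam k) (s : ℝ) (c : M)
    (a b : E3) : ContinuousAt (fun p : ℝ × M =>
      hdot k p.1 p.2 (frame c p.2 a) (frame c p.2 b)) (s, c) := by
  set φ := chartAt E3 c with hφ
  have hc := mem_chart_source E3 c
  have h1 : ContDiffAt ℝ (∞ : ℕ∞ω) (fun p : ℝ × E3 => chartForm (k p.1) φ p.2 a b) (s, φ c) :=
    ((hk.contDiffAt_chartForm (φ.map_source hc) s).clm_apply contDiffAt_const).clm_apply
      contDiffAt_const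
  have h2 : ContinuousAt (fun p : ℝ × M => (p.1, φ p.2)) (s, c) :=
    continuousAt_fst.prodMk ((φ.continuousAt hc).comp continuousAt_snd)
  have h3 := ((continuousAt_fderiv_of_contDiffAt h1).clm_apply
    (continuousAt_const (y := ((1 : ℝ), (0 : E3))))).comp_of_eq h2 rfl
  refine h3.congr_of_eventuallyEq ?_
  filter_upwards [continuousAt_snd.preimage_mem_nhds (φ.open_source.mem_nhds hc)] with p hp
  exact (hk.hasDerivAt_apply p.2 _ _ p.1).unique (hk.hasDerivAt_frame hp a b p.1)

/-- The time derivative of a smooth family is jointly continuous. -/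
lemma SmoothFam.contFam_hdot {k : ℝ → TField M} (hk : SmoothFam k) : ContFam (hdot k) :=
  contFam_of_frame hk.continuousAt_hdot_frame

/-- The Lie derivative of a smooth family along a smooth family is jointly continuous. -/
lemma continuousAt_lieDer_frame {k : ℝ → TField M} {β : ℝ → (x : M) → Tan x} (hk : SmoothFam k)
    (hβ : SmoothVFam β) (s : ℝ) (c : M) (a b : E3) : ContinuousAt (fun p : ℝ × M =>
      lieDer (β p.1) (k p.1) p.2 (frame c p.2 a) (frame c p.2 b)) (s, c) := by
  set φ := chartAt E3 c with hφ
  have hc := mem_chart_source E3 c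
  have h1 := hk.contDiffAt_chartForm (φ.map_source hc) s
  have h2 : ContinuousAt (fun p : ℝ × M => (p.1, φ p.2)) (s, c) :=
    continuousAt_fst.prodMk ((φ.continuousAt hc).comp continuousAt_snd)
  have h3 := (continuousAt_lieForm
    (H := fun p : ℝ × E3 => chartForm (k p.1) φ p.2)
    (B := fun p : ℝ × E3 => chartVec (β p.1) φ p.2) (p₀ := (s, φ c))
    (fun a b => (h1.clm_apply contDiffAt_const).clm_apply contDiffAt_const) h1.continuousAt
    (hβ.contDiffAt_chartVec (φ.map_source hc) s) a b).comp_of_eq h2 rfl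
  refine h3.congr_of_eventuallyEq ?_
  filter_upwards [continuousAt_snd.preimage_mem_nhds (φ.open_source.mem_nhds hc)] with p hp
  refine lieDer_frame hp (fun c' y hy => ?_) (fun c' y hy => ?_) a b
  · exact ((hk.contDiffAt_chartForm hy p.1).differentiableAt (by simp)).comp y
      (hasFDerivAt_prodMk_right p.1 y).differentiableAt
  · exact ((hβ.contDiffAt_chartVec hy p.1).differentiableAt (by simp)).comp y
      (hasFDerivAt_prodMk_right p.1 y).differentiableAt

end Family

/-! ### Localisation of estimates in the mean -/

section Localisation

variable {M : Type*} [TopologicalSpace M] [T2Space M] [CompactSpace M]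
  [ChartedSpace E3 M] [IsManifold (𝓡 3) ∞ M]

lemma exists_bump {c : M} {U : Set M} (hU : U ∈ 𝓝 c) : ∃ χ : M → ℝ,
    ContMDiff (𝓡 3) 𝓘(ℝ, ℝ) (∞ : ℕ∞ω) χ ∧ (∀ x, 0 ≤ χ x) ∧ χ c = 1 ∧ tsupport χ ⊆ U := by
  obtain ⟨f, -, hf⟩ := (SmoothBumpFunction.nhds_basis_tsupport (I := 𝓡 3) c).mem_iff.1 hU
  exact ⟨f, f.contMDiff, fun x => f.nonneg, f.eq_one, hf⟩

/-- The components of a coordinate field of one chart, read in another chart, are smooth. -/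
lemma contMDiffAt_mfderiv_frame {c c' : M} (hc : c' ∈ (chartAt E3 c).source) (a : E3) :
    ContMDiffAt (𝓡 3) 𝓘(ℝ, E3) (∞ : ℕ∞ω)
      (fun x => mfderiv (𝓡 3) 𝓘(ℝ, E3) (chartAt E3 c) x (frame c' x a)) c' := by
  have h2 := (contMDiffOn_frame c' a).contMDiffAt
    ((chartAt E3 c').open_source.mem_nhds (mem_chart_source E3 c'))
  have hb : c' ∈ (trivializationAt E3 (TangentSpace (𝓡 3) (M := M)) c).baseSet := by
    simpa using hc
  have h3 := ((trivializationAt E3 (TangentSpace (𝓡 3) (M := M)) c).contMDiffAt_iff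
    (IM := 𝓡 3) (n := (∞ : ℕ∞ω))
    (f := fun x => (⟨x, frame c' x a⟩ : TangentBundle (𝓡 3) M)) (x₀ := c') hb).1 h2
  refine h3.2.congr_of_eventuallyEq ?_
  filter_upwards [(chartAt E3 c).open_source.mem_nhds hc] with x hs
  have hb' : x ∈ (trivializationAt E3 (TangentSpace (𝓡 3) (M := M)) c).baseSet := by
    simpa using hs
  have h4 := TangentBundle.continuousLinearMapAt_trivializationAt (I := 𝓡 3) hs
  have h5 := DFunLike.congr_fun h4 (frame c' x a)
  rw [Bundle.Trivialization.continuousLinearMapAt_apply,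
    Bundle.Trivialization.coe_linearMapAt_of_mem _ hb'] at h5
  exact h5.symm

lemma SmoothTF.smul {φ : TField M} (hφ : SmoothTF φ) {χ : M → ℝ}
    (hχ : ContMDiff (𝓡 3) 𝓘(ℝ, ℝ) (∞ : ℕ∞ω) χ) : SmoothTF (fun x => χ x • φ x) := by
  refine contMDiff_of_frame fun c a b => ?_
  have h1 := ((contMDiff_iff_loc φ _).1 hφ c).clm_apply (contMDiffAt_const (c := a)) |>.clm_apply
    (contMDiffAt_const (c := b))
  refine ((hχ c).mul h1).congr_of_eventuallyEq ?_
  filter_upwards [(chartAt E3 c).open_source.mem_nhds (mem_chart_source E3 c)] with x hx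
  simp only [Pi.mul_apply]
  rw [loc_apply φ hx]
  rfl

/-- Every symmetric bilinear form on a tangent space is the value of a smooth field: its extension
with constant coefficients in a chart, times a bump function. -/
lemma exists_smoothTF_eq (c : M) (a : Tan c →L[ℝ] Tan c →L[ℝ] ℝ) (ha : ∀ u v, a u v = a v u) :
    ∃ φ : TField M, SmoothTF φ ∧ IsSymm φ ∧ ∀ u v, φ c u v = a u v := by
  obtain ⟨χ, hχ, hχ0, hχc, hχu⟩ := exists_bump
    ((chartAt E3 c).open_source.mem_nhds (mem_chart_source E3 c))
  let θ : (x : M) → Tan x →L[ℝ] E3 := fun x => mfderiv (𝓡 3) 𝓘(ℝ, E3) (chartAt E3 c) x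
  let G : E3 →L[ℝ] E3 →L[ℝ] ℝ := pullForm (frame c c) a
  have hG : ∀ u v, G u v = a (frame c c u) (frame c c v) := fun u v => rfl
  let φ : TField M := fun x => χ x • pullForm (θ x) G
  have hφ : ∀ x u v, φ x u v = χ x * a (frame c c (θ x u)) (frame c c (θ x v)) :=
    fun x u v => rfl
  refine ⟨φ, contMDiff_of_frame fun c' u v => ?_, fun x w z => ?_, fun u v => ?_⟩
  · by_cases hc : c' ∈ (chartAt E3 c).source
    · have h1 : ContMDiffAt (𝓡 3) 𝓘(ℝ, ℝ) (∞ : ℕ∞ω)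
          (fun x => G (θ x (frame c' x u)) (θ x (frame c' x v))) c' :=
        ((contMDiffAt_const (c := G)).clm_apply (contMDiffAt_mfderiv_frame hc u)).clm_apply
          (contMDiffAt_mfderiv_frame hc v)
      exact (hχ c').mul h1
    · refine (contMDiffAt_const (c := (0 : ℝ))).congr_of_eventuallyEq ?_
      filter_upwards [(isClosed_tsupport χ).isOpen_compl.mem_nhds
        (show c' ∈ (tsupport χ)ᶜ from fun h => hc (hχu h))] with x hx
      rw [hφ, image_eq_zero_of_notMem_tsupport hx, zero_mul]
  · rw [hφ, hφ, ha]
  · have h1 : ∀ u : Tan c, frame c c (θ c u) = u := fun u => frame_self_mfderiv c u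
    rw [hφ, hχc, one_mul, h1, h1]

variable [SecondCountableTopology M] [MeasurableSpace M] [BorelSpace M] {γ : TField M} {n : ℕ} {X : Fin n → (x : M) → Tan x}

namespace TightFrame

variable (F : TightFrame γ X)

include F

lemma continuous_pair {h k : TField M} (hh : ContTF h) (hk : ContTF k) :
    Continuous fun x => pair γ x (fun u v => h x u v) (fun u v => k x u v) := by
  simp only [F.pair_eq]
  exact continuous_finsetSum _ fun q _ => (F.continuous_hat hh q).mul (F.continuous_hat hk q)

/-- A pointwise estimate from its integrated form: test with a bump function times a smooth
extension of the value at the point. -/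
lemma tlen_le_of_ip_le {V : TField M} (hV : ContTF V) (hs : IsSymm V) {C : ℝ} (hC : 0 ≤ C)
    (H : ∀ φ, SmoothTF φ → IsSymm φ → |ip γ V φ| ≤ C * norm1 γ φ) (c : M) :
    tlen γ c (V c) ≤ C := by
  by_contra! hlt
  have := F.isFinite_vol
  have := F.isOpenPos_vol
  obtain ⟨φ, hφ, hφs, hφc⟩ := exists_smoothTF_eq c (V c) (hs c)
  have hφc' : φ c = V c :=
    ContinuousLinearMap.ext fun u => ContinuousLinearMap.ext fun v => hφc u v
  -- The estimate fails where `u` is positive, in particular at `c`.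
  set u : M → ℝ := fun x => pair γ x (fun u v => V x u v) (fun u v => φ x u v) -
    C * tlen γ x (φ x) with hu
  have hp := F.continuous_pair hV hφ.contTF
  have ht : Continuous fun x => tlen γ x (φ x) := (F.continuous_pair hφ.contTF hφ.contTF).sqrt
  have huc : Continuous u := hp.sub (ht.const_mul C)
  have hpos : 0 < u c := by
    have h0 : pair γ c (fun u v => V c u v) (fun u v => V c u v) = tlen γ c (V c) ^ 2 := by
      rw [F.tlen_sq, F.pair_eq]
      simp only [pow_two]
    simp only [hu, hφc', h0]
    nlinarith
  obtain ⟨χ, hχ, hχ0, hχc, hχu⟩ := exists_bump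
    ((isOpen_lt continuous_const huc).mem_nhds (show c ∈ {x | 0 < u x} from hpos))
  have hχz : ∀ x, 0 ≤ χ x * u x := by
    intro x
    by_cases hx : x ∈ tsupport χ
    · exact mul_nonneg (hχ0 x) (hχu hx).le
    · rw [image_eq_zero_of_notMem_tsupport hx, zero_mul]
  have h1 : 0 < ∫ x, χ x * u x ∂(vol γ) :=
    (hχ.continuous.mul huc).integral_pos_of_hasCompactSupport_nonneg_nonzero
      (HasCompactSupport.of_compactSpace _) hχz (x := c) (by
        rw [hχc, one_mul]; exact hpos.ne')
  have h2 := H (fun x => χ x • φ x) (hφ.smul hχ) fun x w z =>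
    congrArg (fun y : ℝ => χ x * y) (hφs x w z)
  have h3 : ip γ V (fun x => χ x • φ x) = ∫ x, χ x * pair γ x (fun u v => V x u v) (fun u v => φ x u v)
      ∂(vol γ) :=
    integral_congr_ae (.of_forall fun x => pair_smul_right γ x (χ x) _ _)
  have h4 : norm1 γ (fun x => χ x • φ x) = ∫ x, χ x * tlen γ x (φ x) ∂(vol γ) := by
    refine integral_congr_ae (.of_forall fun x => ?_)
    change Real.sqrt (pair γ x (fun u v => χ x * φ x u v) (fun u v => χ x * φ x u v)) = _
    rw [pair_smul_left, pair_smul_right, ← mul_assoc, Real.sqrt_mul (mul_self_nonneg _),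
      Real.sqrt_mul_self (hχ0 x)]
    rfl
  have hi : ∀ {f : M → ℝ}, Continuous f → Integrable f (vol γ) := fun hf =>
    hf.integrable_of_hasCompactSupport (HasCompactSupport.of_compactSpace _)
  have h5 : ∫ x, χ x * u x ∂(vol γ) = ip γ V (fun x => χ x • φ x) - C * norm1 γ (fun x => χ x • φ x) := by
    have h6 := integral_sub (hi (hχ.continuous.mul hp)) ((hi (hχ.continuous.mul ht)).const_mul C)
    simp only [Pi.mul_apply] at h6
    rw [h3, h4, ← integral_const_mul, ← h6]
    refine integral_congr_ae (.of_forall fun x => ?_)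
    simp only [hu]
    ring
  linarith [le_abs_self (ip γ V (fun x => χ x • φ x))]

end TightFrame

end Localisation

/-! ### The drift at the means -/

section Defect

variable {M : Type*} [TopologicalSpace M] [ChartedSpace E3 M] [IsManifold (𝓡 3) ∞ M]
  [MeasurableSpace M] {Ω : Type*} [MeasurableSpace Ω]
variable {P : Measure Ω} {γ : TField M} {l : ℝ} {D : ℝ → TField M → TField M}
  {g : ℝ → Ω → TField M} {L r : ℝ} {h : ℝ → TField M} {α N : ℝ → M → ℝ}
  {β : ℝ → (x : M) → Tan x} {q : TField M → ℝ≥0∞} {A B κ : ℝ}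

/-- The difference between the velocity of the means and the drift at the means. -/
noncomputable def flowDefect (D : ℝ → TField M → TField M) (h : ℝ → TField M) (s : ℝ) : TField M :=
  hdot h s - D s (h s)

namespace IsSemiclassical

variable (hS : IsSemiclassical P γ l D g L r h α N β q A B κ)

include hS

lemma smoothFam : SmoothFam h := hS.smooth_h

lemma extCurv_eq (s : ℝ) (x : M) (u v : Tan x) : extCurv α β h s x u v =
    -(1 / (2 * α s x)) * (hdot h s x u v - lieDer (β s) (h s) x u v) := by
  rw [extCurv, (hS.smoothFam.hasDerivAt_apply x u v s).deriv]

lemma drift_apply {s : ℝ} (hs : s ∈ Icc 0 r) (x : M) (u v : Tan x) : D s (h s) x u v =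
    N s x / α s x * hdot h s x u v + (1 - N s x / α s x) * lieDer (β s) (h s) x u v := by
  have hα := (hS.α_pos s x).ne'
  rw [hS.einstein s hs, hS.extCurv_eq]
  field_simp
  ring

/-- The velocity of the means is the drift with the proper lapse in place of the lapse of the
Einstein flow. -/
lemma flowDefect_apply {s : ℝ} (hs : s ∈ Icc 0 r) (x : M) (u v : Tan x) :
    flowDefect D h s x u v = -2 * (α s x - N s x) * extCurv α β h s x u v := by
  have hα := (hS.α_pos s x).ne'
  change hdot h s x u v - D s (h s) x u v = _
  rw [hS.einstein s hs, hS.extCurv_eq]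
  field_simp
  ring

lemma isSymm_hdot {s : ℝ} (hs : s ∈ Icc 0 r) : IsSymm (hdot h s) := by
  intro x u v
  have h1 := (hS.smoothFam.hasDerivAt_apply x u v s).hasDerivWithinAt (s := Icc 0 r)
  have h2 := (hS.smoothFam.hasDerivAt_apply x v u s).hasDerivWithinAt (s := Icc 0 r)
  -- The means are known to be symmetric only on `[0, r]`, so at the endpoints the derivative has to
  -- be compared within that interval.
  refine UniqueDiffWithinAt.eq_deriv _ (uniqueDiffOn_Icc hS.duration_pos s hs) h1
    (h2.congr (fun t ht => (hS.metric t ht).symm x u v) ((hS.metric s hs).symm x u v))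

lemma isSymm_drift {s : ℝ} (hs : s ∈ Icc 0 r) : IsSymm (D s (h s)) := by
  intro x u v
  rw [hS.drift_apply hs, hS.drift_apply hs, hS.isSymm_hdot hs,
    lieDer_symm (hS.metric s hs).symm]

/-- The drift at the means is jointly continuous. It is controlled only on `[0, r]`, so the time is
clamped to that interval. -/
lemma contFam_drift : ContFam fun s =>
    D (projIcc 0 r hS.duration_pos.le s) (h (projIcc 0 r hS.duration_pos.le s)) := by
  set c : ℝ → ℝ := fun s => projIcc 0 r hS.duration_pos.le s
  have hc : Continuous c := continuous_subtype_val.comp continuous_projIcc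
  refine contFam_of_frame fun s x a b => ?_
  have h0 : ContinuousAt (fun p : ℝ × M => (c p.1, p.2)) (s, x) := by fun_prop
  have hα : Continuous fun p : ℝ × M => α p.1 p.2 := hS.smooth_α.continuous
  have hN : Continuous fun p : ℝ × M => N p.1 p.2 := hS.smooth_N.continuous
  have hNα : Continuous fun p : ℝ × M => N p.1 p.2 / α p.1 p.2 :=
    hN.div hα fun p => (hS.α_pos _ _).ne'
  have h1 := hS.smoothFam.continuousAt_hdot_frame (c s) x a b
  have h2 := continuousAt_lieDer_frame hS.smoothFam hS.smooth_β (c s) x a b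
  have h3 := (hNα.continuousAt.mul h1).add
    (((continuous_const (y := (1 : ℝ))).sub hNα).continuousAt.mul h2)
  refine (h3.comp_of_eq h0 rfl).congr_of_eventuallyEq (.of_forall fun p => ?_)
  exact hS.drift_apply (projIcc 0 r hS.duration_pos.le p.1).2 p.2 _ _

lemma contTF_drift {s : ℝ} (hs : s ∈ Icc 0 r) : ContTF (D s (h s)) := by
  have h1 := hS.contFam_drift.contTF s
  rwa [projIcc_of_mem _ hs] at h1

end IsSemiclassical

end Defect

section ParametricIntegral

/-- Differentiation under the integral sign over a compact space. -/
lemma hasDerivAt_integral_of_compactSpace {Z : Type*} [TopologicalSpace Z] [CompactSpace Z]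
    [MeasurableSpace Z] [OpensMeasurableSpace Z] {μ : Measure Z} [IsFiniteMeasure μ]
    {f f' : ℝ → Z → ℝ} (hf : Continuous fun p : ℝ × Z => f p.1 p.2)
    (hf' : Continuous fun p : ℝ × Z => f' p.1 p.2)
    (hd : ∀ s z, HasDerivAt (fun s => f s z) (f' s z) s) (s : ℝ) :
    HasDerivAt (fun s => ∫ z, f s z ∂μ) (∫ z, f' s z ∂μ) s := by
  obtain ⟨C, hC⟩ := (isCompact_Icc (a := s - 1) (b := s + 1)).prod
    (isCompact_univ (X := Z)) |>.exists_bound_of_continuousOn hf'.continuousOn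
  have h2 : ∀ s, Continuous (f s) := fun s => hf.comp (Continuous.prodMk_right s)
  have h3 : Continuous (f' s) := hf'.comp (Continuous.prodMk_right s)
  exact (hasDerivAt_integral_of_dominated_loc_of_deriv_le (bound := fun _ => C)
    (s := Icc (s - 1) (s + 1)) (Icc_mem_nhds (by linarith) (by linarith))
    (.of_forall fun s => (h2 s).aestronglyMeasurable)
    ((h2 s).integrable_of_hasCompactSupport (HasCompactSupport.of_compactSpace _))
    h3.aestronglyMeasurable (.of_forall fun z t ht => hC (t, z) ⟨ht, mem_univ z⟩)
    (integrable_const C) (.of_forall fun z t _ => hd t z)).2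

variable {M : Type*} [TopologicalSpace M] [T2Space M] [CompactSpace M] [SecondCountableTopology M]
  [ChartedSpace E3 M] [IsManifold (𝓡 3) ∞ M] [MeasurableSpace M] [BorelSpace M]
variable {γ : TField M} {n : ℕ} {X : Fin n → (x : M) → Tan x}

namespace TightFrame

variable (F : TightFrame γ X)

include F

lemma continuous_hat_fam {k : ℝ → TField M} (hk : ContFam k) :
    Continuous fun p : ℝ × (M × (Fin n × Fin n)) => hat X (k p.1) p.2 := by
  have h1 : Continuous fun p : (ℝ × M) × (Fin n × Fin n) => hat X (k p.1.1) (p.1.2, p.2) :=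
    continuous_prod_of_discrete_right.2 fun q => hk.continuous_apply (F.cont q.1) (F.cont q.2)
  exact h1.comp (Homeomorph.prodAssoc ℝ M (Fin n × Fin n)).symm.continuous

lemma continuous_hat_prod {φ : TField M} (hφ : ContTF φ) : Continuous (hat X φ) :=
  continuous_prod_of_discrete_right.2 (F.continuous_hat hφ)

lemma continuous_integral_hat {k : ℝ → TField M} (hk : ContFam k) {φ : TField M} (hφ : ContTF φ) :
    Continuous fun s => ∫ z, hat X (k s) z * hat X φ z ∂(volZ γ n) := by
  have := F.isFinite_vol
  have h1 : Continuous (Function.uncurry fun (s : ℝ) z => hat X (k s) z * hat X φ z) :=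
    (F.continuous_hat_fam hk).mul ((F.continuous_hat_prod hφ).comp continuous_snd)
  simpa using continuous_parametric_integral_of_continuous (μ := volZ γ n) h1 isCompact_univ

lemma hasDerivAt_integral_hat {k : ℝ → TField M} (hk : SmoothFam k) {φ : TField M} (hφ : ContTF φ)
    (s : ℝ) : HasDerivAt (fun s => ∫ z, hat X (k s) z * hat X φ z ∂(volZ γ n))
      (∫ z, hat X (hdot k s) z * hat X φ z ∂(volZ γ n)) s := by
  have := F.isFinite_vol
  have hφc := (F.continuous_hat_prod hφ).comp (continuous_snd (X := ℝ))
  have hd : ∀ (s : ℝ) (z : M × (Fin n × Fin n)),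
      HasDerivAt (fun s => hat X (k s) z * hat X φ z) (hat X (hdot k s) z * hat X φ z) s := by
    intro s z
    have h1 : HasDerivAt (fun s => hat X (k s) z) (hat X (hdot k s) z) s :=
      hk.hasDerivAt_apply z.1 (X z.2.1 z.1) (X z.2.2 z.1) s
    exact h1.mul_const _
  exact hasDerivAt_integral_of_compactSpace ((F.continuous_hat_fam hk.continuous).mul hφc)
    ((F.continuous_hat_fam hk.contFam_hdot).mul hφc) hd s

end TightFrame

end ParametricIntegral

/-! ### The averaged equation -/

section Averaging

lemma ennreal_le_one_add_sq (a : ℝ≥0∞) : a ≤ 1 + a ^ 2 := by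
  rcases le_total a 1 with h | h
  · exact h.trans le_self_add
  · calc a = a * 1 := (mul_one a).symm
      _ ≤ a * a := by gcongr
      _ = a ^ 2 := (pow_two a).symm
      _ ≤ 1 + a ^ 2 := le_add_self

variable {M : Type*} [TopologicalSpace M] [T2Space M] [CompactSpace M] [SecondCountableTopology M]
  [ChartedSpace E3 M] [IsManifold (𝓡 3) ∞ M] [MeasurableSpace M] [BorelSpace M]
variable {γ : TField M} {n : ℕ} {X : Fin n → (x : M) → Tan x}
variable {Ω : Type*} [MeasurableSpace Ω] {P : Measure Ω} [IsProbabilityMeasure P]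
  {K : TKernel M} {W : ℝ → Ω → TField M} {lam : ℕ → ℝ} {e : ℕ → TField M}

namespace TightFrame

variable (F : TightFrame γ X) (hK : IsCovKernel γ K) (hW : IsWiener P γ K W)
  (he : IsEigensystem γ K lam e)

include F hK hW in
/-- The noise is centred when tested against a continuous field. -/
lemma integral_ip_wiener_field {φ : TField M} (hφ : ContTF φ) (hs : IsSymm φ) (t : ℝ≥0) :
    Integrable (fun ξ => ip γ (W t ξ) φ) P ∧ ∫ ξ, ip γ (W t ξ) φ ∂P = 0 := by
  have := F.isFinite_vol
  have hc := F.continuous_hat_prod hφ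
  obtain ⟨C, hC⟩ := isCompact_univ.exists_bound_of_continuousOn hc.continuousOn
  have hC' : ∀ z, |hat X φ z| ≤ C := fun z => hC z (mem_univ z)
  have hae : (fun ξ => ∫ z, wienerZ X W (t, z) ξ * hat X φ z ∂(volZ γ n)) =ᵐ[P]
      fun ξ => ip γ (W t ξ) φ := by
    filter_upwards [hW.mem] with ξ hξ
    exact (F.ip_eq_integral (hξ t t.2) (F.memField_cont hφ hs 2)).symm
  have hm : Measurable (hat X φ) :=
    measurable_of_slices fun q => (F.continuous_hat hφ q).measurable
  have h1 := memLp_integral_field (F.memLp_wienerZ hK hW t) hm hC'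
  have h2 := integral_mul_integral_field (F.memLp_wienerZ hK hW t) hm hC' (memLp_const (1 : ℝ))
  simp only [one_mul, integral_wienerZ hW, mul_zero, integral_zero] at h2
  exact ⟨(h1.integrable (by norm_num)).congr hae, (integral_congr_ae hae).symm.trans h2⟩

include F he in
/-- A random field whose modes are centred is centred when tested against any field of class `L²`,
by dominated convergence of its expansion. -/
lemma integral_ip_of_modes {Z : Ω → TField M} (hZ : ∀ᵐ ξ ∂P, MemField γ 2 (Z ξ))
    (hm : ∀ m, Integrable (fun ξ => ip γ (Z ξ) (e m)) P ∧ ∫ ξ, ip γ (Z ξ) (e m) ∂P = 0)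
    (hfin : ∫⁻ ξ, ENNReal.ofReal (norm2 γ (Z ξ)) ∂P ≠ (⊤ : ℝ≥0∞)) {ψ : TField M} (hψ : MemField γ 2 ψ) :
    Integrable (fun ξ => ip γ (Z ξ) ψ) P ∧ ∫ ξ, ip γ (Z ξ) ψ ∂P = 0 := by
  have := F.isFinite_vol
  have hsq : ∀ {k : TField M}, MemField γ 2 k → HasSum (fun m => ip γ k (e m) ^ 2) (norm2 γ k ^ 2) := by
    intro k hk
    have h1 := F.hasSum_ip he hk hk
    rw [norm2, Real.sq_sqrt]
    · simpa only [pow_two] using h1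
    · rw [F.ip_eq_inner hk hk]
      exact real_inner_self_nonneg
  have hn : ∀ k, 0 ≤ norm2 γ k := fun k => Real.sqrt_nonneg _
  -- The norm is measurable, being a limit of expressions in the modes.
  have hmeas : AEMeasurable (fun ξ => norm2 γ (Z ξ)) P := by
    have h1 : AEMeasurable (fun ξ => norm2 γ (Z ξ) ^ 2) P := by
      refine aemeasurable_of_tendsto_metrizable_ae atTop
        (f := fun N ξ => ∑ m ∈ Finset.range N, ip γ (Z ξ) (e m) ^ 2)
        (fun N => Finset.aemeasurable_fun_sum _ fun m _ => (hm m).1.aemeasurable.pow_const 2) ?_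
      filter_upwards [hZ] with ξ hξ
      exact (hsq hξ).tendsto_sum_nat
    refine (h1.sqrt).congr (.of_forall fun ξ => Real.sqrt_sq (hn _))
  have hint : Integrable (fun ξ => norm2 γ (Z ξ)) P := by
    refine ⟨hmeas.aestronglyMeasurable, ?_⟩
    rw [hasFiniteIntegral_iff_ofReal (.of_forall fun ξ => hn _)]
    exact lt_top_iff_ne_top.2 hfin
  have hlim : ∀ᵐ ξ ∂P, Tendsto (fun N => ∑ m ∈ Finset.range N, ip γ (Z ξ) (e m) * ip γ ψ (e m))
      atTop (𝓝 (ip γ (Z ξ) ψ)) := by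
    filter_upwards [hZ] with ξ hξ
    exact (F.hasSum_ip he hξ hψ).tendsto_sum_nat
  have hpart : ∀ N : ℕ, Integrable
      (fun ξ => ∑ m ∈ Finset.range N, ip γ (Z ξ) (e m) * ip γ ψ (e m)) P := fun N =>
    integrable_finsetSum _ fun m _ => (hm m).1.mul_const _
  have hbound : ∀ N : ℕ, ∀ᵐ ξ ∂P, ‖∑ m ∈ Finset.range N, ip γ (Z ξ) (e m) * ip γ ψ (e m)‖ ≤
      norm2 γ (Z ξ) * norm2 γ ψ := by
    intro N
    filter_upwards [hZ] with ξ hξ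
    rw [Real.norm_eq_abs]
    refine abs_le_of_sq_le_sq' ?_ (mul_nonneg (hn _) (hn _)) |> abs_le.2
    rw [mul_pow]
    refine (Finset.sum_mul_sq_le_sq_mul_sq _ _ _).trans ?_
    gcongr
    · exact sum_le_hasSum _ (fun m _ => sq_nonneg _) (hsq hξ)
    · exact sum_le_hasSum _ (fun m _ => sq_nonneg _) (hsq hψ)
  have hb := hint.mul_const (norm2 γ ψ)
  have h1 := tendsto_integral_of_dominated_convergence _
    (fun N => (hpart N).aestronglyMeasurable) hb hbound hlim
  constructor
  · refine hb.mono' ?_ ?_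
    · exact (aemeasurable_of_tendsto_metrizable_ae atTop
        (fun N => (hpart N).aemeasurable) hlim).aestronglyMeasurable
    · filter_upwards [hZ] with ξ hξ
      exact F.abs_ip_le hξ hψ
  · refine tendsto_nhds_unique h1 ?_
    have h2 : ∀ N : ℕ, ∫ ξ, ∑ m ∈ Finset.range N, ip γ (Z ξ) (e m) * ip γ ψ (e m) ∂P = 0 := by
      intro N
      rw [integral_finsetSum _ fun m _ => (hm m).1.mul_const _]
      refine Finset.sum_eq_zero fun m _ => ?_
      rw [integral_mul_const, (hm m).2, zero_mul]
    simp only [h2]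
    exact tendsto_const_nhds

variable {l : ℝ} {D : ℝ → TField M → TField M}
  {g : ℝ → Ω → TField M} {L r : ℝ} {h : ℝ → TField M} {α N : ℝ → M → ℝ}
  {β : ℝ → (x : M) → Tan x} {q : TField M → ℝ≥0∞} {A B κ : ℝ}
  (hg : SolvesSDE P γ l D W g)
  (hS : IsSemiclassical P γ l D g L r h α N β q A B κ)

include F hS

lemma memField_mean {s : ℝ} (hs : s ∈ Icc 0 r) (p : ℝ≥0∞) : MemField γ p (h s) :=
  F.memField_cont (hS.smoothFam.contTF s).contTF (hS.metric s hs).symm p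

lemma memField_drift {s : ℝ} (hs : s ∈ Icc 0 r) (p : ℝ≥0∞) : MemField γ p (D s (h s)) :=
  F.memField_cont (hS.contTF_drift hs) (hS.isSymm_drift hs) p

include hg

lemma memField_fluctuation {s : ℝ} (hs : s ∈ Icc 0 r) : ∀ᵐ ξ ∂P, MemField γ 2 (g s ξ - h s) := by
  filter_upwards [hg.mem] with ξ hξ
  exact F.memField_sub (hξ s hs.1) (F.memField_mean hS hs 2)

include he

/-- The fluctuations about the mean are centred. -/
lemma integral_ip_fluctuation {s : ℝ} (hs : s ∈ Icc 0 r) {ψ : TField M} (hψ : MemField γ 2 ψ) :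
    Integrable (fun ξ => ip γ (g s ξ - h s) ψ) P ∧ ∫ ξ, ip γ (g s ξ - h s) ψ ∂P = 0 := by
  have hmem := F.memField_fluctuation hg hS hs
  refine F.integral_ip_of_modes he hmem (fun m => ?_) ?_ hψ
  · have h1 := hS.mean s hs (e m) (he.cont m) (he.symm m)
    have h2 : (fun ξ => ip γ (g s ξ) (e m) - ip γ (h s) (e m)) =ᵐ[P]
        fun ξ => ip γ (g s ξ - h s) (e m) := by
      filter_upwards [hg.mem] with ξ hξ
      exact (F.ip_sub_left (hξ s hs.1) (F.memField_mean hS hs 2) (F.memField_eigen he m 2)).symm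
    refine ⟨(h1.1.sub (integrable_const _)).congr h2, (integral_congr_ae h2).symm.trans ?_⟩
    rw [integral_sub h1.1 (integrable_const _), h1.2, integral_const, probReal_univ, one_smul,
      sub_self]
  · refine ne_of_lt (lt_of_le_of_lt (lintegral_mono_ae (g := fun ξ => 1 + q (g s ξ - h s) ^ 2) ?_) ?_)
    · filter_upwards [hmem] with ξ hξ
      exact (hS.norm_le _ hξ).trans (ennreal_le_one_add_sq _)
    · rw [lintegral_add_left measurable_const]
      refine ENNReal.add_lt_top.2 ⟨by simp only [lintegral_const, measure_univ, mul_one, ENNReal.one_lt_top], (hS.fluctuation s hs).trans_lt ENNReal.ofReal_lt_top⟩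

end TightFrame

lemma tfield_add_sub (h k : TField M) : h + (k - h) = k := by
  funext x
  refine ContinuousLinearMap.ext fun u => ContinuousLinearMap.ext fun v => ?_
  exact add_sub_cancel (h x u v) (k x u v)

namespace TightFrame

variable (F : TightFrame γ X) (hK : IsCovKernel γ K) (hW : IsWiener P γ K W)
  (he : IsEigensystem γ K lam e)
variable {l : ℝ} {D : ℝ → TField M → TField M}
  {g : ℝ → Ω → TField M} {L r : ℝ} {h : ℝ → TField M} {α N : ℝ → M → ℝ}
  {β : ℝ → (x : M) → Tan x} {q : TField M → ℝ≥0∞} {A B κ : ℝ}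
  (hg : SolvesSDE P γ l D W g)
  (hS : IsSemiclassical P γ l D g L r h α N β q A B κ)

include F he hg hS

/-- The mean of the drift differs from the drift at the mean by the second-order term, as the
linear term is centred. -/
lemma abs_integral_drift_sub_le {φ : TField M} (hφ : SmoothTF φ) (hφs : IsSymm φ) {s : ℝ}
    (hs : s ∈ Icc 0 r) (hD : ∀ᵐ ξ ∂P, MemField γ 1 (D s (g s ξ)))
    (hi : Integrable (fun ξ => ip γ (D s (g s ξ)) φ) P) :
    |∫ ξ, ip γ (D s (g s ξ)) φ ∂P - ip γ (D s (h s)) φ| ≤ A * B * (l / L) ^ 2 * norm1 γ φ := by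
  obtain ⟨c, hc⟩ := hS.differentiable φ hφ hφs
  obtain ⟨ψ, hψ, hψc, hR⟩ := hc s hs
  have hf := F.integral_ip_fluctuation he hg hS hs hψ
  have hn1 : 0 ≤ norm1 γ φ := integral_nonneg fun x => tlen_nonneg φ x
  have hB := hS.const_nonneg.2
  have hA := hS.const_nonneg.1
  have h1 : ∫ ξ, ip γ (D s (g s ξ)) φ ∂P - ip γ (D s (h s)) φ =
      ∫ ξ, (ip γ (D s (g s ξ)) φ - ip γ (D s (h s)) φ - ip γ (g s ξ - h s) ψ) ∂P := by
    have h2 := integral_sub (hi.sub (integrable_const (ip γ (D s (h s)) φ))) hf.1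
    have h3 := integral_sub hi (integrable_const (ip γ (D s (h s)) φ))
    simp only [Pi.sub_apply, integral_const, probReal_univ, one_smul] at h2 h3
    rw [h2, h3, hf.2, sub_zero]
  rw [h1, ← Real.norm_eq_abs]
  refine (norm_integral_le_lintegral_norm _).trans (ENNReal.toReal_le_of_le_ofReal (by positivity) ?_)
  calc ∫⁻ ξ, ENNReal.ofReal
        ‖ip γ (D s (g s ξ)) φ - ip γ (D s (h s)) φ - ip γ (g s ξ - h s) ψ‖ ∂P
      ≤ ∫⁻ ξ, ENNReal.ofReal (B * norm1 γ φ) * q (g s ξ - h s) ^ 2 ∂P := by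
        refine lintegral_mono_ae ?_
        filter_upwards [hD, F.memField_fluctuation hg hS hs] with ξ h2 h3
        have h4 := hR (g s ξ - h s) h3
        rw [tfield_add_sub] at h4
        exact h4 h2
    _ = ENNReal.ofReal (B * norm1 γ φ) * ∫⁻ ξ, q (g s ξ - h s) ^ 2 ∂P :=
        lintegral_const_mul' _ _ ENNReal.ofReal_ne_top
    _ ≤ ENNReal.ofReal (B * norm1 γ φ) * ENNReal.ofReal (A * (l / L) ^ 2) := by
        gcongr
        exact hS.fluctuation s hs
    _ = ENNReal.ofReal (A * B * (l / L) ^ 2 * norm1 γ φ) := by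
        rw [← ENNReal.ofReal_mul (by positivity)]
        congr 1
        ring

end TightFrame

end Averaging

/-! ### The velocity of the means -/

section Velocity

lemma absolutelyContinuous_prod_restrict {Ω : Type*} [MeasurableSpace Ω] (P : Measure Ω) [SFinite P]
    (r : ℝ) : ((volume.restrict (Ioc 0 r)).prod P).AbsolutelyContinuous
      ((volume.restrict (Ici (0 : ℝ))).prod P) :=
  (Measure.absolutelyContinuous_of_le (Measure.restrict_mono
    (fun _ hs => hs.1.le) le_rfl)).prod Measure.AbsolutelyContinuous.rfl

variable {M : Type*} [TopologicalSpace M] [T2Space M] [CompactSpace M] [SecondCountableTopology M]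
  [ChartedSpace E3 M] [IsManifold (𝓡 3) ∞ M] [MeasurableSpace M] [BorelSpace M]
variable {γ : TField M} {n : ℕ} {X : Fin n → (x : M) → Tan x}
variable {Ω : Type*} [MeasurableSpace Ω] {P : Measure Ω} [IsProbabilityMeasure P]
  {K : TKernel M} {W : ℝ → Ω → TField M} {lam : ℕ → ℝ} {e : ℕ → TField M}

namespace TightFrame

variable (F : TightFrame γ X) (hK : IsCovKernel γ K) (hW : IsWiener P γ K W)
  (he : IsEigensystem γ K lam e)
variable {l : ℝ} {D : ℝ → TField M → TField M}
  {g : ℝ → Ω → TField M} {L r : ℝ} {h : ℝ → TField M} {α N : ℝ → M → ℝ}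
  {β : ℝ → (x : M) → Tan x} {q : TField M → ℝ≥0∞} {A B κ : ℝ}
  (hg : SolvesSDE P γ l D W g)
  (hS : IsSemiclassical P γ l D g L r h α N β q A B κ)

include F hS

/-- The drift at the means, tested against a field, as a continuous function of time. -/
lemma exists_continuous_ip_drift {φ : TField M} (hφ : ContTF φ) (hφs : IsSymm φ) :
    ∃ d : ℝ → ℝ, Continuous d ∧ ∀ s ∈ Icc 0 r, ip γ (D s (h s)) φ = d s := by
  refine ⟨_, F.continuous_integral_hat hS.contFam_drift hφ, fun s hs => ?_⟩
  rw [F.ip_eq_integral (F.memField_drift hS hs 2) (F.memField_cont hφ hφs 2)]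
  simp only [projIcc_of_mem _ hs]

lemma hasDerivAt_ip_mean {φ : TField M} (hφ : ContTF φ) (hφs : IsSymm φ) {s : ℝ}
    (hs : s ∈ Ioo 0 r) :
    HasDerivAt (fun s => ip γ (h s) φ) (ip γ (hdot h s) φ) s := by
  have hm : MemField γ 2 (hdot h s) :=
    F.memField_cont (hS.smoothFam.contFam_hdot.contTF s) (hS.isSymm_hdot (Ioo_subset_Icc_self hs)) 2
  rw [F.ip_eq_integral hm (F.memField_cont hφ hφs 2)]
  refine (F.hasDerivAt_integral_hat hS.smoothFam hφ s).congr_of_eventuallyEq ?_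
  filter_upwards [Icc_mem_nhds hs.1 hs.2] with t ht
  exact F.ip_eq_integral (F.memField_mean hS ht 2) (F.memField_cont hφ hφs 2)

include hg

/-- The drift is integrable on the product of time and probability space, when tested against a
smooth field. The function `q` need not be measurable, so the bound is by upper integrals, which are
additive here because one of the two summands is a constant. -/
lemma integrable_drift {φ : TField M} (hφ : SmoothTF φ) (hφs : IsSymm φ) :
    Integrable (fun p : ℝ × Ω => ip γ (D p.1 (g p.1 p.2)) φ)
      ((volume.restrict (Ioc 0 r)).prod P) := by
  have hac := absolutelyContinuous_prod_restrict P r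
  have hmeas := (hg.drift_meas φ hφ.contTF hφs).mono_ac hac
  have hmem := Measure.ae_ae_of_ae_prod (hac.ae_le hg.drift_mem)
  obtain ⟨c, hc⟩ := hS.differentiable φ hφ hφs
  obtain ⟨d, hd, hdeq⟩ := F.exists_continuous_ip_drift hS hφ.contTF hφs
  obtain ⟨C, hC⟩ := isCompact_Icc (a := (0 : ℝ)) (b := r) |>.exists_bound_of_continuousOn
    hd.continuousOn
  have hn1 : 0 ≤ norm1 γ φ := integral_nonneg fun x => tlen_nonneg φ x
  have hB := hS.const_nonneg.2
  refine ⟨hmeas.aestronglyMeasurable, ?_⟩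
  rw [hasFiniteIntegral_iff_enorm, lintegral_prod _ hmeas.enorm]
  set k₁ : ℝ≥0∞ := ENNReal.ofReal C + ENNReal.ofReal c with hk₁
  set k₂ : ℝ≥0∞ := ENNReal.ofReal c + ENNReal.ofReal (B * norm1 γ φ) with hk₂
  set k₃ : ℝ≥0∞ := k₁ + k₂ * ENNReal.ofReal (A * (l / L) ^ 2) with hk₃
  have hk₂t : k₂ ≠ ⊤ := ENNReal.add_ne_top.2 ⟨ENNReal.ofReal_ne_top, ENNReal.ofReal_ne_top⟩
  have hk₃t : k₃ < ⊤ := ENNReal.add_lt_top.2 ⟨ENNReal.add_lt_top.2 ⟨ENNReal.ofReal_lt_top,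
    ENNReal.ofReal_lt_top⟩, ENNReal.mul_lt_top hk₂t.lt_top ENNReal.ofReal_lt_top⟩
  have hbound : ∀ᵐ s ∂(volume.restrict (Ioc 0 r)),
      ∫⁻ ξ, ‖ip γ (D s (g s ξ)) φ‖ₑ ∂P ≤ k₃ := by
    filter_upwards [hmem, ae_restrict_mem measurableSet_Ioc] with s h1 hs'
    have hs := Ioc_subset_Icc_self hs'
    obtain ⟨ψ, hψ, hψc, hR⟩ := hc s hs
    have hpt : ∀ᵐ ξ ∂P, ‖ip γ (D s (g s ξ)) φ‖ₑ ≤ k₁ + k₂ * q (g s ξ - h s) ^ 2 := by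
      filter_upwards [h1, F.memField_fluctuation hg hS hs] with ξ h2 h3
      have h4 := hR (g s ξ - h s) h3
      rw [tfield_add_sub] at h4
      have h5 : ENNReal.ofReal |ip γ (g s ξ - h s) ψ| ≤
          ENNReal.ofReal c * (1 + q (g s ξ - h s) ^ 2) := by
        refine (ENNReal.ofReal_le_ofReal ((F.abs_ip_le h3 hψ).trans
          (mul_le_mul_of_nonneg_left hψc (Real.sqrt_nonneg _)))).trans ?_
        rw [mul_comm, ENNReal.ofReal_mul ((Real.sqrt_nonneg _).trans hψc)]
        gcongr
        exact (hS.norm_le _ h3).trans (ennreal_le_one_add_sq _)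
      have h6 : |ip γ (D s (g s ξ)) φ| ≤ |ip γ (D s (h s)) φ| + |ip γ (g s ξ - h s) ψ| +
          |ip γ (D s (g s ξ)) φ - ip γ (D s (h s)) φ - ip γ (g s ξ - h s) ψ| := by
        have h7 : ip γ (D s (g s ξ)) φ = ip γ (D s (h s)) φ + ip γ (g s ξ - h s) ψ +
          (ip γ (D s (g s ξ)) φ - ip γ (D s (h s)) φ - ip γ (g s ξ - h s) ψ) := by ring
        conv_lhs => rw [h7]
        exact abs_add_three _ _ _
      rw [← ofReal_norm, Real.norm_eq_abs]
      refine (ENNReal.ofReal_le_ofReal h6).trans ?_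
      refine (ENNReal.ofReal_add_le.trans (add_le_add ENNReal.ofReal_add_le le_rfl)).trans ?_
      have h8 : ENNReal.ofReal |ip γ (D s (h s)) φ| ≤ ENNReal.ofReal C := by
        rw [hdeq s hs]
        exact ENNReal.ofReal_le_ofReal (hC s hs)
      refine (add_le_add (add_le_add h8 h5) (h4 h2)).trans (le_of_eq ?_)
      rw [hk₁, hk₂]
      ring
    calc ∫⁻ ξ, ‖ip γ (D s (g s ξ)) φ‖ₑ ∂P ≤ ∫⁻ ξ, (k₁ + k₂ * q (g s ξ - h s) ^ 2) ∂P :=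
          lintegral_mono_ae hpt
      _ = k₁ + k₂ * ∫⁻ ξ, q (g s ξ - h s) ^ 2 ∂P := by
          rw [lintegral_add_left measurable_const, lintegral_const_mul' _ _ hk₂t, lintegral_const,
            measure_univ, mul_one]
      _ ≤ k₃ := by
          rw [hk₃]
          gcongr
          exact hS.fluctuation s hs
  refine (lintegral_mono_ae hbound).trans_lt ?_
  rw [lintegral_const, Measure.restrict_apply_univ, Real.volume_Ioc]
  exact ENNReal.mul_lt_top hk₃t ENNReal.ofReal_lt_top

include hK hW

/-- The mean of the evolution equation: the noise is centred, and Fubini's theorem exchanges the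
mean with the time integral of the drift. -/
lemma ip_mean_eq {φ : TField M} (hφ : SmoothTF φ) (hφs : IsSymm φ) {t : ℝ} (ht : t ∈ Icc 0 r) :
    ip γ (h t) φ = ip γ (h 0) φ + ∫ s in (0 : ℝ)..t, ∫ ξ, ip γ (D s (g s ξ)) φ ∂P := by
  have hi := (F.integrable_drift hg hS hφ hφs).integrableOn (s := Ioc 0 t ×ˢ univ)
  rw [IntegrableOn, ← Measure.prod_restrict, Measure.restrict_univ,
    Measure.restrict_restrict measurableSet_Ioc,
    inter_eq_self_of_subset_left (Ioc_subset_Ioc_right ht.2)] at hi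
  have h0 : (0 : ℝ) ∈ Icc 0 r := ⟨le_rfl, ht.1.trans ht.2⟩
  have hmt := hS.mean t ht φ hφ.contTF hφs
  have hm0 := hS.mean 0 h0 φ hφ.contTF hφs
  have hw := F.integral_ip_wiener_field hK hW hφ.contTF hφs ⟨t, ht.1⟩
  have h1 : (fun ξ => ∫ s in (0 : ℝ)..t, ip γ (D s (g s ξ)) φ) =ᵐ[P]
      fun ξ => ip γ (g t ξ) φ - ip γ (g 0 ξ) φ - l * ip γ (W t ξ) φ := by
    filter_upwards [hg.eq φ hφ.contTF hφs] with ξ hξ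
    rw [(hξ t ht.1).2]
    ring
  have h2 : ∫ ξ, (∫ s in (0 : ℝ)..t, ip γ (D s (g s ξ)) φ) ∂P = ip γ (h t) φ - ip γ (h 0) φ := by
    have h3 := integral_sub (hmt.1.sub hm0.1) (hw.1.const_mul l)
    have h4 := integral_sub hmt.1 hm0.1
    simp only [Pi.sub_apply] at h3
    rw [integral_congr_ae h1]
    refine h3.trans ?_
    rw [h4, hmt.2, hm0.2, integral_const_mul, hw.2, mul_zero, sub_zero]
  simp only [intervalIntegral.integral_of_le ht.1] at h2 ⊢
  rw [integral_integral_swap hi, h2]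
  ring

include he

/-- The velocity of the means agrees with the drift at the means up to a second-order term. The bound
on the mean drift holds for almost every time only, and it passes to every time because the mean of
the history is differentiable. -/
lemma abs_ip_flowDefect_le {φ : TField M} (hφ : SmoothTF φ) (hφs : IsSymm φ) {s : ℝ}
    (hs : s ∈ Ioo 0 r) :
    |ip γ (flowDefect D h s) φ| ≤ A * B * (l / L) ^ 2 * norm1 γ φ := by
  have hs' := Ioo_subset_Icc_self hs
  have hint := F.integrable_drift hg hS hφ hφs
  have hac := absolutelyContinuous_prod_restrict P r
  have hmem := Measure.ae_ae_of_ae_prod (hac.ae_le hg.drift_mem)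
  obtain ⟨d, hd, hdeq⟩ := F.exists_continuous_ip_drift hS hφ.contTF hφs
  have hn1 : 0 ≤ norm1 γ φ := integral_nonneg fun x => tlen_nonneg φ x
  have hC : 0 ≤ A * B * (l / L) ^ 2 * norm1 γ φ :=
    mul_nonneg (mul_nonneg (mul_nonneg hS.const_nonneg.1 hS.const_nonneg.2) (sq_nonneg _)) hn1
  set m : ℝ → ℝ := fun s => ∫ ξ, ip γ (D s (g s ξ)) φ ∂P with hm
  have hmd : ∀ᵐ t ∂(volume.restrict (Ioc 0 r)), ‖m t - d t‖ ≤ A * B * (l / L) ^ 2 * norm1 γ φ := by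
    filter_upwards [hmem, hint.prod_right_ae, ae_restrict_mem measurableSet_Ioc] with t h1 h2 ht
    rw [← hdeq t (Ioc_subset_Icc_self ht)]
    exact F.abs_integral_drift_sub_le he hg hS hφ hφs (Ioc_subset_Icc_self ht) h1 h2
  rw [ae_restrict_iff' measurableSet_Ioc] at hmd
  have hmi : IntegrableOn m (Ioc 0 r) := hint.integral_prod_left
  have hmi' : ∀ a ∈ Icc 0 r, ∀ b ∈ Icc 0 r, IntervalIntegrable m volume a b := by
    intro a ha b hb
    have h1 : IntervalIntegrable m volume 0 r :=
      (intervalIntegrable_iff_integrableOn_Ioc_of_le hS.duration_pos.le).2 hmi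
    refine h1.mono_set ?_
    rw [uIcc_of_le hS.duration_pos.le]
    exact uIcc_subset_Icc ha hb
  have hdi : ∀ a b, IntervalIntegrable d volume a b := fun a b => hd.intervalIntegrable a b
  -- The function below is Lipschitz, and the tested defect is its derivative.
  set Φ : ℝ → ℝ := fun t => ip γ (h t) φ - ∫ s in (0 : ℝ)..t, d s with hΦ
  have h0 : (0 : ℝ) ∈ Icc 0 r := ⟨le_rfl, hS.duration_pos.le⟩
  have hΦd : ∀ a ∈ Icc 0 r, ∀ b ∈ Icc 0 r, Φ b - Φ a = ∫ s in a..b, (m s - d s) := by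
    intro a ha b hb
    rw [intervalIntegral.integral_sub (hmi' a ha b hb) (hdi a b)]
    simp only [hΦ]
    rw [F.ip_mean_eq hK hW hg hS hφ hφs ha, F.ip_mean_eq hK hW hg hS hφ hφs hb,
      ← intervalIntegral.integral_add_adjacent_intervals (hmi' 0 h0 a ha) (hmi' a ha b hb),
      ← intervalIntegral.integral_add_adjacent_intervals (hdi 0 a) (hdi a b)]
    ring
  have hlip : ∀ a ∈ Icc 0 r, ∀ b ∈ Icc 0 r,
      ‖Φ b - Φ a‖ ≤ A * B * (l / L) ^ 2 * norm1 γ φ * ‖b - a‖ := by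
    intro a ha b hb
    rw [hΦd a ha b hb, Real.norm_eq_abs (b - a)]
    refine intervalIntegral.norm_integral_le_of_norm_le_const_ae ?_
    filter_upwards [hmd] with t ht htab
    refine ht ?_
    rw [uIoc] at htab
    exact ⟨(le_min ha.1 hb.1).trans_lt htab.1, htab.2.trans (max_le ha.2 hb.2)⟩
  have hder : HasDerivAt Φ (ip γ (hdot h s) φ - d s) s :=
    (F.hasDerivAt_ip_mean hS hφ.contTF hφs hs).sub
      (intervalIntegral.integral_hasDerivAt_right (hdi 0 s)
        (hd.stronglyMeasurableAtFilter _ _) hd.continuousAt)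
  have hmdot : MemField γ 2 (hdot h s) :=
    F.memField_cont (hS.smoothFam.contFam_hdot.contTF s) (hS.isSymm_hdot hs') 2
  rw [flowDefect, F.ip_sub_left hmdot (F.memField_drift hS hs' 2)
    (F.memField_cont hφ.contTF hφs 2), hdeq s hs', ← Real.norm_eq_abs]
  refine hder.le_of_lip' hC ?_
  filter_upwards [Icc_mem_nhds hs.1 hs.2] with t ht
  exact hlip s hs' t ht

end TightFrame

end Velocity

/-! ### Lapse and proper time -/

section ProperTime

variable {M : Type*} [TopologicalSpace M] [ChartedSpace E3 M] [IsManifold (𝓡 3) ∞ M]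

lemma ContTF.sub {h k : TField M} (hh : ContTF h) (hk : ContTF k) : ContTF (h - k) := by
  have H : ∀ {h : TField M}, ContTF h → ∀ c, ∀ a b : E3,
      ContinuousAt (fun x => h x (frame c x a) (frame c x b)) c := by
    intro h hh c a b
    have h1 := ((contMDiff_iff_loc h 0).1 hh c).continuousAt
    refine ((h1.clm_apply continuousAt_const).clm_apply continuousAt_const).congr_of_eventuallyEq
      (f := fun x => loc h c x a b) ?_
    filter_upwards [(chartAt E3 c).open_source.mem_nhds (mem_chart_source E3 c)] with x hx
    exact (loc_apply h hx a b).symm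
  exact contTF_of_frame fun c a b => (H hh c a b).sub (H hk c a b)

variable [MeasurableSpace M] {Ω : Type*} [MeasurableSpace Ω] {P : Measure Ω} {γ : TField M}
  {l : ℝ} {D : ℝ → TField M → TField M} {g : ℝ → Ω → TField M} {L r : ℝ} {h : ℝ → TField M}
  {α N : ℝ → M → ℝ} {β : ℝ → (x : M) → Tan x} {q : TField M → ℝ≥0∞} {A B κ : ℝ}

/-- The lapse is controlled by the defect of the flow, as the extrinsic curvature is bounded below.
At the endpoints of `[0, r]` the bound holds by continuity. -/
lemma TightFrame.abs_lapse_sub_le [T2Space M] [CompactSpace M] [SecondCountableTopology M]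
    [BorelSpace M] [IsProbabilityMeasure P] {n : ℕ} {X : Fin n → (x : M) → Tan x}
    {K : TKernel M} {W : ℝ → Ω → TField M} {lam : ℕ → ℝ} {e : ℕ → TField M}
    (F : TightFrame γ X) (hK : IsCovKernel γ K) (hW : IsWiener P γ K W)
    (he : IsEigensystem γ K lam e) (hg : SolvesSDE P γ l D W g)
    (hS : IsSemiclassical P γ l D g L r h α N β q A B κ) {s : ℝ} (hs : s ∈ Icc 0 r) (x : M) :
    |α s x - N s x| ≤ A * B / (2 * κ) * (l / L) ^ 2 := by
  have hα : Continuous fun s => α s x :=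
    hS.smooth_α.continuous.comp (Continuous.prodMk_left x)
  have hN : Continuous fun s => N s x :=
    hS.smooth_N.continuous.comp (Continuous.prodMk_left x)
  suffices H : Ioo 0 r ⊆ {s | |α s x - N s x| ≤ A * B / (2 * κ) * (l / L) ^ 2} by
    have h1 := closure_minimal H (isClosed_le (hα.sub hN).abs continuous_const)
    rw [closure_Ioo hS.duration_pos.ne] at h1
    exact h1 hs
  intro s hs
  have hs' := Ioo_subset_Icc_self hs
  have hκ := hS.curv_pos
  have hsymm : IsSymm (flowDefect D h s) := fun x u v =>
    congrArg₂ (· - ·) (hS.isSymm_hdot hs' x u v) (hS.isSymm_drift hs' x u v)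
  have h1 := F.tlen_le_of_ip_le ((hS.smoothFam.contFam_hdot.contTF s).sub (hS.contTF_drift hs'))
    hsymm (mul_nonneg (mul_nonneg hS.const_nonneg.1 hS.const_nonneg.2) (sq_nonneg _))
    (fun φ hφ hφs => F.abs_ip_flowDefect_le hK hW he hg hS hφ hφs hs) x
  have h2 : tlen γ x (flowDefect D h s x) = 2 * |α s x - N s x| *
      Real.sqrt (pair γ x (extCurv α β h s x) (extCurv α β h s x)) := by
    have h3 : (fun u v => flowDefect D h s x u v) =
        fun u v => -2 * (α s x - N s x) * extCurv α β h s x u v :=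
      funext fun u => funext fun v => hS.flowDefect_apply hs' x u v
    rw [tlen, h3, pair_smul_left, pair_smul_right, ← mul_assoc, Real.sqrt_mul (mul_self_nonneg _),
      Real.sqrt_mul_self_eq_abs, abs_mul]
    norm_num
  have h4 : 2 * |α s x - N s x| * κ ≤ A * B * (l / L) ^ 2 := by
    refine le_trans ?_ (h2 ▸ h1)
    gcongr
    exact hS.curv s hs' x
  rw [mem_ofPred_eq, div_mul_eq_mul_div, le_div_iff₀ (by positivity)]
  linarith

variable {τ : ℝ} {x : ℝ → M}

omit [MeasurableSpace M] in
lemma IsNormalObserver.continuousOn (hx : IsNormalObserver β τ x) : ContinuousOn x (Icc 0 τ) :=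
  fun s hs => (hx s hs).continuousAt.continuousWithinAt

omit [IsManifold (𝓡 3) ∞ M] [MeasurableSpace M] in
/-- An observer normal to the slices reads off the lapse. -/
lemma IsNormalObserver.properTime_eq (hx : IsNormalObserver β τ x) (hτ : 0 ≤ τ)
    (hα : ∀ s x, 0 < α s x) : properTime α β h x τ = ∫ s in (0 : ℝ)..τ, α s (x s) := by
  refine intervalIntegral.integral_congr fun s hs => ?_
  rw [uIcc_of_le hτ] at hs
  have h1 : mfderiv 𝓘(ℝ, ℝ) (𝓡 3) x s (1 : ℝ) = -β s (x s) := by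
    rw [(hx s hs).mfderiv]
    exact one_smul ℝ (-β s (x s))
  have h2 : -β s (x s) + (1 : ℝ) • β s (x s) = 0 := by rw [one_smul, neg_add_cancel]
  simp only [admForm]
  rw [h1, h2, map_zero]
  simp [Real.sqrt_sq (hα s (x s)).le]

lemma IsSemiclassical.continuousOn_lapse (hS : IsSemiclassical P γ l D g L r h α N β q A B κ)
    (hx : IsNormalObserver β τ x) : ContinuousOn (fun s => N s (x s)) (Icc 0 τ) :=
  hS.smooth_N.continuous.comp_continuousOn (continuousOn_id.prodMk hx.continuousOn)

/-- A uniform bound on the lapse integrates along an observer. -/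
lemma IsSemiclassical.abs_properTime_sub_le
    (hS : IsSemiclassical P γ l D g L r h α N β q A B κ) {C : ℝ}
    (hC : ∀ s ∈ Icc 0 r, ∀ x, |α s x - N s x| ≤ C) (hτ : τ ∈ Icc 0 r)
    (hx : IsNormalObserver β τ x) :
    |properTime α β h x τ - ∫ s in (0 : ℝ)..τ, N s (x s)| ≤ C * τ := by
  have hα : ContinuousOn (fun s => α s (x s)) (Icc 0 τ) :=
    hS.smooth_α.continuous.comp_continuousOn (continuousOn_id.prodMk hx.continuousOn)
  rw [← uIcc_of_le hτ.1] at hα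
  have hN := hS.continuousOn_lapse hx
  rw [← uIcc_of_le hτ.1] at hN
  rw [hx.properTime_eq hτ.1 hS.α_pos,
    ← intervalIntegral.integral_sub hα.intervalIntegrable hN.intervalIntegrable]
  have h1 := intervalIntegral.norm_integral_le_of_norm_le_const (a := 0) (b := τ)
    (f := fun s => α s (x s) - N s (x s)) (C := C) fun s hs => by
      rw [uIoc_of_le hτ.1] at hs
      exact hC s ⟨hs.1.le, hs.2.trans hτ.2⟩ (x s)
  rwa [sub_zero, abs_of_nonneg hτ.1] at h1

end ProperTime

end EmergentTime

theorem theoremD {M : Type*} [TopologicalSpace M] [T2Space M] [CompactSpace M] [Nonempty M]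
    [ChartedSpace E3 M] [IsManifold (𝓡 3) ∞ M] [MeasurableSpace M] [BorelSpace M]
    {Ω : Type*} [MeasurableSpace Ω] (P : Measure Ω) [IsProbabilityMeasure P]
    (γ : TField M) (hγ : IsRiemannian γ)
    (K : TKernel M) (hK : IsCovKernel γ K)
    (W : ℝ → Ω → TField M) (hW : IsWiener P γ K W)
    (l : ℝ) (hl : 0 < l)
    (D : ℝ → TField M → TField M) (g : ℝ → Ω → TField M) (hg : SolvesSDE P γ l D W g) :
    -- spectral decomposition of the covariance operator
    (∃ lam e, IsEigensystem γ K lam e) ∧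
    ∀ lam e, IsEigensystem γ K lam e →
      MercerExpansion γ K lam e ∧
      -- Karhunen–Loève expansion, and the product rules for its Brownian motions
      KarhunenLoeve P γ lam e W ∧
      ItoRules P (mode γ lam e W) ∧
      -- the mode equations `dg_n = 𝒟_n dτ + ℓ √λ_n dβ_n`
      (∀ n, ∀ᵐ ξ ∂P, ∀ τ, 0 ≤ τ →
        IntervalIntegrable (fun s => ip γ (D s (g s ξ)) (e n)) volume 0 τ ∧
        ip γ (g τ ξ) (e n) = ip γ (g 0 ξ) (e n) + (∫ s in (0 : ℝ)..τ, ip γ (D s (g s ξ)) (e n))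
          + l * Real.sqrt (lam n) * mode γ lam e W n τ ξ) ∧
      -- the quadratic form, mode by mode
      (∀ f h, MemField γ 2 h → IsPreimage γ K f h →
        HasSum (fun n => ip γ h (e n) ^ 2 / lam n) (invForm γ K h)) ∧
      (∀ (S : Finset ℕ) h, MemField γ 2 h → (∃ f, IsPreimage γ K f (proj γ e S h)) ∧
        invForm γ K (proj γ e S h) = ∑ n ∈ S, ip γ h (e n) ^ 2 / lam n) ∧
      -- `∫ ⟨dg, K⁻¹ dg⟩ = ℓ² n_eff (b - a)`
      (∀ (S : Finset ℕ) (a b : ℝ), 0 ≤ a → a ≤ b →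
        MeshLimit P (fun s t ξ => invForm γ K (proj γ e S (g t ξ - g s ξ))) a b
          fun _ => l ^ 2 * (S.card : ℝ) * (b - a)) ∧
      -- the emergent time functional
      ∀ S : Finset ℕ, S.Nonempty →
        (∃ T, IsEmergentTime P γ K e S l g T) ∧
        ∀ T, IsEmergentTime P γ K e S l g T →
          -- it equals the ordering parameter
          (∀ τ, 0 ≤ τ → ∀ᵐ ξ ∂P, T 0 τ ξ = τ) ∧
          -- strict monotonicity
          (∀ a b, 0 ≤ a → a < b → ∀ᵐ ξ ∂P, T 0 a ξ < T 0 b ξ) ∧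
          -- additivity under concatenation
          (∀ a b c, 0 ≤ a → a ≤ b → b ≤ c → ∀ᵐ ξ ∂P, T a c ξ = T a b ξ + T b c ξ) ∧
          -- independence of the coordinates on the spatial manifold
          (∀ (M' : Type*) [TopologicalSpace M'] [ChartedSpace E3 M'] [IsManifold (𝓡 3) ∞ M']
            [MeasurableSpace M'] [BorelSpace M'] (φ : M' ≃ₘ⟮𝓡 3, 𝓡 3⟯ M),
            IsCovKernel (pullT φ γ) (pullK φ K) ∧
            IsEigensystem (pullT φ γ) (pullK φ K) lam (fun n => pullT φ (e n)) ∧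
            ∀ T', IsEmergentTime P (pullT φ γ) (pullK φ K) (fun n => pullT φ (e n)) S l
                (fun τ ξ => pullT φ (g τ ξ)) T' ↔ IsEmergentTime P γ K e S l g T') ∧
          -- independence of the drift
          (∀ D' g', SolvesSDE P γ l D' W g' →
            ∀ T', IsEmergentTime P γ K e S l g' T' ↔ IsEmergentTime P γ K e S l g T') ∧
          -- agreement with proper time in the semiclassical limit
          (∀ (L r : ℝ) (h : ℝ → TField M) (α N : ℝ → M → ℝ) (β : ℝ → (x : M) → Tan x)
            (q : TField M → ℝ≥0∞) (A B κ : ℝ),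
            IsSemiclassical P γ l D g L r h α N β q A B κ →
            (∀ τ ∈ Icc 0 r, ∀ x, |α τ x - N τ x| ≤ A * B / (2 * κ) * (l / L) ^ 2) ∧
            ∀ τ ∈ Icc 0 r, ∀ x : ℝ → M, IsNormalObserver β τ x →
              (∃ I, MeshLimit P (fun s t ξ => N s (x s) * (T 0 t ξ - T 0 s ξ)) 0 τ I ∧
                ∀ᵐ ξ ∂P, |properTime α β h x τ - I ξ| ≤
                  A * B / (2 * κ) * (l / L) ^ 2 * τ) ∧
              ((∀ s y, N s y = 1) → ∀ᵐ ξ ∂P, |properTime α β h x τ - T 0 τ ξ| ≤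
                  A * B / (2 * κ) * (l / L) ^ 2 * τ)) := by
  obtain ⟨n, X, hX, ht⟩ := exists_tight_frame hγ
  have F : TightFrame γ X := ⟨hγ, hX, ht⟩
  have : SecondCountableTopology M := ChartedSpace.secondCountable_of_sigmaCompact E3 M
  have : IsFiniteMeasure (vol γ) := F.isFinite_vol
  refine ⟨F.exists_eigensystem hK, fun lam e he => ⟨F.mercerExpansion hK he,
    F.karhunenLoeve hK hW he, F.itoRules hK hW he, F.mode_equation he hg,
    fun f h hh hf => F.hasSum_invForm he hK hh hf,
    fun S h _ => ⟨F.exists_isPreimage_proj he hK S h, F.invForm_proj he hK S h⟩,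
    fun S a b ha hab => F.meshLimit_invForm hK hW he hg S ha hab, fun S hS => ?_⟩⟩
  refine ⟨⟨_, F.isEmergentTime_sub hK hW he hl hg hS⟩, fun T hT => ?_⟩
  have hT' := (F.isEmergentTime_iff hK hW he hl hg hS T).1 hT
  have hT0 : ∀ τ, 0 ≤ τ → ∀ᵐ ξ ∂P, T 0 τ ξ = τ := fun τ hτ =>
    (hT' 0 τ le_rfl hτ).mono fun ξ hξ => hξ.trans (sub_zero τ)
  refine ⟨hT0, fun a b ha hab => ?_, fun a b c ha hab hbc => ?_, ?_, fun D' g' hg' T' => ?_, ?_⟩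
  · filter_upwards [hT0 a ha, hT0 b (ha.trans hab.le)] with ξ h1 h2
    rwa [h1, h2]
  · filter_upwards [hT' a c ha (hab.trans hbc), hT' a b ha hab, hT' b c (ha.trans hab) hbc]
      with ξ h1 h2 h3
    rw [h1, h2, h3]
    ring
  · intro M' _ _ _ _ _ φ
    have : T2Space M' := φ.symm.toHomeomorph.t2Space
    have : CompactSpace M' := φ.symm.toHomeomorph.compactSpace
    have : SecondCountableTopology M' := φ.toHomeomorph.secondCountableTopology
    exact ⟨F.isCovKernel_pullT φ hK, F.isEigensystem_pullT φ he,
      F.isEmergentTime_pullT φ hK he S l g⟩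
  · rw [F.isEmergentTime_iff hK hW he hl hg' hS, F.isEmergentTime_iff hK hW he hl hg hS]
  · intro L r h α N β q A B κ hsc
    have hlapse : ∀ τ ∈ Icc 0 r, ∀ x, |α τ x - N τ x| ≤ A * B / (2 * κ) * (l / L) ^ 2 :=
      fun τ hτ x => F.abs_lapse_sub_le hK hW he hg hsc hτ x
    refine ⟨hlapse, fun τ hτ x hx => ?_⟩
    have hp := hsc.abs_properTime_sub_le hlapse hτ hx
    refine ⟨⟨_, (meshLimit_riemann (hsc.continuousOn_lapse hx) hτ.1).congr
      (fun s t hs hst _ => ?_) (.of_forall fun _ => rfl), .of_forall fun _ => hp⟩, fun hN => ?_⟩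
    · filter_upwards [hT0 s hs, hT0 t (hs.trans hst)] with ξ h1 h2
      rw [h1, h2]
    · filter_upwards [hT0 τ hτ.1] with ξ h1
      simpa [hN, h1] using hp
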